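/- **Setting.** Let $\mathsf d\in\{1,\dots,6\}$, $\sigma\in(\mathsf d/3,\mathsf d/2]$, $\mathbb M=\mathbb R^{\mathsf d}$, $[\mu]:=\mu^{1/\sigma}$. For $\varepsilon\ge 0$ and $i,m\in\mathbb N_0$ put $$\varrho_\varepsilon(i,m):=-\tfrac{\mathsf d}{2}-\varepsilon+m\big(\tfrac{\mathsf d}{2}-\sigma+2\varepsilon\big)+i\,(3\sigma-\mathsf d-6\varepsilon),\qquad \varrho:=\varrho_0 .$$ Let $i_\diamond$ be the smallest $n\in\mathbb N_0$ with $\varrho(n+1,0)>0$, let $\varrho_\diamond>0$ be the minimum of the positive numbers among $\varrho(i,m)+l$ with $0\le i\le i_\diamond+1$, $0\le m\le 3i$, $l\in\mathbb N_0$, let $\varepsilon_\diamond:=\min\{\mathsf d/6,\,(3\sigma-\mathsf d)/9,\,\varrho_\diamond/(7+6i_\diamond),\,\sigma\}$, and fix $\varepsilon\in(0,\varepsilon_\diamond/3)$. Fix $\chi\in C^\infty(\mathbb R)$ with $\chi(r)=0$ for $|r|\le1$ and $\chi(r)=1$ for $|r|>2$, let $\chi_\mu(r):=\chi(r(1-\mu)/\mu)$,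 let $G\in L^1(\mathbb M)$ be the fundamental solution of $1+(-\Delta)^{\sigma/2}$, and let $G_{\kappa,\mu}(x):=\chi_\kappa(|x|^\sigma)\chi_\mu(|x|^\sigma)G(x)$. Let $\xi$ be a $2\pi$-periodic real tempered distribution on $\mathbb M$, and let $\kappa\mapsto c^{[i]}_\kappa\in\mathbb R$, $1\le i\le i_\sharp:=\lfloor\sigma/(3\sigma-\mathsf d)\rfloor$, be differentiable on $(0,1/2]$. The *force coefficients* are $F^{0,0}_\kappa=\xi$, $F^{1,3}_\kappa(x;x_1,x_2,x_3)=\prod_{q=1}^3\delta(x-x_q)$, $F^{i,1}_\kappa(x;x_1)=c^{[i]}_\kappa\,\delta(x-x_1)$ for $1\le i\le i_\sharp$, and $F^{i,m}_\kappa=0$ otherwise. The *effective force coefficients* $F^{i,m}_{\kappa,\mu}\in\mathscr S'(\mathbb M^{1+m})$ are determined recursively by $F^{0,0}_{\kappa,\mu}=\xi$, $F^{i,m}_{\kappa,\mu}=0$ for $m>3i$, and $F^{i,m}_{\kappa,\mu}=F^{i,m}_\kappa+\int_0^\mu\partial_\eta F^{i,m}_{\kappa,\eta}\,\mathrm d\eta$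 with $$\partial_\mu F^{i,m}_{\kappa,\mu}=-\frac1{m!}\sum_{\pi\in\mathcal P_m}\sum_{j=0}^i\sum_{k=0}^m(1+k)\,\mathbf Y_\pi\mathbf B\big(\partial_\mu G_{\kappa,\mu},F^{j,1+k}_{\kappa,\mu},F^{i-j,m-k}_{\kappa,\mu}\big),$$ where $\mathbf B(H,W,U)(x;y_1,\dots,y_m)=\int W(x;y_0,\dots,y_k)H(y_0-z)U(z;y_{1+k},\dots,y_m)\,\mathrm dy_0\,\mathrm dz$, $\mathcal P_m$ is the permutation group of $\{1,\dots,m\}$, and $\langle\mathbf Y_\pi V,\psi\otimes\bigotimes_q\varphi_q\rangle=\langle V,\psi\otimes\bigotimes_q\varphi_{\pi(q)}\rangle$. For $a=(a_1,\dots,a_m)\in(\mathbb N_0^{\mathsf d})^m$ the *generalized coefficients* are $$F^{i,m,a}_{\kappa,\mu}:=\frac{1}{a!}(x-y_1)^{a_1}\cdots(x-y_m)^{a_m}\,F^{i,m}_{\kappa,\mu},\qquad \langle f^{i,m,a}_{\kappa,\mu},\psi\rangle:=\langle F^{i,m,a}_{\kappa,\mu},\psi\otimes 1^{\otimes m}\rangle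 .$$ Let $K_\mu:=(1-[\mu]^2\Delta)^{-1}\delta$ and let $K_\mu^{*\mathtt g}$ be its $\mathtt g$-fold convolution power ($K_\mu^{*0}=\delta$). Let $\mathcal V^m$ be the space of $v\in C(\mathbb M^{1+m})$ such that $x\mapsto v(x;y_1+x,\dots,y_m+x)$ is $2\pi$-periodic for all $y_1,\dots,y_m$ and $\|v\|_{\mathcal V^m}:=\sup_x\int|v(x;y_1,\dots,y_m)|\,\mathrm dy_1\cdots\mathrm dy_m<\infty$; put $\mathcal V:=\mathcal V^0$. **Theorem.** Let $\mathtt g_0(i,m,a)\in\mathbb N_0$ be given for all $i,m,a$. For all $i,m\in\mathbb N_0$, $a\in(\mathbb N_0^{\mathsf d})^m$ there are $\mathtt g\in\mathbb N_0$ and $C>0$, depending only on $i,m,a$ (and on the fixed data $\mathsf d,\sigma,\varepsilon,\chi,\mathtt g_0$), such that the following holds for all $R>1$, $\xi$ and $c^{[\cdot]}$ as above. Assume that for all $i',m'\in\mathbb N_0$, $a'\in(\mathbb N_0^{\mathsf d})^{m'}$ with $\varrho(i',m')+|a'|\le0$, all $r\in\{0,1\}$ and all $\kappa,\mu\in(0,1/2]$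 $$\big\|K_\mu^{*\mathtt g_0(i',m',a')}*\partial_\kappa^r f^{i',m',a'}_{\kappa,\mu}\big\|_{\mathcal V}\le R\,[\kappa]^{(\varepsilon-\sigma)r}\,[\mu]^{\varrho_\varepsilon(i',m')+|a'|}.$$ Then for all $r,s\in\{0,1\}$ and all $\kappa,\mu\in(0,1/2]$ $$\big\|K_\mu^{*\mathtt g,\otimes(1+m)}*\partial_\kappa^r\partial_\mu^s F^{i,m,a}_{\kappa,\mu}\big\|_{\mathcal V^m}\le C\,R^{1+3i-m}\,[\kappa]^{(\varepsilon-\sigma)r}\,[\mu]^{\varrho_\varepsilon(i,m)+|a|-\sigma s}.$$ Here a bound on a norm includes that the derivative exists (weakly, i.e. after pairing with test functions) and that the regularized distribution belongs to the space. -/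

import Mathlib

open scoped SchwartzMap ENNReal
open MeasureTheory Set

namespace EllipticFlow

noncomputable section

/-! ### Base space, configurations, multi-indices -/

/-- The space `𝕄 = ℝ^d`. -/
abbrev Space (d : ℕ) : Type := EuclideanSpace ℝ (Fin d)

/-- The space `𝕄^{1+m}`; its points are written `(x; y₁, …, y_m)`. -/
abbrev Config (d m : ℕ) : Type := Space d × (Fin m → Space d)

/-- Lists of `m` multi-indices in `ℕ₀^d`. -/
abbrev MultiIdx (d m : ℕ) : Type := Fin m → Fin d → ℕ

/-- `|a| = |a₁| + … + |a_m|`. -/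
def MultiIdx.order {d m : ℕ} (a : MultiIdx d m) : ℕ := ∑ q, ∑ l, a q l

/-- `𝒳^{m,a}(x; y₁, …, y_m) = (1/a!) (x-y₁)^{a₁} ⋯ (x-y_m)^{a_m}`. -/
def monomial {d m : ℕ} (a : MultiIdx d m) (p : Config d m) : ℝ :=
  ∏ q, ∏ l, (p.1 l - p.2 q l) ^ (a q l) / ((a q l).factorial : ℝ)

/-- The point `2π n` of the lattice `(2πℤ)^d`. -/
def latticePoint {d : ℕ} (n : Fin d → ℤ) : Space d :=
  WithLp.toLp 2 (fun l => 2 * Real.pi * (n l : ℝ))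

/-- The length scale `[μ] = μ^{1/σ}`. -/
def scale (σ μ : ℝ) : ℝ := μ ^ (1 / σ)

/-! ### Dimensions and exponents -/

/-- `ϱ_ε(i,m) = -dim(ξ) - ε + m (dim(Φ) + 2ε) + i (dim(λ) - 6ε)` with `dim(ξ) = d/2`,
`dim(Φ) = d/2 - σ`, `dim(λ) = 3σ - d`. -/
def rho (d : ℕ) (σ ε : ℝ) (i m : ℕ) : ℝ :=
  -((d : ℝ) / 2) - ε + m * ((d : ℝ) / 2 - σ + 2 * ε) + i * (3 * σ - d - 6 * ε)

/-- `i_⋄`: the smallest `n` such that `ϱ(n+1,0) > 0`. -/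
def iDiamond (d : ℕ) (σ : ℝ) : ℕ := sInf {n : ℕ | 0 < rho d σ 0 (n + 1) 0}

/-- `ϱ_⋄`: the minimum of the positive numbers of the form `ϱ(i,m) + l` with
`i ≤ i_⋄ + 1`, `m ≤ 3i` and `l ∈ ℕ₀`. -/
def rhoDiamond (d : ℕ) (σ : ℝ) : ℝ :=
  sInf {ρ : ℝ | ∃ i m l : ℕ, i ≤ iDiamond d σ + 1 ∧ m ≤ 3 * i ∧
    ρ = rho d σ 0 i m + l ∧ 0 < ρ}

/-- `ε_⋄ = dim(ξ)/3 ∧ dim(λ)/9 ∧ ϱ_⋄/(7 + 6 i_⋄) ∧ σ`. -/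
def epsDiamond (d : ℕ) (σ : ℝ) : ℝ :=
  min (min ((d : ℝ) / 2 / 3) ((3 * σ - d) / 9))
    (min (rhoDiamond d σ / (7 + 6 * (iDiamond d σ : ℝ))) σ)

/-- `i_♯ = ⌊σ / (3σ - d)⌋`. -/
def iSharp (d : ℕ) (σ : ℝ) : ℕ := ⌊σ / (3 * σ - d)⌋₊

/-! ### The propagator -/

/-- A smooth cutoff with `χ(r) = 0` for `|r| ≤ 1` and `χ(r) = 1` for `|r| > 2`. -/
structure IsCutoff (χ : ℝ → ℝ) : Prop where
  smooth : ContDiff ℝ (⊤ : ℕ∞) χ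
  eq_zero : ∀ r, |r| ≤ 1 → χ r = 0
  eq_one : ∀ r, 2 < |r| → χ r = 1

/-- The kernel of the semigroup `exp(-t (-Δ)^{σ/2})`, `t > 0`, i.e. the inverse Fourier transform
of `p ↦ exp(-t |p|^σ)`. -/
def fracHeatKernel (d : ℕ) (σ t : ℝ) (x : Space d) : ℝ :=
  (2 * Real.pi) ^ (-(d : ℤ)) * ∫ p : Space d, Real.exp (-t * ‖p‖ ^ σ) * Real.cos (inner ℝ p x)

/-- The fundamental solution `G ∈ L¹(𝕄)` of `1 + (-Δ)^{σ/2}`, i.e. the function with Fourier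
transform `1 / (1 + |p|^σ)`, in the form `G = ∫₀^∞ e^{-t} exp(-t (-Δ)^{σ/2}) dt` of the resolvent.
For `x ≠ 0` the integral converges absolutely and is smooth in `x`; the value at `x = 0` is never
used, because the cutoffs vanish there. -/
def greenFun (d : ℕ) (σ : ℝ) (x : Space d) : ℝ :=
  ∫ t in Ioi (0 : ℝ), Real.exp (-t) * fracHeatKernel d σ t x

/-- `χ_μ(r) = χ(r (1-μ) / μ)`. -/
def cutoffAt (χ : ℝ → ℝ) (μ r : ℝ) : ℝ := χ (r * (1 - μ) / μ)

/-- `G_{κ,μ}(x) = χ_κ(|x|^σ) χ_μ(|x|^σ) G(x)`. -/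
def propagator (d : ℕ) (σ : ℝ) (χ : ℝ → ℝ) (κ μ : ℝ) (x : Space d) : ℝ :=
  cutoffAt χ κ (‖x‖ ^ σ) * cutoffAt χ μ (‖x‖ ^ σ) * greenFun d σ x

/-- `∂_μ G_{κ,μ}(x)`. -/
def dPropagator (d : ℕ) (σ : ℝ) (χ : ℝ → ℝ) (κ μ : ℝ) (x : Space d) : ℝ :=
  deriv (fun η => propagator d σ χ κ η x) μ

/-! ### The noise -/

/-- Real tempered distributions on `𝕄`. -/
abbrev Distr (d : ℕ) : Type := 𝓢(Space d, ℝ) →L[ℝ] ℝ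

/-- `2π`-periodicity of a tempered distribution. -/
def IsPeriodic {d : ℕ} (ξ : Distr d) : Prop :=
  ∀ (n : Fin d → ℤ) (φ ψ : 𝓢(Space d, ℝ)), (∀ x, ψ x = φ (x + latticePoint n)) → ξ ψ = ξ φ

open Classical in
/-- The pairing `⟨ξ, φ⟩` with a function `φ` on `𝕄`; it is only used for Schwartz functions. -/
def pair {d : ℕ} (ξ : Distr d) (φ : Space d → ℝ) : ℝ :=
  if h : ∃ ψ : 𝓢(Space d, ℝ), ∀ x, ψ x = φ x then ξ h.choose else 0

/-! ### Force and effective force coefficients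

A distribution `V` on `𝕄^{1+m}` is represented by its pairing `Ψ ↦ ⟨V, Ψ⟩`. The formulas below
define this pairing also for test functions such as `ψ ⊗ 1^{⊗m}`, multiplied by polynomials
`𝒳^{m,a}`. -/

/-- The pairing of the force coefficient `F^{i,m}_κ` with `Ψ`. The non-zero ones are `F^{0,0} = ξ`,
`F^{1,3}(x; x₁,x₂,x₃) = δ(x-x₁) δ(x-x₂) δ(x-x₃)` and, for `1 ≤ i ≤ i_♯`,
`F^{i,1}(x; x₁) = c_κ^{[i]} δ(x-x₁)`. -/
def force {d : ℕ} (σ : ℝ) (ξ : Distr d) (c : ℕ → ℝ → ℝ) (κ : ℝ) (i m : ℕ)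
    (Ψ : Config d m → ℝ) : ℝ :=
  if i = 0 ∧ m = 0 then pair ξ (fun x => Ψ (x, fun _ => 0))
  else if i = 1 ∧ m = 3 then ∫ x : Space d, Ψ (x, fun _ => x)
  else if (1 ≤ i ∧ i ≤ iSharp d σ) ∧ m = 1 then c i κ * ∫ x : Space d, Ψ (x, fun _ => x)
  else 0

/-- From `(y₀, …, y_k)` and `(y_{k+1}, …, y_m)` form `(y₁, …, y_m)`. -/
def joinVars {d m : ℕ} (k : ℕ) (y : Fin (k + 1) → Space d) (u : Fin (m - k) → Space d) :
    Fin m → Space d := fun p =>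
  if h : (p : ℕ) < k then y ⟨p + 1, by omega⟩ else u ⟨p - k, by omega⟩

/-- `⟨B(H, W, U), Ψ⟩`, where `B(H,W,U)(x; y₁,…,y_m)` is
`∫ W(x; y₀,…,y_k) H(y₀ - z) U(z; y_{k+1},…,y_m) dy₀ dz` and `W`, `U` are given by their
pairings. -/
def pairB {d m : ℕ} (k : ℕ) (H : Space d → ℝ) (W : (Config d (k + 1) → ℝ) → ℝ)
    (U : (Config d (m - k) → ℝ) → ℝ) (Ψ : Config d m → ℝ) : ℝ :=
  W fun p => U fun q => H (p.2 0 - q.1) * Ψ (p.1, joinVars k p.2 q.2)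

/-- `⟨Y_π V, Ψ⟩ = ⟨V, permTest π Ψ⟩`: the test function `ψ ⊗ φ₁ ⊗ ⋯ ⊗ φ_m` is mapped to
`ψ ⊗ φ_{π(1)} ⊗ ⋯ ⊗ φ_{π(m)}`. -/
def permTest {d m : ℕ} (π : Equiv.Perm (Fin m)) (Ψ : Config d m → ℝ) : Config d m → ℝ :=
  fun p => Ψ (p.1, fun q => p.2 (π.symm q))

/-- The pairing of the effective force coefficient `F^{i,m}_{κ,μ}` with `Ψ`. One sets
`F^{0,0}_{κ,μ} = ξ`, `F^{i,m}_{κ,μ} = 0` for `m > 3i`, and otherwise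
`F^{i,m}_{κ,μ} = F^{i,m}_κ + ∫₀^μ ∂_η F^{i,m}_{κ,η} dη`, where `∂_η F^{i,m}_{κ,η}` is given by the
flow equation
`-(1/m!) ∑_π ∑_{j ≤ i} ∑_{k ≤ m} (1+k) Y_π B(∂_η G_{κ,η}, F^{j,1+k}_{κ,η}, F^{i-j,m-k}_{κ,η})`.
The terms with `j = 0` and those with `j = i`, `k < m` are left out for the sake of termination;
they contain `F^{0,n}_{κ,η} = 0` with `n ≥ 1`, see `effForce_eq`. -/
def effForce {d : ℕ} (σ : ℝ) (χ : ℝ → ℝ) (ξ : Distr d) (c : ℕ → ℝ → ℝ) (κ : ℝ) (i m : ℕ)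
    (μ : ℝ) (Ψ : Config d m → ℝ) : ℝ :=
  if _hm : 3 * i < m then 0
  else if _hi : i = 0 then pair ξ (fun x => Ψ (x, fun _ => 0))
  else force σ ξ c κ i m Ψ + ∫ η in (0 : ℝ)..μ,
    -(1 / (m.factorial : ℝ)) * ∑ π : Equiv.Perm (Fin m), ∑ j : Fin (i + 1), ∑ k : Fin (m + 1),
      if h : 0 < (j : ℕ) ∧ ((j : ℕ) < i ∨ (k : ℕ) = m) then
        (1 + (k : ℝ)) * pairB (k : ℕ) (dPropagator d σ χ κ η)
          (effForce σ χ ξ c κ j (k + 1) η)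
          (effForce σ χ ξ c κ (i - j) (m - k) η) (permTest π Ψ)
      else 0
termination_by (i, 3 * i + 1 - m)
decreasing_by
  · rcases h.2 with h' | h'
    · exact Prod.Lex.left _ _ h'
    · rcases Nat.lt_or_ge (j : ℕ) i with h'' | h''
      · exact Prod.Lex.left _ _ h''
      · have hj : (j : ℕ) = i := by omega
        rw [hj]
        exact Prod.Lex.right _ (by omega)
  · exact Prod.Lex.left _ _ (by omega)

theorem effForce_zero_left {d : ℕ} (σ : ℝ) (χ : ℝ → ℝ) (ξ : Distr d) (c : ℕ → ℝ → ℝ) (κ : ℝ)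
    (m : ℕ) (hm : 0 < m) (μ : ℝ) : effForce σ χ ξ c κ 0 m μ = fun _ => 0 := by
  funext Ψ
  rw [effForce, dif_pos (by omega)]

theorem pair_zero {d : ℕ} (ξ : Distr d) : pair ξ (fun _ => 0) = 0 := by
  have h : ∃ ψ : 𝓢(Space d, ℝ), ∀ x, ψ x = (fun _ : Space d => (0 : ℝ)) x := ⟨0, fun _ => rfl⟩
  have h0 : h.choose = 0 := by
    ext x
    exact h.choose_spec x
  rw [pair, dif_pos h, h0, map_zero]

theorem force_const_zero {d : ℕ} (σ : ℝ) (ξ : Distr d) (c : ℕ → ℝ → ℝ) (κ : ℝ) (i m : ℕ) :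
    force σ ξ c κ i m (fun _ => 0) = 0 := by
  unfold force
  split_ifs <;> simp [pair_zero]

theorem effForce_const_zero {d : ℕ} (σ : ℝ) (χ : ℝ → ℝ) (ξ : Distr d) (c : ℕ → ℝ → ℝ) (κ : ℝ)
    (i m : ℕ) (μ : ℝ) : effForce σ χ ξ c κ i m μ (fun _ => 0) = 0 := by
  rw [effForce]
  split_ifs with h1 h2
  · rfl
  · exact pair_zero ξ
  · rw [force_const_zero, zero_add]
    have key : ∀ η : ℝ, (-(1 / (m.factorial : ℝ)) * ∑ π : Equiv.Perm (Fin m),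
        ∑ j : Fin (i + 1), ∑ k : Fin (m + 1),
          if _h : 0 < (j : ℕ) ∧ ((j : ℕ) < i ∨ (k : ℕ) = m) then
            (1 + (k : ℝ)) * pairB (k : ℕ) (dPropagator d σ χ κ η)
              (effForce σ χ ξ c κ j (k + 1) η) (effForce σ χ ξ c κ (i - j) (m - k) η)
              (permTest π (fun _ => 0))
          else 0) = 0 := by
      intro η
      refine mul_eq_zero_of_right _ (Finset.sum_eq_zero fun π _ => Finset.sum_eq_zero fun j _ =>
        Finset.sum_eq_zero fun k _ => ?_)
      split_ifs with h
      · have hU := effForce_const_zero σ χ ξ c κ (i - j) (m - k) η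
        have hW := effForce_const_zero σ χ ξ c κ j (k + 1) η
        simp only [pairB, permTest, mul_zero, hU, hW]
      · rfl
    simp only [key, intervalIntegral.integral_zero]
termination_by (i, 3 * i + 1 - m)
decreasing_by
  · exact Prod.Lex.left _ _ (by omega)
  · rcases Nat.lt_or_ge (j : ℕ) i with h'' | h''
    · exact Prod.Lex.left _ _ h''
    · have hj : (j : ℕ) = i := by omega
      rw [hj]
      exact Prod.Lex.right _ (by omega)

/-- The flow equation with the unrestricted sums over `j` and `k`. -/
theorem effForce_eq {d : ℕ} (σ : ℝ) (χ : ℝ → ℝ) (ξ : Distr d) (c : ℕ → ℝ → ℝ) (κ : ℝ) (i m : ℕ)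
    (hi : 0 < i) (hm : m ≤ 3 * i) (μ : ℝ) (Ψ : Config d m → ℝ) :
    effForce σ χ ξ c κ i m μ Ψ = force σ ξ c κ i m Ψ + ∫ η in (0 : ℝ)..μ,
      -(1 / (m.factorial : ℝ)) * ∑ π : Equiv.Perm (Fin m),
        ∑ j ∈ Finset.range (i + 1), ∑ k ∈ Finset.range (m + 1),
          (1 + (k : ℝ)) * pairB k (dPropagator d σ χ κ η) (effForce σ χ ξ c κ j (k + 1) η)
            (effForce σ χ ξ c κ (i - j) (m - k) η) (permTest π Ψ) := by
  rw [effForce, dif_neg (by omega), dif_neg (by omega)]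
  congr 1
  refine intervalIntegral.integral_congr fun η _ => ?_
  simp only [Finset.sum_range]
  congr 1
  refine Finset.sum_congr rfl fun π _ => Finset.sum_congr rfl fun j _ =>
    Finset.sum_congr rfl fun k _ => ?_
  split_ifs with h
  · rfl
  · rcases Nat.eq_zero_or_pos (j : ℕ) with hj | hj
    · rw [hj, effForce_zero_left _ _ _ _ _ _ (by omega)]
      simp [pairB]
    · have h1 : i - (j : ℕ) = 0 := by omega
      have h2 : 0 < m - (k : ℕ) := by omega
      rw [h1, effForce_zero_left _ _ _ _ _ _ h2]
      simp [pairB, effForce_const_zero]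

/-! ### Generalized coefficients -/

/-- The pairing of `F^{i,m,a}_{κ,μ} = 𝒳^{m,a} F^{i,m}_{κ,μ}` with `Ψ`. -/
def genForce {d : ℕ} (σ : ℝ) (χ : ℝ → ℝ) (ξ : Distr d) (c : ℕ → ℝ → ℝ) (i m : ℕ)
    (a : MultiIdx d m) (κ μ : ℝ) (Ψ : Config d m → ℝ) : ℝ :=
  effForce σ χ ξ c κ i m μ fun p => monomial a p * Ψ p

/-- The pairing of `f^{i,m,a}_{κ,μ}` with `ψ`: `⟨f^{i,m,a}_{κ,μ}, ψ⟩` is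
`⟨F^{i,m,a}_{κ,μ}, ψ ⊗ 1^{⊗m}⟩`. Here `𝕄` is identified with `𝕄^{1+0}`. -/
def enhNoise {d : ℕ} (σ : ℝ) (χ : ℝ → ℝ) (ξ : Distr d) (c : ℕ → ℝ → ℝ) (i m : ℕ)
    (a : MultiIdx d m) (κ μ : ℝ) (ψ : Config d 0 → ℝ) : ℝ :=
  genForce σ χ ξ c i m a κ μ fun p => ψ (p.1, Fin.elim0)

/-! ### Parameter derivatives of families of distributions -/

/-- `D` is the `n`-th derivative at `t`, within the set `S`, of the family `U` of functionals on a
space `Θ` of test functions, in the weak sense (after pairing with every test function). -/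
def HasWeakDeriv {Θ : Type*} (S : Set ℝ) :
    ℕ → (ℝ → Θ → ℝ) → ℝ → (Θ → ℝ) → Prop
  | 0, U, t, D => D = U t
  | n + 1, U, t, D => ∃ U' : ℝ → Θ → ℝ, (∀ t' ∈ S, HasWeakDeriv S n U t' (U' t')) ∧
      ∀ φ, HasDerivWithinAt (fun t' => U' t' φ) (D φ) S t

/-- `D = ∂_κ^r ∂_μ^s V_{κ,μ}` for a family `V` with `κ ∈ (0,1/2]` and `μ ∈ (0,1]`. -/
def HasMixedDeriv {Θ : Type*} (r s : ℕ) (V : ℝ → ℝ → Θ → ℝ) (κ μ : ℝ) (D : Θ → ℝ) : Prop :=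
  ∃ U : ℝ → Θ → ℝ, (∀ κ' ∈ Ioc (0 : ℝ) (1 / 2), HasWeakDeriv (Ioc 0 1) s (V κ') μ (U κ')) ∧
    HasWeakDeriv (Ioc 0 (1 / 2)) r U κ D

/-! ### Regularizing kernels -/

/-- The density of the kernel `K_μ = (1 - ℓ² Δ)⁻¹ δ`, `ℓ = [μ] > 0`, in the form
`∫₀^∞ e^{-t} exp(t ℓ² Δ) dt` of the resolvent. -/
def regDensity (d : ℕ) (ℓ : ℝ) (x : Space d) : ℝ :=
  ∫ t in Ioi (0 : ℝ), Real.exp (-t) *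
    ((4 * Real.pi * t * ℓ ^ 2) ^ (-(d : ℝ) / 2) * Real.exp (-‖x‖ ^ 2 / (4 * t * ℓ ^ 2)))

/-- `K_μ` as a measure on `𝕄`. -/
def regKernel (d : ℕ) (σ μ : ℝ) : Measure (Space d) :=
  volume.withDensity fun x => ENNReal.ofReal (regDensity d (scale σ μ) x)

/-- `K_μ^{∗g}`: `K_μ^{∗0} = δ` and `K_μ^{∗(g+1)} = K_μ ∗ K_μ^{∗g}`. -/
def regKernelPow (d : ℕ) (σ μ : ℝ) : ℕ → Measure (Space d)
  | 0 => Measure.dirac 0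
  | g + 1 => (regKernel d σ μ).conv (regKernelPow d σ μ g)

/-- `K_μ^{∗g,⊗(1+m)}`. -/
def regKernelTensor (d m : ℕ) (σ μ : ℝ) (g : ℕ) : Measure (Config d m) :=
  (regKernelPow d σ μ g).prod (Measure.pi fun _ => regKernelPow d σ μ g)

/-! ### The spaces `𝒱^m` -/

/-- `‖v‖_{𝒱^m} = sup_x ∫ |v(x; y₁,…,y_m)| dy₁ ⋯ dy_m`, with values in `[0,∞]`. -/
def normV {d m : ℕ} (v : Config d m → ℝ) : ℝ≥0∞ :=
  ⨆ x : Space d, ∫⁻ y : Fin m → Space d, ‖v (x, y)‖ₑ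

/-- Membership in `𝒱^m`. -/
structure MemV {d m : ℕ} (v : Config d m → ℝ) : Prop where
  continuous : Continuous v
  norm_lt_top : normV v < ⊤
  periodic : ∀ (n : Fin d → ℤ) (x : Space d) (y : Fin m → Space d),
    v (x + latticePoint n, fun q => y q + (x + latticePoint n)) = v (x, fun q => y q + x)

/-- `K_μ^{∗g,⊗(1+m)} ∗ T = v` for a distribution `T` on `𝕄^{1+m}`: for every test function `Φ`,
`∫ v Φ` is the pairing of `T` with `z ↦ ∫ Φ(z + w) K_μ^{∗g,⊗(1+m)}(dw)`. -/
def IsRegularization {d m : ℕ} (σ : ℝ) (g : ℕ) (μ : ℝ) (T : 𝓢(Config d m, ℝ) → ℝ)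
    (v : Config d m → ℝ) : Prop :=
  ∀ Φ : 𝓢(Config d m, ℝ), ∃ Ψ : 𝓢(Config d m, ℝ),
    (∀ z, Ψ z = ∫ w, Φ (z + w) ∂(regKernelTensor d m σ μ g)) ∧ T Ψ = ∫ z, v z * Φ z

/-- `K_μ^{∗g,⊗(1+m)} ∗ ∂_κ^r ∂_μ^s V_{κ,μ}` exists, belongs to `𝒱^m` and satisfies
`‖K_μ^{∗g,⊗(1+m)} ∗ ∂_κ^r ∂_μ^s V_{κ,μ}‖_{𝒱^m} ≤ B`. -/
def RegBound {d m : ℕ} (σ : ℝ) (g r s : ℕ) (V : ℝ → ℝ → (Config d m → ℝ) → ℝ)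
    (κ μ B : ℝ) : Prop :=
  ∃ (D : 𝓢(Config d m, ℝ) → ℝ) (v : Config d m → ℝ),
    HasMixedDeriv r s (fun κ' μ' (Φ : 𝓢(Config d m, ℝ)) => V κ' μ' Φ) κ μ D ∧
      IsRegularization σ g μ D v ∧ MemV v ∧ normV v ≤ ENNReal.ofReal B

end

end EllipticFlow

open EllipticFlow

namespace EllipticFlow

noncomputable section

/-! ### Pointwise bounds on iterated directional derivatives -/

section DB

variable {E F : Type*} [NormedAddCommGroup E] [NormedSpace ℝ E]
  [NormedAddCommGroup F] [NormedSpace ℝ F]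

/-- `DB n ℓ M f x`: all iterated directional derivatives of `f` at `x` of order `j ≤ n` in the
directions `v₁, …, v_j` are bounded by `M ∏ ‖v_i‖ / ℓ`. -/
def DB : ℕ → ℝ → ℝ → (E → ℝ) → E → Prop
  | 0, _, M, f, x => |f x| ≤ M
  | n + 1, ℓ, M, f, x => |f x| ≤ M ∧ ∀ v, DB n ℓ (M * (‖v‖ / ℓ)) (fun y => fderiv ℝ f y v) x

theorem DB.abs_le {n : ℕ} {ℓ M : ℝ} {f : E → ℝ} {x : E} (h : DB n ℓ M f x) : |f x| ≤ M := by
  cases n with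
  | zero => exact h
  | succ n => exact h.1

theorem DB.nonneg {n : ℕ} {ℓ M : ℝ} {f : E → ℝ} {x : E} (h : DB n ℓ M f x) : 0 ≤ M :=
  (abs_nonneg _).trans h.abs_le

theorem DB.mono {n : ℕ} {ℓ M M' : ℝ} {f : E → ℝ} {x : E} (hℓ : 0 < ℓ) (h : DB n ℓ M f x)
    (hM : M ≤ M') : DB n ℓ M' f x := by
  induction n generalizing M M' f with
  | zero => exact le_trans h hM
  | succ n ih =>
    exact ⟨h.1.trans hM, fun v => ih (h.2 v) (mul_le_mul_of_nonneg_right hM (by positivity))⟩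

theorem DB.of_succ {n : ℕ} {ℓ M : ℝ} {f : E → ℝ} {x : E} (h : DB (n + 1) ℓ M f x) :
    DB n ℓ M f x := by
  induction n generalizing M f with
  | zero => exact h.1
  | succ n ih => exact ⟨h.1, fun v => ih (h.2 v)⟩

theorem DB.of_le {n n' : ℕ} {ℓ M : ℝ} {f : E → ℝ} {x : E} (h : DB n ℓ M f x) (hn : n' ≤ n) :
    DB n' ℓ M f x := by
  induction hn with
  | refl => exact h
  | step _ ih => exact ih h.of_succ

theorem DB.congr {n : ℕ} {ℓ M : ℝ} {f g : E → ℝ} {x : E} (h : DB n ℓ M f x)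
    (hfg : f =ᶠ[nhds x] g) : DB n ℓ M g x := by
  induction n generalizing M f g with
  | zero => simpa [DB, hfg.eq_of_nhds] using h
  | succ n ih =>
    refine ⟨hfg.eq_of_nhds ▸ h.1, fun v => ih (h.2 v) ?_⟩
    filter_upwards [hfg.fderiv (𝕜 := ℝ)] with y hy
    rw [hy]

theorem DB.const {n : ℕ} {ℓ M c : ℝ} {x : E} (hℓ : 0 < ℓ) (h : |c| ≤ M) :
    DB n ℓ M (fun _ : E => c) x := by
  induction n generalizing M c with
  | zero => exact h
  | succ n ih =>
    refine ⟨h, fun v => ?_⟩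
    have : (fun y : E => fderiv ℝ (fun _ : E => c) y v) = fun _ => 0 := by
      funext y; simp
    rw [this]
    exact ih (by simpa using mul_nonneg ((abs_nonneg c).trans h) (by positivity))

theorem DB.of_eventually_zero {n : ℕ} {ℓ M : ℝ} {f : E → ℝ} {x : E} (hℓ : 0 < ℓ) (hM : 0 ≤ M)
    (h : f =ᶠ[nhds x] fun _ => 0) : DB n ℓ M f x :=
  DB.congr (DB.const hℓ (by simpa using hM)) h.symm

theorem contDiffAt_dir {n : ℕ} {f : E → ℝ} {x : E} (hf : ContDiffAt ℝ (n + 1 : ℕ) f x) (v : E) :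
    ContDiffAt ℝ n (fun y => fderiv ℝ f y v) x :=
  (hf.fderiv_right (m := n) (by norm_cast)).clm_apply contDiffAt_const

theorem contDiff_dir {n : ℕ} {f : E → ℝ} (hf : ContDiff ℝ (n + 1 : ℕ) f) (v : E) :
    ContDiff ℝ n (fun y => fderiv ℝ f y v) :=
  (hf.fderiv_right (m := n) (by norm_cast)).clm_apply contDiff_const

theorem eventually_differentiableAt {n : ℕ} {f : E → ℝ} {x : E}
    (hf : ContDiffAt ℝ (n + 1 : ℕ) f x) : ∀ᶠ y in nhds x, DifferentiableAt ℝ f y := by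
  filter_upwards [hf.eventually (by simp)] with y hy
  exact hy.differentiableAt (by simp)

theorem DB.add {n : ℕ} {ℓ M M' : ℝ} {f g : E → ℝ} {x : E}
    (hf : ContDiffAt ℝ n f x) (hg : ContDiffAt ℝ n g x) (h : DB n ℓ M f x) (h' : DB n ℓ M' g x) :
    DB n ℓ (M + M') (fun y => f y + g y) x := by
  induction n generalizing M M' f g with
  | zero => exact (abs_add_le _ _).trans (add_le_add h h')
  | succ n ih =>
    refine ⟨(abs_add_le _ _).trans (add_le_add h.1 h'.1), fun v => ?_⟩
    rw [add_mul]
    refine (ih (contDiffAt_dir hf v) (contDiffAt_dir hg v) (h.2 v) (h'.2 v)).congr ?_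
    filter_upwards [eventually_differentiableAt hf, eventually_differentiableAt hg] with y h1 h2
    rw [fderiv_fun_add h1 h2]; rfl

theorem DB.mul {n : ℕ} {ℓ M M' : ℝ} {f g : E → ℝ} {x : E}
    (hf : ContDiffAt ℝ n f x) (hg : ContDiffAt ℝ n g x) (h : DB n ℓ M f x) (h' : DB n ℓ M' g x) :
    DB n ℓ (2 ^ n * (M * M')) (fun y => f y * g y) x := by
  induction n generalizing M M' f g with
  | zero =>
    simp only [DB, abs_mul, pow_zero, one_mul] at *
    exact mul_le_mul h h' (abs_nonneg _) ((abs_nonneg _).trans h)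
  | succ n ih =>
    have hM := h.nonneg
    have hM' := h'.nonneg
    refine ⟨?_, fun v => ?_⟩
    · rw [abs_mul]
      calc _ ≤ M * M' := mul_le_mul h.1 h'.1 (abs_nonneg _) hM
        _ ≤ _ := le_mul_of_one_le_left (by positivity) (one_le_pow₀ (by norm_num))
    · have h1 := ih (contDiffAt_dir hf v) (hg.of_le (by norm_cast; omega)) (h.2 v) h'.of_succ
      have h2 := ih (hf.of_le (by norm_cast; omega)) (contDiffAt_dir hg v) h.of_succ (h'.2 v)
      have h3 := DB.add ((contDiffAt_dir hf v).mul (hg.of_le (by norm_cast; omega)))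
        ((hf.of_le (by norm_cast; omega)).mul (contDiffAt_dir hg v)) h1 h2
      have e : 2 ^ n * (M * (‖v‖ / ℓ) * M') + 2 ^ n * (M * (M' * (‖v‖ / ℓ)))
          = 2 ^ (n + 1) * (M * M') * (‖v‖ / ℓ) := by ring
      rw [e] at h3
      refine h3.congr ?_
      filter_upwards [eventually_differentiableAt hf, eventually_differentiableAt hg] with y h1 h2
      rw [fderiv_fun_mul h1 h2]
      simp only [add_apply, smul_apply, smul_eq_mul]
      ring

theorem DB.const_mul {n : ℕ} {ℓ M : ℝ} {f : E → ℝ} {x : E} (c : ℝ)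
    (hf : ContDiffAt ℝ n f x) (h : DB n ℓ M f x) : DB n ℓ (|c| * M) (fun y => c * f y) x := by
  induction n generalizing M f with
  | zero =>
    simp only [DB, abs_mul] at *
    gcongr
  | succ n ih =>
    refine ⟨?_, fun v => ?_⟩
    · rw [abs_mul]; exact mul_le_mul_of_nonneg_left h.1 (abs_nonneg _)
    · rw [mul_assoc]
      refine (ih (contDiffAt_dir hf v) (h.2 v)).congr ?_
      filter_upwards [eventually_differentiableAt hf] with y h1
      rw [fderiv_const_mul h1]; rfl

theorem DB.sum {ι : Type*} (s : Finset ι) {n : ℕ} {ℓ : ℝ} {M : ι → ℝ} {f : ι → E → ℝ} {x : E}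
    (hℓ : 0 < ℓ) (hf : ∀ i ∈ s, ContDiffAt ℝ n (f i) x) (h : ∀ i ∈ s, DB n ℓ (M i) (f i) x) :
    DB n ℓ (∑ i ∈ s, M i) (fun y => ∑ i ∈ s, f i y) x := by
  classical
  induction s using Finset.induction_on with
  | empty => simpa using DB.const hℓ (by simp)
  | insert a s ha ih =>
    simp only [Finset.sum_insert ha]
    exact DB.add (hf a (by simp)) (ContDiffAt.sum fun i hi => hf i (by simp [hi])) (h a (by simp))
      (ih (fun i hi => hf i (by simp [hi])) fun i hi => h i (by simp [hi]))

theorem DB.prod {ι : Type*} (s : Finset ι) {n : ℕ} {ℓ : ℝ} {M : ι → ℝ} {f : ι → E → ℝ} {x : E}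
    (hℓ : 0 < ℓ) (hf : ∀ i ∈ s, ContDiffAt ℝ n (f i) x) (h : ∀ i ∈ s, DB n ℓ (M i) (f i) x) :
    DB n ℓ (2 ^ (n * s.card) * ∏ i ∈ s, M i) (fun y => ∏ i ∈ s, f i y) x := by
  classical
  induction s using Finset.induction_on with
  | empty => simpa using DB.const hℓ (by simp)
  | insert a s ha ih =>
    simp only [Finset.prod_insert ha, Finset.card_insert_of_notMem ha]
    have := DB.mul (hf a (by simp)) (contDiffAt_prod fun i hi => hf i (by simp [hi])) (h a (by simp))
      (ih (fun i hi => hf i (by simp [hi])) fun i hi => h i (by simp [hi]))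
    convert this using 1
    ring

theorem DB.rescale {n : ℕ} {ℓ ℓ' c M : ℝ} {f : E → ℝ} {x : E} (hℓ : 0 < ℓ) (hℓ' : 0 < ℓ')
    (hc : 1 ≤ c) (hℓℓ : ℓ' ≤ c * ℓ) (h : DB n ℓ M f x) : DB n ℓ' (c ^ n * M) f x := by
  induction n generalizing M f with
  | zero => simpa [DB] using h
  | succ n ih =>
    have hM := h.nonneg
    refine ⟨h.1.trans (le_mul_of_one_le_left hM (one_le_pow₀ hc)), fun v => ?_⟩
    refine (ih (h.2 v)).mono hℓ' ?_
    rw [pow_succ, mul_assoc, mul_assoc]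
    refine mul_le_mul_of_nonneg_left ?_ (by positivity)
    rw [mul_left_comm c M]
    refine mul_le_mul_of_nonneg_left ?_ hM
    rw [mul_div_assoc', div_le_div_iff₀ hℓ hℓ']
    nlinarith [norm_nonneg v]

theorem DB.scale_le {n : ℕ} {ℓ ℓ' M : ℝ} {f : E → ℝ} {x : E} (hℓ : 0 < ℓ) (hℓ' : 0 < ℓ')
    (hℓℓ : ℓ' ≤ ℓ) (h : DB n ℓ M f x) : DB n ℓ' M f x := by
  simpa using DB.rescale hℓ hℓ' le_rfl (by simpa using hℓℓ) h

theorem DB.comp_affine {n : ℕ} {ℓ ℓ' M : ℝ} {f : E → ℝ} {y : F} (L : F →L[ℝ] E) (b : E)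
    (hℓ' : 0 < ℓ') (hL : ∀ v, ‖L v‖ / ℓ ≤ ‖v‖ / ℓ') (hf : ContDiffAt ℝ n f (L y + b))
    (h : DB n ℓ M f (L y + b)) : DB n ℓ' M (fun z => f (L z + b)) y := by
  induction n generalizing M f with
  | zero => exact h
  | succ n ih =>
    refine ⟨h.1, fun v => ?_⟩
    have h1 := ih (contDiffAt_dir hf (L v)) (h.2 (L v))
    refine (h1.mono hℓ' (mul_le_mul_of_nonneg_left (hL v) h.nonneg)).congr ?_
    have hc : ContinuousAt (fun z : F => L z + b) y := by fun_prop
    filter_upwards [hc.eventually (eventually_differentiableAt hf)] with z hz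
    have h2 : HasFDerivAt (fun z : F => L z + b) L z := L.hasFDerivAt.add_const b
    have h3 := (hz.hasFDerivAt.comp z h2).fderiv
    have h4 : (fun z => f (L z + b)) = f ∘ fun z => L z + b := rfl
    rw [h4, h3]; rfl

theorem DB.linear {n : ℕ} {ℓ M : ℝ} {x : E} (L : E →L[ℝ] ℝ) (b : ℝ) (hℓ : 0 < ℓ)
    (h0 : |L x + b| ≤ M) (h : ∀ v, |L v| ≤ M * (‖v‖ / ℓ)) :
    DB n ℓ M (fun y => L y + b) x := by
  cases n with
  | zero => exact h0
  | succ n =>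
    refine ⟨h0, fun v => ?_⟩
    have : (fun y : E => fderiv ℝ (fun y => L y + b) y v) = fun _ => L v := by
      funext y; rw [(L.hasFDerivAt.add_const b).fderiv]
    rw [this]
    exact DB.const hℓ (h v)

theorem iteratedFDeriv_dir {n : ℕ} {f : E → ℝ} {x : E} (hf : ContDiffAt ℝ (n + 1 : ℕ) f x) (v : E)
    (m : Fin n → E) : iteratedFDeriv ℝ n (fun y => fderiv ℝ f y v) x m =
      iteratedFDeriv ℝ n (fderiv ℝ f) x m v := by
  have : (fun y => fderiv ℝ f y v) = (ContinuousLinearMap.apply ℝ ℝ v) ∘ fderiv ℝ f := rfl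
  rw [this, ContinuousLinearMap.iteratedFDeriv_comp_left _
    (hf.fderiv_right (m := n) (by norm_cast)) le_rfl]
  rfl

theorem DB.of_iteratedFDeriv {n : ℕ} {ℓ M : ℝ} {f : E → ℝ} {x : E} (hℓ : 0 < ℓ)
    (hf : ContDiffAt ℝ n f x)
    (h : ∀ j ≤ n, ‖iteratedFDeriv ℝ j f x‖ ≤ M / ℓ ^ j) : DB n ℓ M f x := by
  induction n generalizing M f with
  | zero => simpa [DB] using h 0 le_rfl
  | succ n ih =>
    refine ⟨by simpa using h 0 (by omega), fun v => ih (contDiffAt_dir hf v) fun j hj => ?_⟩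
    have h1 := h (j + 1) (by omega)
    have hM : 0 ≤ M := by simpa using (norm_nonneg _).trans (h 0 (by omega))
    refine ContinuousMultilinearMap.opNorm_le_bound (by positivity) fun m => ?_
    rw [iteratedFDeriv_dir (hf.of_le (by norm_cast; omega))]
    have h2 : iteratedFDeriv ℝ j (fderiv ℝ f) x m v
        = iteratedFDeriv ℝ (j + 1) f x (Fin.snoc m v) := by
      rw [iteratedFDeriv_succ_apply_right]; simp
    rw [h2]
    refine (ContinuousMultilinearMap.le_of_opNorm_le h1 _).trans (le_of_eq ?_)
    rw [Fin.prod_univ_castSucc]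
    simp only [Fin.snoc_castSucc, Fin.snoc_last]
    rw [pow_succ]
    field_simp

theorem DB.iteratedFDeriv_apply {n : ℕ} {ℓ M : ℝ} {f : E → ℝ} {x : E}
    (hf : ContDiffAt ℝ n f x) (h : DB n ℓ M f x) (m : Fin n → E) :
    |iteratedFDeriv ℝ n f x m| ≤ M * ∏ i, (‖m i‖ / ℓ) := by
  induction n generalizing M f with
  | zero => simpa [DB] using h
  | succ n ih =>
    have h1 := ih (contDiffAt_dir hf (m (Fin.last n))) (h.2 (m (Fin.last n))) (Fin.init m)
    rw [iteratedFDeriv_dir hf] at h1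
    rw [iteratedFDeriv_succ_apply_right, Fin.prod_univ_castSucc]
    refine h1.trans (le_of_eq ?_)
    simp only [Fin.init]
    ring

theorem DB.norm_iteratedFDeriv_le {n : ℕ} {M : ℝ} {f : E → ℝ} {x : E}
    (hf : ContDiffAt ℝ n f x) (h : DB n 1 M f x) : ‖iteratedFDeriv ℝ n f x‖ ≤ M := by
  refine ContinuousMultilinearMap.opNorm_le_bound h.nonneg fun m => ?_
  simpa using h.iteratedFDeriv_apply hf m

theorem DB.norm_fderiv_le {n : ℕ} {M : ℝ} {f : E → ℝ} {x : E}
    (h : DB (n + 1) 1 M f x) : ‖fderiv ℝ f x‖ ≤ M := by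
  refine ContinuousLinearMap.opNorm_le_bound _ h.nonneg fun v => ?_
  simpa using (h.2 v).abs_le

/-- On a compact set the derivatives of a smooth function are bounded. -/
theorem exists_DB_of_isCompact {n : ℕ} {f : E → ℝ} (hf : ContDiff ℝ n f) {K : Set E}
    (hK : IsCompact K) : ∃ C, 0 ≤ C ∧ ∀ x ∈ K, DB n 1 C f x := by
  have h : ∀ j : ℕ, ∃ C : ℝ, j ≤ n → ∀ x ∈ K, ‖iteratedFDeriv ℝ j f x‖ ≤ C := by
    intro j
    by_cases hj : j ≤ n
    · obtain ⟨C, hC⟩ := hK.exists_bound_of_continuousOn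
        (hf.continuous_iteratedFDeriv (m := j) (by exact_mod_cast hj)).continuousOn
      exact ⟨C, fun _ => hC⟩
    · exact ⟨0, fun h => absurd h hj⟩
  choose C hC using h
  refine ⟨∑ j ∈ Finset.range (n + 1), |C j|, Finset.sum_nonneg fun _ _ => abs_nonneg _,
    fun x hx => DB.of_iteratedFDeriv one_pos hf.contDiffAt fun j hj => ?_⟩
  rw [one_pow, div_one]
  refine ((hC j hj x hx).trans (le_abs_self _)).trans ?_
  exact Finset.single_le_sum (f := fun j => |C j|) (fun _ _ => abs_nonneg _)
    (Finset.mem_range.2 (by omega))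

end DB

/-! ### Differentiation under the integral sign -/

section Param

variable {E : Type*} [NormedAddCommGroup E] [NormedSpace ℝ E]
  {T : Type*} [MeasurableSpace T]

/-- The family `f t` of `C^n` functions can be integrated with respect to `τ`. -/
structure ParamInt (τ : Measure T) (n : ℕ) (f : T → E → ℝ) : Prop where
  smooth : ∀ᵐ t ∂τ, ContDiff ℝ n (f t)
  meas : ∀ x, AEStronglyMeasurable (fun t => f t x) τ
  bound : ∀ x₀, ∃ r > 0, ∃ b : T → ℝ, Integrable b τ ∧ ∀ᵐ t ∂τ, ∀ x ∈ Metric.ball x₀ r,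
    DB n 1 (b t) (f t) x

variable {τ : Measure T} {n : ℕ} {f : T → E → ℝ}

theorem ParamInt.integrable (h : ParamInt τ n f) (x : E) : Integrable (fun t => f t x) τ := by
  obtain ⟨r, hr, b, hb, h1⟩ := h.bound x
  refine hb.mono' (h.meas x) ?_
  filter_upwards [h1] with t ht
  exact (ht x (Metric.mem_ball_self hr)).abs_le

theorem ParamInt.meas_dir (h : ParamInt τ (n + 1) f) (x v : E) :
    AEStronglyMeasurable (fun t => fderiv ℝ (f t) x v) τ := by
  refine aestronglyMeasurable_of_tendsto_ae Filter.atTop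
    (f := fun (k : ℕ) t => ((k : ℝ) + 1) * (f t (x + (1 / ((k : ℝ) + 1)) • v) - f t x))
    (fun k => ((h.meas _).sub (h.meas _)).const_mul _) ?_
  filter_upwards [h.smooth] with t ht
  have h1 : HasFDerivAt (f t) (fderiv ℝ (f t) x) x :=
    ((ht.differentiable (by simp)) x).hasFDerivAt
  have := h1.lim v (c := fun k : ℕ => (k : ℝ) + 1) (l := Filter.atTop) (by
    refine Filter.tendsto_atTop_mono (fun k : ℕ => ?_) tendsto_natCast_atTop_atTop
    simp only [Real.norm_eq_abs]; exact (by linarith : (k : ℝ) ≤ k + 1).trans (le_abs_self _))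
  refine this.congr fun k => ?_
  simp [smul_eq_mul]

theorem ParamInt.dir (h : ParamInt τ (n + 1) f) (v : E) :
    ParamInt τ n (fun t x => fderiv ℝ (f t) x v) := by
  refine ⟨?_, fun x => h.meas_dir x v, fun x₀ => ?_⟩
  · filter_upwards [h.smooth] with t ht
    exact contDiff_dir ht v
  · obtain ⟨r, hr, b, hb, h1⟩ := h.bound x₀
    refine ⟨r, hr, fun t => b t * (‖v‖ / 1), hb.mul_const _, ?_⟩
    filter_upwards [h1] with t ht x hx
    exact (ht x hx).2 v

variable [FiniteDimensional ℝ E]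

theorem ParamInt.hasFDerivAt (h : ParamInt τ (n + 1) f) (x : E) :
    Integrable (fun t => fderiv ℝ (f t) x) τ ∧
    HasFDerivAt (fun y => ∫ t, f t y ∂τ) (∫ t, fderiv ℝ (f t) x ∂τ) x := by
  obtain ⟨r, hr, b, hb, h1⟩ := h.bound x
  have hm : AEStronglyMeasurable (fun t => fderiv ℝ (f t) x) τ := by
    let B := Module.finBasis ℝ E
    have e : (fun t => fderiv ℝ (f t) x) = fun t => ∑ i, (fderiv ℝ (f t) x (B i)) •
        (LinearMap.toContinuousLinearMap (B.coord i)) := by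
      funext t
      ext v
      simp only [sum_apply, smul_apply, LinearMap.coe_toContinuousLinearMap',
        Module.Basis.coord_apply, smul_eq_mul]
      conv_lhs => rw [← B.sum_repr v, map_sum]
      simp only [map_smul, smul_eq_mul, mul_comm]
    rw [e]
    exact Finset.aestronglyMeasurable_fun_sum _ fun i _ => (h.meas_dir x (B i)).smul_const _
  refine ⟨hb.mono' hm ?_, hasFDerivAt_integral_of_dominated_of_fderiv_le (s := Metric.ball x r)
    (bound := b)
    (F' := fun y t => fderiv ℝ (f t) y) (Metric.ball_mem_nhds x hr) (Filter.Eventually.of_forall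
    fun y => h.meas y) (h.integrable x) hm ?_ hb ?_⟩
  · filter_upwards [h1] with t ht
    exact (ht x (Metric.mem_ball_self hr)).norm_fderiv_le
  · filter_upwards [h1] with t ht y hy
    exact (ht y hy).norm_fderiv_le
  · filter_upwards [h.smooth] with t ht y _
    exact ((ht.differentiable (by simp)) y).hasFDerivAt

theorem ParamInt.fderiv_apply (h : ParamInt τ (n + 1) f) (x v : E) :
    fderiv ℝ (fun y => ∫ t, f t y ∂τ) x v = ∫ t, fderiv ℝ (f t) x v ∂τ := by
  rw [(h.hasFDerivAt x).2.fderiv, ContinuousLinearMap.integral_apply (h.hasFDerivAt x).1]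

theorem ParamInt.contDiff (h : ParamInt τ n f) : ContDiff ℝ n (fun x => ∫ t, f t x ∂τ) := by
  induction n generalizing f with
  | zero =>
    rw [Nat.cast_zero, contDiff_zero, continuous_iff_continuousAt]
    intro x
    obtain ⟨r, hr, b, hb, h1⟩ := h.bound x
    refine continuousAt_of_dominated (bound := b) (Filter.Eventually.of_forall fun y => h.meas y)
      ?_ hb ?_
    · filter_upwards [Metric.ball_mem_nhds x hr] with y hy
      filter_upwards [h1] with t ht
      exact (ht y hy).abs_le
    · filter_upwards [h.smooth] with t ht
      exact ht.continuous.continuousAt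
  | succ n ih =>
    rw [Nat.cast_add, Nat.cast_one, contDiff_succ_iff_fderiv_apply]
    refine ⟨fun x => (h.hasFDerivAt x).2.differentiableAt, by simp, fun v => ?_⟩
    rw [show (fun x => fderiv ℝ (fun x => ∫ t, f t x ∂τ) x v) = _ from
      funext fun x => h.fderiv_apply x v]
    exact ih (h.dir v)

theorem ParamInt.db (h : ParamInt τ n f) {ℓ : ℝ} {M : T → ℝ} {x : E} (hM : Integrable M τ)
    (hb : ∀ᵐ t ∂τ, DB n ℓ (M t) (f t) x) : DB n ℓ (∫ t, M t ∂τ) (fun x => ∫ t, f t x ∂τ) x := by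
  have h0 : |∫ t, f t x ∂τ| ≤ ∫ t, M t ∂τ := by
    refine norm_integral_le_of_norm_le (f := fun t => f t x) hM ?_
    filter_upwards [hb] with t ht
    exact ht.abs_le
  induction n generalizing f M with
  | zero => exact h0
  | succ n ih =>
    refine ⟨h0, fun v => ?_⟩
    have h2 : ∀ᵐ t ∂τ, DB n ℓ (M t * (‖v‖ / ℓ)) (fun y => fderiv ℝ (f t) y v) x := by
      filter_upwards [hb] with t ht
      exact ht.2 v
    have h3 := ih (h.dir v) (hM.mul_const (‖v‖ / ℓ)) h2 (by
      refine norm_integral_le_of_norm_le (f := fun t => fderiv ℝ (f t) x v) (hM.mul_const _) ?_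
      filter_upwards [h2] with t ht
      exact ht.abs_le)
    rw [integral_mul_const] at h3
    exact h3.congr (Filter.Eventually.of_forall fun y => (h.fderiv_apply y v).symm)

end Param

/-! ### Symbol calculus -/

section Symbol

variable {d : ℕ}

theorem DB.inner {n : ℕ} (v : Space d) {p : Space d} (hp : p ≠ 0) :
    DB n ‖p‖ (‖v‖ * ‖p‖) (fun q => inner ℝ v q) p := by
  have hp' : 0 < ‖p‖ := norm_pos_iff.2 hp
  have := DB.linear (n := n) (x := p) (innerSL ℝ v) 0 (M := ‖v‖ * ‖p‖) hp'
    (by simpa using abs_real_inner_le_norm v p) (fun w => by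
      rw [mul_assoc, mul_div_cancel₀ _ hp'.ne']
      simpa using abs_real_inner_le_norm v w)
  simpa using this

theorem contDiff_inner_const {n : WithTop ℕ∞} (v : Space d) :
    ContDiff ℝ n (fun q : Space d => inner ℝ v q) := (innerSL ℝ v).contDiff

theorem contDiffAt_norm_rpow {n : WithTop ℕ∞} (a : ℝ) {p : Space d} (hp : p ≠ 0) :
    ContDiffAt ℝ n (fun q : Space d => ‖q‖ ^ a) p :=
  (contDiffAt_norm ℝ hp).rpow_const_of_ne (norm_ne_zero_iff.2 hp)

theorem hasFDerivAt_norm_rpow_of_ne (a : ℝ) {p : Space d} (hp : p ≠ 0) :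
    HasFDerivAt (fun q : Space d => ‖q‖ ^ a) ((a * ‖p‖ ^ (a - 2)) • innerSL ℝ p) p := by
  have hp' : 0 < ‖p‖ := norm_pos_iff.2 hp
  have h1 : HasFDerivAt (fun q : Space d => ‖q‖ ^ 2) (2 • innerSL ℝ p) p :=
    (hasStrictFDerivAt_norm_sq p).hasFDerivAt
  have h2 := h1.rpow_const (p := a / 2) (Or.inl (by positivity))
  have e : (fun q : Space d => (‖q‖ ^ 2) ^ (a / 2)) = fun q => ‖q‖ ^ a := by
    funext q
    rw [← Real.rpow_natCast, ← Real.rpow_mul (norm_nonneg _)]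
    congr 1; push_cast; ring
  rw [e] at h2
  refine h2.congr_fderiv ?_
  ext v
  simp only [smul_apply, innerSL_apply_apply, smul_eq_mul, nsmul_eq_mul]
  rw [← Real.rpow_natCast, ← Real.rpow_mul (norm_nonneg _)]
  have : ((2 : ℕ) : ℝ) * (a / 2 - 1) = a - 2 := by push_cast; ring
  rw [this]; push_cast; ring

theorem exists_DB_norm_rpow (n : ℕ) (a : ℝ) :
    ∃ C, 0 ≤ C ∧ ∀ p : Space d, p ≠ 0 → DB n ‖p‖ (C * ‖p‖ ^ a) (fun q => ‖q‖ ^ a) p := by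
  induction n generalizing a with
  | zero =>
    refine ⟨1, zero_le_one, fun p hp => ?_⟩
    simp only [DB, one_mul]
    rw [abs_of_nonneg (by positivity)]
  | succ n ih =>
    obtain ⟨C, hC, h⟩ := ih (a - 2)
    refine ⟨1 + |a| * (2 ^ n * C), by positivity, fun p hp => ?_⟩
    have hp' : 0 < ‖p‖ := norm_pos_iff.2 hp
    constructor
    · rw [abs_of_nonneg (by positivity)]
      refine le_mul_of_one_le_left (by positivity) ?_
      have : 0 ≤ |a| * (2 ^ n * C) := by positivity
      linarith
    · intro v
      have h1 := ((h p hp).mul (contDiffAt_norm_rpow _ hp)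
        (g := fun q => inner ℝ v q) (contDiff_inner_const v).contDiffAt (DB.inner v hp)).const_mul a
        ((contDiffAt_norm_rpow _ hp).mul (contDiff_inner_const v).contDiffAt)
      refine (h1.mono hp' ?_).congr ?_
      · have e : ‖p‖ ^ a = ‖p‖ ^ (a - 2) * ‖p‖ ^ (2 : ℝ) := by
          rw [← Real.rpow_add hp']; congr 1; ring
        have e2 : ‖p‖ ^ (2 : ℝ) = ‖p‖ * ‖p‖ := by
          rw [← sq, ← Real.rpow_natCast]; norm_num
        calc |a| * (2 ^ n * (C * ‖p‖ ^ (a - 2) * (‖v‖ * ‖p‖)))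
            = |a| * (2 ^ n * C) * ‖p‖ ^ a * (‖v‖ / ‖p‖) := by
              rw [e, e2]; field_simp
          _ ≤ _ := by
              gcongr; linarith
      · filter_upwards [isOpen_ne.mem_nhds hp] with q hq
        rw [(hasFDerivAt_norm_rpow_of_ne a hq).fderiv]
        simp only [smul_apply, innerSL_apply_apply, smul_eq_mul]
        rw [real_inner_comm]; ring

theorem pow_mul_exp_neg_le (k : ℕ) {s : ℝ} (hs : 0 ≤ s) :
    s ^ k * Real.exp (-s) ≤ 2 ^ k * k.factorial * Real.exp (-s / 2) := by
  have h1 := Real.pow_div_factorial_le_exp (s / 2) (by positivity) k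
  rw [div_le_iff₀ (by positivity), div_pow, div_le_iff₀ (by positivity)] at h1
  have e : Real.exp (-s) = Real.exp (-s / 2) * Real.exp (-s / 2) := by
    rw [← Real.exp_add]; congr 1; ring
  have e2 : Real.exp (s / 2) * Real.exp (-s / 2) = 1 := by
    rw [← Real.exp_add]; simp [← add_div]
  calc s ^ k * Real.exp (-s) ≤ (Real.exp (s / 2) * k.factorial * 2 ^ k) * Real.exp (-s) := by
        gcongr
    _ = 2 ^ k * k.factorial * Real.exp (-s / 2) * (Real.exp (s / 2) * Real.exp (-s / 2)) := by
        rw [e]; ring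
    _ = _ := by rw [e2, mul_one]

/-- `(t |p|^σ)^k exp(-t |p|^σ)`. -/
def expSymb (d : ℕ) (σ : ℝ) (k : ℕ) (t : ℝ) (p : Space d) : ℝ :=
  (t * ‖p‖ ^ σ) ^ k * Real.exp (-(t * ‖p‖ ^ σ))

theorem contDiffAt_expSymb {n : WithTop ℕ∞} (σ : ℝ) (k : ℕ) (t : ℝ) {p : Space d} (hp : p ≠ 0) :
    ContDiffAt ℝ n (expSymb d σ k t) p :=
  ((contDiffAt_const.mul (contDiffAt_norm_rpow σ hp)).pow k).mul
    ((contDiffAt_const.mul (contDiffAt_norm_rpow σ hp)).neg.exp)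

theorem fderiv_expSymb (σ : ℝ) (k : ℕ) (t : ℝ) {p : Space d} (hp : p ≠ 0) (v : Space d) :
    fderiv ℝ (expSymb d σ k t) p v =
      (k * expSymb d σ k t p + (-1) * expSymb d σ (k + 1) t p) *
        (σ * (‖p‖ ^ (-2 : ℝ) * inner ℝ v p)) := by
  have hp' : 0 < ‖p‖ := norm_pos_iff.2 hp
  have h1 : HasFDerivAt (fun q : Space d => t * ‖q‖ ^ σ)
      (t • ((σ * ‖p‖ ^ (σ - 2)) • innerSL ℝ p)) p :=
    (hasFDerivAt_norm_rpow_of_ne σ hp).const_mul t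
  have h2 : HasDerivAt (fun s : ℝ => s ^ k * Real.exp (-s))
      ((k * (t * ‖p‖ ^ σ) ^ (k - 1)) * Real.exp (-(t * ‖p‖ ^ σ)) +
        (t * ‖p‖ ^ σ) ^ k * (Real.exp (-(t * ‖p‖ ^ σ)) * (-1))) (t * ‖p‖ ^ σ) :=
    (hasDerivAt_pow k _).mul ((hasDerivAt_neg _).exp)
  have h3 := (h2.comp_hasFDerivAt p h1).fderiv
  have e : expSymb d σ k t = (fun s : ℝ => s ^ k * Real.exp (-s)) ∘ fun q : Space d => t * ‖q‖ ^ σ :=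
    rfl
  have e3 : ‖p‖ ^ (σ - 2) = ‖p‖ ^ σ * ‖p‖ ^ (-2 : ℝ) := by
    rw [← Real.rpow_add hp']; congr 1
  rw [e, h3]
  simp only [smul_apply, innerSL_apply_apply, smul_eq_mul, Function.comp]
  rw [real_inner_comm, expSymb, e3]
  rcases k with _ | k
  · simp; ring
  · simp only [Nat.add_sub_cancel]; push_cast; ring

theorem exists_DB_expSymb (σ : ℝ) (n k : ℕ) :
    ∃ C, 0 ≤ C ∧ ∀ t > 0, ∀ p : Space d, p ≠ 0 →
      DB n ‖p‖ (C * Real.exp (-(t * ‖p‖ ^ σ) / 2)) (expSymb d σ k t) p := by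
  have base : ∀ k : ℕ, ∀ t > 0, ∀ p : Space d,
      |expSymb d σ k t p| ≤ 2 ^ k * k.factorial * Real.exp (-(t * ‖p‖ ^ σ) / 2) := by
    intro k t ht p
    rw [expSymb, abs_of_nonneg (by positivity)]
    exact pow_mul_exp_neg_le k (by positivity)
  induction n generalizing k with
  | zero => exact ⟨2 ^ k * k.factorial, by positivity, fun t ht p _ => base k t ht p⟩
  | succ n ih =>
    obtain ⟨C1, hC1, h1⟩ := ih k
    obtain ⟨C2, hC2, h2⟩ := ih (k + 1)
    obtain ⟨C3, hC3, h3⟩ := exists_DB_norm_rpow (d := d) n (-2)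
    refine ⟨2 ^ k * k.factorial + 2 ^ n * ((k * C1 + C2) * (|σ| * (2 ^ n * C3))), by positivity,
      fun t ht p hp => ?_⟩
    have hp' : 0 < ‖p‖ := norm_pos_iff.2 hp
    refine ⟨(base k t ht p).trans ?_, fun v => ?_⟩
    · gcongr
      have : 0 ≤ 2 ^ n * ((k * C1 + C2) * (|σ| * (2 ^ n * C3))) := by positivity
      linarith
    · have c1 : ContDiffAt ℝ n (expSymb d σ k t) p := contDiffAt_expSymb _ _ _ hp
      have c2 : ContDiffAt ℝ n (expSymb d σ (k + 1) t) p := contDiffAt_expSymb _ _ _ hp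
      have c3 : ContDiffAt ℝ n (fun q : Space d => ‖q‖ ^ (-2 : ℝ)) p := contDiffAt_norm_rpow _ hp
      have c4 : ContDiffAt ℝ n (fun q : Space d => inner ℝ v q) p :=
        (contDiff_inner_const v).contDiffAt
      have i1 := ((h1 t ht p hp).const_mul (k : ℝ) c1).add (contDiffAt_const.mul c1)
        (contDiffAt_const.mul c2) ((h2 t ht p hp).const_mul (-1) c2)
      have i2 := ((h3 p hp).mul c3 c4 (DB.inner v hp)).const_mul σ (c3.mul c4)
      have i3 := i1.mul ((contDiffAt_const.mul c1).add (contDiffAt_const.mul c2))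
        (contDiffAt_const.mul (c3.mul c4)) i2
      refine (i3.mono hp' ?_).congr ?_
      · have e : ‖p‖ ^ (-2 : ℝ) = 1 / (‖p‖ * ‖p‖) := by
          rw [Real.rpow_neg hp'.le, one_div, ← sq]; norm_num
        rw [e, abs_neg, abs_one, one_mul, Nat.abs_cast]
        set X := Real.exp (-(t * ‖p‖ ^ σ) / 2)
        calc 2 ^ n * ((k * (C1 * X) + C2 * X) *
              (|σ| * (2 ^ n * (C3 * (1 / (‖p‖ * ‖p‖)) * (‖v‖ * ‖p‖)))))
            = (2 ^ n * ((k * C1 + C2) * (|σ| * (2 ^ n * C3)))) * X * (‖v‖ / ‖p‖) := by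
              field_simp
          _ ≤ _ := by
              gcongr
              have : (0 : ℝ) ≤ 2 ^ k * k.factorial := by positivity
              linarith
      · filter_upwards [isOpen_ne.mem_nhds hp] with q hq
        rw [fderiv_expSymb σ k t hq]

end Symbol

/-! ### The Laplacian and integration by parts against oscillating functions -/

section Laplace

variable {d : ℕ}

/-- The `l`-th unit vector. -/
def unitVec (d : ℕ) (l : Fin d) : Space d := EuclideanSpace.single l 1

theorem norm_unitVec (l : Fin d) : ‖unitVec d l‖ = 1 := by simp [unitVec]

/-- The Laplacian. -/
def lap (f : Space d → ℝ) (x : Space d) : ℝ :=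
  ∑ l, fderiv ℝ (fun y => fderiv ℝ f y (unitVec d l)) x (unitVec d l)

theorem contDiff_lap {n : ℕ} {f : Space d → ℝ} (hf : ContDiff ℝ (n + 2 : ℕ) f) :
    ContDiff ℝ n (lap f) :=
  ContDiff.sum fun _ _ => contDiff_dir (contDiff_dir hf _) _

theorem contDiffAt_lap {n : ℕ} {f : Space d → ℝ} {x : Space d}
    (hf : ContDiffAt ℝ (n + 2 : ℕ) f x) : ContDiffAt ℝ n (lap f) x :=
  ContDiffAt.sum fun _ _ => contDiffAt_dir (contDiffAt_dir hf _) _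

theorem DB.lap {n : ℕ} {ℓ M : ℝ} {f : Space d → ℝ} {x : Space d} (hℓ : 0 < ℓ)
    (hf : ContDiffAt ℝ (n + 2 : ℕ) f x) (h : DB (n + 2) ℓ M f x) :
    DB n ℓ (d * (M / ℓ ^ 2)) (lap f) x := by
  have := DB.sum Finset.univ (n := n) (ℓ := ℓ) (M := fun _ : Fin d => M / ℓ ^ 2)
    (f := fun l y => fderiv ℝ (fun y => fderiv ℝ f y (unitVec d l)) y (unitVec d l)) (x := x) hℓ
    (fun l _ => contDiffAt_dir (contDiffAt_dir hf _) _) (fun l _ => by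
      have := (h.2 (unitVec d l)).2 (unitVec d l)
      rw [norm_unitVec] at this
      convert this using 1
      field_simp)
  simp only [Finset.sum_const, Finset.card_univ, Fintype.card_fin, nsmul_eq_mul] at this
  exact this

theorem lap_congr {f g : Space d → ℝ} {x : Space d} (h : f =ᶠ[nhds x] g) :
    lap f =ᶠ[nhds x] lap g := by
  have : ∀ l, ∀ᶠ y in nhds x, fderiv ℝ (fun y => fderiv ℝ f y (unitVec d l)) y
      = fderiv ℝ (fun y => fderiv ℝ g y (unitVec d l)) y := by
    intro l
    have h1 : (fun y => fderiv ℝ f y (unitVec d l)) =ᶠ[nhds x]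
        fun y => fderiv ℝ g y (unitVec d l) := by
      filter_upwards [h.fderiv (𝕜 := ℝ)] with y hy
      rw [hy]
    exact h1.fderiv (𝕜 := ℝ)
  filter_upwards [Filter.eventually_all.2 this] with y hy
  simp only [lap, hy]

/-- Integration by parts against `cos⟨·, y⟩`. -/
theorem integral_lap_mul_cos {f : Space d → ℝ} (hf : ContDiff ℝ (2 : ℕ) f) {b : Space d → ℝ}
    (hb : Integrable b) (h : ∀ p, DB 2 1 (b p) f p) (y : Space d) :
    ∫ p, lap f p * Real.cos (inner ℝ p y) = -‖y‖ ^ 2 * ∫ p, f p * Real.cos (inner ℝ p y) := by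
  have hcos : ∀ (g : Space d → ℝ) (c : ℝ), Continuous g → (∀ p, |g p| ≤ b p * c) →
      ∀ θ : ℝ, Integrable fun p => g p * Real.cos (inner ℝ p y + θ) := by
    intro g c hg hgb θ
    refine (hb.mul_const c).mono' (by fun_prop) (Filter.Eventually.of_forall fun p => ?_)
    rw [norm_mul]
    exact (mul_le_of_le_one_right (norm_nonneg _) (Real.abs_cos_le_one _)).trans (hgb p)
  have hd : ∀ θ : ℝ, ∀ v p : Space d, fderiv ℝ (fun q : Space d => Real.cos (inner ℝ q y + θ)) p v
      = Real.cos (inner ℝ p y + (θ + Real.pi / 2)) * inner ℝ v y := by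
    intro θ v p
    have h1 : HasFDerivAt (fun q : Space d => inner ℝ q y + θ) (innerSL ℝ y) p := by
      have := ((innerSL ℝ y).hasFDerivAt (x := p)).add_const θ
      simpa [real_inner_comm] using this
    rw [h1.cos.fderiv, ← add_assoc, Real.cos_add_pi_div_two]
    simp [real_inner_comm]
  have step : ∀ (g : Space d → ℝ) (v : Space d) (c c' : ℝ), ContDiff ℝ (1 : ℕ) g →
      (∀ p, |g p| ≤ b p * c) → (∀ p, |fderiv ℝ g p v| ≤ b p * c') → ∀ θ : ℝ,
      ∫ p, fderiv ℝ g p v * Real.cos (inner ℝ p y + θ)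
        = -inner ℝ v y * ∫ p, g p * Real.cos (inner ℝ p y + (θ + Real.pi / 2)) := by
    intro g v c c' hg h1 h2 θ
    have i1 := hcos g c hg.continuous h1 (θ + Real.pi / 2)
    have i2 := hcos (fun p => fderiv ℝ g p v) c' (contDiff_dir (n := 0) hg v).continuous h2 θ
    have := integral_mul_fderiv_eq_neg_fderiv_mul_of_integrable (μ := volume)
      (f := g) (g := fun q : Space d => Real.cos (inner ℝ q y + θ)) (v := v) i2
      (by simp only [hd]; simpa [mul_assoc] using i1.mul_const (inner ℝ v y))
      (hcos g c hg.continuous h1 θ) (fun x _ => hg.differentiable (by simp) x)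
      (fun x _ => by
        simp only [real_inner_comm y]
        exact (Real.differentiable_cos.comp
          (((contDiff_inner_const (n := 1) y).differentiable (by simp)).add_const θ)) x)
    simp only [hd] at this
    rw [eq_neg_iff_add_eq_zero, add_comm, ← eq_neg_iff_add_eq_zero] at this
    rw [this, neg_mul, ← integral_const_mul]
    congr 2
    funext p; ring
  have hl : ∀ l, ∫ p, fderiv ℝ (fun q => fderiv ℝ f q (unitVec d l)) p (unitVec d l) *
      Real.cos (inner ℝ p y) = - (y l) ^ 2 * ∫ p, f p * Real.cos (inner ℝ p y) := by
    intro l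
    have e1 := step (fun q => fderiv ℝ f q (unitVec d l)) (unitVec d l) 1 1
      (contDiff_dir hf _) (fun p => by simpa [norm_unitVec] using ((h p).2 (unitVec d l)).abs_le)
      (fun p => by simpa [norm_unitVec, DB] using ((h p).2 (unitVec d l)).2 (unitVec d l)) 0
    have e2 := step f (unitVec d l) 1 1 (hf.of_le (by norm_num)) (fun p => by simpa using (h p).abs_le)
      (fun p => by simpa [norm_unitVec] using ((h p).2 (unitVec d l)).abs_le) (0 + Real.pi / 2)
    rw [e2] at e1
    simp only [add_zero, zero_add, add_halves] at e1
    rw [e1]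
    have e3 : inner ℝ (unitVec d l) y = y l := by simp [unitVec, EuclideanSpace.inner_single_left]
    simp only [Real.cos_add_pi, mul_neg, integral_neg, e3]
    ring
  simp only [lap, Finset.sum_mul]
  rw [integral_finsetSum _ fun l _ => ?_]
  · simp only [hl, ← Finset.sum_mul, Finset.sum_neg_distrib]
    rw [EuclideanSpace.norm_sq_eq]
    simp
  · have := hcos (fun p => fderiv ℝ (fun q => fderiv ℝ f q (unitVec d l)) p (unitVec d l)) 1
      (contDiff_dir (n := 0) (contDiff_dir hf _) _).continuous
      (fun p => by simpa [norm_unitVec, DB] using ((h p).2 (unitVec d l)).2 (unitVec d l)) 0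
    simpa using this

/-- Oscillatory integrals `∫ m(ω) cos(⟨P(ω), y⟩ + θ) τ(dω)`. -/
theorem paramInt_osc {T : Type*} [MeasurableSpace T] {τ : Measure T} (n : ℕ) {m : T → ℝ}
    {P : T → Space d} (hm : AEStronglyMeasurable m τ) (hP : AEStronglyMeasurable P τ)
    (hi : Integrable (fun ω => |m ω| * (1 + ‖P ω‖) ^ n) τ) (θ : ℝ) :
    ParamInt τ n (fun ω y => m ω * Real.cos (inner ℝ (P ω) y + θ)) ∧
    ∀ y, DB n 1 (∫ ω, |m ω| * (1 + ‖P ω‖) ^ n ∂τ)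
      (fun y => ∫ ω, m ω * Real.cos (inner ℝ (P ω) y + θ) ∂τ) y := by
  have key : ∀ (n : ℕ) (c : ℝ) (p : Space d) (θ : ℝ) (y : Space d), DB n 1 (|c| * (1 + ‖p‖) ^ n)
      (fun y => c * Real.cos (inner ℝ p y + θ)) y := by
    intro n
    induction n with
    | zero =>
      intro c p θ y
      simp only [DB, pow_zero, mul_one, abs_mul]
      exact mul_le_of_le_one_right (abs_nonneg _) (Real.abs_cos_le_one _)
    | succ n ih =>
      intro c p θ y
      refine ⟨?_, fun v => ?_⟩
      · rw [abs_mul]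
        exact mul_le_mul_of_nonneg_left ((Real.abs_cos_le_one _).trans
          (one_le_pow₀ (by linarith [norm_nonneg p]))) (abs_nonneg _)
      · refine ((ih (c * inner ℝ p v) p (θ + Real.pi / 2) y).mono one_pos ?_).congr
          (Filter.Eventually.of_forall fun z => ?_)
        · rw [abs_mul, div_one, pow_succ]
          calc |c| * |inner ℝ p v| * (1 + ‖p‖) ^ n ≤ |c| * ((1 + ‖p‖) * ‖v‖) * (1 + ‖p‖) ^ n := by
                gcongr
                refine (abs_real_inner_le_norm p v).trans ?_
                gcongr; linarith
            _ = _ := by ring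
        · have h1 : HasFDerivAt (fun q : Space d => inner ℝ p q + θ) (innerSL ℝ p) z := by
            have := ((innerSL ℝ p).hasFDerivAt (x := z)).add_const θ
            simpa using this
          have h2 := (h1.cos.const_mul c).fderiv
          simp only [← add_assoc, Real.cos_add_pi_div_two]
          rw [h2]
          simp
          ring
  have h : ParamInt τ n (fun ω y => m ω * Real.cos (inner ℝ (P ω) y + θ)) := by
    refine ⟨Filter.Eventually.of_forall fun ω => contDiff_const.mul
      (Real.contDiff_cos.comp ((contDiff_inner_const _).add contDiff_const)), fun y => ?_, fun y => ⟨1, one_pos, _, hi,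
      Filter.Eventually.of_forall fun ω x _ => key n (m ω) (P ω) θ x⟩⟩
    refine hm.mul ?_
    exact Real.continuous_cos.comp_aestronglyMeasurable
      ((hP.inner aestronglyMeasurable_const).add_const _)
  exact ⟨h, fun y => h.db hi (Filter.Eventually.of_forall fun ω => key n (m ω) (P ω) θ y)⟩

end Laplace

/-! ### The Green function away from the origin -/

section Green

variable {d : ℕ}

/-- A smooth function which vanishes for `‖p‖ ≤ 1` and equals `1` for `‖p‖ ≥ 2`. -/
def hiCut (d : ℕ) (p : Space d) : ℝ :=
  1 - (⟨1, 2, one_pos, one_lt_two⟩ : ContDiffBump (0 : Space d)) p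

theorem contDiff_hiCut {n : ℕ∞} : ContDiff ℝ n (hiCut d) :=
  contDiff_const.sub (ContDiffBump.contDiff _)

theorem hiCut_eq_zero {p : Space d} (hp : ‖p‖ ≤ 1) : hiCut d p = 0 := by
  rw [hiCut, ContDiffBump.one_of_mem_closedBall _ (by simpa using hp), sub_self]

theorem hiCut_eq_one {p : Space d} (hp : 2 ≤ ‖p‖) : hiCut d p = 1 := by
  rw [hiCut, ContDiffBump.zero_of_le_dist _ (by simpa using hp), sub_zero]

theorem one_sub_hiCut_mem (p : Space d) : 0 ≤ 1 - hiCut d p ∧ 1 - hiCut d p ≤ 1 := by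
  rw [hiCut, sub_sub_cancel]
  exact ⟨ContDiffBump.nonneg _, ContDiffBump.le_one _⟩

theorem hiCut_eventually_zero {p : Space d} (hp : ‖p‖ < 1) : hiCut d =ᶠ[nhds p] fun _ => 0 := by
  filter_upwards [continuous_norm.continuousAt.eventually (gt_mem_nhds hp)] with q hq
  exact hiCut_eq_zero (le_of_lt hq)

theorem exists_DB_hiCut (n : ℕ) : ∃ C, 0 ≤ C ∧ ∀ p : Space d, p ≠ 0 → DB n ‖p‖ C (hiCut d) p := by
  obtain ⟨C, hC, h⟩ := exists_DB_of_isCompact (n := n) (f := hiCut d) contDiff_hiCut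
    (isCompact_closedBall (0 : Space d) 2)
  refine ⟨max 1 (2 ^ n * C), by positivity, fun p hp => ?_⟩
  have hp' : 0 < ‖p‖ := norm_pos_iff.2 hp
  rcases le_or_gt ‖p‖ 2 with h2 | h2
  · exact ((h p (by simpa using h2)).rescale one_pos hp' one_le_two (by simpa using h2)).mono hp'
      (le_max_right _ _)
  · refine ((DB.const hp' (c := 1) (by simp)).mono hp' (le_max_left _ _)).congr ?_
    filter_upwards [continuous_norm.continuousAt.eventually (lt_mem_nhds h2)] with q hq
    exact (hiCut_eq_one (le_of_lt hq)).symm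

/-- Products with a cutoff are smooth if the other factor is smooth away from the origin. -/
theorem contDiff_hiCut_mul {F : Type*} [NormedAddCommGroup F] [NormedSpace ℝ F] {n : ℕ∞}
    {P : F → Space d} {f : F → ℝ} (hP : ContDiff ℝ n P)
    (hf : ∀ z, P z ≠ 0 → ContDiffAt ℝ n f z) : ContDiff ℝ n (fun z => hiCut d (P z) * f z) := by
  rw [contDiff_iff_contDiffAt]
  intro z
  by_cases hz : P z = 0
  · refine ContDiffAt.congr_of_eventuallyEq (f := fun _ => 0) contDiffAt_const ?_
    filter_upwards [hP.continuous.continuousAt.eventually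
      (hiCut_eventually_zero (p := P z) (by simp [hz]))] with w hw
    rw [hw, zero_mul]
  · exact (contDiff_hiCut.comp hP).contDiffAt.mul (hf z hz)

/-- The high frequency part of `exp(-t |p|^σ)`. -/
def hiSymb (d : ℕ) (σ t : ℝ) (p : Space d) : ℝ := hiCut d p * expSymb d σ 0 t p

theorem expSymb_zero (σ t : ℝ) (p : Space d) :
    expSymb d σ 0 t p = Real.exp (-t * ‖p‖ ^ σ) := by simp [expSymb]

theorem contDiff_uncurry_dir {f : ℝ → Space d → ℝ}
    (hf : ContDiff ℝ (⊤ : ℕ∞) (Function.uncurry f)) (v : Space d) :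
    ContDiff ℝ (⊤ : ℕ∞) (Function.uncurry fun t p => fderiv ℝ (f t) p v) := by
  have h1 : ContDiff ℝ (⊤ : ℕ∞) (Function.uncurry fun x : ℝ × Space d => f x.1) :=
    hf.comp ((contDiff_fst.comp contDiff_fst).prodMk contDiff_snd)
  exact ContDiff.fderiv_apply (m := (⊤ : ℕ∞)) (n := (⊤ : ℕ∞)) h1 contDiff_snd contDiff_const (by rfl)

theorem contDiff_uncurry_lap_hiSymb (σ : ℝ) (N : ℕ) :
    ContDiff ℝ (⊤ : ℕ∞) (Function.uncurry fun t => lap^[N] (hiSymb d σ t)) := by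
  induction N with
  | zero =>
    refine contDiff_hiCut_mul (P := Prod.snd) contDiff_snd fun z hz => ?_
    have : (fun z : ℝ × Space d => expSymb d σ 0 z.1 z.2) =
        fun z => Real.exp (-z.1 * ‖z.2‖ ^ σ) := by
      funext z; rw [expSymb_zero]
    rw [this]
    exact (contDiffAt_fst.neg.mul ((contDiffAt_norm_rpow σ hz).comp z contDiffAt_snd)).exp
  | succ N ih =>
    have : (Function.uncurry fun t => lap^[N + 1] (hiSymb d σ t)) = fun z => ∑ l,
        (Function.uncurry fun t p => fderiv ℝ (fun q =>
          fderiv ℝ (lap^[N] (hiSymb d σ t)) q (unitVec d l)) p (unitVec d l)) z := by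
      funext z
      simp only [Function.uncurry, Function.iterate_succ_apply', lap]
    rw [this]
    exact ContDiff.sum fun l _ => contDiff_uncurry_dir (contDiff_uncurry_dir ih _) _

theorem contDiff_lap_hiSymb {n : ℕ} (σ t : ℝ) (N : ℕ) : ContDiff ℝ n (lap^[N] (hiSymb d σ t)) := by
  have h := (contDiff_uncurry_lap_hiSymb (d := d) σ N).comp
    (contDiff_const (c := t).prodMk contDiff_id)
  exact h.of_le (by exact_mod_cast le_top)

theorem lap_hiSymb_eventually_zero (σ t : ℝ) (N : ℕ) {p : Space d} (hp : ‖p‖ < 1) :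
    lap^[N] (hiSymb d σ t) =ᶠ[nhds p] fun _ => 0 := by
  induction N with
  | zero =>
    filter_upwards [hiCut_eventually_zero hp] with q hq
    simp [hiSymb, hq]
  | succ N ih =>
    rw [Function.iterate_succ_apply']
    refine (lap_congr ih).trans (Filter.Eventually.of_forall fun q => ?_)
    simp [lap]

theorem exists_DB_lap_hiSymb (σ : ℝ) (N n : ℕ) : ∃ C, 0 ≤ C ∧ ∀ t > 0, ∀ p : Space d, p ≠ 0 →
    DB n ‖p‖ (C / ‖p‖ ^ (2 * N) * Real.exp (-(t * ‖p‖ ^ σ) / 2)) (lap^[N] (hiSymb d σ t)) p := by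
  induction N generalizing n with
  | zero =>
    obtain ⟨C1, hC1, h1⟩ := exists_DB_hiCut (d := d) n
    obtain ⟨C2, hC2, h2⟩ := exists_DB_expSymb (d := d) σ n 0
    refine ⟨2 ^ n * (C1 * C2), by positivity, fun t ht p hp => ?_⟩
    have := DB.mul contDiff_hiCut.contDiffAt (contDiffAt_expSymb σ 0 t hp) (h1 p hp) (h2 t ht p hp)
    convert this using 1
    · simp; ring
    · rfl
  | succ N ih =>
    obtain ⟨C, hC, h⟩ := ih (n + 2)
    refine ⟨d * C, by positivity, fun t ht p hp => ?_⟩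
    rw [Function.iterate_succ_apply']
    have hp' : 0 < ‖p‖ := norm_pos_iff.2 hp
    have := DB.lap hp' (contDiff_lap_hiSymb σ t N).contDiffAt (h t ht p hp)
    convert this using 1
    rw [mul_add, mul_one, pow_add]
    field_simp

theorem integrable_radial (hd : 0 < d) {a c σ : ℝ} (K : ℕ) (ha : a < d) (hc : 0 < c)
    (hσ : 0 < σ) : Integrable fun p : Space d =>
      (1 + ‖p‖) ^ K * (‖p‖ ^ (-a) * Real.exp (-c * ‖p‖ ^ σ)) := by
  have : Nonempty (Fin d) := ⟨⟨0, hd⟩⟩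
  rw [integrable_fun_norm_addHaar volume
    (f := fun r : ℝ => (1 + r) ^ K * (r ^ (-a) * Real.exp (-c * r ^ σ)))]
  rw [finrank_euclideanSpace_fin]
  have i1 := (integrableOn_rpow_mul_exp_neg_mul_rpow (p := σ) (s := d - 1 - a) (b := c)
    (by linarith) hσ hc)
  have i2 := (integrableOn_rpow_mul_exp_neg_mul_rpow (p := σ) (s := d - 1 - a + K) (b := c)
    (by have : (0 : ℝ) ≤ K := by positivity
        linarith) hσ hc)
  refine Integrable.mono' ((i1.add i2).const_mul (2 ^ (K - 1))) ?_ ?_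
  · refine Measurable.aestronglyMeasurable ?_
    fun_prop
  · rw [ae_restrict_iff' measurableSet_Ioi]
    refine Filter.Eventually.of_forall fun r (hr : 0 < r) => ?_
    have e1 : r ^ ((d : ℝ) - 1 - a) = r ^ (d - 1) * r ^ (-a) := by
      rw [← Real.rpow_natCast, ← Real.rpow_add hr, Nat.cast_sub hd]; congr 1; push_cast; ring
    have e2 : r ^ ((d : ℝ) - 1 - a + K) = r ^ (d - 1) * r ^ (-a) * r ^ K := by
      rw [Real.rpow_add hr, e1, Real.rpow_natCast]
    have h3 : (1 + r) ^ K ≤ 2 ^ (K - 1) * (1 ^ K + r ^ K) := add_pow_le zero_le_one hr.le K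
    rw [Real.norm_of_nonneg (by positivity), smul_eq_mul, Pi.add_apply, e1, e2]
    calc _ ≤ r ^ (d - 1) * ((2 ^ (K - 1) * (1 ^ K + r ^ K)) * (r ^ (-a) * Real.exp (-c * r ^ σ))) := by
          gcongr
      _ = _ := by rw [one_pow]; ring

theorem integral_hiSymb_mul_cos (hd : 0 < d) {σ t : ℝ} (hσ : 0 < σ) (ht : 0 < t) (N : ℕ)
    (y : Space d) : ∫ p, lap^[N] (hiSymb d σ t) p * Real.cos (inner ℝ p y) =
      (-‖y‖ ^ 2) ^ N * ∫ p, hiSymb d σ t p * Real.cos (inner ℝ p y) := by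
  induction N with
  | zero => simp
  | succ N ih =>
    obtain ⟨C, hC, h⟩ := exists_DB_lap_hiSymb (d := d) σ N 2
    have hi := (integrable_radial hd (a := 0) 0 (by positivity) (half_pos ht) hσ).const_mul C
    rw [Function.iterate_succ_apply', integral_lap_mul_cos (contDiff_lap_hiSymb σ t N) hi, ih]
    · ring
    · intro p
      rcases lt_or_ge ‖p‖ 1 with hp | hp
      · exact DB.of_eventually_zero one_pos (by positivity) (lap_hiSymb_eventually_zero σ t N hp)
      · have hp0 : p ≠ 0 := by rintro rfl; simp at hp; linarith
        refine ((h t ht p hp0).scale_le (by linarith) one_pos hp).mono one_pos ?_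
        simp only [pow_zero, one_mul, neg_zero, Real.rpow_zero]
        have e : -(t * ‖p‖ ^ σ) / 2 = -(t / 2) * ‖p‖ ^ σ := by ring
        rw [e]
        gcongr
        exact div_le_self hC (one_le_pow₀ hp)

/-- `∫₀^∞ e^{-st} p_t(y) dt` for the kernel `p_t` of `exp(-t (-Δ)^{σ/2})`. -/
def greenScaled (d : ℕ) (σ s : ℝ) (y : Space d) : ℝ :=
  ∫ t in Ioi (0 : ℝ), Real.exp (-s * t) * fracHeatKernel d σ t y

theorem greenFun_smul {σ lam : ℝ} (hl : 0 < lam) (y : Space d) :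
    greenFun d σ (lam • y) = lam ^ (σ - d) * greenScaled d σ (lam ^ σ) y := by
  have h1 : ∀ t : ℝ, fracHeatKernel d σ (lam ^ σ * t) (lam • y)
      = (lam ^ d)⁻¹ * fracHeatKernel d σ t y := by
    intro t
    simp only [fracHeatKernel]
    have := Measure.integral_comp_smul (volume : Measure (Space d))
      (fun p => Real.exp (-(lam ^ σ * t) * ‖(lam⁻¹ • p)‖ ^ σ) * Real.cos (inner ℝ p y)) lam
    simp only [smul_smul, inv_mul_cancel₀ hl.ne', one_smul] at this
    have e1 : ∀ p : Space d, inner ℝ (lam • p) y = inner ℝ p (lam • y) := by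
      intro p; simp [inner_smul_left, inner_smul_right]
    simp only [e1] at this
    rw [this, finrank_euclideanSpace_fin, abs_of_nonneg (by positivity), smul_eq_mul]
    rw [← mul_assoc, mul_comm _ (lam ^ d)⁻¹, mul_assoc]
    congr 3
    funext p
    rw [norm_smul, Real.norm_of_nonneg (by positivity), Real.mul_rpow (by positivity) (by positivity),
      Real.inv_rpow hl.le]
    have : lam ^ σ ≠ 0 := by positivity
    congr 2
    field_simp
  have h2 := integral_comp_mul_left_Ioi
    (fun t => Real.exp (-t) * fracHeatKernel d σ t (lam • y)) 0 (Real.rpow_pos_of_pos hl σ)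
  rw [mul_zero] at h2
  rw [greenFun, greenScaled]
  have h3 : lam ^ (σ - d) = lam ^ σ * (lam ^ d)⁻¹ := by
    rw [Real.rpow_sub hl, Real.rpow_natCast]; rfl
  have h4 : ∫ t in Ioi (0 : ℝ), Real.exp (-t) * fracHeatKernel d σ t (lam • y) =
      lam ^ σ * ∫ t in Ioi (0 : ℝ), Real.exp (-(lam ^ σ * t)) *
        fracHeatKernel d σ (lam ^ σ * t) (lam • y) := by
    rw [h2, smul_eq_mul, mul_inv_cancel_left₀]
    positivity
  rw [h4, h3, mul_assoc, ← integral_const_mul (lam ^ d)⁻¹]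
  congr 2
  funext t
  rw [h1, neg_mul]; ring

theorem measurable_norm_rpow_mul (σ : ℝ) :
    Measurable fun z : ℝ × Space d => Real.exp (-z.1 * ‖z.2‖ ^ σ) := by fun_prop

theorem integrable_low_time (hd : 0 < d) {σ : ℝ} (hσ : 0 < σ) (hσd : σ < d) (K : ℕ) :
    Integrable (fun z : ℝ × Space d => Real.exp (-z.1 * ‖z.2‖ ^ σ) * (1 + ‖z.2‖) ^ K)
      ((volume.restrict (Ioi 1)).prod volume) := by
  have : Nonempty (Fin d) := ⟨⟨0, hd⟩⟩
  have hm : AEStronglyMeasurable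
      (fun z : ℝ × Space d => Real.exp (-z.1 * ‖z.2‖ ^ σ) * (1 + ‖z.2‖) ^ K)
      ((volume.restrict (Ioi 1)).prod volume) :=
    ((measurable_norm_rpow_mul σ).mul (by fun_prop)).aestronglyMeasurable
  rw [integrable_prod_iff' hm]
  have hne : ∀ᵐ p : Space d, p ≠ 0 := by
    simp [ae_iff]
  have hcomm : ∀ (p : Space d) (t : ℝ), -t * ‖p‖ ^ σ = -(‖p‖ ^ σ) * t := fun p t => by ring
  constructor
  · filter_upwards [hne] with p hp
    have hp' : 0 < ‖p‖ := norm_pos_iff.2 hp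
    refine Integrable.mul_const ?_ _
    simp only [hcomm]
    exact integrableOn_exp_mul_Ioi (neg_lt_zero.2 (by positivity)) 1
  · refine (integrable_radial hd K hσd one_pos hσ).congr ?_
    filter_upwards [hne] with p hp
    have hp' : 0 < ‖p‖ := norm_pos_iff.2 hp
    have : ∀ t : ℝ, ‖Real.exp (-t * ‖p‖ ^ σ) * (1 + ‖p‖) ^ K‖
        = Real.exp (-(‖p‖ ^ σ) * t) * (1 + ‖p‖) ^ K := fun t => by
      rw [Real.norm_of_nonneg (by positivity), hcomm]
    simp only [this]
    rw [integral_mul_const, integral_exp_mul_Ioi (neg_lt_zero.2 (by positivity)) 1,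
      Real.rpow_neg hp'.le]
    simp only [mul_one, neg_mul, one_mul, neg_div_neg_eq]
    field_simp

/-- Uniform bounds on the derivatives of the rescaled Green function. -/
theorem exists_greenScaled (hd : 0 < d) {σ : ℝ} (hσ : 0 < σ) (hσd : σ < d) (n : ℕ) (Rm : ℝ) :
    ∃ C, 0 ≤ C ∧ ∀ s, 0 ≤ s → ∃ G : Space d → ℝ, ContDiff ℝ n G ∧
      (∀ y, ‖y‖ ≤ Rm → DB n 1 C G y) ∧ ∀ y, 1 / 2 ≤ ‖y‖ → greenScaled d σ s y = G y := by
  set N := d + n + 1 with hN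
  obtain ⟨C3, hC3, hb3⟩ := exists_DB_lap_hiSymb (d := d) σ N 0
  set τ1 : Measure (ℝ × Space d) := (volume.restrict (Ioi 1)).prod volume
  set τ2 : Measure (ℝ × Space d) := (volume.restrict (Ioc 0 1)).prod volume with hτ2
  let F : ℝ × Space d → ℝ := fun z => Real.exp (-z.1 * ‖z.2‖ ^ σ)
  have hF : Measurable F := measurable_norm_rpow_mul σ
  let B : ℝ × Space d → ℝ := fun z => lap^[N] (hiSymb d σ z.1) z.2
  have hB : Continuous B := (contDiff_uncurry_lap_hiSymb σ N).continuous
  have i1 := integrable_low_time hd hσ hσd n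
  have hpos : ∀ᵐ z ∂τ2, z.1 ∈ Ioc (0 : ℝ) 1 :=
    Measure.quasiMeasurePreserving_fst.ae (ae_restrict_mem measurableSet_Ioc)
  have i2 : Integrable (fun z => |(1 - hiCut d z.2) * F z| * (1 + ‖z.2‖) ^ n) τ2 := by
    have : Integrable (fun z : ℝ × Space d => (1 : ℝ) *
        (Metric.closedBall (0 : Space d) 2).indicator (fun _ => (3 : ℝ) ^ n) z.2) τ2 := by
      refine Integrable.mul_prod (f := fun _ : ℝ => (1 : ℝ)) (integrable_const _) ?_
      refine (integrable_indicator_iff Metric.isClosed_closedBall.measurableSet).2 ?_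
      exact integrableOn_const measure_closedBall_lt_top.ne
    refine this.mono' ?_ ?_
    · refine Measurable.aestronglyMeasurable ?_
      have : Measurable (hiCut d) := (contDiff_hiCut (n := 0)).continuous.measurable
      fun_prop
    · filter_upwards [hpos] with z hz
      rw [Real.norm_of_nonneg (by positivity), one_mul]
      obtain ⟨h1, h2⟩ := one_sub_hiCut_mem z.2
      have h3 : F z ≤ 1 := by
        rw [Real.exp_le_one_iff, neg_mul]
        have := mul_nonneg hz.1.le (Real.rpow_nonneg (norm_nonneg z.2) σ)
        linarith
      by_cases h4 : ‖z.2‖ ≤ 2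
      · rw [indicator_of_mem (by simpa using h4), abs_of_nonneg (mul_nonneg h1 (Real.exp_nonneg _))]
        calc _ ≤ (1 * 1) * (1 + 2 : ℝ) ^ n := by
              gcongr
          _ = _ := by norm_num
      · rw [hiCut_eq_one (by linarith), sub_self, zero_mul, abs_zero, zero_mul]
        exact indicator_nonneg (fun _ _ => by positivity) _
  have i3 : Integrable (fun z => |B z| * (1 + ‖z.2‖) ^ n) τ2 := by
    have : Integrable (fun z : ℝ × Space d => (C3 * 4 ^ N) *
        (1 + ‖z.2‖) ^ (-(d + 1 : ℝ))) τ2 := by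
      refine Integrable.mul_prod (f := fun _ : ℝ => C3 * 4 ^ N)
        (g := fun p : Space d => (1 + ‖p‖) ^ (-(d + 1 : ℝ))) (integrable_const _) ?_
      exact integrable_one_add_norm (by simp)
    refine this.mono' ?_ ?_
    · exact (hB.abs.mul (by fun_prop)).aestronglyMeasurable
    · filter_upwards [hpos] with z hz
      rw [Real.norm_of_nonneg (by positivity)]
      rcases lt_or_ge ‖z.2‖ 1 with hp | hp
      · have : B z = 0 := (lap_hiSymb_eventually_zero σ z.1 N hp).eq_of_nhds
        rw [this, abs_zero, zero_mul]; positivity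
      · have hp0 : z.2 ≠ 0 := by intro h; rw [h] at hp; simp at hp; linarith
        have h1 : |B z| ≤ C3 / ‖z.2‖ ^ (2 * N) := by
          refine (hb3 z.1 hz.1 z.2 hp0).abs_le.trans (mul_le_of_le_one_right (by positivity) ?_)
          rw [Real.exp_le_one_iff]
          have := mul_nonneg hz.1.le (Real.rpow_nonneg (norm_nonneg z.2) σ)
          linarith
        have h2 : (1 + ‖z.2‖) ^ (2 * N) ≤ 4 ^ N * ‖z.2‖ ^ (2 * N) := by
          rw [pow_mul, pow_mul, ← mul_pow]
          refine pow_le_pow_left₀ (by positivity) ?_ N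
          nlinarith
        have h3 : (1 + ‖z.2‖) ^ (-(d + 1 : ℝ)) * (1 + ‖z.2‖) ^ (n + (d + 1)) = (1 + ‖z.2‖) ^ n := by
          rw [pow_add, Real.rpow_neg (by positivity)]
          have : (1 + ‖z.2‖) ^ ((d : ℝ) + 1) = (1 + ‖z.2‖) ^ (d + 1) := by
            rw [← Real.rpow_natCast]; push_cast; rfl
          rw [this]
          have : (1 + ‖z.2‖) ^ (d + 1) ≠ 0 := by positivity
          field_simp
        calc |B z| * (1 + ‖z.2‖) ^ n ≤ C3 / ‖z.2‖ ^ (2 * N) *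
              ((1 + ‖z.2‖) ^ (-(d + 1 : ℝ)) * (1 + ‖z.2‖) ^ (n + (d + 1))) := by
              rw [h3]; gcongr
          _ ≤ C3 / ‖z.2‖ ^ (2 * N) *
              ((1 + ‖z.2‖) ^ (-(d + 1 : ℝ)) * (4 ^ N * ‖z.2‖ ^ (2 * N))) := by
              gcongr
              refine le_trans ?_ h2
              exact pow_le_pow_right₀ (by linarith) (by omega)
          _ = _ := by field_simp
  obtain ⟨Cz, hCz, hz⟩ := exists_DB_of_isCompact (n := n)
    (f := fun y : Space d => hiCut d ((4 : ℝ) • y) * ((-‖y‖ ^ 2) ^ N)⁻¹) (by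
      refine contDiff_hiCut_mul (n := n) (P := fun y : Space d => (4 : ℝ) • y) (by fun_prop) fun y hy => ?_
      have hy' : y ≠ 0 := by rintro rfl; simp at hy
      refine ContDiffAt.inv ((contDiff_norm_sq ℝ).contDiffAt.neg.pow N) ?_
      exact pow_ne_zero _ (neg_ne_zero.2 (by positivity))) (isCompact_closedBall (0 : Space d) Rm)
  set c0 : ℝ := (2 * Real.pi) ^ (-(d : ℤ)) with hc0
  refine ⟨|c0| * (∫ z, F z * (1 + ‖z.2‖) ^ n ∂τ1 +
    ((∫ z, |(1 - hiCut d z.2) * F z| * (1 + ‖z.2‖) ^ n ∂τ2) + 2 ^ n * (Cz *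
      ∫ z, |B z| * (1 + ‖z.2‖) ^ n ∂τ2))), ?_, fun s hs => ?_⟩
  · have : 0 ≤ ∫ z, F z * (1 + ‖z.2‖) ^ n ∂τ1 := integral_nonneg fun z => by positivity
    have : 0 ≤ ∫ z, |(1 - hiCut d z.2) * F z| * (1 + ‖z.2‖) ^ n ∂τ2 :=
      integral_nonneg fun z => by positivity
    have : 0 ≤ ∫ z, |B z| * (1 + ‖z.2‖) ^ n ∂τ2 := integral_nonneg fun z => by positivity
    positivity
  -- the three oscillatory integrals
  have hosc : ∀ (τ : Measure (ℝ × Space d)) (m : ℝ × Space d → ℝ), AEStronglyMeasurable m τ →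
      Integrable (fun z => |m z| * (1 + ‖z.2‖) ^ n) τ → (∀ᵐ z ∂τ, 0 ≤ z.1) →
      ParamInt τ n (fun z y => Real.exp (-s * z.1) * m z * Real.cos (inner ℝ z.2 y + 0)) ∧
      ∀ y, DB n 1 (∫ z, |m z| * (1 + ‖z.2‖) ^ n ∂τ) (fun y => ∫ z, Real.exp (-s * z.1) * m z *
        Real.cos (inner ℝ z.2 y + 0) ∂τ) y := by
    intro τ m hm hi h0
    have hle : ∀ᵐ z ∂τ, |Real.exp (-s * z.1) * m z| * (1 + ‖z.2‖) ^ n ≤ |m z| * (1 + ‖z.2‖) ^ n := by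
      filter_upwards [h0] with z hz
      refine mul_le_mul_of_nonneg_right ?_ (by positivity)
      rw [abs_mul, abs_of_nonneg (Real.exp_nonneg _)]
      refine mul_le_of_le_one_left (abs_nonneg _) ?_
      rw [Real.exp_le_one_iff]
      nlinarith
    have hm' : AEStronglyMeasurable (fun z : ℝ × Space d => Real.exp (-s * z.1) * m z) τ :=
      (by fun_prop : Continuous fun z : ℝ × Space d => Real.exp (-s * z.1)).aestronglyMeasurable.mul hm
    have hi' : Integrable (fun z => |Real.exp (-s * z.1) * m z| * (1 + ‖z.2‖) ^ n) τ := by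
      refine hi.mono' ?_ ?_
      · exact (continuous_abs.comp_aestronglyMeasurable hm').mul
          (by fun_prop : Continuous fun z : ℝ × Space d => (1 + ‖z.2‖) ^ n).aestronglyMeasurable
      · filter_upwards [hle] with z hz
        rwa [Real.norm_of_nonneg (by positivity)]
    obtain ⟨h1, h2⟩ := paramInt_osc (τ := τ) n (m := fun z => Real.exp (-s * z.1) * m z)
      (P := Prod.snd) hm' continuous_snd.aestronglyMeasurable hi' 0
    exact ⟨h1, fun y => (h2 y).mono one_pos (integral_mono_ae hi' hi hle)⟩
  obtain ⟨p1, q1⟩ := hosc τ1 F hF.aestronglyMeasurable (by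
    refine i1.congr (Filter.Eventually.of_forall fun z => ?_)
    simp only [F, abs_of_nonneg (Real.exp_nonneg _)]) (by
    have := Measure.quasiMeasurePreserving_fst (μ := volume.restrict (Ioi (1 : ℝ)))
      (ν := (volume : Measure (Space d))) |>.ae (ae_restrict_mem measurableSet_Ioi)
    filter_upwards [this] with z (hz : 1 < z.1)
    linarith)
  obtain ⟨p2, q2⟩ := hosc τ2 (fun z => (1 - hiCut d z.2) * F z) (by
    refine Measurable.aestronglyMeasurable ?_
    have : Measurable (hiCut d) := (contDiff_hiCut (n := 0)).continuous.measurable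
    fun_prop) i2 (by filter_upwards [hpos] with z hz using hz.1.le)
  obtain ⟨p3, q3⟩ := hosc τ2 B hB.aestronglyMeasurable i3
    (by filter_upwards [hpos] with z hz using hz.1.le)
  have cz : ContDiff ℝ n fun y : Space d => hiCut d ((4 : ℝ) • y) * ((-‖y‖ ^ 2) ^ N)⁻¹ := by
    refine contDiff_hiCut_mul (n := n) (P := fun y : Space d => (4 : ℝ) • y) (by fun_prop) fun y hy => ?_
    have hy' : y ≠ 0 := by rintro rfl; simp at hy
    refine ContDiffAt.inv ((contDiff_norm_sq ℝ).contDiffAt.neg.pow N) ?_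
    exact pow_ne_zero _ (neg_ne_zero.2 (by positivity))
  refine ⟨fun y => c0 * ((∫ z, Real.exp (-s * z.1) * F z * Real.cos (inner ℝ z.2 y + 0) ∂τ1) +
    ((∫ z, Real.exp (-s * z.1) * ((1 - hiCut d z.2) * F z) * Real.cos (inner ℝ z.2 y + 0) ∂τ2) +
      (hiCut d ((4 : ℝ) • y) * ((-‖y‖ ^ 2) ^ N)⁻¹) *
        ∫ z, Real.exp (-s * z.1) * B z * Real.cos (inner ℝ z.2 y + 0) ∂τ2)), ?_, ?_, ?_⟩
  · exact contDiff_const.mul (p1.contDiff.add (p2.contDiff.add (cz.mul p3.contDiff)))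
  · intro y hy
    refine DB.const_mul _ (p1.contDiff.add (p2.contDiff.add (cz.mul p3.contDiff))).contDiffAt ?_
    refine DB.add p1.contDiff.contDiffAt (p2.contDiff.add (cz.mul p3.contDiff)).contDiffAt ?_ ?_
    · convert q1 y using 1
      refine integral_congr_ae (Filter.Eventually.of_forall fun z => ?_)
      simp only [F, abs_of_nonneg (Real.exp_nonneg _)]
    · exact DB.add p2.contDiff.contDiffAt (cz.mul p3.contDiff).contDiffAt (q2 y)
        (DB.mul cz.contDiffAt p3.contDiff.contDiffAt (hz y (by simpa using hy)) (q3 y))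
  · intro y hy
    have hy0 : (-‖y‖ ^ 2) ^ N ≠ 0 := pow_ne_zero _ (neg_ne_zero.2 (by positivity))
    have hcut : hiCut d ((4 : ℝ) • y) = 1 := hiCut_eq_one (by
      rw [norm_smul]; norm_num; linarith)
    have r1 := p1.integrable y
    have r2 := p2.integrable y
    have r3 := p3.integrable y
    have e1 : ∀ t, Real.exp (-s * t) * fracHeatKernel d σ t y =
        c0 * ∫ p, Real.exp (-s * t) * F (t, p) * Real.cos (inner ℝ p y + 0) := by
      intro t
      rw [fracHeatKernel, mul_left_comm, ← integral_const_mul]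
      congr 2; funext p
      simp only [F, add_zero]; ring
    have e2 : ∀ t ∈ Ioc (0 : ℝ) 1, Real.exp (-s * t) * fracHeatKernel d σ t y =
        c0 * ((∫ p, Real.exp (-s * t) * ((1 - hiCut d p) * F (t, p)) * Real.cos (inner ℝ p y + 0)) +
          ((-‖y‖ ^ 2) ^ N)⁻¹ * ∫ p, Real.exp (-s * t) * B (t, p) * Real.cos (inner ℝ p y + 0)) := by
      intro t ht
      rw [e1]
      congr 1
      have j0 : Integrable fun p : Space d => Real.exp (-t * ‖p‖ ^ σ) := by
        have := integrable_radial hd (a := 0) 0 (by positivity) ht.1 hσ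
        simpa using this
      have mc : Continuous fun p : Space d => hiCut d p := (contDiff_hiCut (n := 0)).continuous
      have hcb : ∀ p : Space d, |hiCut d p| ≤ 1 := fun p => by
        obtain ⟨h1, h2⟩ := one_sub_hiCut_mem p
        rw [abs_le]; constructor <;> linarith
      have j1 : Integrable fun p : Space d => hiSymb d σ t p * Real.cos (inner ℝ p y) := by
        refine j0.mono' ?_ (Filter.Eventually.of_forall fun p => ?_)
        · refine Continuous.aestronglyMeasurable ?_
          exact (contDiff_lap_hiSymb (n := 0) σ t 0).continuous.mul (by fun_prop)
        · rw [hiSymb, expSymb_zero, norm_mul, norm_mul]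
          have := hcb p
          have h5 := Real.abs_cos_le_one (inner ℝ p y)
          calc _ ≤ 1 * ‖Real.exp (-t * ‖p‖ ^ σ)‖ * 1 := by
                gcongr <;> assumption
            _ = _ := by rw [one_mul, mul_one, Real.norm_of_nonneg (Real.exp_nonneg _)]
      have j2 : Integrable fun p : Space d => (1 - hiCut d p) * Real.exp (-t * ‖p‖ ^ σ) *
          Real.cos (inner ℝ p y) := by
        refine j0.mono' ?_ (Filter.Eventually.of_forall fun p => ?_)
        · refine Measurable.aestronglyMeasurable ?_
          have := mc.measurable
          fun_prop
        · rw [norm_mul, norm_mul]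
          obtain ⟨h1, h2⟩ := one_sub_hiCut_mem p
          have h5 := Real.abs_cos_le_one (inner ℝ p y)
          calc _ ≤ 1 * ‖Real.exp (-t * ‖p‖ ^ σ)‖ * 1 := by
                gcongr
                · rwa [Real.norm_of_nonneg h1]
                · assumption
            _ = _ := by rw [one_mul, mul_one, Real.norm_of_nonneg (Real.exp_nonneg _)]
      have k1 : ∫ p, Real.exp (-s * t) * B (t, p) * Real.cos (inner ℝ p y + 0)
          = Real.exp (-s * t) * ∫ p, lap^[N] (hiSymb d σ t) p * Real.cos (inner ℝ p y) := by
        rw [← integral_const_mul]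
        congr 1; funext p
        simp only [B, add_zero]; ring
      rw [k1, integral_hiSymb_mul_cos hd hσ ht.1, mul_left_comm (Real.exp (-s * t)), inv_mul_cancel_left₀ hy0,
        ← integral_const_mul, ← integral_add]
      · congr 1; funext p
        simp only [hiSymb, expSymb_zero, F, add_zero]; ring
      · refine (j2.const_mul (Real.exp (-s * t))).congr (Filter.Eventually.of_forall fun p => ?_)
        simp only [F, add_zero]; ring
      · exact j1.const_mul _
    beta_reduce
    rw [greenScaled, ← Ioc_union_Ioi_eq_Ioi zero_le_one, setIntegral_union (Ioc_disjoint_Ioi le_rfl)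
      measurableSet_Ioi]
    · rw [setIntegral_congr_fun measurableSet_Ioc e2, hcut, one_mul, integral_const_mul, integral_add
        r2.integral_prod_left (r3.integral_prod_left.const_mul _), integral_const_mul]
      simp only [e1]
      rw [integral_const_mul, integral_prod _ r1, integral_prod _ r2, integral_prod _ r3]
      ring
    · refine IntegrableOn.congr_fun (Integrable.const_mul (r2.integral_prod_left.add
        (r3.integral_prod_left.const_mul ((-‖y‖ ^ 2) ^ N)⁻¹)) c0) (fun t ht => (e2 t ht).symm)
        measurableSet_Ioc
    · simp only [e1]
      exact r1.integral_prod_left.const_mul _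

end Green

/-! ### The propagator: quantitative bounds -/

section Propagator

variable {d : ℕ} {σ : ℝ} {χ : ℝ → ℝ}

theorem IsCutoff.contDiff_deriv (hχ : IsCutoff χ) : ContDiff ℝ (⊤ : ℕ∞) (deriv χ) :=
  (contDiff_infty_iff_deriv.1 hχ.smooth).2

theorem IsCutoff.hasDerivAt (hχ : IsCutoff χ) (r : ℝ) : HasDerivAt χ (deriv χ r) r :=
  ((contDiff_infty_iff_deriv.1 hχ.smooth).1 r).hasDerivAt

theorem IsCutoff.deriv_eq_zero (hχ : IsCutoff χ) {r : ℝ} (hr : |r| < 1) : deriv χ r = 0 := by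
  have : χ =ᶠ[nhds r] fun _ => 0 := by
    filter_upwards [continuous_abs.continuousAt.eventually (gt_mem_nhds hr)] with q hq
    exact hχ.eq_zero q (le_of_lt hq)
  rw [this.deriv_eq]; simp

theorem IsCutoff.deriv_eq_zero' (hχ : IsCutoff χ) {r : ℝ} (hr : 2 < |r|) : deriv χ r = 0 := by
  have : χ =ᶠ[nhds r] fun _ => 1 := by
    filter_upwards [continuous_abs.continuousAt.eventually (lt_mem_nhds hr)] with q hq
    exact hχ.eq_one q hq
  rw [this.deriv_eq]; simp

theorem dPropagator_eq (hχ : IsCutoff χ) (κ : ℝ) {η : ℝ} (hη : η ≠ 0) (w : Space d) :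
    dPropagator d σ χ κ η w = cutoffAt χ κ (‖w‖ ^ σ) *
      (deriv χ (‖w‖ ^ σ * (1 - η) / η) * (-(‖w‖ ^ σ) / η ^ 2)) * greenFun d σ w := by
  rw [dPropagator]
  have h1 : HasDerivAt (fun η : ℝ => ‖w‖ ^ σ * (1 - η) / η) (-(‖w‖ ^ σ) / η ^ 2) η := by
    have := ((((hasDerivAt_id η).const_sub 1).const_mul (‖w‖ ^ σ)).div (hasDerivAt_id η) hη)
    refine this.congr_deriv ?_
    simp only [id]; ring
  have h2 : HasDerivAt (fun η => cutoffAt χ η (‖w‖ ^ σ))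
      (deriv χ (‖w‖ ^ σ * (1 - η) / η) * (-(‖w‖ ^ σ) / η ^ 2)) η :=
    (hχ.hasDerivAt _).comp η h1
  exact ((h2.const_mul _).mul_const _).deriv

/-- The function `|y|^σ`, made smooth at the origin. -/
def smoothPow (d : ℕ) (σ : ℝ) (y : Space d) : ℝ := hiCut d ((4 : ℝ) • y) * ‖y‖ ^ σ

theorem contDiff_smoothPow {n : ℕ∞} : ContDiff ℝ n (smoothPow d σ) := by
  refine contDiff_hiCut_mul (by fun_prop) fun y hy => contDiffAt_norm_rpow σ ?_
  rintro rfl; simp at hy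

theorem smoothPow_eq {y : Space d} (hy : 1 / 2 ≤ ‖y‖) : smoothPow d σ y = ‖y‖ ^ σ := by
  rw [smoothPow, hiCut_eq_one, one_mul]
  rw [norm_smul]; norm_num; linarith

theorem hiCut_mem (p : Space d) : 0 ≤ hiCut d p ∧ hiCut d p ≤ 1 := by
  obtain ⟨h1, h2⟩ := one_sub_hiCut_mem p
  constructor <;> linarith

theorem smoothPow_nonneg (y : Space d) : 0 ≤ smoothPow d σ y :=
  mul_nonneg (hiCut_mem _).1 (Real.rpow_nonneg (norm_nonneg _) _)

theorem smoothPow_le (y : Space d) : smoothPow d σ y ≤ ‖y‖ ^ σ :=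
  mul_le_of_le_one_left (Real.rpow_nonneg (norm_nonneg _) _) (hiCut_mem _).2

theorem norm_rpow_lt_one (hσ : 0 < σ) {y : Space d} (hy : ‖y‖ < 1 / 2) : ‖y‖ ^ σ < 1 :=
  Real.rpow_lt_one (norm_nonneg _) (by linarith) hσ

/-- The profile of the propagator; `χ₁` is `χ` or `χ'`. -/
def profile (d : ℕ) (σ : ℝ) (χ χ₁ : ℝ → ℝ) (k : ℕ) (z : ℝ × ℝ × Space d) : ℝ :=
  χ₁ (z.1 * smoothPow d σ z.2.2) * (deriv χ (z.2.1 * smoothPow d σ z.2.2) *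
    smoothPow d σ z.2.2 ^ k)

theorem contDiff_profile (hχ : IsCutoff χ) {χ₁ : ℝ → ℝ} (h1 : ContDiff ℝ (⊤ : ℕ∞) χ₁) (k : ℕ) :
    ContDiff ℝ (⊤ : ℕ∞) (profile d σ χ χ₁ k) := by
  have hs : ContDiff ℝ (⊤ : ℕ∞) fun z : ℝ × ℝ × Space d => smoothPow d σ z.2.2 :=
    contDiff_smoothPow.comp (contDiff_snd.comp contDiff_snd)
  exact (h1.comp (contDiff_fst.mul hs)).mul ((hχ.contDiff_deriv.comp
    ((contDiff_fst.comp contDiff_snd).mul hs)).mul (hs.pow k))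

/-- The radius of the support of the profile. -/
def suppRadius (σ : ℝ) : ℝ := 4 ^ (1 / σ)

theorem suppRadius_pos : 0 < suppRadius σ := Real.rpow_pos_of_pos (by norm_num) _

theorem four_lt_rpow (hσ : 0 < σ) {y : Space d} (hy : suppRadius σ < ‖y‖) : 4 < ‖y‖ ^ σ := by
  have := Real.rpow_lt_rpow suppRadius_pos.le hy hσ
  rwa [suppRadius, ← Real.rpow_mul (by norm_num), one_div_mul_cancel hσ.ne', Real.rpow_one] at this

theorem half_lt_of_suppRadius_lt (hσ : 0 < σ) {y : Space d} (hy : suppRadius σ < ‖y‖) :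
    1 / 2 ≤ ‖y‖ := by
  have : 1 ≤ suppRadius σ := Real.one_le_rpow (by norm_num) (by positivity)
  linarith

theorem profile_eq_zero_of_lt (hσ : 0 < σ) (hχ : IsCutoff χ) (χ₁ : ℝ → ℝ) (k : ℕ) {τ θ : ℝ}
    (hθ : 1 / 2 ≤ θ) {y : Space d} (hy : suppRadius σ < ‖y‖) :
    profile d σ χ χ₁ k (τ, θ, y) = 0 := by
  have h1 := four_lt_rpow hσ hy
  simp only [profile]
  rw [smoothPow_eq (half_lt_of_suppRadius_lt hσ hy), hχ.deriv_eq_zero' (r := θ * ‖y‖ ^ σ), zero_mul, mul_zero]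
  rw [abs_of_nonneg (by positivity)]
  nlinarith

theorem exists_DB_profile (hσ : 0 < σ) (hχ : IsCutoff χ) {χ₁ : ℝ → ℝ}
    (h1 : ContDiff ℝ (⊤ : ℕ∞) χ₁) (hc : ∀ r, 2 < r → χ₁ r = χ₁ 3) (k n : ℕ) :
    ∃ C, 0 ≤ C ∧ ∀ τ θ, 0 ≤ τ → θ ∈ Icc (1 / 2 : ℝ) 1 → ∀ y : Space d,
      DB n 1 C (fun y => profile d σ χ χ₁ k (τ, θ, y)) y := by
  obtain ⟨C, hC, h⟩ := exists_DB_of_isCompact (n := n) (f := profile d σ χ χ₁ k)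
    ((contDiff_profile hχ h1 k).of_le (by exact_mod_cast le_top))
    ((isCompact_Icc (a := (0 : ℝ)) (b := 3)).prod ((isCompact_Icc (a := (1 / 2 : ℝ)) (b := 1)).prod
      (isCompact_closedBall (0 : Space d) (suppRadius σ))))
  have small : ∀ τ ∈ Icc (0 : ℝ) 3, ∀ θ ∈ Icc (1 / 2 : ℝ) 1, ∀ y : Space d,
      DB n 1 C (fun y => profile d σ χ χ₁ k (τ, θ, y)) y := by
    intro τ hτ θ hθ y
    rcases le_or_gt ‖y‖ (suppRadius σ) with hy | hy
    · have := DB.comp_affine (n := n) (ℓ := 1) (ℓ' := 1) (M := C) (f := profile d σ χ χ₁ k) (y := y)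
        ((0 : Space d →L[ℝ] ℝ).prod ((0 : Space d →L[ℝ] ℝ).prod (ContinuousLinearMap.id ℝ _)))
        (τ, θ, 0) one_pos (fun v => by simp [Prod.norm_def])
        ((contDiff_profile hχ h1 k).of_le (by exact_mod_cast le_top)).contDiffAt
        (by simpa using h (τ, θ, y) ⟨hτ, hθ, by simpa using hy⟩)
      simpa using this
    · refine DB.of_eventually_zero one_pos hC ?_
      filter_upwards [continuous_norm.continuousAt.eventually (lt_mem_nhds hy)] with q hq
      exact profile_eq_zero_of_lt hσ hχ χ₁ k hθ.1 hq
  refine ⟨C, hC, fun τ θ hτ hθ y => ?_⟩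
  rcases le_or_gt τ 3 with h3 | h3
  · exact small τ ⟨hτ, h3⟩ θ hθ y
  · convert small 3 ⟨by norm_num, le_rfl⟩ θ hθ y using 2 with z
    simp only [profile]
    rcases lt_or_ge (smoothPow d σ z) 1 with hs | hs
    · rw [hχ.deriv_eq_zero, zero_mul, mul_zero, mul_zero]
      have := smoothPow_nonneg (σ := σ) z
      rw [abs_of_nonneg (mul_nonneg (by linarith [hθ.1]) this)]
      nlinarith [hθ.2]
    · rw [hc _ (by nlinarith), hc (3 * _) (by nlinarith)]

theorem scale_pos {μ : ℝ} (hμ : 0 < μ) : 0 < scale σ μ := Real.rpow_pos_of_pos hμ _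

theorem scale_rpow {μ : ℝ} (hσ : 0 < σ) (hμ : 0 < μ) : scale σ μ ^ σ = μ := by
  rw [scale, ← Real.rpow_mul hμ.le, one_div_mul_cancel hσ.ne', Real.rpow_one]

theorem scale_rpow' {μ : ℝ} (hμ : 0 < μ) (a : ℝ) : scale σ μ ^ a = μ ^ (a / σ) := by
  rw [scale, ← Real.rpow_mul hμ.le]; congr 1; ring

theorem scale_le_one {μ : ℝ} (hσ : 0 < σ) (hμ : 0 < μ) (h1 : μ ≤ 1) : scale σ μ ≤ 1 :=
  Real.rpow_le_one hμ.le h1 (by positivity)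

theorem scale_le {μ η : ℝ} (hσ : 0 < σ) (hη : 0 < η) (h : η ≤ μ) : scale σ η ≤ scale σ μ :=
  Real.rpow_le_rpow hη.le h (by positivity)

/-- The `κ`-derivative of `dPropagator`. -/
def ddPropagator (d : ℕ) (σ : ℝ) (χ : ℝ → ℝ) (κ η : ℝ) (w : Space d) : ℝ :=
  deriv χ (‖w‖ ^ σ * (1 - κ) / κ) * (-(‖w‖ ^ σ) / κ ^ 2) *
      (deriv χ (‖w‖ ^ σ * (1 - η) / η) * (-(‖w‖ ^ σ) / η ^ 2)) * greenFun d σ w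

theorem hasDerivAt_dPropagator (hχ : IsCutoff χ) {κ η : ℝ} (hκ : κ ≠ 0) (hη : η ≠ 0)
    (w : Space d) : HasDerivAt (fun κ => dPropagator d σ χ κ η w) (ddPropagator d σ χ κ η w) κ := by
  have h1 : HasDerivAt (fun κ : ℝ => ‖w‖ ^ σ * (1 - κ) / κ) (-(‖w‖ ^ σ) / κ ^ 2) κ := by
    have := ((((hasDerivAt_id κ).const_sub 1).const_mul (‖w‖ ^ σ)).div (hasDerivAt_id κ) hκ)
    refine this.congr_deriv ?_
    simp only [id]; ring
  have h2 : HasDerivAt (fun κ => cutoffAt χ κ (‖w‖ ^ σ))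
      (deriv χ (‖w‖ ^ σ * (1 - κ) / κ) * (-(‖w‖ ^ σ) / κ ^ 2)) κ :=
    (hχ.hasDerivAt _).comp κ h1
  simp only [dPropagator_eq hχ _ hη]
  exact (h2.mul_const _).mul_const _

/-- Rescaled form of the propagator. -/
theorem scaled_aux (hσ : 0 < σ) (hχ : IsCutoff χ) {η : ℝ} (hη : η ∈ Ioc (0 : ℝ) (1 / 2))
    {G : Space d → ℝ} (hG : ∀ y, 1 / 2 ≤ ‖y‖ → greenScaled d σ η y = G y) (χ₁ : ℝ → ℝ) (τ c : ℝ)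
    (k : ℕ) (f : ℝ → ℝ) (hf : ∀ r, f (η * r) = χ₁ (τ * r) * (c * r ^ k)) (w : Space d) :
    f (‖w‖ ^ σ) * (deriv χ (‖w‖ ^ σ * (1 - η) / η) * (-(‖w‖ ^ σ) / η ^ 2)) * greenFun d σ w =
      -c * scale σ η ^ (-(d : ℝ)) * (profile d σ χ χ₁ (k + 1) (τ, 1 - η, (scale σ η)⁻¹ • w) *
        G ((scale σ η)⁻¹ • w)) := by
  have hℓ : 0 < scale σ η := scale_pos hη.1
  set ℓ := scale σ η with hℓd
  obtain ⟨y, rfl⟩ : ∃ y, w = ℓ • y := ⟨ℓ⁻¹ • w, by rw [smul_inv_smul₀ hℓ.ne']⟩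
  rw [inv_smul_smul₀ hℓ.ne']
  have e1 : ‖ℓ • y‖ ^ σ = η * ‖y‖ ^ σ := by
    rw [norm_smul, Real.norm_of_nonneg hℓ.le, Real.mul_rpow hℓ.le (norm_nonneg _), hℓd,
      scale_rpow hσ hη.1]
  have e2 : η * ‖y‖ ^ σ * (1 - η) / η = (1 - η) * ‖y‖ ^ σ := by
    have := hη.1.ne'
    field_simp
  rw [e1, e2, hf]
  simp only [profile]
  have hη2 : 0 < 1 - η := by linarith [hη.2]
  rcases lt_or_ge ‖y‖ (1 / 2) with hy | hy
  · have h1 := norm_rpow_lt_one hσ hy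
    have h2 : 0 ≤ ‖y‖ ^ σ := by positivity
    rw [hχ.deriv_eq_zero, hχ.deriv_eq_zero]
    · ring
    · have h3 := smoothPow_nonneg (σ := σ) y
      have h4 := smoothPow_le (σ := σ) y
      rw [abs_of_nonneg (by positivity)]
      nlinarith [hη.1]
    · rw [abs_of_nonneg (by positivity)]
      nlinarith [hη.1]
  · rw [smoothPow_eq hy, greenFun_smul hℓ, hℓd, scale_rpow hσ hη.1, hG y hy, Real.rpow_sub (hℓd ▸ hℓ),
      scale_rpow hσ hη.1, Real.rpow_neg (hℓd ▸ hℓ).le]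
    have := hη.1.ne'
    field_simp
    ring

theorem DB_scaled {n : ℕ} {ℓ C : ℝ} (hℓ : 0 < ℓ) {f : Space d → ℝ} (hf : ContDiff ℝ n f)
    (h : ∀ y, DB n 1 C f y) (w : Space d) : DB n ℓ C (fun w => f (ℓ⁻¹ • w)) w := by
  have := DB.comp_affine (n := n) (ℓ := 1) (ℓ' := ℓ) (M := C) (f := f) (y := w)
    (ℓ⁻¹ • ContinuousLinearMap.id ℝ (Space d)) 0 hℓ
    (fun v => by simp [norm_smul, abs_of_pos hℓ, div_eq_inv_mul]) hf.contDiffAt (h _)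
  simpa using this

theorem exists_DB_dPropagator (hd : 0 < d) (hσ : 0 < σ) (hσd : σ < d) (hχ : IsCutoff χ) (n : ℕ) :
    ∃ C, 0 ≤ C ∧ ∀ κ ∈ Ioc (0 : ℝ) (1 / 2), ∀ η ∈ Ioc (0 : ℝ) (1 / 2),
      ContDiff ℝ n (dPropagator d σ χ κ η) ∧ (∀ w, DB n (scale σ η) (C * scale σ η ^ (-(d : ℝ)))
        (dPropagator d σ χ κ η) w) ∧
      ∀ w, suppRadius σ * scale σ η < ‖w‖ → dPropagator d σ χ κ η w = 0 := by
  obtain ⟨C1, hC1, h1⟩ := exists_greenScaled hd hσ hσd n (suppRadius σ + 1)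
  obtain ⟨C2, hC2, h2⟩ := exists_DB_profile (d := d) hσ hχ (χ₁ := χ) hχ.smooth
    (fun r hr => by rw [hχ.eq_one r (by rwa [abs_of_nonneg (by linarith)]),
      hχ.eq_one 3 (by norm_num)]) 1 n
  refine ⟨2 ^ n * (C2 * C1), by positivity, fun κ hκ η hη => ?_⟩
  obtain ⟨G, hG, hGb, hGe⟩ := h1 η hη.1.le
  have hℓ : 0 < scale σ η := scale_pos hη.1
  have hθ : 1 - η ∈ Icc (1 / 2 : ℝ) 1 := ⟨by linarith [hη.2], by linarith [hη.1]⟩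
  have hτ : 0 ≤ η * (1 - κ) / κ :=
    div_nonneg (mul_nonneg hη.1.le (by linarith [hκ.2])) hκ.1.le
  have e : dPropagator d σ χ κ η = fun w => -1 * scale σ η ^ (-(d : ℝ)) *
      (profile d σ χ χ (0 + 1) (η * (1 - κ) / κ, 1 - η, (scale σ η)⁻¹ • w) *
        G ((scale σ η)⁻¹ • w)) := by
    funext w
    rw [dPropagator_eq hχ κ hη.1.ne', ← scaled_aux hσ hχ hη hGe χ (η * (1 - κ) / κ) 1 0
      (cutoffAt χ κ) (fun r => by simp only [cutoffAt]; rw [pow_zero, mul_one, mul_one]; congr 1; ring)]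
  have c1 : ContDiff ℝ n fun y : Space d => profile d σ χ χ (0 + 1) (η * (1 - κ) / κ, 1 - η, y) :=
    ((contDiff_profile hχ hχ.smooth _).of_le (by exact_mod_cast le_top)).comp
      (contDiff_const.prodMk (contDiff_const.prodMk contDiff_id))
  have hb : ∀ y, DB n 1 (2 ^ n * (C2 * C1))
      (fun y => profile d σ χ χ (0 + 1) (η * (1 - κ) / κ, 1 - η, y) * G y) y := by
    intro y
    rcases lt_or_ge ‖y‖ (suppRadius σ + 1) with hy | hy
    · exact DB.mul c1.contDiffAt hG.contDiffAt (h2 _ _ hτ hθ y) (hGb y hy.le)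
    · refine DB.of_eventually_zero one_pos (by positivity) ?_
      filter_upwards [continuous_norm.continuousAt.eventually
        (lt_mem_nhds (show suppRadius σ < ‖y‖ by linarith))] with q hq
      rw [profile_eq_zero_of_lt hσ hχ χ _ hθ.1 hq, zero_mul]
  refine ⟨?_, fun w => ?_, fun w hw => ?_⟩
  · rw [e]
    exact contDiff_const.mul ((c1.mul hG).comp (contDiff_const_smul _))
  · rw [e]
    have := (DB_scaled hℓ (c1.mul hG) hb w).const_mul (-1 * scale σ η ^ (-(d : ℝ)))
      ((c1.mul hG).comp (contDiff_const_smul _)).contDiffAt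
    refine this.mono hℓ (le_of_eq ?_)
    rw [abs_mul, abs_neg, abs_one, one_mul, abs_of_nonneg (by positivity)]
    ring
  · rw [e]
    beta_reduce
    rw [profile_eq_zero_of_lt hσ hχ χ _ hθ.1, zero_mul, mul_zero]
    rw [norm_smul, norm_inv, Real.norm_of_nonneg hℓ.le, inv_mul_eq_div, lt_div_iff₀ hℓ]
    exact hw

theorem exists_DB_ddPropagator (hd : 0 < d) (hσ : 0 < σ) (hσd : σ < d) (hχ : IsCutoff χ) {ε : ℝ}
    (hε : 0 < ε) (n : ℕ) :
    ∃ C, 0 ≤ C ∧ ∀ κ ∈ Ioc (0 : ℝ) (1 / 2), ∀ η ∈ Ioc (0 : ℝ) (1 / 2),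
      ContDiff ℝ n (ddPropagator d σ χ κ η) ∧ (∀ w, DB n (scale σ η)
        (C * scale σ κ ^ (ε - σ) * scale σ η ^ (-ε) * scale σ η ^ (-(d : ℝ)))
        (ddPropagator d σ χ κ η) w) ∧
      ∀ w, suppRadius σ * scale σ η < ‖w‖ → ddPropagator d σ χ κ η w = 0 := by
  obtain ⟨C1, hC1, h1⟩ := exists_greenScaled hd hσ hσd n (suppRadius σ + 1)
  obtain ⟨C2, hC2, h2⟩ := exists_DB_profile (d := d) hσ hχ (χ₁ := deriv χ) hχ.contDiff_deriv
    (fun r hr => by rw [hχ.deriv_eq_zero' (r := r) (by rwa [abs_of_nonneg (by linarith)]),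
      hχ.deriv_eq_zero' (r := 3) (by norm_num)]) 2 n
  refine ⟨4 * 4 ^ (ε / σ) * (2 ^ n * (C2 * C1)), by positivity, fun κ hκ η hη => ?_⟩
  obtain ⟨G, hG, hGb, hGe⟩ := h1 η hη.1.le
  have hℓ : 0 < scale σ η := scale_pos hη.1
  have hℓκ : 0 < scale σ κ := scale_pos hκ.1
  have hκ0 := hκ.1
  have hη0 := hη.1
  have hθ : 1 - η ∈ Icc (1 / 2 : ℝ) 1 := ⟨by linarith [hη.2], by linarith [hη.1]⟩
  have hτ : 0 ≤ η * (1 - κ) / κ :=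
    div_nonneg (mul_nonneg hη.1.le (by linarith [hκ.2])) hκ.1.le
  have e : ddPropagator d σ χ κ η = fun w => -(-η / κ ^ 2) * scale σ η ^ (-(d : ℝ)) *
      (profile d σ χ (deriv χ) (1 + 1) (η * (1 - κ) / κ, 1 - η, (scale σ η)⁻¹ • w) *
        G ((scale σ η)⁻¹ • w)) := by
    funext w
    rw [ddPropagator, ← scaled_aux hσ hχ hη hGe (deriv χ) (η * (1 - κ) / κ) (-η / κ ^ 2) 1
      (fun r => deriv χ (r * (1 - κ) / κ) * (-r / κ ^ 2)) (fun r => by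
        rw [show η * r * (1 - κ) / κ = η * (1 - κ) / κ * r by ring]; ring)]
  have c1 : ContDiff ℝ n fun y : Space d =>
      profile d σ χ (deriv χ) (1 + 1) (η * (1 - κ) / κ, 1 - η, y) :=
    ((contDiff_profile hχ hχ.contDiff_deriv _).of_le (by exact_mod_cast le_top)).comp
      (contDiff_const.prodMk (contDiff_const.prodMk contDiff_id))
  have hb : ∀ y, DB n 1 (2 ^ n * (C2 * C1))
      (fun y => profile d σ χ (deriv χ) (1 + 1) (η * (1 - κ) / κ, 1 - η, y) * G y) y := by
    intro y
    rcases lt_or_ge ‖y‖ (suppRadius σ + 1) with hy | hy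
    · exact DB.mul c1.contDiffAt hG.contDiffAt (h2 _ _ hτ hθ y) (hGb y hy.le)
    · refine DB.of_eventually_zero one_pos (by positivity) ?_
      filter_upwards [continuous_norm.continuousAt.eventually
        (lt_mem_nhds (show suppRadius σ < ‖y‖ by linarith))] with q hq
      rw [profile_eq_zero_of_lt hσ hχ _ _ hθ.1 hq, zero_mul]
  refine ⟨?_, fun w => ?_, fun w hw => ?_⟩
  · rw [e]
    exact contDiff_const.mul ((c1.mul hG).comp (contDiff_const_smul _))
  · rw [e]
    rcases le_or_gt η (4 * κ) with h4 | h4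
    · have := (DB_scaled hℓ (c1.mul hG) hb w).const_mul (-(-η / κ ^ 2) * scale σ η ^ (-(d : ℝ)))
        ((c1.mul hG).comp (contDiff_const_smul _)).contDiffAt
      refine this.mono hℓ ?_
      have e1 : |-(-η / κ ^ 2) * scale σ η ^ (-(d : ℝ))| = η / κ ^ 2 * scale σ η ^ (-(d : ℝ)) := by
        rw [neg_div, neg_neg, abs_of_nonneg (by positivity)]
      have e2 : scale σ κ ^ (ε - σ) = scale σ κ ^ ε / κ := by
        rw [Real.rpow_sub hℓκ, scale_rpow hσ hκ0]
      have e3 : scale σ η ^ ε ≤ 4 ^ (ε / σ) * scale σ κ ^ ε := by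
        rw [scale_rpow' hη0, scale_rpow' hκ0, ← Real.mul_rpow (by norm_num) hκ0.le]
        exact Real.rpow_le_rpow hη0.le h4 (by positivity)
      have e4 : η / κ ^ 2 ≤ 4 * 4 ^ (ε / σ) * (scale σ κ ^ ε / κ) * scale σ η ^ (-ε) := by
        rw [Real.rpow_neg hℓ.le, ← div_eq_mul_inv, le_div_iff₀ (by positivity)]
        calc η / κ ^ 2 * scale σ η ^ ε ≤ (4 * κ) / κ ^ 2 * (4 ^ (ε / σ) * scale σ κ ^ ε) := by gcongr
          _ = _ := by field_simp
      rw [e1, e2]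
      calc η / κ ^ 2 * scale σ η ^ (-(d : ℝ)) * (2 ^ n * (C2 * C1))
          ≤ (4 * 4 ^ (ε / σ) * (scale σ κ ^ ε / κ) * scale σ η ^ (-ε)) *
            scale σ η ^ (-(d : ℝ)) * (2 ^ n * (C2 * C1)) := by gcongr
        _ = _ := by ring
    · refine DB.of_eventually_zero hℓ (by positivity) (Filter.Eventually.of_forall fun q => ?_)
      suffices h : profile d σ χ (deriv χ) (1 + 1) (η * (1 - κ) / κ, 1 - η, (scale σ η)⁻¹ • q) = 0 by
        beta_reduce
        rw [h, zero_mul, mul_zero]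
      simp only [profile]
      have hs := smoothPow_nonneg (σ := σ) ((scale σ η)⁻¹ • q)
      rcases lt_or_ge (smoothPow d σ ((scale σ η)⁻¹ • q)) 1 with h1 | h1
      · rw [hχ.deriv_eq_zero (r := (1 - η) * _), zero_mul, mul_zero]
        rw [abs_of_nonneg (mul_nonneg (by linarith [hθ.1]) hs)]
        nlinarith [hθ.2, hθ.1]
      · rw [hχ.deriv_eq_zero' (r := η * (1 - κ) / κ * _), zero_mul]
        rw [abs_of_nonneg (mul_nonneg hτ hs)]
        have : 2 < η * (1 - κ) / κ := by
          rw [lt_div_iff₀ hκ0]; nlinarith [hκ.2]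
        nlinarith
  · rw [e]
    beta_reduce
    rw [profile_eq_zero_of_lt hσ hχ _ _ hθ.1, zero_mul, mul_zero]
    rw [norm_smul, norm_inv, Real.norm_of_nonneg hℓ.le, inv_mul_eq_div, lt_div_iff₀ hℓ]
    exact hw

end Propagator

/-! ### Smooth dependence of the propagator on its parameters -/

section Curves

open scoped BoundedContinuousFunction

variable {d : ℕ} {σ : ℝ} {χ : ℝ → ℝ}

theorem contDiffAt_greenFun (hd : 0 < d) (hσ : 0 < σ) (hσd : σ < d) (n : ℕ) {w : Space d}
    (hw : w ≠ 0) : ContDiffAt ℝ n (greenFun d σ) w := by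
  have hl : 0 < ‖w‖ := norm_pos_iff.2 hw
  obtain ⟨C, -, h⟩ := exists_greenScaled hd hσ hσd n 1
  obtain ⟨G, hG, -, hGe⟩ := h (‖w‖ ^ σ) (by positivity)
  have h1 : ContDiff ℝ n fun z => ‖w‖ ^ (σ - d) * G (‖w‖⁻¹ • z) :=
    contDiff_const.mul (hG.comp (contDiff_const_smul _))
  refine h1.contDiffAt.congr_of_eventuallyEq ?_
  filter_upwards [continuous_norm.continuousAt.eventually
    (lt_mem_nhds (show ‖w‖ / 2 < ‖w‖ by linarith))] with z hz
  conv_lhs => rw [← smul_inv_smul₀ hl.ne' z]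
  rw [greenFun_smul hl, hGe]
  rw [norm_smul, norm_inv, norm_norm, inv_mul_eq_div, le_div_iff₀ hl]
  linarith

/-- Families of compactly supported functions that depend smoothly on two parameters. -/
structure SmoothFamily (F : ℝ → ℝ → Space d → ℝ) : Prop where
  smooth : ∀ (n : ℕ), ∀ κ ∈ Ioo (0 : ℝ) 1, ∀ η < 1, ∀ w,
    ContDiffAt ℝ n (fun z : ℝ × ℝ × Space d => F z.1 z.2.1 z.2.2) (κ, η, w)
  supp : ∃ ρ, ∀ κ ∈ Ioo (0 : ℝ) 1, ∀ η ≤ 3 / 4, ∀ w, ρ < ‖w‖ → F κ η w = 0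

/-- `∂_μ G_{κ,μ}`, extended by zero to `μ ≤ 0`. -/
def extPropagator (d : ℕ) (σ : ℝ) (χ : ℝ → ℝ) (κ η : ℝ) (w : Space d) : ℝ :=
  if η ≤ 0 then 0 else dPropagator d σ χ κ η w

theorem smoothFamily_extPropagator (hd : 0 < d) (hσ : 0 < σ) (hσd : σ < d) (hχ : IsCutoff χ) :
    SmoothFamily (extPropagator d σ χ) := by
  constructor
  · intro n κ hκ η hη w
    have hκ1 : 0 < 1 - κ := by linarith [hκ.2]
    rcases lt_or_ge 0 η with h0 | h0
    · have hpos : ∀ᶠ z : ℝ × ℝ × Space d in nhds (κ, η, w), 0 < z.2.1 :=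
        (continuous_fst.comp continuous_snd).continuousAt.eventually (lt_mem_nhds h0)
      by_cases hw : w = 0
      · subst hw
        have h1 : ContinuousAt (fun z : ℝ × ℝ × Space d => ‖z.2.2‖ ^ σ * (1 - z.2.1) / z.2.1)
            (κ, η, 0) := by
          refine ContinuousAt.div (ContinuousAt.mul (ContinuousAt.rpow_const ?_ (Or.inr hσ.le)) ?_)
            ?_ h0.ne' <;> fun_prop
        refine (contDiffAt_const (c := (0 : ℝ))).congr_of_eventuallyEq ?_
        have h2 := h1.eventually (gt_mem_nhds (show ‖(0 : Space d)‖ ^ σ * (1 - η) / η < 1 by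
          simp [hσ.ne']))
        have h3 := h1.eventually (lt_mem_nhds (show -1 < ‖(0 : Space d)‖ ^ σ * (1 - η) / η by
          simp [hσ.ne']))
        filter_upwards [h2, h3, hpos] with z hz hz' hz0
        rw [extPropagator, if_neg (not_le.2 hz0), dPropagator_eq hχ _ hz0.ne',
          hχ.deriv_eq_zero (abs_lt.2 ⟨hz', hz⟩)]
        ring
      · have e : (fun z : ℝ × ℝ × Space d => extPropagator d σ χ z.1 z.2.1 z.2.2) =ᶠ[nhds (κ, η, w)]
            fun z => χ (‖z.2.2‖ ^ σ * (1 - z.1) / z.1) *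
              (deriv χ (‖z.2.2‖ ^ σ * (1 - z.2.1) / z.2.1) * (-(‖z.2.2‖ ^ σ) / z.2.1 ^ 2)) *
                greenFun d σ z.2.2 := by
          filter_upwards [hpos] with z hz
          rw [extPropagator, if_neg (not_le.2 hz), dPropagator_eq hχ _ hz.ne']
          rfl
        have hr : ContDiffAt ℝ n (fun z : ℝ × ℝ × Space d => ‖z.2.2‖ ^ σ) (κ, η, w) :=
          (contDiffAt_norm_rpow σ (p := w) hw).comp (κ, η, w)
            (f := fun z : ℝ × ℝ × Space d => z.2.2) (by fun_prop)
        have hG : ContDiffAt ℝ n (fun z : ℝ × ℝ × Space d => greenFun d σ z.2.2) (κ, η, w) :=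
          (contDiffAt_greenFun hd hσ hσd n (w := w) hw).comp (κ, η, w)
            (f := fun z : ℝ × ℝ × Space d => z.2.2) (by fun_prop)
        have h1 : ContDiffAt ℝ n (fun z : ℝ × ℝ × Space d => z.1) (κ, η, w) := by fun_prop
        have h2 : ContDiffAt ℝ n (fun z : ℝ × ℝ × Space d => z.2.1) (κ, η, w) := by fun_prop
        refine ContDiffAt.congr_of_eventuallyEq (((ContDiffAt.comp (κ, η, w)
          (f := fun z : ℝ × ℝ × Space d => ‖z.2.2‖ ^ σ * (1 - z.1) / z.1) (g := χ)
          (hχ.smooth.of_le (by exact_mod_cast le_top)).contDiffAt ?_).mul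
          ((ContDiffAt.comp (κ, η, w)
          (f := fun z : ℝ × ℝ × Space d => ‖z.2.2‖ ^ σ * (1 - z.2.1) / z.2.1) (g := deriv χ)
          (hχ.contDiff_deriv.of_le (by exact_mod_cast le_top)).contDiffAt ?_).mul
          (hr.neg.div (h2.pow 2) (pow_ne_zero 2 h0.ne')))).mul hG) e
        · exact (hr.mul (contDiffAt_const.sub h1)).div h1 hκ.1.ne'
        · exact (hr.mul (contDiffAt_const.sub h2)).div h2 h0.ne'
    · refine (contDiffAt_const (c := (0 : ℝ))).congr_of_eventuallyEq ?_
      have hc : ∀ᶠ z : ℝ × ℝ × Space d in nhds (κ, η, w),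
          2 * z.2.1 * (1 - z.1) < z.1 * (1 - z.2.1) :=
        ContinuousAt.eventually_lt (f := fun z : ℝ × ℝ × Space d => 2 * z.2.1 * (1 - z.1))
          (g := fun z => z.1 * (1 - z.2.1)) (by fun_prop) (by fun_prop)
          (by show 2 * η * (1 - κ) < κ * (1 - η); nlinarith [hκ.1])
      have hk : ∀ᶠ z : ℝ × ℝ × Space d in nhds (κ, η, w), 0 < z.1 :=
        continuous_fst.continuousAt.eventually (lt_mem_nhds hκ.1)
      have hk1 : ∀ᶠ z : ℝ × ℝ × Space d in nhds (κ, η, w), z.1 < 1 :=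
        continuous_fst.continuousAt.eventually (gt_mem_nhds hκ.2)
      filter_upwards [hc, hk, hk1] with z hz hz0 hz1
      rw [extPropagator]
      split_ifs with hle
      · rfl
      have hle := not_le.1 hle
      have hr : 0 ≤ ‖z.2.2‖ ^ σ := by positivity
      have h1 : 0 < 1 - z.2.1 := by
        by_contra hcon
        have : 0 < 2 * z.2.1 * (1 - z.1) := by
          have : 0 < 1 - z.1 := by linarith
          positivity
        nlinarith
      rw [dPropagator_eq hχ _ hle.ne']
      rcases le_or_gt (‖z.2.2‖ ^ σ * (1 - z.1) / z.1) 1 with h4 | h4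
      · rw [cutoffAt, hχ.eq_zero _ (by
          rwa [abs_of_nonneg (div_nonneg (mul_nonneg hr (by linarith)) hz0.le)]), zero_mul, zero_mul]
      · rw [hχ.deriv_eq_zero', zero_mul, mul_zero, zero_mul]
        rw [abs_of_nonneg (by positivity), lt_div_iff₀ hle]
        rw [lt_div_iff₀ hz0, one_mul] at h4
        have h5 : 0 < 1 - z.1 := by linarith
        have h6 : z.1 * (2 * z.2.1) < z.1 * (‖z.2.2‖ ^ σ * (1 - z.2.1)) := by
          have : 0 < ‖z.2.2‖ ^ σ := by
            by_contra hcon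
            nlinarith
          calc z.1 * (2 * z.2.1) < ‖z.2.2‖ ^ σ * (1 - z.1) * (2 * z.2.1) := by gcongr
            _ = ‖z.2.2‖ ^ σ * (2 * z.2.1 * (1 - z.1)) := by ring
            _ < ‖z.2.2‖ ^ σ * (z.1 * (1 - z.2.1)) := by gcongr
            _ = _ := by ring
        exact lt_of_mul_lt_mul_left h6 hz0.le
  · refine ⟨6 ^ (1 / σ), fun κ hκ η hη w hw => ?_⟩
    rw [extPropagator]
    split_ifs with hle
    · rfl
    have hle := not_le.1 hle
    have h6 : 6 < ‖w‖ ^ σ := by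
      have := Real.rpow_lt_rpow (by positivity) hw hσ
      rwa [← Real.rpow_mul (by norm_num), one_div_mul_cancel hσ.ne', Real.rpow_one] at this
    rw [dPropagator_eq hχ _ hle.ne', hχ.deriv_eq_zero', zero_mul, mul_zero, zero_mul]
    have : 0 ≤ 1 - η := by linarith
    rw [abs_of_nonneg (by positivity), lt_div_iff₀ hle]
    nlinarith

namespace SmoothFamily

variable {F : ℝ → ℝ → Space d → ℝ}

theorem eventually_mem {κ η : ℝ} (hκ : κ ∈ Ioo (0 : ℝ) 1) (hη : η < 1) (w : Space d) :
    ∀ᶠ z : ℝ × ℝ × Space d in nhds (κ, η, w), z.1 ∈ Ioo (0 : ℝ) 1 ∧ z.2.1 < 1 := by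
  have h1 : ∀ᶠ z : ℝ × ℝ × Space d in nhds (κ, η, w), z.1 ∈ Ioo (0 : ℝ) 1 :=
    continuous_fst.continuousAt.eventually (Ioo_mem_nhds hκ.1 hκ.2)
  have h2 : ∀ᶠ z : ℝ × ℝ × Space d in nhds (κ, η, w), z.2.1 < 1 :=
    (continuous_fst.comp continuous_snd).continuousAt.eventually (gt_mem_nhds hη)
  exact h1.and h2

theorem differentiableAt (hF : SmoothFamily F) {κ η : ℝ} (hκ : κ ∈ Ioo (0 : ℝ) 1) (hη : η < 1)
    (w : Space d) :
    DifferentiableAt ℝ (fun z : ℝ × ℝ × Space d => F z.1 z.2.1 z.2.2) (κ, η, w) :=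
  (hF.smooth 1 κ hκ η hη w).differentiableAt (by simp)

theorem contDiff_right (hF : SmoothFamily F) {κ η : ℝ} (hκ : κ ∈ Ioo (0 : ℝ) 1) (hη : η < 1)
    (n : ℕ) : ContDiff ℝ n (F κ η) :=
  contDiff_iff_contDiffAt.2 fun w => (hF.smooth n κ hκ η hη w).comp w
    (f := fun w : Space d => (κ, η, w)) (by fun_prop)

theorem hasDerivAt (hF : SmoothFamily F) {κ η : ℝ} (hκ : κ ∈ Ioo (0 : ℝ) 1) (hη : η < 1)
    (w : Space d) : HasDerivAt (fun κ' => F κ' η w) (deriv (fun κ' => F κ' η w) κ) κ :=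
  (DifferentiableAt.comp κ (f := fun κ' : ℝ => (κ', η, w)) (hF.differentiableAt hκ hη w)
    (by fun_prop)).hasDerivAt

theorem dir (hF : SmoothFamily F) (v : Space d) :
    SmoothFamily fun κ η w => fderiv ℝ (F κ η) w v := by
  constructor
  · intro n κ hκ η hη w
    refine (contDiffAt_dir (hF.smooth (n + 1) κ hκ η hη w) (0, 0, v)).congr_of_eventuallyEq ?_
    filter_upwards [eventually_mem hκ hη w] with z hz
    have h1 : HasFDerivAt (fun w : Space d => (z.1, z.2.1, w))
        ((0 : Space d →L[ℝ] ℝ).prod ((0 : Space d →L[ℝ] ℝ).prod (ContinuousLinearMap.id ℝ _)))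
        z.2.2 := (hasFDerivAt_const _ _).prodMk ((hasFDerivAt_const _ _).prodMk (hasFDerivAt_id _))
    have h2 := (HasFDerivAt.comp z.2.2 (f := fun w : Space d => (z.1, z.2.1, w))
      (hF.differentiableAt hz.1 hz.2 z.2.2).hasFDerivAt h1).fderiv
    have h3 : F z.1 z.2.1 = (fun z : ℝ × ℝ × Space d => F z.1 z.2.1 z.2.2) ∘
      fun w => (z.1, z.2.1, w) := rfl
    rw [h3, h2]; rfl
  · obtain ⟨ρ, hρ⟩ := hF.supp
    refine ⟨ρ, fun κ hκ η hη w hw => ?_⟩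
    have : F κ η =ᶠ[nhds w] fun _ => 0 := by
      filter_upwards [continuous_norm.continuousAt.eventually (lt_mem_nhds hw)] with z hz
      exact hρ κ hκ η hη z hz
    rw [this.fderiv_eq]; simp

theorem param (hF : SmoothFamily F) :
    SmoothFamily fun κ η w => deriv (fun κ' => F κ' η w) κ := by
  constructor
  · intro n κ hκ η hη w
    refine (contDiffAt_dir (hF.smooth (n + 1) κ hκ η hη w) (1, 0, 0)).congr_of_eventuallyEq ?_
    filter_upwards [eventually_mem hκ hη w] with z hz
    have h1 : HasDerivAt (fun κ' : ℝ => (κ', z.2.1, z.2.2)) (1, 0, 0) z.1 :=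
      (hasDerivAt_id _).prodMk ((hasDerivAt_const _ _).prodMk (hasDerivAt_const _ _))
    exact ((hF.differentiableAt hz.1 hz.2 z.2.2).hasFDerivAt.comp_hasDerivAt z.1 h1).deriv
  · obtain ⟨ρ, hρ⟩ := hF.supp
    refine ⟨ρ, fun κ hκ η hη w hw => ?_⟩
    have : (fun κ' => F κ' η w) =ᶠ[nhds κ] fun _ => 0 := by
      filter_upwards [Ioo_mem_nhds hκ.1 hκ.2] with z hz
      exact hρ z hz η hη w hw
    rw [this.deriv_eq]; simp

theorem add {F' : ℝ → ℝ → Space d → ℝ} (hF : SmoothFamily F) (hF' : SmoothFamily F') :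
    SmoothFamily fun κ η w => F κ η w + F' κ η w := by
  constructor
  · exact fun n κ hκ η hη w => (hF.smooth n κ hκ η hη w).add (hF'.smooth n κ hκ η hη w)
  · obtain ⟨ρ, hρ⟩ := hF.supp
    obtain ⟨ρ', hρ'⟩ := hF'.supp
    refine ⟨max ρ ρ', fun κ hκ η hη w hw => ?_⟩
    rw [hρ κ hκ η hη w ((le_max_left _ _).trans_lt hw),
      hρ' κ hκ η hη w ((le_max_right _ _).trans_lt hw), add_zero]

theorem const_mul (hF : SmoothFamily F) (c : ℝ) : SmoothFamily fun κ η w => c * F κ η w := by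
  constructor
  · exact fun n κ hκ η hη w => contDiffAt_const.mul (hF.smooth n κ hκ η hη w)
  · obtain ⟨ρ, hρ⟩ := hF.supp
    exact ⟨ρ, fun κ hκ η hη w hw => by rw [hρ κ hκ η hη w hw, mul_zero]⟩

theorem zero : SmoothFamily fun _ _ (_ : Space d) => 0 :=
  ⟨fun _ _ _ _ _ _ => contDiffAt_const, 0, fun _ _ _ _ _ _ => rfl⟩

theorem lap (hF : SmoothFamily F) : SmoothFamily fun κ η => lap (F κ η) := by
  have h : ∀ s : Finset (Fin d), SmoothFamily fun κ η w => ∑ l ∈ s,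
      fderiv ℝ (fun y => fderiv ℝ (F κ η) y (unitVec d l)) w (unitVec d l) := by
    intro s
    classical
    induction s using Finset.induction_on with
    | empty => simpa using SmoothFamily.zero
    | insert a s ha ih =>
      simp only [Finset.sum_insert ha]
      exact ((hF.dir _).dir _).add ih
  exact h Finset.univ

theorem exists_bound (hF : SmoothFamily F) {a b : ℝ} (ha : 0 < a) (hb : b < 1) :
    ∃ C, 0 ≤ C ∧ ∀ κ ∈ Icc a b, ∀ η ∈ Icc (0 : ℝ) (3 / 4), ∀ w, |F κ η w| ≤ C := by
  obtain ⟨ρ, hρ⟩ := hF.supp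
  obtain ⟨C, hC⟩ := (isCompact_Icc.prod (isCompact_Icc.prod
    (isCompact_closedBall (0 : Space d) ρ))).exists_bound_of_continuousOn
    (s := Icc a b ×ˢ Icc (0 : ℝ) (3 / 4) ×ˢ Metric.closedBall (0 : Space d) ρ)
    (f := fun z : ℝ × ℝ × Space d => F z.1 z.2.1 z.2.2) (fun z hz =>
      (hF.smooth 0 z.1 ⟨ha.trans_le hz.1.1, hz.1.2.trans_lt hb⟩ z.2.1
        (by linarith [hz.2.1.2]) z.2.2).continuousAt.continuousWithinAt)
  refine ⟨max C 0, le_max_right _ _, fun κ hκ η hη w => ?_⟩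
  rcases le_or_gt ‖w‖ ρ with hw | hw
  · exact (hC (κ, η, w) ⟨hκ, hη, by simpa using hw⟩).trans (le_max_left _ _)
  · rw [hρ κ ⟨ha.trans_le hκ.1, hκ.2.trans_lt hb⟩ η hη.2 w hw]; simp

end SmoothFamily

/-- The retraction of `ℝ` onto `[0, 3/4]`. -/
def clamp (η : ℝ) : ℝ := max 0 (min η (3 / 4))

theorem clamp_mem (η : ℝ) : clamp η ∈ Icc (0 : ℝ) (3 / 4) :=
  ⟨le_max_left _ _, max_le (by norm_num) (min_le_right _ _)⟩

theorem clamp_eq {η : ℝ} (hη : η ∈ Icc (0 : ℝ) (3 / 4)) : clamp η = η := by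
  rw [clamp, min_eq_left hη.2, max_eq_right hη.1]

theorem continuous_clamp : Continuous clamp := by unfold clamp; fun_prop

open Classical in
/-- A smooth family as a curve of bounded continuous functions. -/
def curve (F : ℝ → ℝ → Space d → ℝ) (κ : ℝ) : (ℝ × Space d) →ᵇ ℝ :=
  if h : Continuous (fun p : ℝ × Space d => F κ (clamp p.1) p.2) ∧
      ∃ C, ∀ p : ℝ × Space d, ‖F κ (clamp p.1) p.2‖ ≤ C then
    BoundedContinuousFunction.ofNormedAddCommGroup _ h.1 _ h.2.choose_spec
  else 0

namespace SmoothFamily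

variable {F : ℝ → ℝ → Space d → ℝ}

theorem curve_apply (hF : SmoothFamily F) {κ : ℝ} (hκ : κ ∈ Ioo (0 : ℝ) 1) (p : ℝ × Space d) :
    curve F κ p = F κ (clamp p.1) p.2 := by
  rw [curve, dif_pos]
  · rfl
  constructor
  · refine continuous_iff_continuousAt.2 fun p => ?_
    exact ContinuousAt.comp (x := p) (f := fun p : ℝ × Space d => (κ, clamp p.1, p.2))
      (hF.smooth 0 κ hκ (clamp p.1) (by linarith [(clamp_mem p.1).2]) p.2).continuousAt
      (continuous_const.prodMk ((continuous_clamp.comp continuous_fst).prodMk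
        continuous_snd)).continuousAt
  · obtain ⟨C, -, hC⟩ := hF.exists_bound hκ.1 hκ.2
    exact ⟨C, fun p => hC κ ⟨le_rfl, le_rfl⟩ _ (clamp_mem _) _⟩

theorem hasDerivAt_curve (hF : SmoothFamily F) {κ : ℝ} (hκ : κ ∈ Ioo (0 : ℝ) 1) :
    HasDerivAt (curve F) (curve (fun κ η w => deriv (fun κ' => F κ' η w) κ) κ) κ := by
  obtain ⟨δ, hδ, hδs⟩ : ∃ δ > 0, Icc (κ - δ) (κ + δ) ⊆ Ioo (0 : ℝ) 1 := by
    refine ⟨min κ (1 - κ) / 2, half_pos (lt_min hκ.1 (by linarith [hκ.2])), fun t ht => ?_⟩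
    have h1 := min_le_left κ (1 - κ)
    have h2 := min_le_right κ (1 - κ)
    constructor <;> linarith [ht.1, ht.2, hκ.1, hκ.2]
  have ha := (hδs ⟨le_rfl, by linarith⟩).1
  have hb := (hδs ⟨by linarith, le_rfl⟩).2
  obtain ⟨C, hC0, hC⟩ := hF.param.param.exists_bound ha hb
  rw [hasDerivAt_iff_isLittleO_nhds_zero]
  have hO : (fun h : ℝ => curve F (κ + h) - curve F κ -
      h • curve (fun κ η w => deriv (fun κ' => F κ' η w) κ) κ) =O[nhds 0] fun h => h ^ 2 := by
    refine Asymptotics.IsBigO.of_bound C ?_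
    filter_upwards [Metric.ball_mem_nhds (0 : ℝ) hδ] with h hh
    rw [mem_ball_zero_iff, Real.norm_eq_abs] at hh
    have hκh : κ + h ∈ Ioo (0 : ℝ) 1 := hδs (by
      obtain ⟨h1, h2⟩ := abs_lt.1 hh
      constructor <;> linarith)
    rw [BoundedContinuousFunction.norm_le (by positivity)]
    intro p
    simp only [BoundedContinuousFunction.sub_apply, BoundedContinuousFunction.smul_apply,
      hF.curve_apply hκh, hF.curve_apply hκ, hF.param.curve_apply hκ, smul_eq_mul]
    set η := clamp p.1
    have hη := clamp_mem p.1
    have hη1 : η < 1 := by linarith [hη.2]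
    have hmem : ∀ t ∈ Metric.closedBall κ |h|, t ∈ Icc (κ - δ) (κ + δ) := by
      intro t ht
      rw [Metric.mem_closedBall, Real.dist_eq] at ht
      obtain ⟨h1, h2⟩ := abs_le.1 (ht.trans hh.le)
      constructor <;> linarith
    have hx : κ ∈ Metric.closedBall κ |h| := Metric.mem_closedBall_self (abs_nonneg h)
    have hy : κ + h ∈ Metric.closedBall κ |h| := by simp
    have b1 : ∀ t ∈ Metric.closedBall κ |h|,
        ‖deriv (fun κ' => F κ' η p.2) t - deriv (fun κ' => F κ' η p.2) κ‖ ≤ C * |h| := by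
      intro t ht
      refine ((convex_closedBall κ |h|).norm_image_sub_le_of_norm_hasDerivWithin_le (C := C)
        (f := fun t => deriv (fun κ' => F κ' η p.2) t)
        (fun s hs => (hF.param.hasDerivAt (hδs (hmem s hs)) hη1 p.2).hasDerivWithinAt)
        (fun s hs => hC s (hmem s hs) η hη p.2) hx ht).trans ?_
      gcongr
      simpa [Real.dist_eq] using ht
    have b2 := (convex_closedBall κ |h|).norm_image_sub_le_of_norm_hasDerivWithin_le (C := C * |h|)
      (f := fun t => F t η p.2 - t * deriv (fun κ' => F κ' η p.2) κ)
      (fun s hs => ((hF.hasDerivAt (hδs (hmem s hs)) hη1 p.2).sub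
        ((hasDerivAt_id s).mul_const _)).hasDerivWithinAt)
      (fun s hs => by simpa using b1 s hs) hx hy
    calc _ = ‖F (κ + h) η p.2 - (κ + h) * deriv (fun κ' => F κ' η p.2) κ -
          (F κ η p.2 - κ * deriv (fun κ' => F κ' η p.2) κ)‖ := by congr 1; ring
      _ ≤ _ := b2
      _ = _ := by
        rw [add_sub_cancel_left, norm_pow, Real.norm_eq_abs]; ring
  exact hO.trans_isLittleO (Asymptotics.isLittleO_pow_id one_lt_two)

end SmoothFamily

end Curves

/-! ### The regularizing kernels as Gaussian mixtures -/

section Mixture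

variable {d : ℕ}

/-- The density of the heat kernel at time `1`. -/
def gauss (d : ℕ) (z : Space d) : ℝ :=
  (4 * Real.pi) ^ (-(d : ℝ) / 2) * Real.exp (-‖z‖ ^ 2 / 4)

theorem gauss_nonneg (z : Space d) : 0 ≤ gauss d z := by unfold gauss; positivity

@[fun_prop]
theorem continuous_gauss : Continuous (gauss d) := by unfold gauss; fun_prop

/-- The heat kernel measure at time `1`. -/
def gaussMeas (d : ℕ) : Measure (Space d) := volume.withDensity fun z => ENNReal.ofReal (gauss d z)

theorem gauss_const : (4 * Real.pi) ^ (-(d : ℝ) / 2) * (Real.pi / (1 / 4)) ^ ((d : ℝ) / 2) = 1 := by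
  rw [show Real.pi / (1 / 4) = 4 * Real.pi by ring, ← Real.rpow_add (by positivity),
    show -(d : ℝ) / 2 + d / 2 = 0 by ring, Real.rpow_zero]

theorem integral_gauss : ∫ z, gauss d z = 1 := by
  have h := GaussianFourier.integral_rexp_neg_mul_sq_norm (V := Space d) (b := 1 / 4) (by norm_num)
  simp only [gauss, integral_const_mul]
  rw [← gauss_const (d := d)]
  congr 1
  rw [finrank_euclideanSpace_fin] at h
  rw [← h]
  congr 1; ext z; congr 1; ring

theorem integrable_gauss : Integrable (gauss d) := by
  by_contra h
  have := integral_undef h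
  rw [integral_gauss] at this
  exact one_ne_zero this

theorem integral_gaussMeas {E : Type*} [NormedAddCommGroup E] [NormedSpace ℝ E] (f : Space d → E) :
    ∫ z, f z ∂(gaussMeas d) = ∫ z, gauss d z • f z := by
  rw [gaussMeas, integral_withDensity_eq_integral_toReal_smul (by fun_prop) (by simp)]
  simp [ENNReal.toReal_ofReal (gauss_nonneg _)]

instance : IsProbabilityMeasure (gaussMeas d) := by
  constructor
  rw [gaussMeas, withDensity_apply _ MeasurableSet.univ, Measure.restrict_univ,
    ← ofReal_integral_eq_lintegral_ofReal integrable_gauss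
    (Filter.Eventually.of_forall gauss_nonneg), integral_gauss, ENNReal.ofReal_one]

theorem charFun_gaussMeas (p : Space d) :
    charFun (gaussMeas d) p = Real.exp (-‖p‖ ^ 2) := by
  have h := GaussianFourier.integral_cexp_neg_mul_sq_norm_add (V := Space d) (b := 1 / 4) (by norm_num)
    Complex.I p
  rw [charFun_apply, integral_gaussMeas]
  have e : ∀ z : Space d, gauss d z • Complex.exp (inner ℝ z p * Complex.I) =
      ((4 * Real.pi) ^ (-(d : ℝ) / 2) : ℝ) *
        Complex.exp (-(1 / 4) * (‖z‖ : ℂ) ^ 2 + Complex.I * (inner ℝ p z : ℝ)) := by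
    intro z
    rw [Complex.real_smul, gauss, Complex.ofReal_mul, mul_assoc, Complex.ofReal_exp,
      ← Complex.exp_add, real_inner_comm]
    congr 2
    push_cast
    ring
  simp_rw [e]
  rw [integral_const_mul, h, ← mul_assoc, finrank_euclideanSpace_fin]
  have h2 : (Real.pi / (1 / 4) : ℂ) ^ ((d : ℂ) / 2) = ((Real.pi / (1 / 4)) ^ ((d : ℝ) / 2) : ℝ) := by
    rw [Complex.ofReal_cpow (by positivity)]; push_cast; rfl
  rw [h2, ← Complex.ofReal_mul, gauss_const, Complex.ofReal_one, one_mul, Complex.ofReal_exp]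
  congr 1
  rw [Complex.I_sq]; push_cast; ring

/-- The density of the mixing measures. -/
def gammaWeight (g : ℕ) (s : ℝ) : ℝ := 2 / (g.factorial : ℝ) * (s ^ (2 * g + 1) * Real.exp (-s ^ 2))

@[fun_prop]
theorem continuous_gammaWeight (g : ℕ) : Continuous (gammaWeight g) := by
  unfold gammaWeight; fun_prop

theorem gammaWeight_nonneg (g : ℕ) {s : ℝ} (hs : 0 ≤ s) : 0 ≤ gammaWeight g s := by
  unfold gammaWeight; positivity

theorem integral_gammaWeight_mul (g : ℕ) {b : ℝ} (hb : 0 ≤ b) :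
    ∫ s in Ioi (0 : ℝ), gammaWeight g s * Real.exp (-b * s ^ 2) = ((1 + b) ^ (g + 1))⁻¹ := by
  have h := integral_rpow_mul_exp_neg_mul_rpow (p := 2) (q := ((2 * g + 1 : ℕ) : ℝ)) (b := 1 + b)
    (by norm_num) (by linarith [Nat.cast_nonneg (α := ℝ) (2 * g + 1)]) (by linarith)
  have e : ((2 * g + 1 : ℕ) + 1 : ℝ) / 2 = ((g : ℝ) + 1) := by push_cast; ring
  rw [neg_div, e, Real.Gamma_nat_eq_factorial, Real.rpow_neg (by linarith)] at h
  have e2 : (1 + b) ^ ((g : ℝ) + 1) = (1 + b) ^ (g + 1) := by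
    rw [← Real.rpow_natCast]; push_cast; rfl
  rw [e2] at h
  have e3 : ∀ s : ℝ, gammaWeight g s * Real.exp (-b * s ^ 2) = 2 / (g.factorial : ℝ) *
      (s ^ ((2 * g + 1 : ℕ) : ℝ) * Real.exp (-(1 + b) * s ^ (2 : ℝ))) := by
    intro s
    rw [gammaWeight, Real.rpow_natCast, Real.rpow_ofNat, mul_assoc, mul_assoc, ← Real.exp_add]
    congr 3; ring
  simp_rw [e3]
  rw [integral_const_mul, h]
  field_simp

theorem integral_gammaWeight (g : ℕ) : ∫ s in Ioi (0 : ℝ), gammaWeight g s = 1 := by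
  simpa using integral_gammaWeight_mul g le_rfl

theorem integrableOn_gammaWeight (g : ℕ) : IntegrableOn (gammaWeight g) (Ioi 0) := by
  by_contra h
  have := integral_undef h
  rw [integral_gammaWeight] at this
  exact one_ne_zero this

/-- The mixing measure. -/
def gammaMeas (g : ℕ) : Measure ℝ :=
  (volume.restrict (Ioi 0)).withDensity fun s => ENNReal.ofReal (gammaWeight g s)

theorem ae_gammaMeas_pos (g : ℕ) : ∀ᵐ s ∂(gammaMeas g), 0 < s :=
  (withDensity_absolutelyContinuous _ _).ae_le (ae_restrict_mem measurableSet_Ioi)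

theorem integral_gammaMeas {E : Type*} [NormedAddCommGroup E] [NormedSpace ℝ E] (g : ℕ)
    (f : ℝ → E) : ∫ s, f s ∂(gammaMeas g) = ∫ s in Ioi (0 : ℝ), gammaWeight g s • f s := by
  rw [gammaMeas, integral_withDensity_eq_integral_toReal_smul (by fun_prop) (by simp)]
  refine setIntegral_congr_fun measurableSet_Ioi fun s hs => ?_
  simp only [ENNReal.toReal_ofReal (gammaWeight_nonneg g (le_of_lt hs))]

instance (g : ℕ) : IsProbabilityMeasure (gammaMeas g) := by
  constructor
  rw [gammaMeas, withDensity_apply _ MeasurableSet.univ, Measure.restrict_univ,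
    ← ofReal_integral_eq_lintegral_ofReal (integrableOn_gammaWeight g)
    ((ae_restrict_mem measurableSet_Ioi).mono fun s hs => gammaWeight_nonneg g (le_of_lt hs)),
    integral_gammaWeight, ENNReal.ofReal_one]

/-- The law of `ℓ s z` for `s` and `z` distributed according to `gammaMeas g` and `gaussMeas d`. -/
def mixKernel (d g : ℕ) (ℓ : ℝ) : Measure (Space d) :=
  ((gammaMeas g).prod (gaussMeas d)).map fun p => (ℓ * p.1) • p.2

theorem measurable_mix (ℓ : ℝ) : Measurable fun p : ℝ × Space d => (ℓ * p.1) • p.2 := by fun_prop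

instance (g : ℕ) (ℓ : ℝ) : IsProbabilityMeasure (mixKernel d g ℓ) :=
  Measure.isProbabilityMeasure_map (measurable_mix ℓ).aemeasurable

theorem charFun_mixKernel (g : ℕ) (ℓ : ℝ) (p : Space d) :
    charFun (mixKernel d g ℓ) p = (((1 + ℓ ^ 2 * ‖p‖ ^ 2) ^ (g + 1))⁻¹ : ℝ) := by
  rw [charFun_apply, mixKernel, integral_map (measurable_mix ℓ).aemeasurable (by fun_prop),
    integral_prod]
  · have e : ∀ s : ℝ, ∫ z, Complex.exp (inner ℝ ((ℓ * s) • z) p * Complex.I) ∂(gaussMeas d) =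
        Real.exp (-(ℓ ^ 2 * ‖p‖ ^ 2) * s ^ 2) := by
      intro s
      have := charFun_gaussMeas ((ℓ * s) • p)
      rw [charFun_apply] at this
      simp only [inner_smul_left, inner_smul_right] at this ⊢
      refine this.trans ?_
      rw [norm_smul, mul_pow, Real.norm_eq_abs, sq_abs]
      congr 2; ring
    simp only [e]
    rw [integral_gammaMeas]
    simp only [Complex.real_smul, ← Complex.ofReal_mul]
    rw [integral_complex_ofReal, integral_gammaWeight_mul g (by positivity)]
  · refine Integrable.of_bound (C := 1) (by fun_prop) (Filter.Eventually.of_forall fun q => ?_)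
    rw [Complex.norm_exp_ofReal_mul_I]

/-- The density of `mixKernel`. -/
def mixDensity (d g : ℕ) (ℓ : ℝ) (y : Space d) : ℝ :=
  ∫ s in Ioi (0 : ℝ), gammaWeight g s * ((ℓ * s) ^ (-(d : ℝ)) * gauss d ((ℓ * s)⁻¹ • y))

theorem lintegral_gaussMeas_smul {r : ℝ} (hr : 0 < r) {B : Set (Space d)} (hB : MeasurableSet B) :
    gaussMeas d ((fun z => r • z) ⁻¹' B) =
      ∫⁻ y in B, ENNReal.ofReal (r ^ (-(d : ℝ)) * gauss d (r⁻¹ • y)) := by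
  have hm : MeasurableSet ((fun z : Space d => r • z) ⁻¹' B) := (measurable_const_smul r) hB
  rw [gaussMeas, withDensity_apply _ hm]
  have h1 := Measure.map_addHaar_smul (volume : Measure (Space d)) hr.ne'
  rw [finrank_euclideanSpace_fin] at h1
  have h2 : ∫⁻ z in (fun z : Space d => r • z) ⁻¹' B, ENNReal.ofReal (gauss d z) =
      ∫⁻ y in B, ENNReal.ofReal (gauss d (r⁻¹ • y)) ∂(Measure.map (r • ·) volume) := by
    rw [setLIntegral_map hB (by fun_prop) (by fun_prop)]
    simp [inv_smul_smul₀ hr.ne']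
  rw [h2, h1, Measure.restrict_smul, lintegral_smul_measure, smul_eq_mul,
    ← lintegral_const_mul _ (by fun_prop)]
  congr 1; ext y
  rw [← ENNReal.ofReal_mul (abs_nonneg _), abs_of_pos (by positivity), Real.rpow_neg hr.le,
    Real.rpow_natCast]

theorem measurable_mix_integrand (g : ℕ) (ℓ : ℝ) : Measurable fun p : ℝ × Space d =>
    gammaWeight g p.1 * ((ℓ * p.1) ^ (-(d : ℝ)) * gauss d ((ℓ * p.1)⁻¹ • p.2)) := by
  have h : Measurable (gauss d) := continuous_gauss.measurable
  have h2 : Measurable fun p : ℝ × Space d => gauss d ((ℓ * p.1)⁻¹ • p.2) := h.comp (by fun_prop)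
  have h3 : Measurable (gammaWeight g) := (continuous_gammaWeight g).measurable
  exact (h3.comp measurable_fst).mul ((by fun_prop : Measurable fun p : ℝ × Space d =>
    (ℓ * p.1) ^ (-(d : ℝ))).mul h2)

theorem mixKernel_eq_withDensity (g : ℕ) {ℓ : ℝ} (hℓ : 0 < ℓ) : mixKernel d g ℓ =
    volume.withDensity fun y => ENNReal.ofReal (mixDensity d g ℓ y) := by
  set f : ℝ → Space d → ℝ := fun s y =>
    gammaWeight g s * ((ℓ * s) ^ (-(d : ℝ)) * gauss d ((ℓ * s)⁻¹ • y)) with hf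
  have hfm : Measurable (Function.uncurry f) := measurable_mix_integrand g ℓ
  have hf0 : ∀ s ∈ Ioi (0 : ℝ), ∀ y, 0 ≤ f s y := fun s hs y => by
    have h0 : 0 < s := hs
    exact mul_nonneg (gammaWeight_nonneg g h0.le) (mul_nonneg (by positivity) (gauss_nonneg _))
  have key : ∀ B : Set (Space d), MeasurableSet B → mixKernel d g ℓ B =
      ∫⁻ y in B, ∫⁻ s in Ioi (0 : ℝ), ENNReal.ofReal (f s y) := by
    intro B hB
    rw [mixKernel, Measure.map_apply (measurable_mix ℓ) hB, Measure.prod_apply (measurable_mix ℓ hB),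
      lintegral_lintegral_swap (by fun_prop), gammaMeas,
      lintegral_withDensity_eq_lintegral_mul _ (by fun_prop)
        (measurable_measure_prodMk_left (measurable_mix ℓ hB))]
    refine setLIntegral_congr_fun measurableSet_Ioi fun s hs => ?_
    have h0 : 0 < s := hs
    have := lintegral_gaussMeas_smul (mul_pos hℓ h0) hB
    have e : Prod.mk s ⁻¹' ((fun p : ℝ × Space d => (ℓ * p.1) • p.2) ⁻¹' B) =
      (fun z => (ℓ * s) • z) ⁻¹' B := rfl
    simp only [Pi.mul_apply]
    rw [e, this, ← lintegral_const_mul _ (by fun_prop)]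
    refine lintegral_congr fun y => ?_
    rw [← ENNReal.ofReal_mul (gammaWeight_nonneg g h0.le)]
  have hfin : ∀ᵐ y : Space d, ∫⁻ s in Ioi (0 : ℝ), ENNReal.ofReal (f s y) < ∞ := by
    refine ae_lt_top ?_ ?_
    · exact (hfm.comp measurable_swap).ennreal_ofReal.lintegral_prod_right'
    · have := key univ MeasurableSet.univ
      rw [Measure.restrict_univ] at this
      rw [← this, measure_univ]; simp
  refine Measure.ext fun B hB => ?_
  rw [key B hB, withDensity_apply _ hB]
  refine lintegral_congr_ae (ae_restrict_of_ae ?_)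
  filter_upwards [hfin] with y hy
  have hpos : 0 ≤ᵐ[volume.restrict (Ioi (0 : ℝ))] fun s => f s y :=
    (ae_restrict_mem measurableSet_Ioi).mono fun s hs => hf0 s hs y
  have hint : Integrable (fun s => f s y) (volume.restrict (Ioi (0 : ℝ))) := by
    refine ⟨(hfm.comp (measurable_id.prodMk measurable_const)).aestronglyMeasurable, ?_⟩
    rwa [hasFiniteIntegral_iff_ofReal hpos]
  rw [mixDensity, ofReal_integral_eq_lintegral_ofReal hint hpos]

theorem regDensity_eq {ℓ : ℝ} (hℓ : 0 < ℓ) (y : Space d) : regDensity d ℓ y = mixDensity d 0 ℓ y := by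
  rw [regDensity, ← integral_comp_rpow_Ioi_of_pos (p := 2) (by norm_num), mixDensity]
  refine setIntegral_congr_fun measurableSet_Ioi fun s hs => ?_
  have h0 : 0 < s := hs
  simp only [smul_eq_mul, gammaWeight, gauss, Real.rpow_ofNat]
  have e1 : (4 * Real.pi * s ^ 2 * ℓ ^ 2) ^ (-(d : ℝ) / 2) =
      (4 * Real.pi) ^ (-(d : ℝ) / 2) * (ℓ * s) ^ (-(d : ℝ)) := by
    rw [show 4 * Real.pi * s ^ 2 * ℓ ^ 2 = 4 * Real.pi * (ℓ * s) ^ 2 by ring,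
      Real.mul_rpow (by positivity) (by positivity), ← Real.rpow_natCast (ℓ * s) 2,
      ← Real.rpow_mul (by positivity)]
    congr 2; push_cast; ring
  have e2 : -‖y‖ ^ 2 / (4 * s ^ 2 * ℓ ^ 2) = -‖(ℓ * s)⁻¹ • y‖ ^ 2 / 4 := by
    rw [norm_smul, norm_inv, Real.norm_of_nonneg (by positivity)]
    field_simp
  rw [e1, e2]
  norm_num
  ring

theorem regKernel_eq {σ μ : ℝ} (hμ : 0 < μ) : regKernel d σ μ = mixKernel d 0 (scale σ μ) := by
  rw [regKernel, mixKernel_eq_withDensity 0 (scale_pos hμ)]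
  congr 1; ext y
  rw [regDensity_eq (scale_pos hμ)]

theorem regKernelPow_succ {σ μ : ℝ} (hμ : 0 < μ) (g : ℕ) :
    regKernelPow d σ μ (g + 1) = mixKernel d g (scale σ μ) := by
  induction g with
  | zero =>
    rw [regKernelPow, regKernelPow, regKernel_eq hμ, Measure.conv_dirac_zero]
  | succ g ih =>
    rw [regKernelPow, ih, regKernel_eq hμ]
    refine Measure.ext_of_charFun ?_
    ext p
    rw [charFun_conv, charFun_mixKernel, charFun_mixKernel, charFun_mixKernel, ← Complex.ofReal_mul,
      ← mul_inv, ← pow_add]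
    congr 3; ring

theorem isProbabilityMeasure_regKernelPow {σ μ : ℝ} (hμ : 0 < μ) (g : ℕ) :
    IsProbabilityMeasure (regKernelPow d σ μ g) := by
  cases g with
  | zero => rw [regKernelPow]; infer_instance
  | succ g => rw [regKernelPow_succ hμ]; infer_instance

end Mixture

/-! ### Decay of the regularizing kernels -/

section Decay

variable {d : ℕ}

/-- The weight `(1 + ‖z‖)^{-N}`. -/
def decay {E : Type*} [NormedAddCommGroup E] (N : ℕ) (z : E) : ℝ := ((1 + ‖z‖) ^ N)⁻¹

section

variable {E : Type*} [NormedAddCommGroup E]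

theorem decay_pos (N : ℕ) (z : E) : 0 < decay N z := by unfold decay; positivity

theorem decay_le_one (N : ℕ) (z : E) : decay N z ≤ 1 :=
  inv_le_one_of_one_le₀ (one_le_pow₀ (by linarith [norm_nonneg z]))

@[fun_prop]
theorem continuous_decay (N : ℕ) : Continuous (decay N : E → ℝ) := by
  unfold decay
  exact (by fun_prop : Continuous fun z : E => (1 + ‖z‖) ^ N).inv₀ fun z => by positivity

theorem pow_mul_decay (k N : ℕ) (z : E) : (1 + ‖z‖) ^ k * decay (N + k) z = decay N z := by
  unfold decay; rw [pow_add]; field_simp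

theorem decay_le_of_le {N : ℕ} {c : ℝ} {z z' : E} (h : 1 + ‖z'‖ ≤ c * (1 + ‖z‖)) :
    decay N z ≤ c ^ N * decay N z' := by
  unfold decay
  have h1 : 0 < 1 + ‖z‖ := by positivity
  have h2 : 0 < 1 + ‖z'‖ := by positivity
  rw [← div_eq_mul_inv, le_div_iff₀ (by positivity), inv_mul_eq_div, div_le_iff₀ (by positivity),
    ← mul_pow]
  gcongr

theorem decay_add_le (N : ℕ) (z w : E) : decay N (z + w) ≤ (1 + ‖w‖) ^ N * decay N z := by
  refine decay_le_of_le ?_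
  have := norm_sub_le (z + w) w
  rw [add_sub_cancel_right] at this
  nlinarith [norm_nonneg w, norm_nonneg (z + w)]

theorem integrable_decay {N : ℕ} (hN : d < N) : Integrable (decay N : Space d → ℝ) := by
  have := integrable_one_add_norm (E := Space d) (μ := volume) (r := N)
    (by rw [finrank_euclideanSpace_fin]; exact_mod_cast hN)
  refine this.congr (Filter.Eventually.of_forall fun z => ?_)
  simp only [decay]
  rw [Real.rpow_neg (by positivity), Real.rpow_natCast]

end

section Exp

variable {E : Type*} [NormedAddCommGroup E] [NormedSpace ℝ E]

theorem DB.exists_exp (n : ℕ) {M : ℝ} (hM : 0 ≤ M) : ∃ c, 1 ≤ c ∧ ∀ (ℓ : ℝ) (q : E → ℝ) (x : E),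
    0 < ℓ → ContDiffAt ℝ n q x → (∀ v, ∀ k, n = k + 1 → DB k ℓ (M * (‖v‖ / ℓ))
      (fun y => fderiv ℝ q y v) x) → DB n ℓ (c * Real.exp (q x)) (fun y => Real.exp (q y)) x := by
  induction n with
  | zero => exact ⟨1, le_rfl, fun ℓ q x _ _ _ => by simp [DB]⟩
  | succ n ih =>
    obtain ⟨c, hc, h⟩ := ih
    refine ⟨c + 2 ^ n * (c * M), le_add_of_le_of_nonneg hc (by positivity),
      fun ℓ q x hℓ hq hb => ⟨?_, fun v => ?_⟩⟩
    · rw [abs_of_pos (Real.exp_pos _)]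
      exact le_mul_of_one_le_left (Real.exp_pos _).le
        (le_add_of_le_of_nonneg hc (by positivity))
    · have hq' : ContDiffAt ℝ n q x := hq.of_le (by norm_cast; omega)
      have h1 := h ℓ q x hℓ hq' fun v k hk => by
        have := hb v n rfl
        rw [hk] at this
        exact this.of_succ
      have h2 := DB.mul hq'.exp (contDiffAt_dir hq v) h1 (hb v n rfl)
      refine (h2.mono hℓ ?_).congr ?_
      · have h3 : 0 ≤ c * Real.exp (q x) * (‖v‖ / ℓ) := by positivity
        linarith
      · filter_upwards [eventually_differentiableAt hq] with y hy
        rw [(hy.hasFDerivAt.exp).fderiv]; rfl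

end Exp

theorem contDiff_gauss {n : WithTop ℕ∞} : ContDiff ℝ n (gauss d) := by
  unfold gauss
  exact contDiff_const.mul (((contDiff_norm_sq ℝ).neg.div_const _).exp)

theorem exists_pow_mul_exp_sq_le (k : ℕ) :
    ∃ C, 0 ≤ C ∧ ∀ r : ℝ, 0 ≤ r → (1 + r) ^ k * Real.exp (-r ^ 2 / 4) ≤ C * Real.exp (-r / 2) := by
  refine ⟨2 ^ k * k.factorial * Real.exp 2, by positivity, fun r hr => ?_⟩
  have h := pow_mul_exp_neg_le k (s := 1 + r) (by linarith)
  have h1 : Real.exp (-r ^ 2 / 4) ≤ Real.exp (-(1 + r)) * Real.exp 2 := by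
    rw [← Real.exp_add]; gcongr; nlinarith [sq_nonneg (r / 2 - 1)]
  have h2 : Real.exp (-(1 + r) / 2) ≤ Real.exp (-r / 2) := by gcongr; linarith
  calc (1 + r) ^ k * Real.exp (-r ^ 2 / 4) ≤ (1 + r) ^ k * (Real.exp (-(1 + r)) * Real.exp 2) := by
        gcongr
    _ = (1 + r) ^ k * Real.exp (-(1 + r)) * Real.exp 2 := by ring
    _ ≤ 2 ^ k * k.factorial * Real.exp (-r / 2) * Real.exp 2 := by
        exact mul_le_mul_of_nonneg_right (h.trans (by gcongr)) (by positivity)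
    _ = _ := by ring

theorem exists_DB_gauss (n N : ℕ) :
    ∃ C, 0 ≤ C ∧ ∀ z : Space d, DB n 1 (C * decay N z) (gauss d) z := by
  obtain ⟨c, hc, h⟩ := DB.exists_exp (E := Space d) n zero_le_one
  obtain ⟨C, hC, h2⟩ := exists_pow_mul_exp_sq_le (n + N)
  set A : ℝ := (4 * Real.pi) ^ (-(d : ℝ) / 2) with hA
  have hA0 : 0 ≤ A := by positivity
  refine ⟨A * (c * C), by positivity, fun z => ?_⟩
  have hz : 0 < 1 + ‖z‖ := by positivity
  have hq : ContDiff ℝ (n : WithTop ℕ∞) fun y : Space d => -‖y‖ ^ 2 / 4 :=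
    (contDiff_norm_sq ℝ).neg.div_const _
  have h1 := h (1 + ‖z‖)⁻¹ (fun y => -‖y‖ ^ 2 / 4) z (by positivity) hq.contDiffAt (by
    intro v k hk
    have e : (fun y : Space d => fderiv ℝ (fun y : Space d => -‖y‖ ^ 2 / 4) y v) =
        fun y => (-(1 / 2 : ℝ) • innerSL ℝ v) y + 0 := by
      funext y
      have h0 : HasFDerivAt (fun y : Space d => (-1 / 4 : ℝ) * ‖y‖ ^ 2)
          ((-1 / 4 : ℝ) • (2 • innerSL ℝ y)) y :=
        (hasStrictFDerivAt_norm_sq y).hasFDerivAt.const_mul _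
      have e0 : (fun y : Space d => -‖y‖ ^ 2 / 4) = fun y => (-1 / 4 : ℝ) * ‖y‖ ^ 2 := by
        funext y; ring
      rw [e0, h0.fderiv]
      simp only [smul_apply, innerSL_apply_apply, smul_eq_mul, real_inner_comm v y, add_zero]
      rw [nsmul_eq_mul]
      push_cast
      ring
    rw [e]
    refine DB.linear _ _ (by positivity) ?_ fun w => ?_
    · simp only [neg_smul, neg_apply, smul_apply, innerSL_apply_apply, smul_eq_mul, add_zero]
      rw [abs_neg, abs_mul, div_inv_eq_mul]
      have := abs_real_inner_le_norm v z
      rw [abs_of_pos (by norm_num : (0 : ℝ) < 1 / 2)]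
      nlinarith [norm_nonneg v, norm_nonneg z, mul_nonneg (norm_nonneg v) (norm_nonneg z)]
    · simp only [neg_smul, neg_apply, smul_apply, innerSL_apply_apply, smul_eq_mul]
      rw [abs_neg, abs_mul, div_inv_eq_mul, div_inv_eq_mul,
        abs_of_pos (by norm_num : (0 : ℝ) < 1 / 2)]
      have h3 := abs_real_inner_le_norm v w
      have h4 : ‖v‖ * ‖w‖ ≤ ‖v‖ * (1 + ‖z‖) * (‖w‖ * (1 + ‖z‖)) := by
        calc ‖v‖ * ‖w‖ = ‖v‖ * 1 * (‖w‖ * 1) := by ring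
          _ ≤ _ := by gcongr <;> linarith [norm_nonneg z]
      nlinarith [mul_nonneg (norm_nonneg v) (norm_nonneg w)])
  have h3 := DB.rescale (ℓ' := 1) (c := 1 + ‖z‖) (by positivity) one_pos
    (by linarith [norm_nonneg z]) (by rw [mul_inv_cancel₀ hz.ne']) h1
  have h4 := h3.const_mul A hq.exp.contDiffAt
  refine h4.mono one_pos ?_
  rw [abs_of_nonneg hA0, mul_assoc A]
  refine mul_le_mul_of_nonneg_left ?_ hA0
  have h5 := h2 ‖z‖ (norm_nonneg z)
  have h6 : Real.exp (-‖z‖ / 2) ≤ 1 := Real.exp_le_one_iff.2 (by linarith [norm_nonneg z])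
  unfold decay
  rw [← div_eq_mul_inv, le_div_iff₀ (by positivity)]
  calc (1 + ‖z‖) ^ n * (c * Real.exp (-‖z‖ ^ 2 / 4)) * (1 + ‖z‖) ^ N
      = c * ((1 + ‖z‖) ^ (n + N) * Real.exp (-‖z‖ ^ 2 / 4)) := by rw [pow_add]; ring
    _ ≤ c * (C * 1) := mul_le_mul_of_nonneg_left (h5.trans (by gcongr)) (by linarith)
    _ = c * C := by ring

theorem integrable_norm_pow_mul_gauss (k : ℕ) :
    Integrable fun z : Space d => ‖z‖ ^ k * gauss d z := by
  obtain ⟨C, hC, h⟩ := exists_DB_gauss (d := d) 0 (d + 1 + k)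
  refine ((integrable_decay (d := d) (Nat.lt_succ_self d)).const_mul C).mono' (by fun_prop)
    (Filter.Eventually.of_forall fun z => ?_)
  rw [norm_mul, norm_pow, norm_norm, ← pow_mul_decay k (d + 1)]
  have h1 : ‖gauss d z‖ ≤ C * decay (d + 1 + k) z := (h z).abs_le
  have := (decay_pos (d + 1 + k) z).le
  calc ‖z‖ ^ k * ‖gauss d z‖ ≤ (1 + ‖z‖) ^ k * (C * decay (d + 1 + k) z) := by
        gcongr; linarith
    _ = _ := by ring

theorem integrableOn_gammaWeight_mul (g : ℕ) {f : ℝ → ℝ} (hf : Measurable f) {C : ℝ} {k : ℕ}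
    (h : ∀ s, 0 < s → s ^ (2 * g + 1) * |f s| ≤ C * (1 + s) ^ k) : Integrable f (gammaMeas g) := by
  obtain ⟨C', hC', h2⟩ := exists_pow_mul_exp_sq_le k
  rw [gammaMeas, integrable_withDensity_iff_integrable_smul' (by fun_prop) (by simp)]
  have hC : 0 ≤ C := by
    have := (mul_nonneg (by positivity) (abs_nonneg (f 1))).trans (h 1 one_pos)
    exact nonneg_of_mul_nonneg_left this (by positivity)
  have hi : IntegrableOn (fun s => 2 / (g.factorial : ℝ) * C * C' * Real.exp (-(1 / 2) * s))
      (Ioi 0) := (integrableOn_exp_mul_Ioi (by norm_num) 0).const_mul _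
  refine hi.mono' (((by fun_prop : Measurable fun s => (ENNReal.ofReal (gammaWeight g s)).toReal).mul
    hf).aestronglyMeasurable) ?_
  filter_upwards [ae_restrict_mem measurableSet_Ioi] with s hs
  have hs0 : 0 < s := hs
  rw [ENNReal.toReal_ofReal (gammaWeight_nonneg g hs0.le), norm_smul,
    Real.norm_of_nonneg (gammaWeight_nonneg g hs0.le), Real.norm_eq_abs, gammaWeight]
  have h3 := h2 s hs0.le
  have h4 : Real.exp (-s ^ 2) ≤ Real.exp (-s ^ 2 / 4) := by gcongr; nlinarith [sq_nonneg s]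
  calc 2 / (g.factorial : ℝ) * (s ^ (2 * g + 1) * Real.exp (-s ^ 2)) * |f s|
      = 2 / (g.factorial : ℝ) * ((s ^ (2 * g + 1) * |f s|) * Real.exp (-s ^ 2)) := by ring
    _ ≤ 2 / (g.factorial : ℝ) * ((C * (1 + s) ^ k) * Real.exp (-s ^ 2 / 4)) := by
        have := h s hs0
        have h5 : 0 ≤ C * (1 + s) ^ k := by positivity
        exact mul_le_mul_of_nonneg_left (mul_le_mul this h4 (by positivity) h5) (by positivity)
    _ = 2 / (g.factorial : ℝ) * C * ((1 + s) ^ k * Real.exp (-s ^ 2 / 4)) := by ring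
    _ ≤ 2 / (g.factorial : ℝ) * C * (C' * Real.exp (-s / 2)) := by gcongr
    _ = _ := by rw [show -s / 2 = -(1 / 2) * s by ring]; ring

theorem mixDensity_eq (g : ℕ) (ℓ : ℝ) : mixDensity d g ℓ =
    fun y => ∫ s, (ℓ * s) ^ (-(d : ℝ)) * gauss d ((ℓ * s)⁻¹ • y) ∂(gammaMeas g) := by
  funext y
  rw [integral_gammaMeas]; rfl

theorem exists_DB_mixDensity (n N g : ℕ) (hg : d + n ≤ 2 * g + 1) : ∃ C, 0 ≤ C ∧ ∀ ℓ : ℝ, 0 < ℓ →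
    ContDiff ℝ n (mixDensity d g ℓ) ∧
    ∀ y, DB n ℓ (C * (ℓ ^ (-(d : ℝ)) * decay N (ℓ⁻¹ • y))) (mixDensity d g ℓ) y := by
  obtain ⟨C, hC, h⟩ := exists_DB_gauss (d := d) n N
  set b : ℝ → ℝ := fun s => (s ^ (d + n))⁻¹ * (1 + s) ^ (n + N) with hb
  have hbi : Integrable b (gammaMeas g) := by
    refine integrableOn_gammaWeight_mul g (by fun_prop) (C := 1)
      (k := (2 * g + 1 - (d + n)) + (n + N)) fun s hs => ?_
    rw [abs_of_nonneg (by positivity), one_mul, pow_add (1 + s), ← mul_assoc]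
    refine mul_le_mul_of_nonneg_right ?_ (by positivity)
    rw [← pow_sub₀ _ hs.ne' hg]
    gcongr; linarith
  have hsm : ∀ ℓ s : ℝ, ContDiff ℝ n
      fun y : Space d => (ℓ * s) ^ (-(d : ℝ)) * gauss d ((ℓ * s)⁻¹ • y) := fun ℓ s =>
    contDiff_const.mul (contDiff_gauss.comp (contDiff_const_smul _))
  have key : ∀ ℓ : ℝ, 0 < ℓ → ∀ s, 0 < s → ∀ y, DB n ℓ (C * (ℓ ^ (-(d : ℝ)) *
      decay N (ℓ⁻¹ • y)) * b s)
      (fun y : Space d => (ℓ * s) ^ (-(d : ℝ)) * gauss d ((ℓ * s)⁻¹ • y)) y := by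
    intro ℓ hℓ s hs y
    have hls : 0 < ℓ * s := by positivity
    have h1 : DB n (ℓ * s) (C * decay N ((ℓ * s)⁻¹ • y))
        (fun y : Space d => gauss d ((ℓ * s)⁻¹ • y)) y := by
      have := DB.comp_affine (n := n) (ℓ := 1) (ℓ' := ℓ * s) (M := C * decay N ((ℓ * s)⁻¹ • y))
        (f := gauss d) (y := y) ((ℓ * s)⁻¹ • ContinuousLinearMap.id ℝ (Space d)) 0 hls
        (fun v => by
          simp only [smul_apply, ContinuousLinearMap.id_apply, norm_smul, norm_inv,
            Real.norm_of_nonneg hls.le, div_one]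
          rw [div_eq_inv_mul])
        contDiff_gauss.contDiffAt (by simpa using h ((ℓ * s)⁻¹ • y))
      simpa using this
    have h2 := DB.rescale (ℓ' := ℓ) (c := (1 + s) / s) hls hℓ
      (by rw [le_div_iff₀ hs]; linarith) (by field_simp; linarith) h1
    have h3 := h2.const_mul ((ℓ * s) ^ (-(d : ℝ)))
      ((contDiff_gauss (n := n)).comp (contDiff_const_smul (F := Space d) (ℓ * s)⁻¹)).contDiffAt
    refine h3.mono hℓ ?_
    rw [abs_of_nonneg (by positivity), Real.mul_rpow hℓ.le hs.le]
    have h4 : decay N ((ℓ * s)⁻¹ • y) ≤ (1 + s) ^ N * decay N (ℓ⁻¹ • y) := by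
      refine decay_le_of_le ?_
      rw [norm_smul, norm_smul, norm_inv, norm_inv, Real.norm_of_nonneg hls.le,
        Real.norm_of_nonneg hℓ.le]
      have : 0 ≤ ℓ⁻¹ * ‖y‖ := by positivity
      have e : (1 + s) * (1 + (ℓ * s)⁻¹ * ‖y‖) = 1 + s + ℓ⁻¹ * ‖y‖ / s + ℓ⁻¹ * ‖y‖ := by
        field_simp; ring
      rw [e]
      have : 0 ≤ ℓ⁻¹ * ‖y‖ / s := by positivity
      linarith
    have e5 : s ^ (-(d : ℝ)) = (s ^ d)⁻¹ := by rw [Real.rpow_neg hs.le, Real.rpow_natCast]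
    rw [e5]
    calc ℓ ^ (-(d : ℝ)) * (s ^ d)⁻¹ * (((1 + s) / s) ^ n * (C * decay N ((ℓ * s)⁻¹ • y)))
        ≤ ℓ ^ (-(d : ℝ)) * (s ^ d)⁻¹ * (((1 + s) / s) ^ n *
          (C * ((1 + s) ^ N * decay N (ℓ⁻¹ • y)))) := by gcongr
      _ = _ := by
        simp only [hb]
        rw [div_pow, pow_add s, pow_add (1 + s)]
        field_simp
  refine ⟨C * ∫ s, b s ∂(gammaMeas g), mul_nonneg hC (integral_nonneg_of_ae
    ((ae_gammaMeas_pos g).mono fun s hs => by simp only [hb, Pi.zero_apply]; positivity)),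
    fun ℓ hℓ => ?_⟩
  have hP : ParamInt (gammaMeas g) n
      fun s (y : Space d) => (ℓ * s) ^ (-(d : ℝ)) * gauss d ((ℓ * s)⁻¹ • y) := by
    refine ⟨Filter.Eventually.of_forall fun s => hsm ℓ s, fun y => ?_, fun y₀ => ?_⟩
    · have h1 : Measurable (gauss d) := continuous_gauss.measurable
      have h2 : Measurable fun s : ℝ => gauss d ((ℓ * s)⁻¹ • y) := h1.comp (by fun_prop)
      exact ((by fun_prop : Measurable fun s : ℝ => (ℓ * s) ^ (-(d : ℝ))).mul h2).aestronglyMeasurable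
    · refine ⟨1, one_pos, fun s => (max 1 ℓ⁻¹) ^ n * (C * (ℓ ^ (-(d : ℝ)) * 1) * b s),
        (hbi.const_mul _).const_mul _, (ae_gammaMeas_pos g).mono fun s hs y _ => ?_⟩
      have h1 := DB.rescale (ℓ' := 1) (c := max 1 ℓ⁻¹) hℓ one_pos (le_max_left _ _) (by
        calc (1 : ℝ) = ℓ⁻¹ * ℓ := by field_simp
          _ ≤ _ := by gcongr; exact le_max_right _ _) (key ℓ hℓ s hs y)
      refine h1.mono one_pos ?_
      have hbs : 0 ≤ b s := by simp only [hb]; positivity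
      have hd1 := decay_le_one N (ℓ⁻¹ • y)
      have hℓd : 0 ≤ ℓ ^ (-(d : ℝ)) := by positivity
      show _ ≤ (max 1 ℓ⁻¹) ^ n * (C * (ℓ ^ (-(d : ℝ)) * 1) * b s)
      gcongr
  rw [mixDensity_eq]
  refine ⟨hP.contDiff, fun y => ?_⟩
  have := hP.db (ℓ := ℓ) (x := y) (M := fun s => C * (ℓ ^ (-(d : ℝ)) * decay N (ℓ⁻¹ • y)) * b s)
    (hbi.const_mul _) ((ae_gammaMeas_pos g).mono fun s hs => key ℓ hℓ s hs y)
  rw [integral_const_mul] at this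
  convert this using 1
  ring

end Decay

/-! ### The regularizing kernel inverts `1 - ℓ² Δ` -/

section Resolvent

variable {d : ℕ}

/-- The operator `1 - ℓ² Δ`. -/
def resolventInv (ℓ : ℝ) (φ : Space d → ℝ) (x : Space d) : ℝ := φ x - ℓ ^ 2 * lap φ x

theorem contDiff_resolventInv {n : ℕ} {ℓ : ℝ} {φ : Space d → ℝ} (h : ContDiff ℝ (n + 2 : ℕ) φ) :
    ContDiff ℝ n (resolventInv ℓ φ) :=
  (h.of_le (by norm_cast; omega)).sub (contDiff_const.mul (contDiff_lap h))

theorem DB_resolventInv {n : ℕ} {ℓ ℓ' M : ℝ} {φ : Space d → ℝ} {x : Space d} (hℓ' : 0 < ℓ')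
    (hℓ : |ℓ| ≤ ℓ') (hφ : ContDiffAt ℝ (n + 2 : ℕ) φ x) (h : DB (n + 2) ℓ' M φ x) :
    DB n ℓ' ((1 + d) * M) (resolventInv ℓ φ) x := by
  have hM := h.nonneg
  have h1 := DB.add (hφ.of_le (by norm_cast; omega) : ContDiffAt ℝ n φ x)
    (contDiffAt_const.mul (contDiffAt_lap hφ)) (h.of_le (by omega))
    ((h.lap hℓ' hφ).const_mul (-ℓ ^ 2) (contDiffAt_lap hφ))
  refine (h1.mono hℓ' ?_).congr (Filter.Eventually.of_forall fun y => ?_)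
  · rw [abs_neg, abs_of_nonneg (sq_nonneg ℓ)]
    have h2 : ℓ ^ 2 ≤ ℓ' ^ 2 := by rw [← sq_abs]; gcongr
    have h3 : ℓ ^ 2 * (d * (M / ℓ' ^ 2)) ≤ ℓ' ^ 2 * (d * (M / ℓ' ^ 2)) := by gcongr
    have h4 : ℓ' ^ 2 * (d * (M / ℓ' ^ 2)) = d * M := by field_simp
    linarith
  · simp only [resolventInv]; ring

theorem contDiff_resolventInv_iterate {n : ℕ} {ℓ : ℝ} {g : ℕ} {φ : Space d → ℝ}
    (h : ContDiff ℝ (n + 2 * g : ℕ) φ) : ContDiff ℝ n ((resolventInv ℓ)^[g] φ) := by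
  induction g generalizing n with
  | zero => simpa using h
  | succ g ih =>
    rw [Function.iterate_succ_apply']
    exact contDiff_resolventInv (ih (by convert h using 2; omega))

theorem DB_resolventInv_iterate {n : ℕ} {ℓ ℓ' M : ℝ} {g : ℕ} {φ : Space d → ℝ} {x : Space d}
    (hℓ' : 0 < ℓ') (hℓ : |ℓ| ≤ ℓ') (hφ : ContDiff ℝ (n + 2 * g : ℕ) φ)
    (h : DB (n + 2 * g) ℓ' M φ x) : DB n ℓ' ((1 + d) ^ g * M) ((resolventInv ℓ)^[g] φ) x := by
  induction g generalizing n with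
  | zero => simpa using h
  | succ g ih =>
    rw [Function.iterate_succ_apply']
    have e : n + 2 + 2 * g = n + 2 * (g + 1) := by omega
    have := DB_resolventInv hℓ' hℓ
      (contDiff_resolventInv_iterate (n := n + 2) (e ▸ hφ)).contDiffAt
      (ih (n := n + 2) (e ▸ hφ) (e ▸ h))
    rwa [pow_succ', mul_assoc]

theorem hasFDerivAt_gauss (z : Space d) (v : Space d) :
    fderiv ℝ (gauss d) z v = -(inner ℝ z v / 2) * gauss d z := by
  have h0 : HasFDerivAt (fun y : Space d => (-1 / 4 : ℝ) * ‖y‖ ^ 2)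
      ((-1 / 4 : ℝ) • (2 • innerSL ℝ z)) z :=
    (hasStrictFDerivAt_norm_sq z).hasFDerivAt.const_mul _
  have e0 : gauss d = fun y => (4 * Real.pi) ^ (-(d : ℝ) / 2) * Real.exp ((-1 / 4 : ℝ) * ‖y‖ ^ 2) := by
    funext y; rw [gauss]; congr 2; ring
  rw [e0, (h0.exp.const_mul _).fderiv]
  simp only [smul_apply, innerSL_apply_apply, smul_eq_mul]
  rw [nsmul_eq_mul]
  push_cast
  ring

variable {φ : Space d → ℝ} {M : ℝ}

theorem integrable_gauss_mul {f : Space d → ℝ} {C : ℝ} (hf : Continuous f) (k : ℕ)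
    (hb : ∀ z, |f z| ≤ C * ‖z‖ ^ k) : Integrable fun z => gauss d z * f z := by
  refine ((integrable_norm_pow_mul_gauss k).const_mul C).mono' (by fun_prop)
    (Filter.Eventually.of_forall fun z => ?_)
  rw [norm_mul, Real.norm_of_nonneg (gauss_nonneg z), Real.norm_eq_abs]
  calc gauss d z * |f z| ≤ gauss d z * (C * ‖z‖ ^ k) :=
        mul_le_mul_of_nonneg_left (hb z) (gauss_nonneg z)
    _ = _ := by ring

theorem integral_gauss_mul_fderiv (hφ : ContDiff ℝ (2 : ℕ) φ) (hM : ∀ x, DB 2 1 M φ x)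
    (x : Space d) (r : ℝ) : ∫ z, gauss d z * fderiv ℝ φ (x + r • z) z =
      2 * r * ∫ z, gauss d z * lap φ (x + r • z) := by
  have hM0 : 0 ≤ M := (hM 0).nonneg
  set e := unitVec d with he
  have hd1 : ∀ l, ContDiff ℝ (1 : ℕ) fun y => fderiv ℝ φ y (e l) := fun l => contDiff_dir hφ _
  have hb1 : ∀ l y, |fderiv ℝ φ y (e l)| ≤ M := fun l y => by
    have := ((hM y).2 (e l)).abs_le
    rwa [he, norm_unitVec, div_one, mul_one] at this
  have hb2 : ∀ l y, |fderiv ℝ (fun y => fderiv ℝ φ y (e l)) y (e l)| ≤ M := fun l y => by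
    have := (((hM y).2 (e l)).2 (e l)).abs_le
    simpa only [he, norm_unitVec, div_one, mul_one] using this
  have hc2 : ∀ l, Continuous fun y => fderiv ℝ (fun y => fderiv ℝ φ y (e l)) y (e l) := fun l =>
    (contDiff_dir (n := 0) (hd1 l) (e l)).continuous
  have hsum : ∀ z : Space d, z = ∑ l, z l • e l := fun z => by
    have h1 := (EuclideanSpace.basisFun (Fin d) ℝ).sum_repr z
    simp only [EuclideanSpace.basisFun_repr, EuclideanSpace.basisFun_apply] at h1
    exact h1.symm
  have hinn : ∀ (z : Space d) l, inner ℝ z (e l) = z l := fun z l => by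
    simp [he, unitVec, EuclideanSpace.inner_single_right]
  have hzl : ∀ (z : Space d) l, |z l| ≤ ‖z‖ := fun z l => by
    have := abs_real_inner_le_norm z (e l)
    rwa [hinn, he, norm_unitVec, mul_one] at this
  have hi1 : ∀ l, Integrable fun z => gauss d z * (z l * fderiv ℝ φ (x + r • z) (e l)) := fun l => by
    refine integrable_gauss_mul (C := M) (by have := (hd1 l).continuous; fun_prop) 1 fun z => ?_
    rw [abs_mul, pow_one, mul_comm]
    exact mul_le_mul (hb1 l _) (hzl z l) (abs_nonneg _) hM0
  have hi2 : ∀ l, Integrable fun z =>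
      gauss d z * fderiv ℝ (fun y => fderiv ℝ φ y (e l)) (x + r • z) (e l) := fun l => by
    refine integrable_gauss_mul (C := M) (by have := hc2 l; fun_prop) 0 fun z => ?_
    simpa using hb2 l _
  have hi0 : ∀ l, Integrable fun z => gauss d z * fderiv ℝ φ (x + r • z) (e l) := fun l => by
    refine integrable_gauss_mul (C := M) (by have := (hd1 l).continuous; fun_prop) 0 fun z => ?_
    simpa using hb1 l _
  have hder : ∀ l z, fderiv ℝ (fun z => fderiv ℝ φ (x + r • z) (e l)) z (e l) =
      r * fderiv ℝ (fun y => fderiv ℝ φ y (e l)) (x + r • z) (e l) := fun l z => by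
    have h1 : HasFDerivAt (fun z : Space d => x + r • z) (r • ContinuousLinearMap.id ℝ (Space d)) z :=
      ((hasFDerivAt_id z).const_smul r).const_add x
    have h2 := (HasFDerivAt.comp z (f := fun z : Space d => x + r • z)
      (((hd1 l).differentiable (by simp)) (x + r • z)).hasFDerivAt h1).fderiv
    simp only [Function.comp_def] at h2
    rw [h2]; simp
  have key : ∀ l, ∫ z, gauss d z * (z l * fderiv ℝ φ (x + r • z) (e l)) =
      2 * r * ∫ z, gauss d z * fderiv ℝ (fun y => fderiv ℝ φ y (e l)) (x + r • z) (e l) := fun l => by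
    have h := integral_mul_fderiv_eq_neg_fderiv_mul_of_integrable (μ := volume) (f := gauss d)
      (g := fun z => fderiv ℝ φ (x + r • z) (e l)) (v := e l) ?_ ?_ (hi0 l)
      (fun z _ => (contDiff_gauss (n := 1)).differentiable (by simp) z)
      (fun z _ => (((hd1 l).comp (contDiff_const.add (contDiff_const_smul r))).differentiable
        (by simp)) z)
    · simp only [hasFDerivAt_gauss, hinn, hder] at h
      have e1 : ∀ z : Space d, -(z l / 2) * gauss d z * fderiv ℝ φ (x + r • z) (e l) =
          (-1 / 2) * (gauss d z * (z l * fderiv ℝ φ (x + r • z) (e l))) := fun z => by ring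
      have e2 : ∀ z : Space d, gauss d z * (r * fderiv ℝ (fun y => fderiv ℝ φ y (e l)) (x + r • z) (e l))
          = r * (gauss d z * fderiv ℝ (fun y => fderiv ℝ φ y (e l)) (x + r • z) (e l)) :=
        fun z => by ring
      simp only [e1, e2, integral_const_mul] at h
      linarith
    · simp only [hasFDerivAt_gauss, hinn]
      refine ((hi1 l).const_mul (-1 / 2)).congr (Filter.Eventually.of_forall fun z => ?_)
      ring
    · simp only [hder]
      refine ((hi2 l).const_mul r).congr (Filter.Eventually.of_forall fun z => ?_)
      ring
  have e3 : ∀ z : Space d, gauss d z * fderiv ℝ φ (x + r • z) z =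
      ∑ l, gauss d z * (z l * fderiv ℝ φ (x + r • z) (e l)) := fun z => by
    have h1 := congrArg (fderiv ℝ φ (x + r • z)) (hsum z)
    simp only [map_sum, map_smul, smul_eq_mul] at h1
    rw [h1, Finset.mul_sum]
  simp only [e3, lap, Finset.mul_sum]
  rw [integral_finsetSum _ fun l _ => hi1 l, integral_finsetSum _ fun l _ => hi2 l, Finset.mul_sum]
  exact Finset.sum_congr rfl fun l _ => key l

theorem integral_mixKernel {E : Type*} [NormedAddCommGroup E] [NormedSpace ℝ E] (g : ℕ) (ℓ : ℝ)
    {f : Space d → E} (hf : Continuous f) {C : ℝ} (hC : ∀ w, ‖f w‖ ≤ C) :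
    ∫ w, f w ∂(mixKernel d g ℓ) =
      ∫ s in Ioi (0 : ℝ), gammaWeight g s • ∫ z, gauss d z • f ((ℓ * s) • z) := by
  have hm : AEStronglyMeasurable f (mixKernel d g ℓ) := hf.aestronglyMeasurable
  have hc : Continuous fun p : ℝ × Space d => f ((ℓ * p.1) • p.2) := by fun_prop
  rw [mixKernel, integral_map (measurable_mix ℓ).aemeasurable hm, integral_prod, integral_gammaMeas]
  · simp only [integral_gaussMeas]
  · exact Integrable.of_bound (C := C) hc.aestronglyMeasurable
      (Filter.Eventually.of_forall fun q => hC _)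

theorem abs_integral_gauss_mul_le {f : Space d → ℝ} (hb : ∀ z, |f z| ≤ M) :
    |∫ z, gauss d z * f z| ≤ M := by
  refine (norm_integral_le_of_norm_le (f := fun z => gauss d z * f z)
    (g := fun z => gauss d z * M) (integrable_gauss.mul_const M)
    (Filter.Eventually.of_forall fun z => ?_)).trans (le_of_eq ?_)
  · rw [norm_mul, Real.norm_of_nonneg (gauss_nonneg z)]
    exact mul_le_mul_of_nonneg_left (hb z) (gauss_nonneg z)
  · rw [integral_mul_const, integral_gauss, one_mul]

theorem integral_resolventInv (hφ : ContDiff ℝ (2 : ℕ) φ) (hM : ∀ x, DB 2 1 M φ x) {ℓ : ℝ}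
    (x : Space d) : ∫ w, resolventInv ℓ φ (x + w) ∂(mixKernel d 0 ℓ) = φ x := by
  have hM0 : 0 ≤ M := (hM 0).nonneg
  have hbφ : ∀ y, |φ y| ≤ M := fun y => (hM y).abs_le
  have hcl : Continuous (lap φ) := (contDiff_lap (n := 0) hφ).continuous
  have hcφ : Continuous φ := hφ.continuous
  have hcf : Continuous (fderiv ℝ φ) := hφ.continuous_fderiv (by simp)
  have hbl : ∀ y, |lap φ y| ≤ d * M := fun y => by
    have := ((hM y).lap (n := 0) one_pos hφ.contDiffAt).abs_le
    simpa using this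
  have hcP : Continuous (resolventInv ℓ φ) := (contDiff_resolventInv (n := 0) hφ).continuous
  have hbP : ∀ y, |resolventInv ℓ φ y| ≤ M + ℓ ^ 2 * (d * M) := fun y => by
    refine (abs_sub _ _).trans ?_
    rw [abs_mul, abs_of_nonneg (sq_nonneg ℓ)]
    exact add_le_add (hbφ y) (mul_le_mul_of_nonneg_left (hbl y) (sq_nonneg ℓ))
  rw [integral_mixKernel 0 ℓ (by fun_prop) (C := M + ℓ ^ 2 * (d * M)) fun w => hbP _]
  simp only [smul_eq_mul]
  set W : ℝ → ℝ := fun s => ∫ z, gauss d z * φ (x + (ℓ * s) • z) with hW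
  have hWd : ∀ s, HasDerivAt W (∫ z, gauss d z * (ℓ * fderiv ℝ φ (x + (ℓ * s) • z) z)) s := by
    intro s
    refine (hasDerivAt_integral_of_dominated_loc_of_deriv_le (s := univ)
      (F := fun s z => gauss d z * φ (x + (ℓ * s) • z))
      (F' := fun s z => gauss d z * (ℓ * fderiv ℝ φ (x + (ℓ * s) • z) z))
      (bound := fun z => |ℓ| * M * (‖z‖ ^ 1 * gauss d z)) Filter.univ_mem
      (Filter.Eventually.of_forall fun s => Continuous.aestronglyMeasurable (by fun_prop)) ?_
      (Continuous.aestronglyMeasurable (by fun_prop)) ?_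
      ((integrable_norm_pow_mul_gauss 1).const_mul _) ?_).2
    · exact integrable_gauss_mul (C := M) (by fun_prop) 0 fun z => by simpa using hbφ _
    · refine Filter.Eventually.of_forall fun z s _ => ?_
      rw [norm_mul, norm_mul, Real.norm_of_nonneg (gauss_nonneg z), Real.norm_eq_abs, pow_one]
      have h1 := (fderiv ℝ φ (x + (ℓ * s) • z)).le_opNorm z
      have h2 : ‖fderiv ℝ φ (x + (ℓ * s) • z)‖ ≤ M := (hM _).norm_fderiv_le
      have h3 : ‖fderiv ℝ φ (x + (ℓ * s) • z) z‖ ≤ M * ‖z‖ := h1.trans (by gcongr)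
      have h4 := gauss_nonneg z
      calc gauss d z * (|ℓ| * ‖fderiv ℝ φ (x + (ℓ * s) • z) z‖)
          ≤ gauss d z * (|ℓ| * (M * ‖z‖)) := by gcongr
        _ = _ := by ring
    · refine Filter.Eventually.of_forall fun z s _ => ?_
      have h1 : HasDerivAt (fun s : ℝ => x + (ℓ * s) • z) (ℓ • z) s := by
        have := (((hasDerivAt_id s).const_mul ℓ).smul_const z).const_add x
        simpa using this
      have h2 := ((hφ.differentiable (by simp)) (x + (ℓ * s) • z)).hasFDerivAt.comp_hasDerivAt s h1
      rw [map_smul, smul_eq_mul] at h2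
      exact h2.const_mul _
  have hWe : ∀ s, ∫ z, gauss d z * (ℓ * fderiv ℝ φ (x + (ℓ * s) • z) z) =
      2 * s * (ℓ ^ 2 * ∫ z, gauss d z * lap φ (x + (ℓ * s) • z)) := fun s => by
    have e : ∀ z, gauss d z * (ℓ * fderiv ℝ φ (x + (ℓ * s) • z) z) =
      ℓ * (gauss d z * fderiv ℝ φ (x + (ℓ * s) • z) z) := fun z => by ring
    simp only [e]
    rw [integral_const_mul, integral_gauss_mul_fderiv hφ hM]
    ring
  have hWb : ∀ s, |W s| ≤ M := fun s => abs_integral_gauss_mul_le fun z => hbφ _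
  have hP : ∀ s, ∫ z, gauss d z * resolventInv ℓ φ (x + (ℓ * s) • z) =
      W s - ℓ ^ 2 * ∫ z, gauss d z * lap φ (x + (ℓ * s) • z) := fun s => by
    rw [← integral_const_mul, hW, ← integral_sub]
    · congr 1; ext z; rw [resolventInv]; ring
    · exact integrable_gauss_mul (C := M) (by fun_prop) 0 fun z => by simpa using hbφ _
    · exact (integrable_gauss_mul (C := d * M) (by fun_prop) 0
        fun z => by simpa using hbl _).const_mul _
  have hF : ∀ s, HasDerivAt (fun s => -(Real.exp (-s ^ 2) * W s))
      (gammaWeight 0 s * ∫ z, gauss d z * resolventInv ℓ φ (x + (ℓ * s) • z)) s := fun s => by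
    have h1 : HasDerivAt (fun s : ℝ => Real.exp (-s ^ 2)) (Real.exp (-s ^ 2) * (-(2 * s))) s := by
      have := ((hasDerivAt_pow 2 s).neg).exp
      simpa using this
    refine (h1.mul (hWd s)).neg.congr_deriv ?_
    rw [hP, hWe, gammaWeight]
    simp
    ring
  have hmeas : Continuous fun s => ∫ z, gauss d z * resolventInv ℓ φ (x + (ℓ * s) • z) := by
    refine continuous_of_dominated (F := fun s z => gauss d z * resolventInv ℓ φ (x + (ℓ * s) • z))
      (bound := fun z => gauss d z * (M + ℓ ^ 2 * (d * M))) (fun s => by fun_prop)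
      (fun s => Filter.Eventually.of_forall fun z => ?_) (integrable_gauss.mul_const _)
      (Filter.Eventually.of_forall fun z => by fun_prop)
    rw [norm_mul, Real.norm_of_nonneg (gauss_nonneg z)]
    exact mul_le_mul_of_nonneg_left (hbP _) (gauss_nonneg z)
  have hint : IntegrableOn (fun s => gammaWeight 0 s *
      ∫ z, gauss d z * resolventInv ℓ φ (x + (ℓ * s) • z)) (Ioi 0) := by
    refine ((integrableOn_gammaWeight 0).mul_const (M + ℓ ^ 2 * (d * M))).mono'
      (by fun_prop) ?_
    filter_upwards [ae_restrict_mem measurableSet_Ioi] with s hs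
    rw [norm_mul, Real.norm_of_nonneg (gammaWeight_nonneg 0 (le_of_lt hs))]
    exact mul_le_mul_of_nonneg_left (abs_integral_gauss_mul_le fun z => hbP _)
      (gammaWeight_nonneg 0 (le_of_lt hs))
  have hlim : Filter.Tendsto (fun s => -(Real.exp (-s ^ 2) * W s)) Filter.atTop (nhds 0) := by
    have h1 : Filter.Tendsto (fun s : ℝ => Real.exp (-s ^ 2)) Filter.atTop (nhds 0) :=
      Real.tendsto_exp_neg_atTop_nhds_zero.comp (Filter.tendsto_pow_atTop two_ne_zero)
    have := (bdd_le_mul_tendsto_zero' M (Filter.Eventually.of_forall hWb) h1).neg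
    simpa [mul_comm] using this
  rw [integral_Ioi_of_hasDerivAt_of_tendsto' (fun s _ => hF s) hint hlim]
  simp [hW, integral_mul_const, integral_gauss]

theorem integral_resolventInv_iterate {σ μ : ℝ} (hμ : 0 < μ) (g : ℕ)
    (hφ : ContDiff ℝ (2 * g : ℕ) φ) (hM : ∀ x, DB (2 * g) 1 M φ x) (x : Space d) :
    ∫ w, (resolventInv (scale σ μ))^[g] φ (x + w) ∂(regKernelPow d σ μ g) = φ x := by
  set ℓ := scale σ μ with hℓ
  have hℓ0 : 0 < ℓ := scale_pos hμ
  induction g generalizing x with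
  | zero => simp [regKernelPow]
  | succ g ih =>
    have hs := isProbabilityMeasure_regKernelPow (d := d) (σ := σ) hμ g
    have hb : ∀ y, DB 2 1 ((1 + d) ^ g * (max 1 ℓ ^ (2 * (g + 1)) * M))
        ((resolventInv ℓ)^[g] φ) y := fun y => by
      have h1 := DB_resolventInv_iterate (n := 2) (g := g) (ℓ := ℓ) (ℓ' := max 1 ℓ) (by positivity)
        (by rw [abs_of_pos hℓ0]; exact le_max_right _ _) (by convert hφ using 2; omega)
        (DB.rescale (ℓ' := max 1 ℓ) (c := max 1 ℓ) one_pos (by positivity) (le_max_left _ _) (by simp)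
          (by convert hM y using 1; omega))
      exact h1.scale_le (by positivity) one_pos (le_max_left _ _) |>.mono one_pos (by
        rw [show 2 + 2 * g = 2 * (g + 1) by ring])
    have hcd : ContDiff ℝ (2 : ℕ) ((resolventInv ℓ)^[g] φ) :=
      contDiff_resolventInv_iterate (n := 2) (by convert hφ using 2; omega)
    have hcP : Continuous (resolventInv ℓ ((resolventInv ℓ)^[g] φ)) :=
      (contDiff_resolventInv (n := 0) hcd).continuous
    rw [regKernelPow, Measure.conv, integral_map (by fun_prop) (by
      rw [Function.iterate_succ_apply']; fun_prop), regKernel_eq hμ, integral_prod_symm]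
    · have e : ∀ w, ∫ y, (resolventInv ℓ)^[g + 1] φ (x + (y + w)) ∂(mixKernel d 0 ℓ) =
          (resolventInv ℓ)^[g] φ (x + w) := fun w => by
        rw [Function.iterate_succ_apply', ← integral_resolventInv hcd hb (ℓ := ℓ) (x + w)]
        congr 1; ext y; congr 1; abel
      simp only [← hℓ, e]
      exact ih (hφ.of_le (by norm_cast; omega)) (fun y => (hM y).of_le (by omega)) x
    · rw [Function.iterate_succ_apply', ← hℓ]
      refine Integrable.of_bound (C := (1 + d) * (max 1 ℓ ^ 2 * ((1 + d) ^ g *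
        (max 1 ℓ ^ (2 * (g + 1)) * M)))) (by fun_prop) (Filter.Eventually.of_forall fun p => ?_)
      have h1 := DB_resolventInv (n := 0) (ℓ := ℓ) (ℓ' := max 1 ℓ) (by positivity)
        (by rw [abs_of_pos hℓ0]; exact le_max_right _ _) hcd.contDiffAt
        (DB.rescale (ℓ' := max 1 ℓ) (c := max 1 ℓ) one_pos (by positivity) (le_max_left _ _) (by simp)
          (hb (x + (p.1 + p.2))))
      exact h1.abs_le

end Resolvent

/-! ### Regularization of Schwartz functions -/

section Schwartz

variable {E : Type*} [NormedAddCommGroup E] [NormedSpace ℝ E]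

theorem exists_DB_schwartz (Φ : 𝓢(E, ℝ)) (n k : ℕ) :
    ∃ C, 0 ≤ C ∧ ∀ z, DB n 1 (C * decay k z) Φ z := by
  refine ⟨2 ^ k * (Finset.Iic (k, n)).sup (fun m => SchwartzMap.seminorm ℝ m.1 m.2) Φ,
    by positivity, fun z => DB.of_iteratedFDeriv one_pos
    ((Φ.smooth n).contDiffAt) fun j hj => ?_⟩
  have := SchwartzMap.one_add_le_sup_seminorm_apply (𝕜 := ℝ) (m := (k, n)) (k := k) (n := j) le_rfl hj
    Φ z
  rw [one_pow, div_one, decay, ← div_eq_mul_inv, le_div_iff₀ (by positivity), mul_comm]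
  exact this

theorem exists_schwartz_of_DB {f : E → ℝ}
    (h : ∀ n k : ℕ, ContDiff ℝ n f ∧ ∃ C, ∀ z, DB n 1 (C * decay k z) f z) :
    ∃ Ψ : 𝓢(E, ℝ), ∀ z, Ψ z = f z := by
  refine ⟨⟨f, contDiff_infty.2 fun n => (h n 0).1, fun k n => ?_⟩, fun z => rfl⟩
  obtain ⟨hf, C, hC⟩ := h n k
  refine ⟨C, fun z => ?_⟩
  have h1 := (hC z).norm_iteratedFDeriv_le hf.contDiffAt
  rw [decay, ← div_eq_mul_inv, le_div_iff₀ (by positivity)] at h1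
  calc ‖z‖ ^ k * ‖iteratedFDeriv ℝ n f z‖ ≤ (1 + ‖z‖) ^ k * ‖iteratedFDeriv ℝ n f z‖ := by
        gcongr; linarith
    _ ≤ C := by rw [mul_comm]; exact h1

theorem DB_comp_add {n : ℕ} {ℓ M : ℝ} {f : E → ℝ} {z w : E} (hℓ : 0 < ℓ)
    (hf : ContDiffAt ℝ n f (z + w)) (h : DB n ℓ M f (z + w)) : DB n ℓ M (fun z => f (z + w)) z := by
  have := DB.comp_affine (n := n) (ℓ := ℓ) (ℓ' := ℓ) (y := z) (f := f) (M := M)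
    (ContinuousLinearMap.id ℝ E) w hℓ (fun v => le_rfl) (by simpa using hf) (by simpa using h)
  simpa using this

variable [FiniteDimensional ℝ E] [MeasurableSpace E] [BorelSpace E]

theorem exists_schwartz_average {μ : Measure E} (hμ : ∀ k : ℕ, Integrable (fun w => (1 + ‖w‖) ^ k) μ)
    (Φ : 𝓢(E, ℝ)) : ∃ Ψ : 𝓢(E, ℝ), ∀ z, Ψ z = ∫ w, Φ (z + w) ∂μ := by
  refine exists_schwartz_of_DB fun n k => ?_
  obtain ⟨C, hC, h⟩ := exists_DB_schwartz Φ n k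
  have hb : ∀ z w, DB n 1 (C * decay k z * (1 + ‖w‖) ^ k) (fun z => Φ (z + w)) z := fun z w =>
    (DB_comp_add one_pos (Φ.smooth n).contDiffAt (h (z + w))).mono one_pos (by
      have := decay_add_le k z w
      calc C * decay k (z + w) ≤ C * ((1 + ‖w‖) ^ k * decay k z) := by gcongr
        _ = _ := by ring)
  have hc : Continuous Φ := Φ.continuous
  have hP : ParamInt μ n fun w z => Φ (z + w) := by
    refine ⟨Filter.Eventually.of_forall fun w => (Φ.smooth n).comp (contDiff_id.add contDiff_const),
      fun z => Continuous.aestronglyMeasurable (by fun_prop), fun z₀ =>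
      ⟨1, one_pos, fun w => C * 1 * (1 + ‖w‖) ^ k, (hμ k).const_mul _,
        Filter.Eventually.of_forall fun w z _ => (hb z w).mono one_pos ?_⟩⟩
    have := decay_le_one k z
    show _ ≤ C * 1 * (1 + ‖w‖) ^ k
    gcongr
  refine ⟨hP.contDiff, C * ∫ w, (1 + ‖w‖) ^ k ∂μ, fun z => ?_⟩
  have := hP.db (x := z) ((hμ k).const_mul _) (Filter.Eventually.of_forall fun w => hb z w)
  rw [integral_const_mul] at this
  convert this using 1
  ring

end Schwartz

section Tensor

variable {d : ℕ}

theorem integrable_moment_gaussMeas (k : ℕ) :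
    Integrable (fun z => (1 + ‖z‖) ^ k) (gaussMeas d) := by
  rw [gaussMeas, integrable_withDensity_iff_integrable_smul' (by fun_prop) (by simp)]
  simp only [ENNReal.toReal_ofReal (gauss_nonneg _), smul_eq_mul]
  obtain ⟨C, hC, h⟩ := exists_DB_gauss (d := d) 0 (d + 1 + k)
  refine ((integrable_decay (d := d) (Nat.lt_succ_self d)).const_mul C).mono' (by fun_prop)
    (Filter.Eventually.of_forall fun z => ?_)
  rw [norm_mul, norm_pow, Real.norm_of_nonneg (by positivity : 0 ≤ 1 + ‖z‖),
    ← pow_mul_decay k (d + 1)]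
  have h1 : ‖gauss d z‖ ≤ C * decay (d + 1 + k) z := (h z).abs_le
  calc ‖gauss d z‖ * (1 + ‖z‖) ^ k ≤ (C * decay (d + 1 + k) z) * (1 + ‖z‖) ^ k := by gcongr
    _ = _ := by ring

theorem integrable_moment_mixKernel (g : ℕ) {ℓ : ℝ} (hℓ : 0 ≤ ℓ) (k : ℕ) :
    Integrable (fun w => (1 + ‖w‖) ^ k) (mixKernel d g ℓ) := by
  rw [mixKernel, integrable_map_measure (by fun_prop) (measurable_mix ℓ).aemeasurable]
  have h1 : Integrable (fun s => (1 + ℓ * |s|) ^ k) (gammaMeas g) := by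
    refine integrableOn_gammaWeight_mul g (by fun_prop) (C := (1 + ℓ) ^ k) (k := 2 * g + 1 + k)
      fun s hs => ?_
    rw [abs_of_pos hs, abs_of_nonneg (by positivity), pow_add (1 + s)]
    calc s ^ (2 * g + 1) * (1 + ℓ * s) ^ k
        ≤ (1 + s) ^ (2 * g + 1) * ((1 + ℓ) * (1 + s)) ^ k := by
          gcongr
          · linarith
          · nlinarith
      _ = _ := by rw [mul_pow]; ring
  refine (h1.mul_prod (integrable_moment_gaussMeas k)).mono' (by fun_prop)
    (Filter.Eventually.of_forall fun p => ?_)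
  simp only [Function.comp]
  rw [Real.norm_of_nonneg (by positivity), norm_smul, Real.norm_eq_abs, abs_mul, abs_of_nonneg hℓ,
    ← mul_pow]
  gcongr
  have : 0 ≤ ℓ * |p.1| := by positivity
  nlinarith [norm_nonneg p.2]

theorem integrable_moment_regKernelPow {σ μ : ℝ} (hμ : 0 < μ) (g k : ℕ) :
    Integrable (fun w => (1 + ‖w‖) ^ k) (regKernelPow d σ μ g) := by
  cases g with
  | zero => rw [regKernelPow]; exact integrable_dirac (by simp)
  | succ g => rw [regKernelPow_succ hμ]; exact integrable_moment_mixKernel g (scale_pos hμ).le k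

theorem integrable_moment_regKernelTensor {m : ℕ} {σ μ : ℝ} (hμ : 0 < μ) (g k : ℕ) :
    Integrable (fun w => (1 + ‖w‖) ^ k) (regKernelTensor d m σ μ g) := by
  have := isProbabilityMeasure_regKernelPow (d := d) (σ := σ) hμ g
  have h1 : Integrable (fun y : Fin m → Space d => ∏ q, (1 + ‖y q‖) ^ k)
      (Measure.pi fun _ => regKernelPow d σ μ g) :=
    Integrable.fintype_prod fun _ => integrable_moment_regKernelPow hμ g k
  refine ((integrable_moment_regKernelPow hμ g k).mul_prod h1).mono' (by fun_prop)
    (Filter.Eventually.of_forall fun p => ?_)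
  rw [Real.norm_of_nonneg (by positivity), Finset.prod_pow, ← mul_pow]
  gcongr
  have h3 : 1 ≤ ∏ q, (1 + ‖p.2 q‖) :=
    Finset.prod_induction _ (fun r : ℝ => 1 ≤ r) (fun _ _ => one_le_mul_of_one_le_of_one_le) le_rfl
      fun q _ => by linarith [norm_nonneg (p.2 q)]
  have h2 : ∀ q, 1 + ‖p.2 q‖ ≤ ∏ q, (1 + ‖p.2 q‖) := fun q => by
    calc 1 + ‖p.2 q‖ = ∏ i, if i = q then 1 + ‖p.2 i‖ else 1 := by simp
      _ ≤ _ := Finset.prod_le_prod (fun i _ => by split_ifs <;> positivity) fun i _ => by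
        split_ifs
        · exact le_rfl
        · linarith [norm_nonneg (p.2 i)]
  have h4 : ‖p.2‖ ≤ ∏ q, (1 + ‖p.2 q‖) - 1 :=
    (pi_norm_le_iff_of_nonneg (by linarith)).2 fun q => by linarith [h2 q]
  rw [Prod.norm_def]
  rcases max_cases ‖p.1‖ ‖p.2‖ with ⟨h, -⟩ | ⟨h, -⟩ <;> rw [h]
  · nlinarith [norm_nonneg p.1]
  · nlinarith [norm_nonneg p.1]

theorem mixDensity_nonneg (g : ℕ) {ℓ : ℝ} (hℓ : 0 < ℓ) (y : Space d) : 0 ≤ mixDensity d g ℓ y :=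
  setIntegral_nonneg measurableSet_Ioi fun s hs => by
    have hs0 : 0 < s := hs
    exact mul_nonneg (gammaWeight_nonneg g hs0.le) (mul_nonneg (by positivity) (gauss_nonneg _))

theorem continuous_mixDensity {g : ℕ} (hg : d ≤ 2 * g + 1) {ℓ : ℝ} (hℓ : 0 < ℓ) :
    Continuous (mixDensity d g ℓ) := by
  obtain ⟨C, -, h⟩ := exists_DB_mixDensity (d := d) 0 0 g (by omega)
  exact (h ℓ hℓ).1.continuous

theorem integrable_mixDensity {g : ℕ} (hg : d ≤ 2 * g + 1) {ℓ : ℝ} (hℓ : 0 < ℓ) :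
    Integrable (mixDensity d g ℓ) := by
  obtain ⟨C, hC, h⟩ := exists_DB_mixDensity (d := d) 0 (d + 1) g (by omega)
  refine (((((integrable_decay (d := d) (Nat.lt_succ_self d)).comp_smul (inv_ne_zero hℓ.ne')).const_mul
    (ℓ ^ (-(d : ℝ)))).const_mul C).mono' (continuous_mixDensity hg hℓ).aestronglyMeasurable
    (Filter.Eventually.of_forall fun y => ((h ℓ hℓ).2 y).abs_le))

theorem pi_withDensity_ofReal {m : ℕ} {k : Space d → ℝ} (hi : Integrable k)
    (h0 : ∀ y, 0 ≤ k y) :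
    (Measure.pi fun _ : Fin m => volume.withDensity fun y => ENNReal.ofReal (k y)) =
      volume.withDensity fun y : Fin m → Space d => ENNReal.ofReal (∏ q, k (y q)) := by
  have hf : IsFiniteMeasure (volume.withDensity fun y => ENNReal.ofReal (k y)) :=
    isFiniteMeasure_withDensity_ofReal hi.2
  refine Measure.pi_eq fun s hs => ?_
  rw [withDensity_apply _ (MeasurableSet.univ_pi hs)]
  have e1 : ∀ q, volume.withDensity (fun y => ENNReal.ofReal (k y)) (s q) =
      ENNReal.ofReal (∫ y, (s q).indicator k y) := fun q => by
    rw [withDensity_apply _ (hs q), integral_indicator (hs q),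
      ofReal_integral_eq_lintegral_ofReal hi.integrableOn (Filter.Eventually.of_forall h0)]
  have h1 : ∀ q (y : Space d), 0 ≤ (s q).indicator k y := fun q y =>
    indicator_nonneg (fun y _ => h0 y) y
  simp only [e1]
  rw [← ENNReal.ofReal_prod_of_nonneg fun q _ => integral_nonneg (h1 q),
    ← integral_fintype_prod_volume_eq_prod, ofReal_integral_eq_lintegral_ofReal
      (show Integrable (fun y : Fin m → Space d => ∏ q, (s q).indicator k (y q)) volume from
        Integrable.fintype_prod fun q => hi.indicator (hs q))
      (Filter.Eventually.of_forall fun y => Finset.prod_nonneg fun q _ => h1 q _),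
    ← lintegral_indicator (MeasurableSet.univ_pi hs)]
  refine lintegral_congr fun y => ?_
  by_cases hy : y ∈ pi univ s
  · rw [indicator_of_mem hy]
    congr 1
    exact Finset.prod_congr rfl fun q _ => (indicator_of_mem (hy q (mem_univ q)) k).symm
  · rw [indicator_of_notMem hy]
    obtain ⟨q, hq⟩ : ∃ q, y q ∉ s q := by simpa [mem_pi] using hy
    rw [Finset.prod_eq_zero (Finset.mem_univ q) (indicator_of_notMem hq k), ENNReal.ofReal_zero]

/-- The density of `regKernelTensor`. -/
def mixTensor (d m g : ℕ) (ℓ : ℝ) (p : Config d m) : ℝ :=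
  mixDensity d g ℓ p.1 * ∏ q, mixDensity d g ℓ (p.2 q)

theorem continuous_mixTensor {m g : ℕ} (hg : d ≤ 2 * g + 1) {ℓ : ℝ} (hℓ : 0 < ℓ) :
    Continuous (mixTensor d m g ℓ) := by
  have := continuous_mixDensity (d := d) hg hℓ
  unfold mixTensor
  fun_prop

theorem mixTensor_nonneg {m g : ℕ} {ℓ : ℝ} (hℓ : 0 < ℓ) (p : Config d m) :
    0 ≤ mixTensor d m g ℓ p :=
  mul_nonneg (mixDensity_nonneg g hℓ _) (Finset.prod_nonneg fun _ _ => mixDensity_nonneg g hℓ _)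

theorem regKernelTensor_succ {m g : ℕ} {σ μ : ℝ} (hg : d ≤ 2 * g + 1) (hμ : 0 < μ) :
    regKernelTensor d m σ μ (g + 1) =
      volume.withDensity fun p => ENNReal.ofReal (mixTensor d m g (scale σ μ) p) := by
  have hℓ : 0 < scale σ μ := scale_pos hμ
  have hc := continuous_mixDensity (d := d) hg hℓ
  rw [regKernelTensor, regKernelPow_succ hμ, mixKernel_eq_withDensity g hℓ,
    pi_withDensity_ofReal (integrable_mixDensity hg hℓ) (mixDensity_nonneg g hℓ),
    prod_withDensity (by fun_prop) (by fun_prop), Measure.volume_eq_prod]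
  congr 1
  ext p
  rw [mixTensor, ENNReal.ofReal_mul (mixDensity_nonneg g hℓ _)]

instance {m : ℕ} : (volume : Measure (Config d m)).IsAddHaarMeasure :=
  Measure.prod.instIsAddHaarMeasure _ _

theorem integral_regKernelTensor {m g : ℕ} {σ μ : ℝ} (hg : d ≤ 2 * g + 1) (hμ : 0 < μ)
    (f : Config d m → ℝ) (z : Config d m) : ∫ w, f (z + w) ∂(regKernelTensor d m σ μ (g + 1)) =
      ∫ ζ, mixTensor d m g (scale σ μ) (ζ - z) * f ζ := by
  have hℓ : 0 < scale σ μ := scale_pos hμ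
  have hc := continuous_mixTensor (d := d) (m := m) hg hℓ
  rw [regKernelTensor_succ hg hμ, integral_withDensity_eq_integral_toReal_smul (by fun_prop) (by simp),
    ← integral_sub_right_eq_self _ z]
  simp only [ENNReal.toReal_ofReal (mixTensor_nonneg hℓ _), smul_eq_mul, add_sub_cancel]

end Tensor

/-! ### Functionals with bounded densities -/

section Act

variable {d m : ℕ}

/-- Weights that control test functions. -/
structure Good (M : Space d → ℝ) : Prop where
  integrable : Integrable M
  nonneg : ∀ x, 0 ≤ M x
  bdd : ∃ B, ∀ x, M x ≤ B

theorem Good.const_mul {M : Space d → ℝ} (h : Good M) {c : ℝ} (hc : 0 ≤ c) :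
    Good fun x => c * M x := by
  obtain ⟨B, hB⟩ := h.bdd
  exact ⟨h.integrable.const_mul c, fun x => mul_nonneg hc (h.nonneg x), c * B,
    fun x => mul_le_mul_of_nonneg_left (hB x) hc⟩

theorem Good.mul_const {M : Space d → ℝ} (h : Good M) {c : ℝ} (hc : 0 ≤ c) :
    Good fun x => M x * c := by
  simpa only [mul_comm] using h.const_mul hc

theorem Good.add {M M' : Space d → ℝ} (h : Good M) (h' : Good M') : Good fun x => M x + M' x := by
  obtain ⟨B, hB⟩ := h.bdd
  obtain ⟨B', hB'⟩ := h'.bdd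
  exact ⟨h.integrable.add h'.integrable, fun x => add_nonneg (h.nonneg x) (h'.nonneg x), B + B',
    fun x => add_le_add (hB x) (hB' x)⟩

theorem Good.integral_nonneg {M : Space d → ℝ} (h : Good M) : 0 ≤ ∫ x, M x :=
  MeasureTheory.integral_nonneg h.nonneg

theorem good_indicator (c : Space d) (r : ℝ) {A : ℝ} (hA : 0 ≤ A) :
    Good ((Metric.closedBall c r).indicator fun _ => A) := by
  refine ⟨(integrable_indicator_iff measurableSet_closedBall).2
    (integrableOn_const (by exact (isCompact_closedBall c r).measure_lt_top.ne)),
    fun x => indicator_nonneg (fun _ _ => hA) x, A, fun x => ?_⟩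
  exact indicator_le_self' (fun _ _ => hA) x

/-- The points whose coordinates differ by at most `ρ` from the first one. -/
def tube (d m : ℕ) (ρ : ℝ) : Set (Config d m) := {p | ∀ q, ‖p.2 q - p.1‖ ≤ ρ}

/-- Test functions with `n` derivatives that are integrable on the tubes. -/
structure Adm (n : ℕ) (Ψ : Config d m → ℝ) : Prop where
  smooth : ContDiff ℝ n Ψ
  bound : ∀ ρ, ∃ M, Good M ∧ ∀ p ∈ tube d m ρ, DB n 1 (M p.1) Ψ p

theorem Adm.of_le {n n' : ℕ} {Ψ : Config d m → ℝ} (h : Adm n Ψ) (hn : n' ≤ n) : Adm n' Ψ := by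
  refine ⟨h.smooth.of_le (by exact_mod_cast hn), fun ρ => ?_⟩
  obtain ⟨M, hM, hb⟩ := h.bound ρ
  exact ⟨M, hM, fun p hp => (hb p hp).of_le hn⟩

/-- Families of test functions that depend smoothly on a parameter. -/
structure AdmFam {P : Type*} [NormedAddCommGroup P] [NormedSpace ℝ P] (n : ℕ)
    (J : P × Config d m → ℝ) : Prop where
  smooth : ContDiff ℝ n J
  bound : ∀ (p₀ : P) (ρ : ℝ), ∃ r > 0, ∃ M, Good M ∧ ∀ p ∈ Metric.ball p₀ r, ∀ q ∈ tube d m ρ,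
    DB n 1 (M q.1) J (p, q)

section AdmFam

variable {P : Type*} [NormedAddCommGroup P] [NormedSpace ℝ P] {n : ℕ} {J : P × Config d m → ℝ}

theorem AdmFam.of_le (h : AdmFam n J) {n' : ℕ} (hn : n' ≤ n) : AdmFam n' J := by
  refine ⟨h.smooth.of_le (by exact_mod_cast hn), fun p₀ ρ => ?_⟩
  obtain ⟨r, hr, M, hM, hb⟩ := h.bound p₀ ρ
  exact ⟨r, hr, M, hM, fun p hp q hq => (hb p hp q hq).of_le hn⟩

theorem AdmFam.dir (h : AdmFam (n + 1) J) (v : P × Config d m) :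
    AdmFam n fun z => fderiv ℝ J z v := by
  refine ⟨contDiff_dir h.smooth v, fun p₀ ρ => ?_⟩
  obtain ⟨r, hr, M, hM, hb⟩ := h.bound p₀ ρ
  exact ⟨r, hr, fun x => M x * (‖v‖ / 1), hM.mul_const (by positivity),
    fun p hp q hq => (hb p hp q hq).2 v⟩

theorem DB_prodMk_left {F G : Type*} [NormedAddCommGroup F] [NormedSpace ℝ F]
    [NormedAddCommGroup G] [NormedSpace ℝ G] {n : ℕ} {ℓ M : ℝ} {J : F × G → ℝ} {p : F} {q : G}
    (hℓ : 0 < ℓ) (hJ : ContDiffAt ℝ n J (p, q)) (h : DB n ℓ M J (p, q)) :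
    DB n ℓ M (fun q => J (p, q)) q := by
  have := DB.comp_affine (n := n) (ℓ := ℓ) (ℓ' := ℓ) (y := q) (f := J) (M := M)
    (ContinuousLinearMap.inr ℝ F G) (p, 0) hℓ (fun v => by simp) (by simpa using hJ)
    (by simpa using h)
  simpa using this

theorem DB_prodMk_right {F G : Type*} [NormedAddCommGroup F] [NormedSpace ℝ F]
    [NormedAddCommGroup G] [NormedSpace ℝ G] {n : ℕ} {ℓ M : ℝ} {J : F × G → ℝ} {p : F} {q : G}
    (hℓ : 0 < ℓ) (hJ : ContDiffAt ℝ n J (p, q)) (h : DB n ℓ M J (p, q)) :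
    DB n ℓ M (fun p => J (p, q)) p := by
  have := DB.comp_affine (n := n) (ℓ := ℓ) (ℓ' := ℓ) (y := p) (f := J) (M := M)
    (ContinuousLinearMap.inl ℝ F G) (0, q) hℓ (fun v => by simp) (by simpa using hJ)
    (by simpa using h)
  simpa using this

theorem AdmFam.adm (h : AdmFam n J) (p : P) : Adm n fun q => J (p, q) := by
  refine ⟨h.smooth.comp (by fun_prop), fun ρ => ?_⟩
  obtain ⟨r, hr, M, hM, hb⟩ := h.bound p ρ
  exact ⟨M, hM, fun q hq => DB_prodMk_left one_pos h.smooth.contDiffAt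
    (hb p (Metric.mem_ball_self hr) q hq)⟩

end AdmFam

/-- Random shifts. -/
structure Kern (d m : ℕ) where
  Ω : Type
  [top : TopologicalSpace Ω]
  [meas : MeasurableSpace Ω]
  [opens : OpensMeasurableSpace Ω]
  [sec : SecondCountableTopology Ω]
  ν : Measure Ω
  [prob : IsProbabilityMeasure ν]
  Y : Ω → Fin m → Space d
  cont : Continuous Y
  bdd : ∃ ρ, ∀ᵐ ω ∂ν, ∀ q, ‖Y ω q‖ ≤ ρ

attribute [instance] Kern.top Kern.meas Kern.opens Kern.sec Kern.prob

namespace Kern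

/-- The points at which the test functions are evaluated. -/
def point (k : Kern d m) (t : Space d × k.Ω) : Config d m := (t.1, fun q => t.1 + k.Y t.2 q)

@[fun_prop]
theorem continuous_point (k : Kern d m) : Continuous k.point := by
  have := k.cont
  unfold point
  fun_prop

/-- The functional with density `a`. -/
def act (k : Kern d m) (a : Space d × k.Ω → ℝ) (Ψ : Config d m → ℝ) : ℝ :=
  ∫ t, a t * Ψ (k.point t) ∂((volume : Measure (Space d)).prod k.ν)

theorem exists_tube (k : Kern d m) : ∃ ρ, ∀ ρ' ≥ ρ,
    ∀ᵐ t ∂((volume : Measure (Space d)).prod k.ν), k.point t ∈ tube d m ρ' := by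
  obtain ⟨ρ, h⟩ := k.bdd
  refine ⟨ρ, fun ρ' hρ => ?_⟩
  filter_upwards [Measure.quasiMeasurePreserving_snd.ae h] with t ht q
  simpa [point] using (ht q).trans hρ

theorem integrable_fst (k : Kern d m) {M : Space d → ℝ} (hM : Integrable M) :
    Integrable (fun t : Space d × k.Ω => M t.1) ((volume : Measure (Space d)).prod k.ν) := by
  simpa using hM.mul_prod (integrable_const (μ := k.ν) (1 : ℝ))

theorem integral_fst (k : Kern d m) (M : Space d → ℝ) :
    ∫ t : Space d × k.Ω, M t.1 ∂((volume : Measure (Space d)).prod k.ν) =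
      k.ν.real univ * ∫ x, M x := by
  have := integral_prod_mul (μ := (volume : Measure (Space d))) (ν := k.ν) M fun _ => (1 : ℝ)
  simp only [mul_one, integral_const, smul_eq_mul] at this
  rw [this, mul_comm]

variable {k : Kern d m} {a : Space d × k.Ω → ℝ} {A : ℝ}

theorem paramInt {P : Type*} [NormedAddCommGroup P] [NormedSpace ℝ P] {n : ℕ}
    {J : P × Config d m → ℝ} (hJ : AdmFam n J) (ha : Continuous a) (hA : ∀ t, |a t| ≤ A) :
    ParamInt ((volume : Measure (Space d)).prod k.ν) n fun t p => a t * J (p, k.point t) := by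
  have hJc := hJ.smooth.continuous
  refine ⟨Filter.Eventually.of_forall fun t => contDiff_const.mul (hJ.smooth.comp (by fun_prop)),
    fun p => Continuous.aestronglyMeasurable (by fun_prop), fun p₀ => ?_⟩
  obtain ⟨ρ, hρ⟩ := k.exists_tube
  obtain ⟨r, hr, M, hM, hb⟩ := hJ.bound p₀ ρ
  refine ⟨r, hr, fun t => A * M t.1, (k.integrable_fst hM.integrable).const_mul A, ?_⟩
  filter_upwards [hρ ρ le_rfl] with t ht p hp
  refine (DB.const_mul (a t) (hJ.smooth.comp (by fun_prop : ContDiff ℝ n fun p => (p, k.point t))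
    ).contDiffAt (DB_prodMk_right one_pos hJ.smooth.contDiffAt (hb p hp _ ht))).mono one_pos ?_
  exact mul_le_mul_of_nonneg_right (hA t) (hM.nonneg _)

theorem integrable {Ψ : Config d m → ℝ} (hΨ : Adm 0 Ψ) (ha : Continuous a) (hA : ∀ t, |a t| ≤ A) :
    Integrable (fun t => a t * Ψ (k.point t)) ((volume : Measure (Space d)).prod k.ν) := by
  have hc := hΨ.smooth.continuous
  obtain ⟨ρ, hρ⟩ := k.exists_tube
  obtain ⟨M, hM, hb⟩ := hΨ.bound ρ
  refine ((k.integrable_fst hM.integrable).const_mul A).mono'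
    (Continuous.aestronglyMeasurable (by fun_prop)) ?_
  filter_upwards [hρ ρ le_rfl] with t ht
  rw [norm_mul]
  exact mul_le_mul (hA t) (hb _ ht).abs_le (norm_nonneg _) ((abs_nonneg _).trans (hA t))

theorem act_add {Ψ Ψ' : Config d m → ℝ} (hΨ : Adm 0 Ψ) (hΨ' : Adm 0 Ψ') (ha : Continuous a)
    (hA : ∀ t, |a t| ≤ A) : k.act a (fun p => Ψ p + Ψ' p) = k.act a Ψ + k.act a Ψ' := by
  rw [act, act, act, ← integral_add (integrable hΨ ha hA) (integrable hΨ' ha hA)]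
  simp only [mul_add]

theorem act_const_mul (c : ℝ) (Ψ : Config d m → ℝ) :
    k.act a (fun p => c * Ψ p) = c * k.act a Ψ := by
  rw [act, act, ← integral_const_mul]
  congr 1; ext t; ring

theorem fderiv_act {P : Type*} [NormedAddCommGroup P] [NormedSpace ℝ P] [FiniteDimensional ℝ P]
    {n : ℕ} {J : P × Config d m → ℝ} (hJ : AdmFam (n + 1) J) (ha : Continuous a)
    (hA : ∀ t, |a t| ≤ A) (p v : P) : fderiv ℝ (fun p => k.act a fun q => J (p, q)) p v =
      k.act a fun q => fderiv ℝ J (p, q) (v, 0) := by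
  have h := (paramInt hJ ha hA).fderiv_apply p v
  unfold act
  rw [h]
  congr 1; ext t
  have h1 : HasFDerivAt (fun p : P => (p, k.point t)) (ContinuousLinearMap.inl ℝ P (Config d m)) p :=
    hasFDerivAt_prodMk_left p _
  have h2 := ((hJ.smooth.differentiable (by simp) (p, k.point t)).hasFDerivAt.comp p h1)
  have h3 := (h2.const_mul (a t)).fderiv
  simp only [Function.comp_def] at h3
  rw [h3]; simp

theorem contDiff_act {P : Type*} [NormedAddCommGroup P] [NormedSpace ℝ P] [FiniteDimensional ℝ P]
    {n : ℕ} {J : P × Config d m → ℝ} (hJ : AdmFam n J) (ha : Continuous a)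
    (hA : ∀ t, |a t| ≤ A) : ContDiff ℝ n fun p => k.act a fun q => J (p, q) :=
  (paramInt hJ ha hA).contDiff

end Kern

/-- `U` is bounded by `c` on test functions that are controlled at scale `ℓ`. -/
def Bdd (n : ℕ) (ℓ ρ c : ℝ) (U : (Config d m → ℝ) → ℝ) : Prop :=
  ∀ Ψ M, Adm n Ψ → Good M → (∀ p ∈ tube d m ρ, DB n ℓ (M p.1) Ψ p) → |U Ψ| ≤ c * ∫ x, M x

theorem Bdd.mono {n n' : ℕ} {ℓ ρ ρ' c c' : ℝ} {U : (Config d m → ℝ) → ℝ} (h : Bdd n ℓ ρ c U)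
    (hn : n ≤ n') (hρ : ρ ≤ ρ') (hc : c ≤ c') : Bdd n' ℓ ρ' c' U := fun Ψ M hΨ hM hb =>
  (h Ψ M (hΨ.of_le hn) hM fun p hp => (hb p fun q => (hp q).trans hρ).of_le hn).trans
    (mul_le_mul_of_nonneg_right hc hM.integral_nonneg)

theorem Kern.exists_bdd (k : Kern d m) : ∃ ρ₀ c₀, ∀ ρ ≥ ρ₀, ∀ (a : Space d × k.Ω → ℝ) (A : ℝ),
    (∀ t, |a t| ≤ A) → Bdd 0 1 ρ (A * c₀) (k.act a) := by
  obtain ⟨ρ, hρ⟩ := k.exists_tube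
  refine ⟨ρ, k.ν.real univ, fun ρ' hρ' a A hA Ψ M _ hM hb => ?_⟩
  rw [mul_assoc, ← k.integral_fst, ← integral_const_mul]
  refine norm_integral_le_of_norm_le (f := fun t => a t * Ψ (k.point t))
    ((k.integrable_fst hM.integrable).const_mul A) ?_
  filter_upwards [hρ ρ' hρ'] with t ht
  rw [norm_mul]
  exact mul_le_mul (hA t) (hb _ ht).abs_le (norm_nonneg _) ((abs_nonneg _).trans (hA t))

/-- Bounds on `p ↦ U (J (p, ·))`. -/
theorem Bdd.db {P : Type*} [NormedAddCommGroup P] [NormedSpace ℝ P] [FiniteDimensional ℝ P]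
    {k : Kern d m} {a : Space d × k.Ω → ℝ} {A : ℝ} (ha : Continuous a) (hA : ∀ t, |a t| ≤ A)
    {n N : ℕ} {ℓ ρ c : ℝ} (hℓ : 0 < ℓ) (hU : Bdd N ℓ ρ c (k.act a)) {J : P × Config d m → ℝ}
    (hJ : AdmFam (N + n) J) {M : Space d → ℝ} (hM : Good M) {p : P}
    (hb : ∀ q ∈ tube d m ρ, DB (N + n) ℓ (M q.1) J (p, q)) :
    DB n ℓ (c * ∫ x, M x) (fun p => k.act a fun q => J (p, q)) p := by
  have h0 : |k.act a fun q => J (p, q)| ≤ c * ∫ x, M x :=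
    hU _ M ((hJ.of_le (by omega)).adm p) hM fun q hq =>
      (DB_prodMk_left hℓ hJ.smooth.contDiffAt (hb q hq)).of_le (by omega)
  induction n generalizing J M with
  | zero => exact h0
  | succ n ih =>
    refine ⟨h0, fun v => ?_⟩
    have hb' : ∀ q ∈ tube d m ρ, DB (N + n) ℓ (M q.1 * (‖v‖ / ℓ))
        (fun z => fderiv ℝ J z (v, 0)) (p, q) := fun q hq => by
      simpa using (hb q hq).2 (v, 0)
    have hM' : Good fun x => M x * (‖v‖ / ℓ) := hM.mul_const (by positivity)
    have h1 := ih (hJ.dir (n := N + n) (v, 0)) hM' hb' (hU _ _ ((hJ.dir (n := N + n) (v, 0)).of_le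
      (by omega) |>.adm p) hM' fun q hq => (DB_prodMk_left hℓ
        (hJ.dir (n := N + n) (v, 0)).smooth.contDiffAt (hb' q hq)).of_le (by omega))
    rw [integral_mul_const, ← mul_assoc] at h1
    exact h1.congr (Filter.Eventually.of_forall fun y =>
      (Kern.fderiv_act (n := N + n) hJ ha hA y v).symm)

end Act

/-! ### The bilinear operation: bounds -/

section PairB

variable {d m : ℕ}

/-- The volume of the balls of radius `r`. -/
def ballVol (d : ℕ) (r : ℝ) : ℝ := (volume (Metric.closedBall (0 : Space d) r)).toReal

theorem integral_indicator_closedBall (c : Space d) (r A : ℝ) :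
    ∫ x, (Metric.closedBall c r).indicator (fun _ => A) x = ballVol d r * A := by
  rw [integral_indicator measurableSet_closedBall, setIntegral_const, smul_eq_mul, ballVol,
    Measure.real, Measure.addHaar_closedBall_center]

/-- Compactly supported functions that are controlled at scale `ℓ`. -/
structure IsLocal (n : ℕ) (ℓ r C : ℝ) (H : Space d → ℝ) : Prop where
  smooth : ContDiff ℝ n H
  bound : ∀ w, DB n ℓ C H w
  supp : ∀ w, r < ‖w‖ → H w = 0

theorem IsLocal.rescale {n : ℕ} {ℓ r C : ℝ} {H : Space d → ℝ} (h : IsLocal n ℓ r C H) (hℓ : 0 < ℓ) :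
    IsLocal n 1 r (max 1 ℓ⁻¹ ^ n * C) H :=
  ⟨h.smooth, fun w => DB.rescale hℓ one_pos (le_max_left _ _) (by
    calc (1 : ℝ) = ℓ⁻¹ * ℓ := by field_simp
      _ ≤ _ := by gcongr; exact le_max_right _ _) (h.bound w), h.supp⟩

variable (m) in
/-- The linear map underlying `joinVars`. -/
def joinL (k : ℕ) : (Config d (k + 1) × Config d (m - k)) →L[ℝ] Config d m :=
  ((ContinuousLinearMap.fst ℝ _ _).comp (ContinuousLinearMap.fst ℝ _ _)).prod
    (ContinuousLinearMap.pi fun p : Fin m =>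
      if h : (p : ℕ) < k then (ContinuousLinearMap.proj (⟨p + 1, by omega⟩ : Fin (k + 1))).comp
        ((ContinuousLinearMap.snd ℝ _ _).comp (ContinuousLinearMap.fst ℝ _ _))
      else (ContinuousLinearMap.proj (⟨p - k, by omega⟩ : Fin (m - k))).comp
        ((ContinuousLinearMap.snd ℝ _ _).comp (ContinuousLinearMap.snd ℝ _ _)))

theorem joinL_apply (k : ℕ) (z : Config d (k + 1) × Config d (m - k)) :
    joinL m k z = (z.1.1, joinVars k z.1.2 z.2.2) := by
  refine Prod.ext rfl ?_
  funext p
  simp only [joinL, ContinuousLinearMap.prod_apply, ContinuousLinearMap.coe_pi', joinVars]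
  split_ifs <;> rfl

theorem norm_joinL_le (k : ℕ) (z : Config d (k + 1) × Config d (m - k)) : ‖joinL m k z‖ ≤ ‖z‖ := by
  rw [joinL_apply, Prod.norm_def]
  have h1 : ‖z.1.2‖ ≤ ‖z‖ := (norm_snd_le z.1).trans (norm_fst_le z)
  have h2 : ‖z.2.2‖ ≤ ‖z‖ := (norm_snd_le z.2).trans (norm_snd_le z)
  refine max_le ((norm_fst_le z.1).trans (norm_fst_le z))
    ((pi_norm_le_iff_of_nonneg (norm_nonneg z)).2 fun p => ?_)
  simp only [joinVars]
  split_ifs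
  · exact (norm_le_pi_norm z.1.2 _).trans h1
  · exact (norm_le_pi_norm z.2.2 _).trans h2

variable (m) in
/-- The argument of the propagator. -/
def diffL (k : ℕ) : (Config d (k + 1) × Config d (m - k)) →L[ℝ] Space d :=
  (ContinuousLinearMap.proj (0 : Fin (k + 1))).comp
    ((ContinuousLinearMap.snd ℝ _ _).comp (ContinuousLinearMap.fst ℝ _ _)) -
  (ContinuousLinearMap.fst ℝ _ _).comp (ContinuousLinearMap.snd ℝ _ _)

theorem diffL_apply (k : ℕ) (z : Config d (k + 1) × Config d (m - k)) :
    diffL m k z = z.1.2 0 - z.2.1 := rfl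

theorem norm_diffL_le (k : ℕ) (z : Config d (k + 1) × Config d (m - k)) :
    ‖diffL m k z‖ ≤ 2 * ‖z‖ := by
  rw [diffL_apply]
  have h1 : ‖z.1.2 0‖ ≤ ‖z‖ := (norm_le_pi_norm z.1.2 0).trans
    ((norm_snd_le z.1).trans (norm_fst_le z))
  have h2 : ‖z.2.1‖ ≤ ‖z‖ := (norm_fst_le z.2).trans (norm_snd_le z)
  linarith [norm_sub_le (z.1.2 0) z.2.1]

/-- The integrand of `pairB`. -/
def pairJ (k : ℕ) (H : Space d → ℝ) (Ψ : Config d m → ℝ)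
    (z : Config d (k + 1) × Config d (m - k)) : ℝ :=
  H (diffL m k z) * Ψ (joinL m k z)

theorem pairB_eq (k : ℕ) (H : Space d → ℝ) (W : (Config d (k + 1) → ℝ) → ℝ)
    (U : (Config d (m - k) → ℝ) → ℝ) (Ψ : Config d m → ℝ) :
    pairB k H W U Ψ = W fun p => U fun q => pairJ k H Ψ (p, q) := by
  simp only [pairB, pairJ, joinL_apply, diffL_apply]

theorem contDiff_pairJ {n : ℕ} (k : ℕ) {H : Space d → ℝ} {Ψ : Config d m → ℝ}
    (hH : ContDiff ℝ n H) (hΨ : ContDiff ℝ n Ψ) : ContDiff ℝ n (pairJ k H Ψ) :=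
  (hH.comp (diffL m k).contDiff).mul (hΨ.comp (joinL m k).contDiff)

theorem joinL_mem_tube {k : ℕ} {ρ r ρ' : ℝ} (hr : 0 ≤ r) (hρ' : 0 ≤ ρ') {p : Config d (k + 1)}
    {q : Config d (m - k)} (hp : p ∈ tube d (k + 1) ρ) (hq : q ∈ tube d (m - k) ρ')
    (h : ‖p.2 0 - q.1‖ ≤ r) : joinL m k (p, q) ∈ tube d m (ρ + r + ρ') := by
  intro i
  rw [joinL_apply]
  simp only [joinVars]
  split_ifs
  · linarith [hp ⟨i + 1, by omega⟩]
  · rename_i hi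
    have h1 := hq ⟨i - k, by omega⟩
    have h2 := hp 0
    have e : q.2 ⟨i - k, by omega⟩ - p.1 =
        (q.2 ⟨i - k, by omega⟩ - q.1) + (-(p.2 0 - q.1)) + (p.2 0 - p.1) := by abel
    rw [e]
    refine (norm_add₃_le).trans ?_
    rw [norm_neg]
    linarith

theorem DB_pairJ {n k : ℕ} {ℓ r C ρ ρ' : ℝ} (hℓ : 0 < ℓ) (hr : 0 ≤ r) (hρ' : 0 ≤ ρ')
    {H : Space d → ℝ} (hH : IsLocal n ℓ r C H) {Ψ : Config d m → ℝ} (hΨ : ContDiff ℝ n Ψ)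
    {M : Space d → ℝ} (hb : ∀ p ∈ tube d m (ρ + r + ρ'), DB n ℓ (M p.1) Ψ p) {p : Config d (k + 1)}
    {q : Config d (m - k)} (hp : p ∈ tube d (k + 1) ρ) (hq : q ∈ tube d (m - k) ρ') (hM : 0 ≤ M p.1) :
    DB n ℓ ((Metric.closedBall (p.2 0) r).indicator (fun _ => 4 ^ n * C * M p.1) q.1)
      (pairJ k H Ψ) (p, q) := by
  rcases le_or_gt ‖p.2 0 - q.1‖ r with h | h
  · rw [indicator_of_mem (by rwa [Metric.mem_closedBall, dist_comm, dist_eq_norm])]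
    have h1 : DB n ℓ (2 ^ n * C) (fun z => H (diffL m k z)) (p, q) := by
      have := DB.comp_affine (n := n) (ℓ := ℓ) (ℓ' := ℓ / 2) (y := (p, q)) (f := H) (M := C)
        (diffL m k) 0 (by positivity) (fun v => by
          rw [div_div_eq_mul_div]
          gcongr
          rw [mul_comm]; exact norm_diffL_le k v) hH.smooth.contDiffAt (hH.bound _)
      simp only [add_zero] at this
      exact DB.rescale (by positivity) hℓ one_le_two (by linarith) this
    have h2 : DB n ℓ (M p.1) (fun z => Ψ (joinL m k z)) (p, q) := by
      have := DB.comp_affine (n := n) (ℓ := ℓ) (ℓ' := ℓ) (y := (p, q)) (f := Ψ) (M := M p.1)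
        (joinL m k) 0 hℓ (fun v => by gcongr; exact norm_joinL_le k v) hΨ.contDiffAt (by
          rw [add_zero]
          have := hb _ (joinL_mem_tube hr hρ' hp hq h)
          rwa [show (joinL m k (p, q)).1 = p.1 by rw [joinL_apply]] at this)
      simpa using this
    refine (DB.mul (hH.smooth.comp (diffL m k).contDiff).contDiffAt
      (hΨ.comp (joinL m k).contDiff).contDiffAt h1 h2).mono hℓ (le_of_eq ?_)
    rw [show (4 : ℝ) = 2 * 2 by norm_num, mul_pow]; ring
  · have hC : 0 ≤ C := (hH.bound 0).nonneg
    refine DB.of_eventually_zero hℓ (indicator_nonneg (fun _ _ => by positivity) _) ?_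
    have hc : Continuous fun z : Config d (k + 1) × Config d (m - k) => ‖diffL m k z‖ := by fun_prop
    filter_upwards [hc.continuousAt.eventually (lt_mem_nhds (show r < ‖diffL m k (p, q)‖ from h))]
      with z hz
    rw [pairJ, hH.supp _ hz, zero_mul]

theorem mem_tube_of_norm {m : ℕ} (p : Config d m) : p ∈ tube d m (2 * ‖p‖) := fun q => by
  have h1 := norm_sub_le (p.2 q) p.1
  have h2 : ‖p.2 q‖ ≤ ‖p‖ := (norm_le_pi_norm p.2 q).trans (norm_snd_le p)
  have h3 : ‖p.1‖ ≤ ‖p‖ := norm_fst_le p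
  linarith

theorem tube_mono {m : ℕ} {ρ ρ' : ℝ} (h : ρ ≤ ρ') : tube d m ρ ⊆ tube d m ρ' :=
  fun _ hp q => (hp q).trans h

theorem admFam_pairJ {n k : ℕ} {r C : ℝ} (hr : 0 ≤ r) {H : Space d → ℝ} (hH : IsLocal n 1 r C H)
    {Ψ : Config d m → ℝ} (hΨ : Adm n Ψ) : AdmFam n (pairJ (m := m) k H Ψ) := by
  have hC : 0 ≤ C := (hH.bound 0).nonneg
  refine ⟨contDiff_pairJ k hH.smooth hΨ.smooth, fun p₀ ρ => ?_⟩
  obtain ⟨M, hM, hb⟩ := hΨ.bound (2 * (‖p₀‖ + 1) + r + max ρ 0)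
  obtain ⟨B, hB⟩ := hM.bdd
  have hB0 : 0 ≤ B := (hM.nonneg 0).trans (hB 0)
  refine ⟨1, one_pos, (Metric.closedBall (p₀.2 0) (r + 1)).indicator fun _ => 4 ^ n * C * B,
    good_indicator _ _ (by positivity), fun p hp q hq => ?_⟩
  rw [mem_ball_iff_norm] at hp
  have hpn : ‖p‖ ≤ ‖p₀‖ + 1 := by
    have := norm_sub_norm_le p p₀
    linarith
  have h1 := DB_pairJ (k := k) one_pos hr (le_max_right ρ 0) hH hΨ.smooth hb
    (tube_mono (by linarith) (mem_tube_of_norm p)) (tube_mono (le_max_left ρ 0) hq) (hM.nonneg _)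
  refine h1.mono one_pos ?_
  by_cases h2 : q.1 ∈ Metric.closedBall (p.2 0) r
  · rw [indicator_of_mem h2, indicator_of_mem]
    · exact mul_le_mul_of_nonneg_left (hB _) (by positivity)
    · rw [Metric.mem_closedBall] at h2 ⊢
      have h3 : ‖p.2 0 - p₀.2 0‖ ≤ ‖p - p₀‖ :=
        (norm_le_pi_norm (p - p₀).2 0).trans (norm_snd_le (p - p₀))
      have h4 := dist_triangle q.1 (p.2 0) (p₀.2 0)
      rw [dist_eq_norm (p.2 0)] at h4
      linarith
  · rw [indicator_of_notMem h2]
    exact indicator_nonneg (fun _ _ => by positivity) _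

section

variable {n nU k : ℕ} {ℓ r C : ℝ} {H : Space d → ℝ} {Ψ : Config d m → ℝ}
  {K : Kern d (m - k)} {a : Space d × K.Ω → ℝ} {A : ℝ}

/-- Bounds on the test function to which the first factor of `pairB` is applied. -/
theorem DB_act_pairJ (hℓ : 0 < ℓ) (hr : 0 ≤ r) (hH : IsLocal (nU + n) ℓ r C H)
    (hΨ : Adm (nU + n) Ψ) (ha : Continuous a) (hA : ∀ t, |a t| ≤ A) {ρ ρ' c : ℝ} (hρ' : 0 ≤ ρ')
    (hU : Bdd nU ℓ ρ' c (K.act a)) {M : Space d → ℝ} (hM : ∀ x, 0 ≤ M x)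
    (hb : ∀ p ∈ tube d m (ρ + r + ρ'), DB (nU + n) ℓ (M p.1) Ψ p) {p : Config d (k + 1)}
    (hp : p ∈ tube d (k + 1) ρ) :
    DB n ℓ (c * (ballVol d r * (4 ^ (nU + n) * C)) * M p.1)
      (fun p => K.act a fun q => pairJ k H Ψ (p, q)) p := by
  have hC : 0 ≤ C := (hH.bound 0).nonneg
  have h1 := hU.db ha hA hℓ (admFam_pairJ (k := k) hr (hH.rescale hℓ) hΨ)
    (good_indicator (p.2 0) r (A := 4 ^ (nU + n) * C * M p.1)
      (mul_nonneg (by positivity) (hM _))) (p := p)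
    fun q hq => DB_pairJ hℓ hr hρ' hH hΨ.smooth hb hp hq (hM _)
  rw [integral_indicator_closedBall] at h1
  refine h1.mono hℓ (le_of_eq ?_)
  ring

theorem adm_act_pairJ (hr : 0 ≤ r) (hℓ : 0 < ℓ) (hH : IsLocal n ℓ r C H) (hΨ : Adm n Ψ)
    (ha : Continuous a) (hA : ∀ t, |a t| ≤ A) :
    Adm n fun p : Config d (k + 1) => K.act a fun q => pairJ k H Ψ (p, q) := by
  have hH1 := hH.rescale hℓ
  refine ⟨Kern.contDiff_act (admFam_pairJ hr hH1 hΨ) ha hA, fun ρ => ?_⟩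
  obtain ⟨ρ₀, c₀, h0⟩ := K.exists_bdd
  have hU := h0 (max ρ₀ 0) (le_max_left _ _) a A hA
  obtain ⟨M, hM, hb⟩ := hΨ.bound (ρ + r + max ρ₀ 0)
  have e : 0 + n = n := zero_add n
  refine ⟨fun x => |A * c₀ * (ballVol d r * (4 ^ (0 + n) * (max 1 ℓ⁻¹ ^ n * C)))| * M x,
    hM.const_mul (abs_nonneg _), fun p hp => ?_⟩
  refine (DB_act_pairJ (nU := 0) (n := n) (ρ := ρ) one_pos hr (by rw [e]; exact hH1)
    (by rw [e]; exact hΨ) ha hA (le_max_right _ _) hU hM.nonneg (by rw [e]; exact hb) hp).mono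
    one_pos ?_
  exact mul_le_mul_of_nonneg_right (le_abs_self _) (hM.nonneg _)

theorem Bdd.pairB (hℓ : 0 < ℓ) (hr : 0 ≤ r) (hH : IsLocal (nU + n) ℓ r C H)
    (ha : Continuous a) (hA : ∀ t, |a t| ≤ A) {ρ ρ' c c' : ℝ} (hρ' : 0 ≤ ρ') (hc : 0 ≤ c)
    (hU : Bdd nU ℓ ρ' c (K.act a)) {W : (Config d (k + 1) → ℝ) → ℝ} (hW : Bdd n ℓ ρ c' W) :
    Bdd (nU + n) ℓ (ρ + r + ρ') (c' * (c * (ballVol d r * (4 ^ (nU + n) * C))))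
      (pairB k H W (K.act a)) := by
  intro Ψ M hΨ hM hb
  have hC : 0 ≤ C := (hH.bound 0).nonneg
  rw [pairB_eq]
  have hg := (adm_act_pairJ (k := k) hr hℓ hH hΨ ha hA).of_le (n' := n) (by omega)
  have hc0 : 0 ≤ c * (ballVol d r * (4 ^ (nU + n) * C)) := by unfold ballVol; positivity
  have h1 := hW _ _ hg (hM.const_mul hc0) fun p hp =>
    DB_act_pairJ hℓ hr hH hΨ ha hA hρ' hU hM.nonneg hb hp
  rw [integral_const_mul] at h1
  rw [mul_assoc]
  exact h1

end

end PairB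

/-! ### Operations on functionals with densities -/

section Closure

variable {d m : ℕ}

namespace Kern

theorem act_def (k : Kern d m) (a : Space d × k.Ω → ℝ) (Ψ : Config d m → ℝ) :
    k.act a Ψ = ∫ t, a t * Ψ (k.point t) ∂((volume : Measure (Space d)).prod k.ν) := rfl

theorem act_density_add {k : Kern d m} {a b : Space d × k.Ω → ℝ} {A B : ℝ} (ha : Continuous a)
    (hA : ∀ t, |a t| ≤ A) (hb : Continuous b) (hB : ∀ t, |b t| ≤ B) {Ψ : Config d m → ℝ}
    (hΨ : Adm 0 Ψ) : k.act (fun t => a t + b t) Ψ = k.act a Ψ + k.act b Ψ := by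
  rw [act, act, act, ← integral_add (integrable hΨ ha hA) (integrable hΨ hb hB)]
  simp only [add_mul]

theorem act_density_const_mul {k : Kern d m} (c : ℝ) (a : Space d × k.Ω → ℝ) (Ψ : Config d m → ℝ) :
    k.act (fun t => c * a t) Ψ = c * k.act a Ψ := by
  rw [act, act, ← integral_const_mul]
  simp only [mul_assoc]

/-- The shifts with permuted components. -/
def perm (k : Kern d m) (π : Equiv.Perm (Fin m)) : Kern d m where
  Ω := k.Ω
  ν := k.ν
  Y ω q := k.Y ω (π.symm q)
  cont := by have := k.cont; fun_prop
  bdd := by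
    obtain ⟨ρ, h⟩ := k.bdd
    exact ⟨ρ, h.mono fun ω hω q => hω _⟩

/-- No shifts. -/
def point₀ (d m : ℕ) : Kern d m where
  Ω := Unit
  ν := Measure.dirac ()
  Y _ _ := 0
  cont := by fun_prop
  bdd := ⟨0, by simp⟩

theorem act_point₀ (a : Space d × Unit → ℝ) (Ψ : Config d m → ℝ) :
    (point₀ d m).act a Ψ = ∫ x, a (x, ()) * Ψ (x, fun _ => x) := by
  have e : ∀ t : Space d × Unit, (point₀ d m).point t = (t.1, fun _ => t.1) := fun t => by
    simp [point₀, point]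
  refine (act_def _ _ _).trans ?_
  have := (measurePreserving_fst (μ := (volume : Measure (Space d)))
    (ν := Measure.dirac ())).integral_comp (MeasurableEquiv.prodPUnit (α := Space d)).measurableEmbedding
      (fun x => a (x, ()) * Ψ (x, fun _ => x))
  rw [← this]
  exact integral_congr_ae (Filter.Eventually.of_forall fun t => congrArg (a t * Ψ ·) (e t))

/-- The uniform distribution on the booleans. -/
def coin : Measure Bool := (2⁻¹ : ℝ≥0∞) • (Measure.dirac true + Measure.dirac false)

instance : IsProbabilityMeasure coin := ⟨by simp [coin, ENNReal.inv_two_add_inv_two]⟩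

theorem integral_coin (f : Bool → ℝ) : ∫ b, f b ∂coin = 2⁻¹ * (f true + f false) := by
  rw [coin, integral_smul_measure, integral_add_measure (by exact integrable_dirac (by simp))
    (by exact integrable_dirac (by simp)), integral_dirac, integral_dirac]
  simp

/-- A random choice between two families of shifts. -/
def choice (k k' : Kern d m) : Kern d m where
  Ω := Bool × (k.Ω × k'.Ω)
  ν := coin.prod (k.ν.prod k'.ν)
  Y ω := if ω.1 then k.Y ω.2.1 else k'.Y ω.2.2
  cont := by
    have h1 := k.cont
    have h2 := k'.cont
    refine continuous_prod_of_discrete_left.2 fun b => ?_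
    cases b
    · exact h2.comp continuous_snd
    · exact h1.comp continuous_fst
  bdd := by
    obtain ⟨ρ, h⟩ := k.bdd
    obtain ⟨ρ', h'⟩ := k'.bdd
    refine ⟨max ρ ρ', ?_⟩
    have h1 : ∀ᵐ ω ∂(coin.prod (k.ν.prod k'.ν)), ∀ q, ‖k.Y ω.2.1 q‖ ≤ ρ :=
      Measure.quasiMeasurePreserving_snd.ae (Measure.quasiMeasurePreserving_fst.ae h)
    have h2 : ∀ᵐ ω ∂(coin.prod (k.ν.prod k'.ν)), ∀ q, ‖k'.Y ω.2.2 q‖ ≤ ρ' :=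
      Measure.quasiMeasurePreserving_snd.ae (Measure.quasiMeasurePreserving_snd.ae h')
    filter_upwards [h1, h2] with ω h1 h2 q
    split_ifs
    · exact (h1 q).trans (le_max_left _ _)
    · exact (h2 q).trans (le_max_right _ _)

/-- The density of a sum. -/
def choiceDensity {α : Type*} {Ω Ω' : Type*} (a : α × Ω → ℝ) (a' : α × Ω' → ℝ)
    (t : α × (Bool × (Ω × Ω'))) : ℝ :=
  2 * ((if t.2.1 then 1 else 0) * a (t.1, t.2.2.1) + (if t.2.1 then 0 else 1) * a' (t.1, t.2.2.2))

theorem continuous_ite_bool (u v : ℝ) : Continuous fun b : Bool => if b then u else v :=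
  continuous_of_discreteTopology

theorem act_choice {k k' : Kern d m} {a : Space d × k.Ω → ℝ} {a' : Space d × k'.Ω → ℝ} {A A' : ℝ}
    (ha : Continuous a) (hA : ∀ t, |a t| ≤ A) (ha' : Continuous a') (hA' : ∀ t, |a' t| ≤ A')
    {Ψ : Config d m → ℝ} (hΨ : Adm 0 Ψ) :
    (choice k k').act (choiceDensity a a') Ψ = k.act a Ψ + k'.act a' Ψ := by
  have hc : Continuous (fun t : Space d × (choice k k').Ω => choiceDensity a a' t) := by
    have h1 := continuous_ite_bool 1 0
    have h2 := continuous_ite_bool 0 1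
    unfold choiceDensity
    exact continuous_const.mul (((h1.comp (continuous_fst.comp continuous_snd)).mul (ha.comp
      (continuous_fst.prodMk (continuous_fst.comp (continuous_snd.comp continuous_snd))))).add
      ((h2.comp (continuous_fst.comp continuous_snd)).mul (ha'.comp
      (continuous_fst.prodMk (continuous_snd.comp (continuous_snd.comp continuous_snd))))))
  have hb : ∀ t : Space d × (choice k k').Ω, |choiceDensity a a' t| ≤ 2 * max A A' := by
    rintro ⟨x, b, ω, ω'⟩
    unfold choiceDensity
    rw [abs_mul, abs_two]
    cases b
    · simpa using (hA' (x, ω')).trans (le_max_right A A')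
    · simpa using (hA (x, ω)).trans (le_max_left A A')
  have hi := integrable (k := choice k k') hΨ hc hb
  have h1 := integrable (k := k) hΨ ha hA
  have h2 := integrable (k := k') hΨ ha' hA'
  unfold act
  rw [integral_prod _ hi, integral_prod _ h1, integral_prod _ h2,
    ← integral_add h1.integral_prod_left h2.integral_prod_left]
  refine integral_congr_ae ?_
  filter_upwards [hi.prod_right_ae] with x hx
  have e := integral_prod _ hx
  refine e.trans ?_
  rw [integral_coin]
  have e1 : ∀ y : k.Ω × k'.Ω, choiceDensity a a' (x, true, y) * Ψ ((choice k k').point (x, true, y)) =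
      2 * (a (x, y.1) * Ψ (k.point (x, y.1))) := fun y => by
    simp [choiceDensity, point, choice, mul_assoc]
  have e2 : ∀ y : k.Ω × k'.Ω, choiceDensity a a' (x, false, y) * Ψ ((choice k k').point (x, false, y)) =
      2 * (a' (x, y.2) * Ψ (k'.point (x, y.2))) := fun y => by
    simp [choiceDensity, point, choice, mul_assoc]
  have e5 := integral_congr_ae (μ := k.ν.prod k'.ν) (Filter.Eventually.of_forall e1)
  have e6 := integral_congr_ae (μ := k.ν.prod k'.ν) (Filter.Eventually.of_forall e2)
  rw [integral_const_mul] at e5 e6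
  have e3 := integral_fun_fst (μ := k.ν) (ν := k'.ν) fun ω => a (x, ω) * Ψ (k.point (x, ω))
  have e4 := integral_fun_snd (μ := k.ν) (ν := k'.ν) fun ω => a' (x, ω) * Ψ (k'.point (x, ω))
  simp only [probReal_univ, one_smul] at e3 e4
  rw [e3] at e5
  rw [e4] at e6
  refine (congrArg₂ (fun u v : ℝ => 2⁻¹ * (u + v)) e5 e6).trans ?_
  ring

/-- The uniform distribution on a ball. -/
def ballMeas (d : ℕ) (r : ℝ) : Measure (Space d) :=
  ProbabilityTheory.cond volume (Metric.closedBall (0 : Space d) (max r 1))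

theorem ballVol_pos (r : ℝ) : 0 < ballVol d (max r 1) :=
  ENNReal.toReal_pos (Metric.measure_closedBall_pos _ _ (by positivity)).ne'
    measure_closedBall_lt_top.ne

instance (r : ℝ) : IsProbabilityMeasure (ballMeas d r) :=
  ProbabilityTheory.cond_isProbabilityMeasure_of_finite
    (Metric.measure_closedBall_pos _ _ (by positivity)).ne' measure_closedBall_lt_top.ne

theorem ae_ballMeas (r : ℝ) : ∀ᵐ w ∂(ballMeas d r), ‖w‖ ≤ max r 1 := by
  have := ProbabilityTheory.ae_cond_mem (μ := volume) (s := Metric.closedBall (0 : Space d) (max r 1))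
    measurableSet_closedBall
  filter_upwards [this] with w hw
  simpa using hw

/-- The shifts of `pairB`. -/
def join {k : ℕ} (W : Kern d (k + 1)) (U : Kern d (m - k)) (r : ℝ) : Kern d m where
  Ω := W.Ω × (Space d × U.Ω)
  ν := W.ν.prod ((ballMeas d r).prod U.ν)
  Y ω := joinVars k (W.Y ω.1) fun q => W.Y ω.1 0 - ω.2.1 + U.Y ω.2.2 q
  cont := by
    have h1 := W.cont
    have h2 := U.cont
    refine continuous_pi fun p => ?_
    simp only [joinVars]
    split_ifs <;> fun_prop
  bdd := by
    obtain ⟨ρ, h⟩ := W.bdd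
    obtain ⟨ρ', h'⟩ := U.bdd
    refine ⟨|ρ| + max r 1 + |ρ'|, ?_⟩
    have h1 : ∀ᵐ ω ∂(W.ν.prod ((ballMeas d r).prod U.ν)), ∀ q, ‖W.Y ω.1 q‖ ≤ ρ :=
      Measure.quasiMeasurePreserving_fst.ae h
    have h2 : ∀ᵐ ω ∂(W.ν.prod ((ballMeas d r).prod U.ν)), ∀ q, ‖U.Y ω.2.2 q‖ ≤ ρ' :=
      Measure.quasiMeasurePreserving_snd.ae (Measure.quasiMeasurePreserving_snd.ae h')
    have h3 : ∀ᵐ ω ∂(W.ν.prod ((ballMeas d r).prod U.ν)), ‖ω.2.1‖ ≤ max r 1 :=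
      Measure.quasiMeasurePreserving_snd.ae (Measure.quasiMeasurePreserving_fst.ae (ae_ballMeas r))
    filter_upwards [h1, h2, h3] with ω h1 h2 h3 p
    have h4 := le_abs_self ρ
    have h5 := le_abs_self ρ'
    have h6 : (1 : ℝ) ≤ max r 1 := le_max_right _ _
    simp only [joinVars]
    split_ifs
    · linarith [h1 ⟨p + 1, by omega⟩, abs_nonneg ρ']
    · refine (norm_add_le _ _).trans ?_
      have := norm_sub_le (W.Y ω.1 0) ω.2.1
      linarith [h1 0, h2 ⟨p - k, by omega⟩]

/-- The density of `pairB`. -/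
def joinDensity {k : ℕ} (W : Kern d (k + 1)) (U : Kern d (m - k)) (r : ℝ)
    (aW : Space d × W.Ω → ℝ) (h : Space d → ℝ) (aU : Space d × U.Ω → ℝ)
    (t : Space d × (W.Ω × (Space d × U.Ω))) : ℝ :=
  ballVol d (max r 1) * (aW (t.1, t.2.1) * h t.2.2.1 *
    aU (t.1 + W.Y t.2.1 0 - t.2.2.1, t.2.2.2))

theorem pairB_act {k : ℕ} {W : Kern d (k + 1)} {U : Kern d (m - k)} {r : ℝ}
    {aW : Space d × W.Ω → ℝ} {h : Space d → ℝ} {aU : Space d × U.Ω → ℝ} {AW C AU : ℝ}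
    (haW : Continuous aW) (hAW : ∀ t, |aW t| ≤ AW) (hh : Continuous h) (hC : ∀ w, |h w| ≤ C)
    (hr : ∀ w, r < ‖w‖ → h w = 0) (haU : Continuous aU) (hAU : ∀ t, |aU t| ≤ AU)
    {Ψ : Config d m → ℝ} (hΨ : Adm 0 Ψ) :
    pairB k h (W.act aW) (U.act aU) Ψ = (W.join U r).act (joinDensity W U r aW h aU) Ψ := by
  set V := ballVol d (max r 1) with hV
  have hV0 : 0 < V := ballVol_pos r
  have hC0 : 0 ≤ C := (abs_nonneg _).trans (hC 0)
  have hr' : ∀ w, max r 1 < ‖w‖ → h w = 0 := fun w hw => hr w ((le_max_left _ _).trans_lt hw)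
  have hH : IsLocal 0 1 (max r 1) C h := ⟨contDiff_zero.2 hh, hC, hr'⟩
  have hWc := W.cont
  have hjc : Continuous fun t : Space d × (W.Ω × (Space d × U.Ω)) =>
      joinDensity W U r aW h aU t := by unfold joinDensity; fun_prop
  have hjb : ∀ t, |joinDensity W U r aW h aU t| ≤ V * (AW * C * AU) := fun t => by
    unfold joinDensity
    rw [abs_mul, abs_of_pos hV0, abs_mul, abs_mul]
    have h1 := (abs_nonneg _).trans (hAW (t.1, t.2.1))
    have h2 := (abs_nonneg _).trans (hAU (t.1 + W.Y t.2.1 0 - t.2.2.1, t.2.2.2))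
    gcongr
    · exact hAW _
    · exact hC _
    · exact hAU _
  have hi := integrable (k := W.join U r) hΨ hjc hjb
  have hfam : AdmFam 0 (pairJ k h Ψ) := admFam_pairJ (m := m) (k := k) (by positivity) hH hΨ
  have hg : Adm 0 fun p : Config d (k + 1) => U.act aU fun q => pairJ k h Ψ (p, q) :=
    adm_act_pairJ (k := k) (by positivity) one_pos hH hΨ haU hAU
  have hmp := measurePreserving_prodAssoc (volume : Measure (Space d)) W.ν
    ((ballMeas d r).prod U.ν)
  have hi2 := (hmp.integrable_comp_emb MeasurableEquiv.prodAssoc.measurableEmbedding).2 hi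
  rw [pairB_eq, act_def W]
  refine Eq.trans ?_ (act_def (W.join U r) _ _).symm
  refine Eq.trans ?_ (hmp.integral_comp MeasurableEquiv.prodAssoc.measurableEmbedding _)
  refine Eq.trans ?_ (integral_prod _ hi2).symm
  congr 1
  ext ⟨x, ω⟩
  set c := x + W.Y ω 0 with hc
  have hsub : MeasurePreserving (fun t : Space d × U.Ω => (c - t.1, t.2))
      ((volume : Measure (Space d)).prod U.ν) ((volume : Measure (Space d)).prod U.ν) :=
    (Measure.measurePreserving_sub_left volume c).prod (MeasurePreserving.id U.ν)
  have hemb : MeasurableEmbedding (fun t : Space d × U.Ω => (c - t.1, t.2)) :=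
    ((MeasurableEquiv.subLeft c).prodCongr (MeasurableEquiv.refl U.Ω)).measurableEmbedding
  have e1 : U.act aU (fun q => pairJ k h Ψ (W.point (x, ω), q)) =
      ∫ t : Space d × U.Ω, aU (c - t.1, t.2) *
        pairJ k h Ψ (W.point (x, ω), U.point (c - t.1, t.2)) ∂((volume : Measure (Space d)).prod U.ν) :=
    (hsub.integral_comp hemb _).symm
  have e2 : ((ballMeas d r).prod U.ν) = (volume (Metric.closedBall (0 : Space d) (max r 1)))⁻¹ •
      (((volume : Measure (Space d)).prod U.ν).restrict
        (Metric.closedBall (0 : Space d) (max r 1) ×ˢ univ)) := by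
    rw [← Measure.prod_restrict, Measure.restrict_univ, ballMeas, ProbabilityTheory.cond,
      Measure.prod_smul_left]
  rw [e1, e2, integral_smul_measure, setIntegral_eq_integral_of_forall_compl_eq_zero, smul_eq_mul,
    ← integral_const_mul, ← integral_const_mul, ENNReal.toReal_inv]
  · congr 1
    ext ⟨w, ω'⟩
    have e3 : joinDensity W U r aW h aU (x, ω, w, ω') = V * (aW (x, ω) * h w * aU (c - w, ω')) := rfl
    have e4 : diffL m k (W.point (x, ω), U.point (c - w, ω')) = w := by
      rw [diffL_apply]; simp [point, hc]
    have e5 : joinL m k (W.point (x, ω), U.point (c - w, ω')) = (W.join U r).point (x, ω, w, ω') := by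
      rw [joinL_apply]
      refine Prod.ext rfl (funext fun p => ?_)
      simp only [point, join, joinVars, hc]
      split_ifs
      · rfl
      · abel
    have e6 : V⁻¹ * V = 1 := inv_mul_cancel₀ hV0.ne'
    simp only [pairJ, e4, e5, Function.comp]
    show _ = V⁻¹ * (joinDensity W U r aW h aU (x, ω, w, ω') * Ψ ((W.join U r).point (x, ω, w, ω')))
    rw [e3]
    calc aW (x, ω) * (aU (c - w, ω') * (h w * Ψ ((W.join U r).point (x, ω, w, ω'))))
        = (V⁻¹ * V) * (aW (x, ω) * (aU (c - w, ω') * (h w *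
          Ψ ((W.join U r).point (x, ω, w, ω'))))) := by rw [e6, one_mul]
      _ = _ := by ring
  · rintro ⟨w, ω'⟩ hw
    have : h w = 0 := hr' w (by simpa using hw)
    show joinDensity W U r aW h aU (x, ω, w, ω') * Ψ ((W.join U r).point (x, ω, w, ω')) = 0
    rw [show joinDensity W U r aW h aU (x, ω, w, ω') = V * (aW (x, ω) * h w * aU (c - w, ω')) from rfl,
      this]
    ring

instance : IsProbabilityMeasure ((volume : Measure ℝ).restrict (Ioc 0 1)) := ⟨by simp⟩

/-- The shifts of an integral over a parameter. -/
def time (k : Kern d m) : Kern d m where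
  Ω := k.Ω × ℝ
  ν := k.ν.prod ((volume : Measure ℝ).restrict (Ioc 0 1))
  Y ω := k.Y ω.1
  cont := k.cont.comp continuous_fst
  bdd := by
    obtain ⟨ρ, h⟩ := k.bdd
    exact ⟨ρ, Measure.quasiMeasurePreserving_fst.ae h⟩

theorem integral_act {k : Kern d m} {a : ℝ × (Space d × k.Ω) → ℝ} {A : ℝ} (ha : Continuous a)
    (hA : ∀ t, |a t| ≤ A) {Ψ : Config d m → ℝ} (hΨ : Adm 0 Ψ) (μ : ℝ) :
    ∫ η in (0 : ℝ)..μ, k.act (fun t => a (η, t)) Ψ =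
      k.time.act (fun t => μ * a (μ * t.2.2, (t.1, t.2.1))) Ψ := by
  have hi := integrable (k := k.time) (a := fun t => μ * a (μ * t.2.2, (t.1, t.2.1))) hΨ
    (by have : Continuous a := ha; exact continuous_const.mul (this.comp (by fun_prop)))
    (A := |μ| * A) (fun t => by rw [abs_mul]; exact mul_le_mul_of_nonneg_left (hA _) (abs_nonneg _))
  have hmp := measurePreserving_prodAssoc (volume : Measure (Space d)) k.ν
    ((volume : Measure ℝ).restrict (Ioc 0 1))
  have hi2 := (hmp.integrable_comp_emb MeasurableEquiv.prodAssoc.measurableEmbedding).2 hi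
  have e1 := intervalIntegral.mul_integral_comp_mul_left (a := 0) (b := 1)
    (f := fun η => k.act (fun t => a (η, t)) Ψ) μ
  rw [mul_zero, mul_one] at e1
  rw [← e1, intervalIntegral.integral_of_le zero_le_one, ← integral_const_mul]
  conv_rhs => rw [act]
  refine Eq.trans ?_ (hmp.integral_comp MeasurableEquiv.prodAssoc.measurableEmbedding _)
  refine Eq.trans ?_ (integral_prod_symm _ hi2).symm
  congr 1
  ext t
  rw [act, ← integral_const_mul]
  congr 1
  ext ⟨x, ω⟩
  show μ * (a (μ * t, (x, ω)) * Ψ (k.point (x, ω))) = μ * a (μ * t, (x, ω)) * Ψ (k.point (x, ω))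
  ring

end Kern

end Closure

/-! ### Families of functionals with densities -/

section CKern

open BoundedContinuousFunction

variable {d m : ℕ}

/-- Functionals whose densities depend on a scale and, differentiably, on a cutoff. -/
structure CKern (d m : ℕ) where
  K : Kern d m
  A : ℝ → (ℝ × (Space d × K.Ω)) →ᵇ ℝ
  A' : ℝ → (ℝ × (Space d × K.Ω)) →ᵇ ℝ
  deriv : ∀ κ ∈ Ioc (0 : ℝ) (1 / 2), HasDerivWithinAt A (A' κ) (Ioc 0 (1 / 2)) κ
  periodic : ∀ κ ∈ Ioc (0 : ℝ) (1 / 2), ∀ η n x ω,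
    A κ (η, (x + latticePoint n, ω)) = A κ (η, (x, ω))

theorem uniqueDiffWithinAt_cutoff {κ : ℝ} (hκ : κ ∈ Ioc (0 : ℝ) (1 / 2)) :
    UniqueDiffWithinAt ℝ (Ioc (0 : ℝ) (1 / 2)) κ := uniqueDiffOn_Ioc 0 (1 / 2) κ hκ

/-- The functional with a bounded continuous density, as a function of the density. -/
theorem Kern.exists_actL (K : Kern d m) {Ψ : Config d m → ℝ} (hΨ : Adm 0 Ψ) (η : ℝ) :
    ∃ L : ((ℝ × (Space d × K.Ω)) →ᵇ ℝ) →L[ℝ] ℝ, ∀ a, L a = K.act (fun t => a (η, t)) Ψ := by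
  have h1 := Kern.integrable (k := K) hΨ (a := fun _ => 1) continuous_const (A := 1) (by simp)
  simp only [one_mul] at h1
  refine ⟨LinearMap.mkContinuous
    { toFun := fun a => K.act (fun t => a (η, t)) Ψ
      map_add' := fun a b => Kern.act_density_add (by fun_prop) (fun t => a.norm_coe_le_norm (η, t))
        (by fun_prop) (fun t => b.norm_coe_le_norm (η, t)) hΨ
      map_smul' := fun c a => Kern.act_density_const_mul c _ Ψ }
    (∫ t, ‖Ψ (K.point t)‖ ∂((volume : Measure (Space d)).prod K.ν)) fun a => ?_, fun a => rfl⟩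
  rw [mul_comm, ← integral_const_mul]
  refine norm_integral_le_of_norm_le (f := fun t => a (η, t) * Ψ (K.point t))
    (h1.norm.const_mul _) (Filter.Eventually.of_forall fun t => ?_)
  rw [norm_mul]
  exact mul_le_mul_of_nonneg_right (a.norm_coe_le_norm _) (norm_nonneg _)

theorem hasDerivWithinAt_compContinuous {α β : Type*} [TopologicalSpace α] [TopologicalSpace β]
    {A : ℝ → α →ᵇ ℝ} {A' : α →ᵇ ℝ} {s : Set ℝ} {κ : ℝ} (h : HasDerivWithinAt A A' s κ)
    (g : C(β, α)) :
    HasDerivWithinAt (fun κ => (A κ).compContinuous g) (A'.compContinuous g) s κ :=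
  (compContinuousCLM ℝ ℝ g).hasFDerivAt.comp_hasDerivWithinAt κ h

namespace CKern

/-- The functional. -/
def act (V : CKern d m) (κ η : ℝ) (Ψ : Config d m → ℝ) : ℝ := V.K.act (fun t => V.A κ (η, t)) Ψ

/-- The derivative of the functional with respect to the cutoff. -/
def act' (V : CKern d m) (κ η : ℝ) (Ψ : Config d m → ℝ) : ℝ :=
  V.K.act (fun t => V.A' κ (η, t)) Ψ

theorem hasDeriv (V : CKern d m) {κ : ℝ} (hκ : κ ∈ Ioc (0 : ℝ) (1 / 2)) (η : ℝ)
    {Ψ : Config d m → ℝ} (hΨ : Adm 0 Ψ) :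
    HasDerivWithinAt (fun κ => V.act κ η Ψ) (V.act' κ η Ψ) (Ioc 0 (1 / 2)) κ := by
  obtain ⟨L, hL⟩ := V.K.exists_actL hΨ η
  have h := L.hasFDerivAt.comp_hasDerivWithinAt κ (V.deriv κ hκ)
  simp only [Function.comp_def, hL] at h
  exact h

theorem periodic' (V : CKern d m) {κ : ℝ} (hκ : κ ∈ Ioc (0 : ℝ) (1 / 2)) (η : ℝ) (n : Fin d → ℤ)
    (x : Space d) (ω : V.K.Ω) : V.A' κ (η, (x + latticePoint n, ω)) = V.A' κ (η, (x, ω)) := by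
  have h : ∀ p, HasDerivWithinAt (fun κ => V.A κ p) (V.A' κ p) (Ioc 0 (1 / 2)) κ := fun p =>
    (evalCLM ℝ (β := ℝ) p).hasFDerivAt.comp_hasDerivWithinAt κ (V.deriv κ hκ)
  refine (uniqueDiffWithinAt_cutoff hκ).eq_deriv _ (h _) ((h _).congr (fun κ' hκ' => ?_) ?_)
  · exact V.periodic κ' hκ' _ _ _ _
  · exact V.periodic κ hκ _ _ _ _

/-- The zero functional. -/
def zero (d m : ℕ) : CKern d m where
  K := Kern.point₀ d m
  A _ := 0
  A' _ := 0
  deriv κ _ := hasDerivWithinAt_const κ _ _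
  periodic _ _ _ _ _ _ := rfl

theorem act_zero (κ η : ℝ) (Ψ : Config d m → ℝ) : (zero d m).act κ η Ψ = 0 := by
  refine (integral_congr_ae (Filter.Eventually.of_forall fun t => ?_)).trans (integral_zero _ _)
  exact zero_mul _

/-- A multiple of a family. -/
def constMul (c : ℝ) (V : CKern d m) : CKern d m where
  K := V.K
  A κ := c • V.A κ
  A' κ := c • V.A' κ
  deriv κ hκ := (V.deriv κ hκ).const_smul c
  periodic κ hκ η n x ω := by
    show c * V.A κ _ = c * V.A κ _
    rw [V.periodic κ hκ]

theorem act_constMul (c : ℝ) (V : CKern d m) (κ η : ℝ) (Ψ : Config d m → ℝ) :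
    (constMul c V).act κ η Ψ = c * V.act κ η Ψ := Kern.act_density_const_mul c _ Ψ

/-- A family with permuted arguments. -/
def perm (V : CKern d m) (π : Equiv.Perm (Fin m)) : CKern d m where
  K := V.K.perm π
  A := V.A
  A' := V.A'
  deriv := V.deriv
  periodic := V.periodic

/-- The function that is `1` at one of the booleans. -/
def selectB (α Ω' Ω'' : Type*) [TopologicalSpace α] [TopologicalSpace Ω'] [TopologicalSpace Ω'']
    (b : Bool) : (ℝ × (α × (Bool × (Ω' × Ω'')))) →ᵇ ℝ :=
  ofNormedAddCommGroup (fun p => if p.2.2.1 = b then 1 else 0)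
    (by
      have h : Continuous fun c : Bool => if c = b then (1 : ℝ) else 0 :=
        continuous_of_discreteTopology
      exact h.comp (by fun_prop)) 1 (fun p => by split_ifs <;> simp)

/-- The sum of two families. -/
def add (V V' : CKern d m) : CKern d m where
  K := Kern.choice V.K V'.K
  A κ := (2 : ℝ) • (selectB (Space d) V.K.Ω V'.K.Ω true *
      (V.A κ).compContinuous ⟨fun p => (p.1, (p.2.1, p.2.2.2.1)), by fun_prop⟩ +
    selectB (Space d) V.K.Ω V'.K.Ω false *
      (V'.A κ).compContinuous ⟨fun p => (p.1, (p.2.1, p.2.2.2.2)), by fun_prop⟩)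
  A' κ := (2 : ℝ) • (selectB (Space d) V.K.Ω V'.K.Ω true *
      (V.A' κ).compContinuous ⟨fun p => (p.1, (p.2.1, p.2.2.2.1)), by fun_prop⟩ +
    selectB (Space d) V.K.Ω V'.K.Ω false *
      (V'.A' κ).compContinuous ⟨fun p => (p.1, (p.2.1, p.2.2.2.2)), by fun_prop⟩)
  deriv κ hκ := by
    have h1 := HasDerivWithinAt.const_mul (selectB (Space d) V.K.Ω V'.K.Ω true)
      (hasDerivWithinAt_compContinuous (V.deriv κ hκ) ⟨fun p => (p.1, (p.2.1, p.2.2.2.1)),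
        by fun_prop⟩)
    have h2 := HasDerivWithinAt.const_mul (selectB (Space d) V.K.Ω V'.K.Ω false)
      (hasDerivWithinAt_compContinuous (V'.deriv κ hκ) ⟨fun p => (p.1, (p.2.1, p.2.2.2.2)),
        by fun_prop⟩)
    exact (h1.add h2).const_smul (2 : ℝ)
  periodic κ hκ η n x ω := by
    show (2 : ℝ) * ((if ω.1 = true then 1 else 0) * V.A κ (η, (x + latticePoint n, ω.2.1)) +
        (if ω.1 = false then 1 else 0) * V'.A κ (η, (x + latticePoint n, ω.2.2))) =
      (2 : ℝ) * ((if ω.1 = true then 1 else 0) * V.A κ (η, (x, ω.2.1)) +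
        (if ω.1 = false then 1 else 0) * V'.A κ (η, (x, ω.2.2)))
    rw [V.periodic κ hκ, V'.periodic κ hκ]

theorem choiceDensity_eq {V V' : CKern d m} (a : (ℝ × (Space d × V.K.Ω)) →ᵇ ℝ)
    (a' : (ℝ × (Space d × V'.K.Ω)) →ᵇ ℝ) (η : ℝ) :
    (fun t : Space d × (Bool × (V.K.Ω × V'.K.Ω)) => (2 : ℝ) • ((if t.2.1 = true then 1 else 0) *
      a (η, (t.1, t.2.2.1)) + (if t.2.1 = false then 1 else 0) * a' (η, (t.1, t.2.2.2)))) =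
    Kern.choiceDensity (fun t => a (η, t)) fun t => a' (η, t) := by
  ext ⟨x, b, ω⟩
  cases b <;> simp [Kern.choiceDensity]

theorem act_add (V V' : CKern d m) (κ η : ℝ) {Ψ : Config d m → ℝ} (hΨ : Adm 0 Ψ) :
    (V.add V').act κ η Ψ = V.act κ η Ψ + V'.act κ η Ψ := by
  have := Kern.act_choice (k := V.K) (k' := V'.K) (a := fun t => V.A κ (η, t))
    (a' := fun t => V'.A κ (η, t)) (by fun_prop) (fun t => (V.A κ).norm_coe_le_norm (η, t))
    (by fun_prop) (fun t => (V'.A κ).norm_coe_le_norm (η, t)) hΨ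
  rw [← choiceDensity_eq] at this
  exact this

/-- The integral of a family over the scale. -/
def integral (V : CKern d m) : CKern d m where
  K := V.K.time
  A κ := (ofNormedAddCommGroup (fun p : ℝ × (Space d × (V.K.Ω × ℝ)) => clamp p.1)
      (continuous_clamp.comp continuous_fst) 1 fun p => by
        have := clamp_mem p.1
        rw [Real.norm_eq_abs, abs_of_nonneg this.1]; linarith [this.2]) *
    (V.A κ).compContinuous ⟨fun p => (clamp p.1 * p.2.2.2, (p.2.1, p.2.2.1)), by
      have := continuous_clamp; fun_prop⟩
  A' κ := (ofNormedAddCommGroup (fun p : ℝ × (Space d × (V.K.Ω × ℝ)) => clamp p.1)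
      (continuous_clamp.comp continuous_fst) 1 fun p => by
        have := clamp_mem p.1
        rw [Real.norm_eq_abs, abs_of_nonneg this.1]; linarith [this.2]) *
    (V.A' κ).compContinuous ⟨fun p => (clamp p.1 * p.2.2.2, (p.2.1, p.2.2.1)), by
      have := continuous_clamp; fun_prop⟩
  deriv κ hκ := HasDerivWithinAt.const_mul _ (hasDerivWithinAt_compContinuous (V.deriv κ hκ) _)
  periodic κ hκ η n x ω := by
    show clamp η * V.A κ (_, (x + latticePoint n, ω.1)) = clamp η * V.A κ (_, (x, ω.1))
    rw [V.periodic κ hκ]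

theorem act_integral (V : CKern d m) (κ : ℝ) {μ : ℝ} (hμ : μ ∈ Icc (0 : ℝ) (3 / 4))
    {Ψ : Config d m → ℝ} (hΨ : Adm 0 Ψ) :
    V.integral.act κ μ Ψ = ∫ η in (0 : ℝ)..μ, V.act κ η Ψ := by
  refine Eq.trans ?_ (Kern.integral_act (k := V.K) (a := V.A κ) (V.A κ).continuous
    (V.A κ).norm_coe_le_norm hΨ μ).symm
  refine congrArg (fun a => V.K.time.act a Ψ) (funext fun t => ?_)
  show clamp μ * V.A κ (clamp μ * _, _) = _
  rw [clamp_eq hμ]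

theorem act'_integral (V : CKern d m) (κ : ℝ) {μ : ℝ} (hμ : μ ∈ Icc (0 : ℝ) (3 / 4))
    {Ψ : Config d m → ℝ} (hΨ : Adm 0 Ψ) :
    V.integral.act' κ μ Ψ = ∫ η in (0 : ℝ)..μ, V.act' κ η Ψ := by
  refine Eq.trans ?_ (Kern.integral_act (k := V.K) (a := V.A' κ) (V.A' κ).continuous
    (V.A' κ).norm_coe_le_norm hΨ μ).symm
  refine congrArg (fun a => V.K.time.act a Ψ) (funext fun t => ?_)
  show clamp μ * V.A' κ (clamp μ * _, _) = _
  rw [clamp_eq hμ]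

/-- `pairB` for families. -/
def pairB {k : ℕ} (W : CKern d (k + 1)) (U : CKern d (m - k)) {F : ℝ → ℝ → Space d → ℝ}
    (hF : SmoothFamily F) (r : ℝ) : CKern d m where
  K := W.K.join U.K r
  A κ := ballVol d (max r 1) • (
    (W.A κ).compContinuous ⟨fun p => (p.1, (p.2.1, p.2.2.1)), by fun_prop⟩ *
    (curve F κ).compContinuous ⟨fun p => (p.1, p.2.2.2.1), by fun_prop⟩ *
    (U.A κ).compContinuous ⟨fun p => (p.1, (p.2.1 + W.K.Y p.2.2.1 0 - p.2.2.2.1, p.2.2.2.2)), by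
      have := W.K.cont; fun_prop⟩)
  A' κ := ballVol d (max r 1) • (
    ((W.A' κ).compContinuous ⟨fun p => (p.1, (p.2.1, p.2.2.1)), by fun_prop⟩ *
      (curve F κ).compContinuous ⟨fun p => (p.1, p.2.2.2.1), by fun_prop⟩ +
     (W.A κ).compContinuous ⟨fun p => (p.1, (p.2.1, p.2.2.1)), by fun_prop⟩ *
      (curve (fun κ η w => _root_.deriv (fun κ' => F κ' η w) κ) κ).compContinuous
        ⟨fun p => (p.1, p.2.2.2.1), by fun_prop⟩) *
    (U.A κ).compContinuous ⟨fun p => (p.1, (p.2.1 + W.K.Y p.2.2.1 0 - p.2.2.2.1, p.2.2.2.2)), by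
      have := W.K.cont; fun_prop⟩ +
    (W.A κ).compContinuous ⟨fun p => (p.1, (p.2.1, p.2.2.1)), by fun_prop⟩ *
    (curve F κ).compContinuous ⟨fun p => (p.1, p.2.2.2.1), by fun_prop⟩ *
    (U.A' κ).compContinuous ⟨fun p => (p.1, (p.2.1 + W.K.Y p.2.2.1 0 - p.2.2.2.1, p.2.2.2.2)), by
      have := W.K.cont; fun_prop⟩)
  deriv κ hκ := by
    have h1 := (hF.hasDerivAt_curve (κ := κ) ⟨hκ.1, by linarith [hκ.2]⟩).hasDerivWithinAt
      (s := Ioc 0 (1 / 2))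
    have h2 := hasDerivWithinAt_compContinuous (W.deriv κ hκ)
      (β := ℝ × (Space d × (W.K.join U.K r).Ω)) ⟨fun p => (p.1, (p.2.1, p.2.2.1)), by fun_prop⟩
    have h3 := hasDerivWithinAt_compContinuous h1 (β := ℝ × (Space d × (W.K.join U.K r).Ω))
      ⟨fun p => (p.1, p.2.2.2.1), by fun_prop⟩
    have h4 := hasDerivWithinAt_compContinuous (U.deriv κ hκ)
      (β := ℝ × (Space d × (W.K.join U.K r).Ω))
      ⟨fun p => (p.1, (p.2.1 + W.K.Y p.2.2.1 0 - p.2.2.2.1, p.2.2.2.2)), by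
        have := W.K.cont; fun_prop⟩
    exact ((h2.mul h3).mul h4).const_smul (ballVol d (max r 1))
  periodic κ hκ η n x ω := by
    show ballVol d (max r 1) * (W.A κ (η, (x + latticePoint n, ω.1)) * curve F κ (η, ω.2.1) *
        U.A κ (η, (x + latticePoint n + W.K.Y ω.1 0 - ω.2.1, ω.2.2))) =
      ballVol d (max r 1) * (W.A κ (η, (x, ω.1)) * curve F κ (η, ω.2.1) *
        U.A κ (η, (x + W.K.Y ω.1 0 - ω.2.1, ω.2.2)))
    rw [W.periodic κ hκ, show x + latticePoint n + W.K.Y ω.1 0 - ω.2.1 =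
      x + W.K.Y ω.1 0 - ω.2.1 + latticePoint n by abel, U.periodic κ hκ]

end CKern

end CKern

/-! ### Represented families of functionals -/

section Rep

variable {d m : ℕ}

namespace CKern

theorem joinDensity_bound {k : ℕ} {W : Kern d (k + 1)} {U : Kern d (m - k)} {r : ℝ}
    {aW : Space d × W.Ω → ℝ} {h : Space d → ℝ} {aU : Space d × U.Ω → ℝ} {AW C AU : ℝ}
    (hAW : ∀ t, |aW t| ≤ AW) (hC : ∀ w, |h w| ≤ C) (hAU : ∀ t, |aU t| ≤ AU)
    (t : Space d × (W.join U r).Ω) :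
    |W.joinDensity U r aW h aU t| ≤ ballVol d (max r 1) * (AW * C * AU) := by
  have hC0 : 0 ≤ C := (abs_nonneg _).trans (hC 0)
  have h1 := (abs_nonneg _).trans (hAW (t.1, t.2.1))
  have h2 := (abs_nonneg _).trans (hAU (t.1 + W.Y t.2.1 0 - t.2.2.1, t.2.2.2))
  unfold Kern.joinDensity
  rw [abs_mul, abs_of_pos (Kern.ballVol_pos r), abs_mul, abs_mul]
  exact mul_le_mul_of_nonneg_left (mul_le_mul (mul_le_mul (hAW _) (hC _) (abs_nonneg _) h1)
    (hAU _) (abs_nonneg _) (mul_nonneg h1 hC0)) (Kern.ballVol_pos r).le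

theorem continuous_joinDensity {k : ℕ} {W : Kern d (k + 1)} {U : Kern d (m - k)} {r : ℝ}
    {aW : Space d × W.Ω → ℝ} {h : Space d → ℝ} {aU : Space d × U.Ω → ℝ}
    (haW : Continuous aW) (hh : Continuous h) (haU : Continuous aU) :
    Continuous fun t : Space d × (W.Ω × (Space d × U.Ω)) => W.joinDensity U r aW h aU t := by
  have := W.cont
  unfold Kern.joinDensity
  fun_prop

section PairB

variable {k : ℕ} (W : CKern d (k + 1)) (U : CKern d (m - k)) {F : ℝ → ℝ → Space d → ℝ}
  (hF : SmoothFamily F) {r : ℝ}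

theorem curve_eq {F : ℝ → ℝ → Space d → ℝ} (hF : SmoothFamily F) {κ η : ℝ}
    (hκ : κ ∈ Ioc (0 : ℝ) (1 / 2)) (hη : η ∈ Icc (0 : ℝ) (3 / 4)) :
    (fun w => curve F κ (η, w)) = F κ η := by
  ext w
  rw [hF.curve_apply ⟨hκ.1, by linarith [hκ.2]⟩, clamp_eq hη]

theorem act_pairB (hr : ∀ κ ∈ Ioc (0 : ℝ) (1 / 2), ∀ η ∈ Icc (0 : ℝ) (3 / 4), ∀ w, r < ‖w‖ →
      F κ η w = 0) {κ η : ℝ} (hκ : κ ∈ Ioc (0 : ℝ) (1 / 2)) (hη : η ∈ Icc (0 : ℝ) (3 / 4))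
    {Ψ : Config d m → ℝ} (hΨ : Adm 0 Ψ) :
    (pairB W U hF r).act κ η Ψ = EllipticFlow.pairB k (F κ η) (W.act κ η) (U.act κ η) Ψ := by
  have e := curve_eq hF hκ hη
  have := Kern.pairB_act (W := W.K) (U := U.K) (r := r) (aW := fun t => W.A κ (η, t))
    (h := F κ η) (aU := fun t => U.A κ (η, t)) (by fun_prop)
    (fun t => (W.A κ).norm_coe_le_norm (η, t)) (by rw [← e]; fun_prop)
    (fun w => by rw [← e]; exact (curve F κ).norm_coe_le_norm (η, w)) (hr κ hκ η hη)
    (by fun_prop) (fun t => (U.A κ).norm_coe_le_norm (η, t)) hΨ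
  rw [← e] at this ⊢
  exact this.symm

theorem act'_pairB (hr : ∀ κ ∈ Ioc (0 : ℝ) (1 / 2), ∀ η ∈ Icc (0 : ℝ) (3 / 4), ∀ w, r < ‖w‖ →
      F κ η w = 0) (hr' : ∀ κ ∈ Ioc (0 : ℝ) (1 / 2), ∀ η ∈ Icc (0 : ℝ) (3 / 4), ∀ w, r < ‖w‖ →
      _root_.deriv (fun κ' => F κ' η w) κ = 0)
    {κ η : ℝ} (hκ : κ ∈ Ioc (0 : ℝ) (1 / 2)) (hη : η ∈ Icc (0 : ℝ) (3 / 4))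
    {Ψ : Config d m → ℝ} (hΨ : Adm 0 Ψ) :
    (pairB W U hF r).act' κ η Ψ = EllipticFlow.pairB k (F κ η) (W.act' κ η) (U.act κ η) Ψ +
      EllipticFlow.pairB k (fun w => _root_.deriv (fun κ' => F κ' η w) κ) (W.act κ η) (U.act κ η) Ψ +
      EllipticFlow.pairB k (F κ η) (W.act κ η) (U.act' κ η) Ψ := by
  have e := curve_eq hF hκ hη
  have e' := curve_eq hF.param hκ hη
  beta_reduce at e'
  set F' : ℝ → ℝ → Space d → ℝ := fun κ η w => _root_.deriv (fun κ' => F κ' η w) κ with hF'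
  have cF : Continuous fun w => curve F κ (η, w) := by fun_prop
  have cF' : Continuous fun w => curve F' κ (η, w) := by fun_prop
  have bF : ∀ w, |curve F κ (η, w)| ≤ ‖curve F κ‖ := fun w => (curve F κ).norm_coe_le_norm (η, w)
  have bF' : ∀ w, |curve F' κ (η, w)| ≤ ‖curve F' κ‖ :=
    fun w => (curve F' κ).norm_coe_le_norm (η, w)
  have cW : Continuous fun t => W.A κ (η, t) := by fun_prop
  have cW' : Continuous fun t => W.A' κ (η, t) := by fun_prop
  have cU : Continuous fun t => U.A κ (η, t) := by fun_prop
  have cU' : Continuous fun t => U.A' κ (η, t) := by fun_prop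
  have bW : ∀ t, |W.A κ (η, t)| ≤ ‖W.A κ‖ := fun t => (W.A κ).norm_coe_le_norm (η, t)
  have bW' : ∀ t, |W.A' κ (η, t)| ≤ ‖W.A' κ‖ := fun t => (W.A' κ).norm_coe_le_norm (η, t)
  have bU : ∀ t, |U.A κ (η, t)| ≤ ‖U.A κ‖ := fun t => (U.A κ).norm_coe_le_norm (η, t)
  have bU' : ∀ t, |U.A' κ (η, t)| ≤ ‖U.A' κ‖ := fun t => (U.A' κ).norm_coe_le_norm (η, t)
  have sF : ∀ w, r < ‖w‖ → curve F κ (η, w) = 0 := fun w hw => by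
    rw [congrFun e w, hr κ hκ η hη w hw]
  have sF' : ∀ w, r < ‖w‖ → curve F' κ (η, w) = 0 := fun w hw => by
    rw [congrFun e' w, hr' κ hκ η hη w hw]
  have i1 := Kern.pairB_act (W := W.K) (U := U.K) (r := r) cW' bW' cF bF sF cU bU hΨ
  have i2 := Kern.pairB_act (W := W.K) (U := U.K) (r := r) cW bW cF' bF' sF' cU bU hΨ
  have i3 := Kern.pairB_act (W := W.K) (U := U.K) (r := r) cW bW cF bF sF cU' bU' hΨ
  have c1 := continuous_joinDensity (W := W.K) (U := U.K) (r := r) cW' cF cU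
  have c2 := continuous_joinDensity (W := W.K) (U := U.K) (r := r) cW cF' cU
  have c3 := continuous_joinDensity (W := W.K) (U := U.K) (r := r) cW cF cU'
  have b1 := joinDensity_bound (W := W.K) (U := U.K) (r := r) bW' bF bU
  have b2 := joinDensity_bound (W := W.K) (U := U.K) (r := r) bW bF' bU
  have b3 := joinDensity_bound (W := W.K) (U := U.K) (r := r) bW bF bU'
  have s1 := Kern.act_density_add (k := W.K.join U.K r) c1 b1 c2 b2 hΨ
  have s2 := Kern.act_density_add (k := W.K.join U.K r) (c1.add c2) (fun t => (abs_add_le _ _).trans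
    (add_le_add (b1 t) (b2 t))) c3 b3 hΨ
  have s3 := s2.trans (congrArg (· + _) s1)
  rw [e] at i1 i3
  rw [show (fun w => curve F' κ (η, w)) = fun w => _root_.deriv (fun κ' => F κ' η w) κ from e'] at i2
  refine Eq.trans ?_ (congrArg₂ (· + ·) (congrArg₂ (· + ·) i1 i2) i3).symm
  rw [← e]
  refine Eq.trans ?_ (s3.trans ?_)
  · refine congrArg (fun a => (W.K.join U.K r).act a Ψ) (funext fun t => ?_)
    have key : ∀ v x x' f f' u u' : ℝ, v * ((x' * f + x * f') * u + x * f * u') =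
        v * (x' * f * u) + v * (x * f' * u) + v * (x * f * u') := by intros; ring
    exact key _ _ _ _ _ _ _
  · rw [← e']

end PairB

end CKern

/-- `F` is represented by densities. -/
def Rep (F : ℝ → ℝ → (Config d m → ℝ) → ℝ) : Prop :=
  ∃ V : CKern d m, ∀ κ ∈ Ioc (0 : ℝ) (1 / 2), ∀ η ∈ Ioc (0 : ℝ) (3 / 4), ∀ Ψ, Adm 0 Ψ →
    F κ η Ψ = V.act κ η Ψ

/-- The derivative with respect to the cutoff. -/
def cutDeriv (F : ℝ → ℝ → (Config d m → ℝ) → ℝ) (κ η : ℝ) (Ψ : Config d m → ℝ) : ℝ :=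
  derivWithin (fun κ => F κ η Ψ) (Ioc 0 (1 / 2)) κ

/-- `U` has a bounded, continuous, periodic density. -/
def IsAct (U : (Config d m → ℝ) → ℝ) : Prop :=
  ∃ (K : Kern d m) (a : Space d × K.Ω → ℝ) (A : ℝ), Continuous a ∧ (∀ t, |a t| ≤ A) ∧
    (∀ n x ω, a (x + latticePoint n, ω) = a (x, ω)) ∧ ∀ Ψ, Adm 0 Ψ → U Ψ = K.act a Ψ

theorem cutDeriv_eq {F : ℝ → ℝ → (Config d m → ℝ) → ℝ} {V : CKern d m}
    (hV : ∀ κ ∈ Ioc (0 : ℝ) (1 / 2), ∀ η ∈ Ioc (0 : ℝ) (3 / 4), ∀ Ψ, Adm 0 Ψ →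
      F κ η Ψ = V.act κ η Ψ) {κ η : ℝ} (hκ : κ ∈ Ioc (0 : ℝ) (1 / 2))
    (hη : η ∈ Ioc (0 : ℝ) (3 / 4)) {Ψ : Config d m → ℝ} (hΨ : Adm 0 Ψ) :
    cutDeriv F κ η Ψ = V.act' κ η Ψ :=
  ((V.hasDeriv hκ η hΨ).congr (fun κ' hκ' => hV κ' hκ' η hη Ψ hΨ)
    (hV κ hκ η hη Ψ hΨ)).derivWithin (uniqueDiffWithinAt_cutoff hκ)

theorem cutDeriv_unique {F : ℝ → ℝ → (Config d m → ℝ) → ℝ} {κ η D : ℝ} {Ψ : Config d m → ℝ}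
    (hκ : κ ∈ Ioc (0 : ℝ) (1 / 2))
    (h : HasDerivWithinAt (fun κ => F κ η Ψ) D (Ioc 0 (1 / 2)) κ) : cutDeriv F κ η Ψ = D :=
  h.derivWithin (uniqueDiffWithinAt_cutoff hκ)

namespace Rep

variable {F : ℝ → ℝ → (Config d m → ℝ) → ℝ}

theorem hasDeriv (h : Rep F) {κ η : ℝ} (hκ : κ ∈ Ioc (0 : ℝ) (1 / 2)) (hη : η ∈ Ioc (0 : ℝ) (3 / 4))
    {Ψ : Config d m → ℝ} (hΨ : Adm 0 Ψ) :
    HasDerivWithinAt (fun κ => F κ η Ψ) (cutDeriv F κ η Ψ) (Ioc 0 (1 / 2)) κ := by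
  obtain ⟨V, hV⟩ := h
  rw [cutDeriv_eq hV hκ hη hΨ]
  exact (V.hasDeriv hκ η hΨ).congr (fun κ' hκ' => hV κ' hκ' η hη Ψ hΨ) (hV κ hκ η hη Ψ hΨ)

theorem isAct (h : Rep F) {κ η : ℝ} (hκ : κ ∈ Ioc (0 : ℝ) (1 / 2)) (hη : η ∈ Ioc (0 : ℝ) (3 / 4)) :
    IsAct (F κ η) := by
  obtain ⟨V, hV⟩ := h
  exact ⟨V.K, fun t => V.A κ (η, t), ‖V.A κ‖, by fun_prop, fun t => (V.A κ).norm_coe_le_norm (η, t),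
    fun n x ω => V.periodic κ hκ η n x ω, fun Ψ hΨ => hV κ hκ η hη Ψ hΨ⟩

theorem isAct_cutDeriv (h : Rep F) {κ η : ℝ} (hκ : κ ∈ Ioc (0 : ℝ) (1 / 2))
    (hη : η ∈ Ioc (0 : ℝ) (3 / 4)) : IsAct (cutDeriv F κ η) := by
  obtain ⟨V, hV⟩ := h
  exact ⟨V.K, fun t => V.A' κ (η, t), ‖V.A' κ‖, by fun_prop,
    fun t => (V.A' κ).norm_coe_le_norm (η, t),
    fun n x ω => V.periodic' hκ η n x ω, fun Ψ hΨ => cutDeriv_eq hV hκ hη hΨ⟩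

theorem congr {F' : ℝ → ℝ → (Config d m → ℝ) → ℝ} (h : Rep F) (hF' : ∀ κ ∈ Ioc (0 : ℝ) (1 / 2),
    ∀ η ∈ Ioc (0 : ℝ) (3 / 4), ∀ Ψ, Adm 0 Ψ → F' κ η Ψ = F κ η Ψ) : Rep F' := by
  obtain ⟨V, hV⟩ := h
  exact ⟨V, fun κ hκ η hη Ψ hΨ => (hF' κ hκ η hη Ψ hΨ).trans (hV κ hκ η hη Ψ hΨ)⟩

theorem zero : Rep fun _ _ (_ : Config d m → ℝ) => 0 :=
  ⟨CKern.zero d m, fun κ _ η _ Ψ _ => (CKern.act_zero κ η Ψ).symm⟩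

theorem add {F' : ℝ → ℝ → (Config d m → ℝ) → ℝ} (h : Rep F) (h' : Rep F') :
    Rep fun κ η Ψ => F κ η Ψ + F' κ η Ψ := by
  obtain ⟨V, hV⟩ := h
  obtain ⟨V', hV'⟩ := h'
  refine ⟨V.add V', fun κ hκ η hη Ψ hΨ => ?_⟩
  beta_reduce
  rw [CKern.act_add _ _ _ _ hΨ, hV κ hκ η hη Ψ hΨ, hV' κ hκ η hη Ψ hΨ]

theorem const_mul (h : Rep F) (c : ℝ) : Rep fun κ η Ψ => c * F κ η Ψ := by
  obtain ⟨V, hV⟩ := h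
  exact ⟨V.constMul c, fun κ hκ η hη Ψ hΨ => by
    beta_reduce
    rw [CKern.act_constMul, hV κ hκ η hη Ψ hΨ]⟩

theorem sum {ι : Type*} (s : Finset ι) {F : ι → ℝ → ℝ → (Config d m → ℝ) → ℝ}
    (h : ∀ i ∈ s, Rep (F i)) : Rep fun κ η Ψ => ∑ i ∈ s, F i κ η Ψ := by
  classical
  induction s using Finset.induction_on with
  | empty => simpa using zero
  | insert a s ha ih =>
    simp only [Finset.sum_insert ha]
    exact (h a (by simp)).add (ih fun i hi => h i (by simp [hi]))

end Rep

theorem DB_permTest {n : ℕ} {ℓ M : ℝ} (hℓ : 0 < ℓ) (π : Equiv.Perm (Fin m)) {Ψ : Config d m → ℝ}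
    {p : Config d m} (hΨ : ContDiff ℝ n Ψ)
    (h : DB n ℓ M Ψ (p.1, fun q => p.2 (π.symm q))) : DB n ℓ M (permTest π Ψ) p := by
  let L : Config d m →L[ℝ] Config d m := (ContinuousLinearMap.fst ℝ _ _).prod
    (ContinuousLinearMap.pi fun q => (ContinuousLinearMap.proj (π.symm q)).comp
      (ContinuousLinearMap.snd ℝ (Space d) (Fin m → Space d)))
  have hL : ∀ v, L v = (v.1, fun q => v.2 (π.symm q)) := fun v => rfl
  have := DB.comp_affine (n := n) (ℓ := ℓ) (ℓ' := ℓ) (y := p) (f := Ψ) (M := M) L 0 hℓ (fun v => by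
    rw [hL]
    gcongr
    refine max_le (norm_fst_le v) ((pi_norm_le_iff_of_nonneg (norm_nonneg v)).2 fun q => ?_)
    exact (norm_le_pi_norm v.2 _).trans (norm_snd_le v)) hΨ.contDiffAt (by simpa [hL] using h)
  simp only [add_zero, hL] at this
  exact this

theorem Adm.permTest {n : ℕ} {Ψ : Config d m → ℝ} (h : Adm n Ψ) (π : Equiv.Perm (Fin m)) :
    Adm n (permTest π Ψ) := by
  refine ⟨h.smooth.comp (by fun_prop), fun ρ => ?_⟩
  obtain ⟨M, hM, hb⟩ := h.bound ρ
  exact ⟨M, hM, fun p hp => DB_permTest one_pos π h.smooth (hb (p.1, fun q => p.2 (π.symm q)) fun q => hp _)⟩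

theorem Bdd.perm {n : ℕ} {ℓ ρ c : ℝ} {U : (Config d m → ℝ) → ℝ} (hℓ : 0 < ℓ) (h : Bdd n ℓ ρ c U)
    (π : Equiv.Perm (Fin m)) : Bdd n ℓ ρ c fun Ψ => U (permTest π Ψ) :=
  fun _ M hΨ hM hb => h _ M (hΨ.permTest π) hM fun p hp =>
    DB_permTest hℓ π hΨ.smooth (hb (p.1, fun q => p.2 (π.symm q)) fun q => hp _)

theorem Bdd.congr {n : ℕ} {ℓ ρ c : ℝ} {U U' : (Config d m → ℝ) → ℝ} (h : Bdd n ℓ ρ c U)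
    (hU : ∀ Ψ, Adm 0 Ψ → U' Ψ = U Ψ) : Bdd n ℓ ρ c U' := fun Ψ M hΨ hM hb => by
  rw [hU Ψ (hΨ.of_le (Nat.zero_le n))]
  exact h Ψ M hΨ hM hb

theorem Bdd.zero {n : ℕ} {ℓ ρ : ℝ} : Bdd n ℓ ρ 0 fun _ : Config d m → ℝ => 0 :=
  fun Ψ M _ _ _ => by simp

theorem Bdd.add {n : ℕ} {ℓ ρ c c' : ℝ} {U U' : (Config d m → ℝ) → ℝ} (h : Bdd n ℓ ρ c U)
    (h' : Bdd n ℓ ρ c' U') : Bdd n ℓ ρ (c + c') fun Ψ => U Ψ + U' Ψ := fun Ψ M hΨ hM hb => by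
  rw [add_mul]
  exact (abs_add_le _ _).trans (add_le_add (h Ψ M hΨ hM hb) (h' Ψ M hΨ hM hb))

theorem Bdd.const_mul {n : ℕ} {ℓ ρ c : ℝ} {U : (Config d m → ℝ) → ℝ} (h : Bdd n ℓ ρ c U) (b : ℝ) :
    Bdd n ℓ ρ (|b| * c) fun Ψ => b * U Ψ := fun Ψ M hΨ hM hb => by
  rw [abs_mul, mul_assoc]
  exact mul_le_mul_of_nonneg_left (h Ψ M hΨ hM hb) (abs_nonneg b)

/-- `pairB` depends only on the values of the functionals at admissible test functions. -/
theorem pairB_congr {k : ℕ} {r C : ℝ} (hr : 0 ≤ r) {H : Space d → ℝ} (hH : IsLocal 0 1 r C H)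
    {W W' : (Config d (k + 1) → ℝ) → ℝ} {U U' : (Config d (m - k) → ℝ) → ℝ}
    (hW : ∀ Ψ, Adm 0 Ψ → W Ψ = W' Ψ) (hU : ∀ Ψ, Adm 0 Ψ → U Ψ = U' Ψ) (hU' : IsAct U')
    {Ψ : Config d m → ℝ} (hΨ : Adm 0 Ψ) : pairB k H W U Ψ = pairB k H W' U' Ψ := by
  obtain ⟨K, a, A, ha, hA, -, hK⟩ := hU'
  have hJ := admFam_pairJ (m := m) (k := k) hr hH hΨ
  have e : ∀ p, U (fun q => pairJ k H Ψ (p, q)) = K.act a fun q => pairJ k H Ψ (p, q) := fun p =>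
    (hU _ (hJ.adm p)).trans (hK _ (hJ.adm p))
  have e' : ∀ p, U' (fun q => pairJ k H Ψ (p, q)) = K.act a fun q => pairJ k H Ψ (p, q) :=
    fun p => hK _ (hJ.adm p)
  rw [pairB_eq, pairB_eq]
  simp only [e, e']
  exact hW _ (adm_act_pairJ hr one_pos hH hΨ ha hA)

theorem Bdd.pairB_isAct {n nU k : ℕ} {ℓ r C ρ ρ' c c' : ℝ} {H : Space d → ℝ} (hℓ : 0 < ℓ)
    (hr : 0 ≤ r) (hH : IsLocal (nU + n) ℓ r C H) (hρ' : 0 ≤ ρ') (hc : 0 ≤ c)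
    {W : (Config d (k + 1) → ℝ) → ℝ} {U : (Config d (m - k) → ℝ) → ℝ} (hUa : IsAct U)
    (hU : Bdd nU ℓ ρ' c U) (hW : Bdd n ℓ ρ c' W) :
    Bdd (nU + n) ℓ (ρ + r + ρ') (c' * (c * (ballVol d r * (4 ^ (nU + n) * C))))
      (EllipticFlow.pairB k H W U) := by
  have hUa' := hUa
  obtain ⟨K, a, A, ha, hA, -, hK⟩ := hUa'
  have h1 := Bdd.pairB hℓ hr hH ha hA hρ' hc (hU.congr fun Ψ hΨ => (hK Ψ hΨ).symm) hW
  have hC : 0 ≤ C := (hH.bound 0).nonneg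
  have hH0 : IsLocal 0 1 r (max 1 ℓ⁻¹ ^ (nU + n) * C) H :=
    ⟨(hH.smooth.of_le (by simp)), fun w => ((hH.rescale hℓ).bound w).of_le (Nat.zero_le _), hH.supp⟩
  refine h1.congr fun Ψ hΨ => ?_
  rw [pairB_eq, pairB_eq]
  congr 1
  ext p
  exact hK _ ((admFam_pairJ (m := m) (k := k) hr hH0 hΨ).adm p)

end Rep

/-! ### The effective force coefficients have densities -/

section EffRep

open BoundedContinuousFunction

variable {d m : ℕ}

theorem fderiv_fderiv_swap {E : Type*} [NormedAddCommGroup E] [NormedSpace ℝ E] {f : E → ℝ} {z : E}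
    (h : ContDiffAt ℝ 2 f z) (a b : E) :
    fderiv ℝ (fun z => fderiv ℝ f z a) z b = fderiv ℝ (fun z => fderiv ℝ f z b) z a := by
  have hd : DifferentiableAt ℝ (fderiv ℝ f) z :=
    (h.fderiv_right (m := 1) (by norm_num)).differentiableAt (by simp)
  have key : ∀ a b : E, fderiv ℝ (fun z => fderiv ℝ f z a) z b = fderiv ℝ (fderiv ℝ f) z b a := by
    intro a b
    have := (hd.hasFDerivAt.clm_apply (hasFDerivAt_const a z)).fderiv
    rw [this]; simp
  rw [key, key]
  exact h.isSymmSndFDerivAt (by simp) b a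

theorem SmoothFamily.deriv_dir {F : ℝ → ℝ → Space d → ℝ} (hF : SmoothFamily F) {κ η : ℝ}
    (hκ : κ ∈ Ioo (0 : ℝ) 1) (hη : η < 1) (w v : Space d) :
    deriv (fun κ' => fderiv ℝ (F κ' η) w v) κ =
      fderiv ℝ (fun w => deriv (fun κ' => F κ' η w) κ) w v := by
  set f : ℝ × Space d → ℝ := fun z => F z.1 η z.2 with hf
  have hfs : ∀ κ' ∈ Ioo (0 : ℝ) 1, ∀ w', ContDiffAt ℝ 2 f (κ', w') := fun κ' hκ' w' =>
    ContDiffAt.comp (κ', w') (f := fun z : ℝ × Space d => (z.1, η, z.2))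
      (hF.smooth 2 κ' hκ' η hη w') (by fun_prop)
  have hfd : ∀ κ' ∈ Ioo (0 : ℝ) 1, ∀ w', DifferentiableAt ℝ f (κ', w') := fun κ' hκ' w' =>
    (hfs κ' hκ' w').differentiableAt (by simp)
  have h1 : ∀ κ' w', HasFDerivAt (fun w : Space d => (κ', w))
      (ContinuousLinearMap.inr ℝ ℝ (Space d)) w' := fun κ' w' => hasFDerivAt_prodMk_right κ' w'
  have h2 : ∀ κ' w', HasDerivAt (fun κ' : ℝ => (κ', w')) ((1, 0) : ℝ × Space d) κ' := fun κ' w' =>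
    (hasDerivAt_id κ').prodMk (hasDerivAt_const κ' w')
  have e1 : ∀ κ' ∈ Ioo (0 : ℝ) 1, ∀ w', fderiv ℝ (F κ' η) w' v = fderiv ℝ f (κ', w') (0, v) := by
    intro κ' hκ' w'
    have := ((hfd κ' hκ' w').hasFDerivAt.comp w' (h1 κ' w')).fderiv
    rw [show F κ' η = f ∘ fun w => (κ', w) from rfl, this]
    simp
  have e2 : ∀ w', deriv (fun κ' => F κ' η w') κ = fderiv ℝ f (κ, w') (1, 0) := fun w' =>
    (HasFDerivAt.comp_hasDerivAt (f := fun κ' => (κ', w')) κ (hfd κ hκ w').hasFDerivAt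
      (h2 κ w')).deriv
  have e3 : (fun κ' => fderiv ℝ (F κ' η) w v) =ᶠ[nhds κ] fun κ' => fderiv ℝ f (κ', w) (0, v) := by
    filter_upwards [Ioo_mem_nhds hκ.1 hκ.2] with κ' hκ'
    exact e1 κ' hκ' w
  have hd : ∀ a, DifferentiableAt ℝ (fun z => fderiv ℝ f z a) (κ, w) := fun a =>
    (contDiffAt_dir (n := 1) (hfs κ hκ w) a).differentiableAt (by simp)
  have h5 : HasDerivAt (fun κ' => fderiv ℝ f (κ', w) (0, v))
      (fderiv ℝ (fun z => fderiv ℝ f z (0, v)) (κ, w) (1, 0)) κ :=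
    HasFDerivAt.comp_hasDerivAt (f := fun κ' => (κ', w)) κ (hd (0, v)).hasFDerivAt (h2 κ w)
  have h6 : fderiv ℝ (fun w => fderiv ℝ f (κ, w) (1, 0)) w v =
      fderiv ℝ (fun z => fderiv ℝ f z (1, 0)) (κ, w) (0, v) := by
    have := ((hd (1, 0)).hasFDerivAt.comp w (h1 κ w)).fderiv
    rw [show (fun w => fderiv ℝ f (κ, w) (1, 0)) = (fun z => fderiv ℝ f z (1, 0)) ∘
      fun w => (κ, w) from rfl, this]
    simp
  rw [e3.deriv_eq, h5.deriv]
  simp only [e2]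
  rw [h6, fderiv_fderiv_swap (hfs κ hκ w)]

namespace SmoothFamily

variable {F : ℝ → ℝ → Space d → ℝ}

theorem resolventInv (hF : SmoothFamily F) (ℓ : ℝ) :
    SmoothFamily fun κ η => resolventInv ℓ (F κ η) := by
  have e : (fun κ η => EllipticFlow.resolventInv ℓ (F κ η)) =
      fun κ η w => F κ η w + -ℓ ^ 2 * EllipticFlow.lap (F κ η) w := by
    ext κ η w
    simp only [EllipticFlow.resolventInv]; ring
  rw [e]
  exact hF.add (hF.lap.const_mul (-ℓ ^ 2))

theorem resolventInv_iterate (hF : SmoothFamily F) (ℓ : ℝ) (g : ℕ) :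
    SmoothFamily fun κ η => (EllipticFlow.resolventInv ℓ)^[g] (F κ η) := by
  induction g generalizing F with
  | zero => exact hF
  | succ g ih => exact ih (hF.resolventInv ℓ)

theorem deriv_lap (hF : SmoothFamily F) {κ η : ℝ} (hκ : κ ∈ Ioo (0 : ℝ) 1) (hη : η < 1)
    (w : Space d) : deriv (fun κ' => EllipticFlow.lap (F κ' η) w) κ =
      EllipticFlow.lap (fun w => deriv (fun κ' => F κ' η w) κ) w := by
  unfold EllipticFlow.lap
  rw [deriv_fun_sum fun l _ => (((hF.dir (unitVec d l)).dir (unitVec d l)).hasDerivAt hκ hη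
    w).differentiableAt]
  refine Finset.sum_congr rfl fun l _ => ?_
  rw [(hF.dir (unitVec d l)).deriv_dir hκ hη]
  congr 2
  ext w'
  exact hF.deriv_dir hκ hη w' _

theorem deriv_resolventInv (hF : SmoothFamily F) (ℓ : ℝ) {κ η : ℝ} (hκ : κ ∈ Ioo (0 : ℝ) 1)
    (hη : η < 1) (w : Space d) : deriv (fun κ' => EllipticFlow.resolventInv ℓ (F κ' η) w) κ =
      EllipticFlow.resolventInv ℓ (fun w => deriv (fun κ' => F κ' η w) κ) w := by
  unfold EllipticFlow.resolventInv
  have h1 := hF.hasDerivAt hκ hη w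
  have h2 := hF.lap.hasDerivAt hκ hη w
  rw [hF.deriv_lap hκ hη w] at h2
  exact (h1.sub (h2.const_mul (ℓ ^ 2))).deriv

theorem deriv_resolventInv_iterate (hF : SmoothFamily F) (ℓ : ℝ) (g : ℕ) {κ η : ℝ}
    (hκ : κ ∈ Ioo (0 : ℝ) 1) (hη : η < 1) (w : Space d) :
    deriv (fun κ' => (EllipticFlow.resolventInv ℓ)^[g] (F κ' η) w) κ =
      (EllipticFlow.resolventInv ℓ)^[g] (fun w => deriv (fun κ' => F κ' η w) κ) w := by
  induction g generalizing F with
  | zero => rfl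
  | succ g ih =>
    simp only [Function.iterate_succ_apply]
    rw [ih (hF.resolventInv ℓ)]
    exact congrArg (fun φ => (EllipticFlow.resolventInv ℓ)^[g] φ w)
      (funext fun w' => hF.deriv_resolventInv ℓ hκ hη w')

theorem exists_isLocal (hF : SmoothFamily F) {κ η : ℝ} (hκ : κ ∈ Ioo (0 : ℝ) 1)
    (hη : η ∈ Icc (0 : ℝ) (3 / 4)) : ∃ r C, 0 ≤ r ∧ IsLocal 0 1 r C (F κ η) := by
  obtain ⟨ρ, hρ⟩ := hF.supp
  obtain ⟨C, hC, hb⟩ := hF.exists_bound hκ.1 hκ.2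
  exact ⟨max ρ 0, C, le_max_right _ _, hF.contDiff_right hκ (by linarith [hη.2]) 0,
    fun w => hb κ ⟨le_rfl, le_rfl⟩ η hη w, fun w hw =>
    hρ κ hκ η hη.2 w ((le_max_left _ _).trans_lt hw)⟩

end SmoothFamily

namespace Rep

variable {F : ℝ → ℝ → (Config d m → ℝ) → ℝ}

theorem perm (h : Rep F) (π : Equiv.Perm (Fin m)) : Rep fun κ η Ψ => F κ η (permTest π Ψ) := by
  obtain ⟨V, hV⟩ := h
  exact ⟨V.perm π, fun κ hκ η hη Ψ hΨ => hV κ hκ η hη _ (hΨ.permTest π)⟩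

theorem exists_continuous (h : Rep F) : ∃ f f' : ℝ → ℝ → (Config d m → ℝ) → ℝ,
    (∀ κ Ψ, Adm 0 Ψ → Continuous fun η => f κ η Ψ) ∧
    (∀ κ Ψ, Adm 0 Ψ → Continuous fun η => f' κ η Ψ) ∧
    (∀ κ ∈ Ioc (0 : ℝ) (1 / 2), ∀ η ∈ Ioc (0 : ℝ) (3 / 4), ∀ Ψ, Adm 0 Ψ →
      F κ η Ψ = f κ η Ψ ∧ cutDeriv F κ η Ψ = f' κ η Ψ) := by
  obtain ⟨V, hV⟩ := h
  have key : ∀ (a : (ℝ × (Space d × V.K.Ω)) →ᵇ ℝ) (Ψ : Config d m → ℝ), Adm 0 Ψ →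
      Continuous fun η => V.K.act (fun t => a (η, t)) Ψ := by
    intro a Ψ hΨ
    have hc := hΨ.smooth.continuous
    have h1 := Kern.integrable (k := V.K) hΨ (a := fun _ => 1) continuous_const (A := 1) (by simp)
    simp only [one_mul] at h1
    refine continuous_of_dominated (F := fun η t => a (η, t) * Ψ (V.K.point t))
      (bound := fun t => ‖a‖ * ‖Ψ (V.K.point t)‖)
      (fun η => Continuous.aestronglyMeasurable (by fun_prop)) (fun η => ?_) (h1.norm.const_mul _)
      (Filter.Eventually.of_forall fun t => by fun_prop)
    refine Filter.Eventually.of_forall fun t => ?_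
    rw [norm_mul]
    exact mul_le_mul_of_nonneg_right (a.norm_coe_le_norm _) (norm_nonneg _)
  exact ⟨V.act, V.act', fun κ => key (V.A κ), fun κ => key (V.A' κ), fun κ hκ η hη Ψ hΨ =>
    ⟨hV κ hκ η hη Ψ hΨ, cutDeriv_eq hV hκ hη hΨ⟩⟩

theorem integral (h : Rep F) : Rep fun κ μ Ψ => ∫ η in (0 : ℝ)..μ, F κ η Ψ := by
  obtain ⟨V, hV⟩ := h
  refine ⟨V.integral, fun κ hκ μ hμ Ψ hΨ => ?_⟩
  rw [V.act_integral κ ⟨hμ.1.le, hμ.2⟩ hΨ]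
  beta_reduce
  rw [intervalIntegral.integral_of_le hμ.1.le, intervalIntegral.integral_of_le hμ.1.le]
  exact setIntegral_congr_fun measurableSet_Ioc fun η hη =>
    hV κ hκ η ⟨hη.1, hη.2.trans hμ.2⟩ Ψ hΨ

theorem cutDeriv_integral (h : Rep F) {κ μ : ℝ} (hκ : κ ∈ Ioc (0 : ℝ) (1 / 2))
    (hμ : μ ∈ Ioc (0 : ℝ) (3 / 4)) {Ψ : Config d m → ℝ} (hΨ : Adm 0 Ψ) :
    cutDeriv (fun κ μ Ψ => ∫ η in (0 : ℝ)..μ, F κ η Ψ) κ μ Ψ =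
      ∫ η in (0 : ℝ)..μ, cutDeriv F κ η Ψ := by
  obtain ⟨V, hV⟩ := h
  rw [cutDeriv_eq (V := V.integral) _ hκ hμ hΨ, V.act'_integral κ ⟨hμ.1.le, hμ.2⟩ hΨ]
  · rw [intervalIntegral.integral_of_le hμ.1.le, intervalIntegral.integral_of_le hμ.1.le]
    exact setIntegral_congr_fun measurableSet_Ioc fun η hη =>
      (cutDeriv_eq hV hκ ⟨hη.1, hη.2.trans hμ.2⟩ hΨ).symm
  · intro κ hκ μ hμ Ψ hΨ
    rw [V.act_integral κ ⟨hμ.1.le, hμ.2⟩ hΨ, intervalIntegral.integral_of_le hμ.1.le,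
      intervalIntegral.integral_of_le hμ.1.le]
    exact setIntegral_congr_fun measurableSet_Ioc fun η hη =>
      hV κ hκ η ⟨hη.1, hη.2.trans hμ.2⟩ Ψ hΨ

theorem pairB {k : ℕ} {W : ℝ → ℝ → (Config d (k + 1) → ℝ) → ℝ}
    {U : ℝ → ℝ → (Config d (m - k) → ℝ) → ℝ} (hW : Rep W) (hU : Rep U) {F : ℝ → ℝ → Space d → ℝ}
    (hF : SmoothFamily F) :
    Rep (fun κ η => EllipticFlow.pairB (m := m) k (F κ η) (W κ η) (U κ η)) ∧
    ∀ κ ∈ Ioc (0 : ℝ) (1 / 2), ∀ η ∈ Ioc (0 : ℝ) (3 / 4), ∀ Ψ, Adm 0 Ψ →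
      cutDeriv (fun κ η => EllipticFlow.pairB (m := m) k (F κ η) (W κ η) (U κ η)) κ η Ψ =
        EllipticFlow.pairB k (F κ η) (cutDeriv W κ η) (U κ η) Ψ +
        EllipticFlow.pairB k (fun w => deriv (fun κ' => F κ' η w) κ) (W κ η) (U κ η) Ψ +
        EllipticFlow.pairB k (F κ η) (W κ η) (cutDeriv U κ η) Ψ := by
  have hUr := hU
  have hWr := hW
  obtain ⟨VW, hW⟩ := hW
  obtain ⟨VU, hU⟩ := hU
  obtain ⟨r, hr⟩ := hF.supp
  obtain ⟨r', hr'⟩ := hF.param.supp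
  have hκ1 : ∀ κ ∈ Ioc (0 : ℝ) (1 / 2), κ ∈ Ioo (0 : ℝ) 1 := fun κ hκ =>
    ⟨hκ.1, by linarith [hκ.2]⟩
  have h1 : ∀ κ ∈ Ioc (0 : ℝ) (1 / 2), ∀ η ∈ Icc (0 : ℝ) (3 / 4), ∀ w, max r r' < ‖w‖ →
      F κ η w = 0 := fun κ hκ η hη w hw => hr κ (hκ1 κ hκ) η hη.2 w ((le_max_left _ _).trans_lt hw)
  have h1' : ∀ κ ∈ Ioc (0 : ℝ) (1 / 2), ∀ η ∈ Icc (0 : ℝ) (3 / 4), ∀ w, max r r' < ‖w‖ →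
      deriv (fun κ' => F κ' η w) κ = 0 := fun κ hκ η hη w hw =>
    hr' κ (hκ1 κ hκ) η hη.2 w ((le_max_right _ _).trans_lt hw)
  have key : ∀ κ ∈ Ioc (0 : ℝ) (1 / 2), ∀ η ∈ Ioc (0 : ℝ) (3 / 4), ∀ Ψ, Adm 0 Ψ →
      EllipticFlow.pairB (m := m) k (F κ η) (W κ η) (U κ η) Ψ =
        (CKern.pairB VW VU hF (max r r')).act κ η Ψ := by
    intro κ hκ η hη Ψ hΨ
    obtain ⟨r₁, C, hr₁, hL⟩ := hF.exists_isLocal (hκ1 κ hκ) ⟨hη.1.le, hη.2⟩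
    rw [CKern.act_pairB VW VU hF h1 hκ ⟨hη.1.le, hη.2⟩ hΨ]
    exact pairB_congr hr₁ hL (hW κ hκ η hη) (hU κ hκ η hη) (Rep.isAct ⟨VU, fun _ _ _ _ _ _ => rfl⟩
      hκ hη) hΨ
  refine ⟨⟨_, key⟩, fun κ hκ η hη Ψ hΨ => ?_⟩
  obtain ⟨r₁, C, hr₁, hL⟩ := hF.exists_isLocal (hκ1 κ hκ) ⟨hη.1.le, hη.2⟩
  obtain ⟨r₂, C', hr₂, hL'⟩ := hF.param.exists_isLocal (hκ1 κ hκ) ⟨hη.1.le, hη.2⟩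
  rw [cutDeriv_eq key hκ hη hΨ, CKern.act'_pairB VW VU hF h1 h1' hκ ⟨hη.1.le, hη.2⟩ hΨ]
  have dW : ∀ Ψ, Adm 0 Ψ → VW.act' κ η Ψ = cutDeriv W κ η Ψ := fun Ψ hΨ =>
    (cutDeriv_eq hW hκ hη hΨ).symm
  have dU : ∀ Ψ, Adm 0 Ψ → VU.act' κ η Ψ = cutDeriv U κ η Ψ := fun Ψ hΨ =>
    (cutDeriv_eq hU hκ hη hΨ).symm
  have aW : ∀ Ψ, Adm 0 Ψ → VW.act κ η Ψ = W κ η Ψ := fun Ψ hΨ => (hW κ hκ η hη Ψ hΨ).symm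
  have aU : ∀ Ψ, Adm 0 Ψ → VU.act κ η Ψ = U κ η Ψ := fun Ψ hΨ => (hU κ hκ η hη Ψ hΨ).symm
  rw [pairB_congr hr₁ hL dW aU (hUr.isAct hκ hη) hΨ, pairB_congr hr₂ hL' aW aU (hUr.isAct hκ hη) hΨ,
    pairB_congr hr₁ hL aW dU (hUr.isAct_cutDeriv hκ hη) hΨ]

end Rep

/-- The functional with density `v` on the diagonal. -/
def diagFun (m : ℕ) (v : Space d → ℝ) (Ψ : Config d m → ℝ) : ℝ := ∫ x, v x * Ψ (x, fun _ => x)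

theorem rep_diagFun {v : Space d → ℝ} {B : ℝ} (hv : Continuous v) (hB : ∀ x, |v x| ≤ B)
    (hp : ∀ n x, v (x + latticePoint n) = v x) {c : ℝ → ℝ}
    (hc : DifferentiableOn ℝ c (Ioc 0 (1 / 2))) : Rep fun κ _ => fun Ψ => c κ * diagFun m v Ψ := by
  let a : (ℝ × (Space d × Unit)) →ᵇ ℝ :=
    ofNormedAddCommGroup (fun p => v p.2.1) (by fun_prop) B fun p => hB _
  refine ⟨⟨Kern.point₀ d m, fun κ => c κ • a, fun κ => derivWithin c (Ioc 0 (1 / 2)) κ • a,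
    fun κ hκ => (hc κ hκ).hasDerivWithinAt.smul_const a, fun κ hκ η n x ω => ?_⟩,
    fun κ hκ η hη Ψ hΨ => ?_⟩
  · show c κ * v (x + latticePoint n) = c κ * v x
    rw [hp]
  · have h1 := Kern.act_density_const_mul (k := Kern.point₀ d m) (c κ) (fun t => v t.1) Ψ
    have h2 := Kern.act_point₀ (m := m) (fun t => v t.1) Ψ
    exact (h1.trans (congrArg (c κ * ·) h2)).symm

theorem bdd_diagFun {v : Space d → ℝ} {B ℓ ρ : ℝ} (hρ : 0 ≤ ρ) (hB : ∀ x, |v x| ≤ B) :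
    Bdd 0 ℓ ρ B (diagFun m v) := by
  intro Ψ M _ hM hb
  rw [← integral_const_mul]
  refine norm_integral_le_of_norm_le (f := fun x => v x * Ψ (x, fun _ => x))
    (hM.integrable.const_mul B) (Filter.Eventually.of_forall fun x => ?_)
  rw [norm_mul]
  exact mul_le_mul (hB x) (hb (x, fun _ => x) fun q => by simpa using hρ).abs_le (norm_nonneg _)
    ((abs_nonneg _).trans (hB x))

/-- `ξ = (1 - ℓ² Δ)^g v`. -/
structure IsNoise (ξ : Distr d) (g : ℕ) (ℓ B : ℝ) (v : Space d → ℝ) : Prop where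
  cont : Continuous v
  bound : ∀ x, |v x| ≤ B
  periodic : ∀ n x, v (x + latticePoint n) = v x
  eq : ∀ φ : Space d → ℝ, (∀ n : ℕ, ContDiff ℝ n φ) → HasCompactSupport φ →
    pair ξ φ = ∫ x, v x * (resolventInv ℓ)^[g] φ x

theorem lap_comp_sub {φ : Space d → ℝ} (hφ : ContDiff ℝ (2 : ℕ) φ) (b : ℝ) (y x : Space d) :
    lap (fun x => φ (y - x) * b) x = lap φ (y - x) * b := by
  have h0 : ∀ (f : Space d → ℝ) (_ : Differentiable ℝ f) (b : ℝ) (x v : Space d),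
      fderiv ℝ (fun x => f (y - x) * b) x v = fderiv ℝ f (y - x) v * (-b) := by
    intro f hf b x v
    have h1 := ((hf (y - x)).hasFDerivAt.comp x ((hasFDerivAt_id x).const_sub y)).mul_const b
    rw [show (fun x => f (y - x) * b) = fun x => (f ∘ HSub.hSub y) x * b from rfl, h1.fderiv]
    simp [mul_comm]
  unfold lap
  rw [Finset.sum_mul]
  refine Finset.sum_congr rfl fun l _ => ?_
  have h1 : (fun x => fderiv ℝ (fun x => φ (y - x) * b) x (unitVec d l)) =
      fun x => (fun z => fderiv ℝ φ z (unitVec d l)) (y - x) * (-b) := by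
    ext x
    exact h0 φ (hφ.differentiable (by simp)) b x _
  rw [h1, h0 (fun z => fderiv ℝ φ z (unitVec d l))
    ((contDiff_dir (n := 1) hφ _).differentiable (by simp)), neg_neg]

theorem resolventInv_comp_sub {φ : Space d → ℝ} (hφ : ∀ n : ℕ, ContDiff ℝ n φ) (ℓ b : ℝ) (g : ℕ)
    (y : Space d) : (resolventInv ℓ)^[g] (fun x => φ (y - x) * b) =
      fun x => (resolventInv ℓ)^[g] φ (y - x) * b := by
  induction g generalizing φ with
  | zero => rfl
  | succ g ih =>
    simp only [Function.iterate_succ_apply]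
    rw [← ih fun n => contDiff_resolventInv (hφ (n + 2))]
    congr 1
    ext x
    simp only [resolventInv, lap_comp_sub (hφ 2)]
    ring

theorem joinVars_self (y : Fin (m + 1) → Space d) (u u' : Fin (m - m) → Space d) :
    joinVars m y u = joinVars m y u' := by
  funext p
  simp [joinVars, p.2]

theorem pairB_noise {ξ : Distr d} {g : ℕ} {ℓ B : ℝ} {v : Space d → ℝ} (hv : IsNoise ξ g ℓ B v)
    (σ : ℝ) (χ : ℝ → ℝ) (c : ℕ → ℝ → ℝ) (κ η : ℝ) {H : Space d → ℝ} (hH : ∀ n : ℕ, ContDiff ℝ n H)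
    (hs : HasCompactSupport H) (W : (Config d (m + 1) → ℝ) → ℝ) (Ψ : Config d m → ℝ) :
    pairB m H W (effForce σ χ ξ c κ 0 (m - m) η) Ψ =
      pairB m ((resolventInv ℓ)^[g] H) W (diagFun (m - m) v) Ψ := by
  unfold pairB
  congr 1
  ext p
  rw [effForce, dif_neg (by omega), dif_pos rfl]
  have e : ∀ u : Fin (m - m) → Space d, joinVars m p.2 u = joinVars m p.2 fun _ => 0 := fun u =>
    joinVars_self _ _ _
  simp only [e, diagFun]
  rw [hv.eq]
  · rw [resolventInv_comp_sub hH]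
  · exact fun n => ((hH n).comp (contDiff_const.sub contDiff_id)).mul contDiff_const
  · exact (hs.comp_homeomorph (Homeomorph.subLeft (p.2 0))).mul_right

end EffRep

/-! ### The flow equation -/

section Flow

variable {d : ℕ} {σ : ℝ} {χ : ℝ → ℝ} {ξ : Distr d} {c : ℕ → ℝ → ℝ}

variable (σ χ ξ c) in
/-- A term of the flow equation. -/
def flowTerm (i m j k : ℕ) (κ η : ℝ) : (Config d m → ℝ) → ℝ :=
  pairB k (dPropagator d σ χ κ η) (effForce σ χ ξ c κ j (k + 1) η)
    (effForce σ χ ξ c κ (i - j) (m - k) η)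

variable (σ χ ξ c) in
/-- The right-hand side of the flow equation. -/
def flowRhs (i m : ℕ) (κ η : ℝ) (Ψ : Config d m → ℝ) : ℝ :=
  -(1 / (m.factorial : ℝ)) * ∑ π : Equiv.Perm (Fin m), ∑ j ∈ Finset.range (i + 1),
    ∑ k ∈ Finset.range (m + 1), (1 + (k : ℝ)) * flowTerm σ χ ξ c i m j k κ η (permTest π Ψ)

theorem effForce_eq_flowRhs {i m : ℕ} (hi : 0 < i) (hm : m ≤ 3 * i) (κ μ : ℝ)
    (Ψ : Config d m → ℝ) : effForce σ χ ξ c κ i m μ Ψ =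
      force σ ξ c κ i m Ψ + ∫ η in (0 : ℝ)..μ, flowRhs σ χ ξ c i m κ η Ψ :=
  effForce_eq σ χ ξ c κ i m hi hm μ Ψ

theorem effForce_of_lt {i m : ℕ} (hm : 3 * i < m) (κ μ : ℝ) :
    effForce σ χ ξ c κ i m μ = fun _ => 0 := by
  funext Ψ
  rw [effForce, dif_pos hm]

theorem flowTerm_of_zero {i m j k : ℕ} (h : j = 0 ∨ (j = i ∧ k < m)) (κ η : ℝ)
    (Ψ : Config d m → ℝ) : flowTerm σ χ ξ c i m j k κ η Ψ = 0 := by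
  rcases h with rfl | ⟨rfl, h⟩
  · simp [flowTerm, pairB, effForce_zero_left]
  · simp [flowTerm, pairB, effForce_zero_left _ _ _ _ _ (m - k) (Nat.sub_pos_of_lt h),
      effForce_const_zero]

theorem extPropagator_eq {κ η : ℝ} (hη : 0 < η) :
    extPropagator d σ χ κ η = dPropagator d σ χ κ η := by
  ext w
  rw [extPropagator, if_neg (not_le.2 hη)]

theorem deriv_extPropagator (hχ : IsCutoff χ) {κ η : ℝ} (hκ : 0 < κ) (hη : 0 < η) :
    (fun w => deriv (fun κ' => extPropagator d σ χ κ' η w) κ) = ddPropagator d σ χ κ η := by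
  ext w
  simp only [extPropagator_eq hη]
  exact (hasDerivAt_dPropagator hχ hκ.ne' hη.ne' w).deriv

theorem SmoothFamily.hasCompactSupport {F : ℝ → ℝ → Space d → ℝ} (hF : SmoothFamily F) {κ η : ℝ}
    (hκ : κ ∈ Ioo (0 : ℝ) 1) (hη : η ≤ 3 / 4) : HasCompactSupport (F κ η) := by
  obtain ⟨ρ, hρ⟩ := hF.supp
  exact HasCompactSupport.intro (isCompact_closedBall (0 : Space d) ρ) fun w hw =>
    hρ κ hκ η hη w (by simpa using hw)

section

variable (hd : 0 < d) (hσ : 0 < σ) (hσd : σ < d) (hχ : IsCutoff χ)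

include hd hσ hσd hχ

theorem flowTerm_noise {g : ℕ} {ℓ B : ℝ} {v : Space d → ℝ} (hv : IsNoise ξ g ℓ B v) (i m : ℕ)
    {κ η : ℝ} (hκ : κ ∈ Ioc (0 : ℝ) (1 / 2)) (hη : η ∈ Ioc (0 : ℝ) (3 / 4)) (Ψ : Config d m → ℝ) :
    flowTerm σ χ ξ c i m i m κ η Ψ = pairB m ((resolventInv ℓ)^[g] (extPropagator d σ χ κ η))
      (effForce σ χ ξ c κ i (m + 1) η) (diagFun (m - m) v) Ψ := by
  have hF := smoothFamily_extPropagator hd hσ hσd hχ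
  have hκ1 : κ ∈ Ioo (0 : ℝ) 1 := ⟨hκ.1, by linarith [hκ.2]⟩
  rw [flowTerm, Nat.sub_self i, ← extPropagator_eq hη.1]
  exact pairB_noise hv σ χ c κ η (fun n => hF.contDiff_right hκ1 (by linarith [hη.2]) n)
    (hF.hasCompactSupport hκ1 hη.2) _ Ψ

theorem rep_flowTerm_noise {g : ℕ} {ℓ B : ℝ} {v : Space d → ℝ} (hv : IsNoise ξ g ℓ B v) {i m : ℕ}
    (hW : Rep fun κ η => effForce σ χ ξ c κ i (m + 1) η) :
    Rep (flowTerm σ χ ξ c i m i m) ∧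
    ∀ κ ∈ Ioc (0 : ℝ) (1 / 2), ∀ η ∈ Ioc (0 : ℝ) (3 / 4), ∀ Ψ, Adm 0 Ψ →
      cutDeriv (flowTerm σ χ ξ c i m i m) κ η Ψ =
        pairB m ((resolventInv ℓ)^[g] (dPropagator d σ χ κ η))
          (cutDeriv (fun κ η => effForce σ χ ξ c κ i (m + 1) η) κ η) (diagFun (m - m) v) Ψ +
        pairB m ((resolventInv ℓ)^[g] (ddPropagator d σ χ κ η))
          (effForce σ χ ξ c κ i (m + 1) η) (diagFun (m - m) v) Ψ := by
  have hF := (smoothFamily_extPropagator hd hσ hσd hχ)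
  have hU : Rep (d := d) fun _ _ => diagFun (m - m) v := by
    have := rep_diagFun (m := m - m) hv.cont hv.bound hv.periodic (c := fun _ => 1)
      (differentiableOn_const _)
    simpa using this
  have key := Rep.pairB (m := m) hW hU (hF.resolventInv_iterate ℓ g)
  refine ⟨key.1.congr fun κ hκ η hη Ψ _ => flowTerm_noise hd hσ hσd hχ hv i m hκ hη Ψ,
    fun κ hκ η hη Ψ hΨ => ?_⟩
  have hκ1 : κ ∈ Ioo (0 : ℝ) 1 := ⟨hκ.1, by linarith [hκ.2]⟩
  have e1 : cutDeriv (flowTerm σ χ ξ c i m i m) κ η Ψ = cutDeriv (fun κ η => pairB m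
      ((resolventInv ℓ)^[g] (extPropagator d σ χ κ η)) (effForce σ χ ξ c κ i (m + 1) η)
        (diagFun (m - m) v)) κ η Ψ :=
    derivWithin_congr (fun κ' hκ' => flowTerm_noise hd hσ hσd hχ hv i m hκ' hη Ψ)
      (flowTerm_noise hd hσ hσd hχ hv i m hκ hη Ψ)
  rw [e1, key.2 κ hκ η hη Ψ hΨ, extPropagator_eq hη.1]
  have e2 : (fun w => deriv (fun κ' => (resolventInv ℓ)^[g] (extPropagator d σ χ κ' η) w) κ) =
      (resolventInv ℓ)^[g] (ddPropagator d σ χ κ η) := by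
    rw [← deriv_extPropagator hχ hκ.1 hη.1]
    ext w
    exact hF.deriv_resolventInv_iterate ℓ g hκ1 (by linarith [hη.2]) w
  have e3 : cutDeriv (fun _ _ => diagFun (m - m) v) κ η = fun _ => 0 := by
    ext Ψ'
    simp [cutDeriv]
  rw [e2, e3]
  have e4 : pairB m ((resolventInv ℓ)^[g] (dPropagator d σ χ κ η)) (effForce σ χ ξ c κ i (m + 1) η)
      (fun _ => 0) Ψ = 0 := by
    simp only [pairB, effForce_const_zero]
  rw [e4, add_zero]

theorem rep_flowTerm_inner {i m j k : ℕ} (hW : Rep fun κ η => effForce σ χ ξ c κ j (k + 1) η)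
    (hU : Rep fun κ η => effForce σ χ ξ c κ (i - j) (m - k) η) :
    Rep (flowTerm σ χ ξ c i m j k) ∧
    ∀ κ ∈ Ioc (0 : ℝ) (1 / 2), ∀ η ∈ Ioc (0 : ℝ) (3 / 4), ∀ Ψ, Adm 0 Ψ →
      cutDeriv (flowTerm σ χ ξ c i m j k) κ η Ψ =
        pairB k (dPropagator d σ χ κ η) (cutDeriv (fun κ η => effForce σ χ ξ c κ j (k + 1) η) κ η)
          (effForce σ χ ξ c κ (i - j) (m - k) η) Ψ +
        pairB k (ddPropagator d σ χ κ η) (effForce σ χ ξ c κ j (k + 1) η)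
          (effForce σ χ ξ c κ (i - j) (m - k) η) Ψ +
        pairB k (dPropagator d σ χ κ η) (effForce σ χ ξ c κ j (k + 1) η)
          (cutDeriv (fun κ η => effForce σ χ ξ c κ (i - j) (m - k) η) κ η) Ψ := by
  have hF := (smoothFamily_extPropagator hd hσ hσd hχ)
  have key := Rep.pairB (m := m) hW hU hF
  have e0 : ∀ κ η, 0 < η → ∀ Ψ : Config d m → ℝ, flowTerm σ χ ξ c i m j k κ η Ψ =
      pairB k (extPropagator d σ χ κ η) (effForce σ χ ξ c κ j (k + 1) η)
        (effForce σ χ ξ c κ (i - j) (m - k) η) Ψ := fun κ η hη Ψ => by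
    rw [flowTerm, extPropagator_eq hη]
  refine ⟨key.1.congr fun κ hκ η hη Ψ _ => e0 κ η hη.1 Ψ, fun κ hκ η hη Ψ hΨ => ?_⟩
  have e1 : cutDeriv (flowTerm σ χ ξ c i m j k) κ η Ψ = cutDeriv (fun κ η => pairB k
      (extPropagator d σ χ κ η) (effForce σ χ ξ c κ j (k + 1) η)
        (effForce σ χ ξ c κ (i - j) (m - k) η)) κ η Ψ :=
    derivWithin_congr (fun κ' hκ' => e0 κ' η hη.1 Ψ) (e0 κ η hη.1 Ψ)
  rw [e1, key.2 κ hκ η hη Ψ hΨ, extPropagator_eq hη.1, deriv_extPropagator hχ hκ.1 hη.1]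

theorem rep_flowTerm {g : ℕ} {ℓ B : ℝ} {v : Space d → ℝ} (hv : IsNoise ξ g ℓ B v) {i m j k : ℕ}
    (hj : j ≤ i) (hk : k ≤ m)
    (ih : ∀ i' m', 0 < i' → (i' < i ∨ i' = i ∧ m < m') →
      Rep fun κ η => effForce σ χ ξ c κ i' m' η) : Rep (flowTerm σ χ ξ c i m j k) := by
  rcases Nat.eq_zero_or_pos j with h0 | h0
  · exact Rep.zero.congr fun κ _ η _ Ψ _ => flowTerm_of_zero (Or.inl h0) κ η Ψ
  rcases hj.lt_or_eq with h1 | rfl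
  · exact (rep_flowTerm_inner hd hσ hσd hχ (ih j (k + 1) h0 (Or.inl h1))
      (ih (i - j) (m - k) (by omega) (Or.inl (by omega)))).1
  rcases hk.lt_or_eq with h2 | rfl
  · exact Rep.zero.congr fun κ _ η _ Ψ _ => flowTerm_of_zero (Or.inr ⟨rfl, h2⟩) κ η Ψ
  · exact (rep_flowTerm_noise hd hσ hσd hχ hv (ih j (k + 1) h0 (Or.inr ⟨rfl, by omega⟩))).1

omit hd hσ hσd hχ in
theorem rep_flowRhs_of_terms {i m : ℕ} (h : ∀ j ≤ i, ∀ k ≤ m, Rep (flowTerm σ χ ξ c i m j k)) :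
    Rep (flowRhs σ χ ξ c i m) :=
  (Rep.sum _ fun π _ => Rep.sum _ fun j hj => Rep.sum _ fun k hk =>
    ((h j (by simpa [Nat.lt_succ_iff] using hj) k (by simpa [Nat.lt_succ_iff] using hk)).perm
      π).const_mul (1 + (k : ℝ))).const_mul _

omit hd hσ hσd hχ in
theorem rep_force (hc : ∀ i ∈ Icc 1 (iSharp d σ), DifferentiableOn ℝ (c i) (Ioc 0 (1 / 2)))
    {i m : ℕ} (hi : 0 < i) : Rep fun κ _ => force (d := d) σ ξ c κ i m := by
  have h1 : ∀ {c₀ : ℝ → ℝ}, DifferentiableOn ℝ c₀ (Ioc 0 (1 / 2)) → Rep fun κ _ =>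
      fun Ψ : Config d m → ℝ => c₀ κ * ∫ x : Space d, Ψ (x, fun _ => x) := fun hc₀ => by
    have := rep_diagFun (d := d) (m := m) (v := fun _ => 1) continuous_const (B := 1)
      (fun _ => by simp) (fun _ _ => rfl) hc₀
    simpa only [diagFun, one_mul] using this
  unfold force
  simp only [hi.ne', false_and, if_false]
  split_ifs with h2 h3
  · have := h1 (c₀ := fun _ => 1) (differentiableOn_const _)
    simpa only [one_mul] using this
  · exact h1 (hc i ⟨h3.1.1, h3.1.2⟩)
  · exact Rep.zero

/-- The effective force coefficients have densities. -/
theorem rep_effForce {g : ℕ} {ℓ B : ℝ} {v : Space d → ℝ} (hv : IsNoise ξ g ℓ B v)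
    (hc : ∀ i ∈ Icc 1 (iSharp d σ), DifferentiableOn ℝ (c i) (Ioc 0 (1 / 2))) :
    ∀ i m, 0 < i → Rep fun κ η => effForce (d := d) σ χ ξ c κ i m η := by
  intro i
  induction i using Nat.strong_induction_on with
  | _ i ihi =>
  intro m hi
  induction hn : 3 * i + 1 - m using Nat.strong_induction_on generalizing m with
  | _ n ihn =>
  subst hn
  rcases lt_or_ge (3 * i) m with hm | hm
  · exact Rep.zero.congr fun κ _ η _ Ψ _ => by rw [effForce_of_lt hm]
  have h1 : Rep (flowRhs σ χ ξ c i m) := rep_flowRhs_of_terms fun j hj k hk =>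
    rep_flowTerm hd hσ hσd hχ hv hj hk fun i' m' hi' h => by
      rcases h with h | ⟨rfl, h⟩
      · exact ihi i' h m' hi'
      · exact ihn (3 * i' + 1 - m') (by omega) m' rfl
  exact ((rep_force hc hi).add h1.integral).congr fun κ _ η _ Ψ _ =>
    effForce_eq_flowRhs hi hm κ η Ψ

theorem rep_flowRhs {g : ℕ} {ℓ B : ℝ} {v : Space d → ℝ} (hv : IsNoise ξ g ℓ B v)
    (hc : ∀ i ∈ Icc 1 (iSharp d σ), DifferentiableOn ℝ (c i) (Ioc 0 (1 / 2))) (i m : ℕ) :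
    Rep (flowRhs σ χ ξ c i m) :=
  rep_flowRhs_of_terms fun _ hj _ hk => rep_flowTerm hd hσ hσd hχ hv hj hk fun i' m' hi' _ =>
    rep_effForce hd hσ hσd hχ hv hc i' m' hi'

end

end Flow

/-! ### Consequences of the bounds on the enhanced noise -/

section Noise

variable {d m : ℕ}

theorem integral_prod_pi_zero (ρ ν : Measure (Space d)) [SFinite ρ] {f : Config d 0 → ℝ}
    (hf : Continuous f) :
    ∫ w, f w ∂(ρ.prod (Measure.pi fun _ => ν)) = ∫ x, f (x, Fin.elim0) ∂ρ := by
  rw [Measure.pi_of_empty _ (Fin.elim0 : Fin 0 → Space d), Measure.prod_dirac,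
    integral_map (by fun_prop) hf.aestronglyMeasurable]

theorem integral_regKernelTensor_zero {σ μ : ℝ} (hμ : 0 < μ) (g : ℕ) {f : Config d 0 → ℝ}
    (hf : Continuous f) :
    ∫ w, f w ∂(regKernelTensor d 0 σ μ g) = ∫ x, f (x, Fin.elim0) ∂(regKernelPow d σ μ g) := by
  have := isProbabilityMeasure_regKernelPow (d := d) (σ := σ) hμ g
  exact integral_prod_pi_zero _ _ hf

theorem integral_config_zero {f : Config d 0 → ℝ} (hf : Continuous f) :
    ∫ w, f w = ∫ x, f (x, Fin.elim0) := integral_prod_pi_zero volume volume hf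

theorem MemV.exists_diag {v : Config d 0 → ℝ} {B : ℝ} (h : MemV v) (hB0 : 0 ≤ B)
    (hB : normV v ≤ ENNReal.ofReal B) : Continuous (fun x => v (x, Fin.elim0)) ∧
      (∀ x, |v (x, Fin.elim0)| ≤ B) ∧
      ∀ n x, v (x + latticePoint n, Fin.elim0) = v (x, Fin.elim0) := by
  refine ⟨h.continuous.comp (by fun_prop), fun x => ?_, fun n x => ?_⟩
  · have h1 := (le_iSup (fun x => ∫⁻ y : Fin 0 → Space d, ‖v (x, y)‖ₑ) x).trans hB
    beta_reduce at h1
    rw [show (volume : Measure (Fin 0 → Space d)) = Measure.dirac Fin.elim0 from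
      Measure.pi_of_empty _ _, lintegral_dirac] at h1
    rw [← Real.norm_eq_abs, ← ENNReal.ofReal_le_ofReal_iff hB0, ofReal_norm]
    exact h1
  · have := h.periodic n x Fin.elim0
    convert this using 2 <;> exact congrArg _ (Subsingleton.elim _ _)

theorem exists_schwartz_lift (Φ : 𝓢(Space d, ℝ)) : ∃ Φ' : 𝓢(Config d 0, ℝ), ∀ p, Φ' p = Φ p.1 := by
  let e : Config d 0 ≃L[ℝ] Space d := ContinuousLinearEquiv.equivOfInverse
    (ContinuousLinearMap.fst ℝ _ _) (ContinuousLinearMap.inl ℝ _ _)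
    (fun p => Prod.ext rfl (Subsingleton.elim _ _)) (fun x => rfl)
  exact ⟨SchwartzMap.compCLMOfContinuousLinearEquiv ℝ e Φ, fun p => rfl⟩

theorem lap_eq_zero {φ : Space d → ℝ} {x : Space d} (h : φ =ᶠ[nhds x] 0) : lap φ =ᶠ[nhds x] 0 := by
  refine (lap_congr h).trans (Filter.Eventually.of_forall fun y => ?_)
  simp [lap]

theorem resolventInv_iterate_hasCompactSupport {φ : Space d → ℝ} (h : HasCompactSupport φ) (ℓ : ℝ)
    (g : ℕ) : HasCompactSupport ((resolventInv ℓ)^[g] φ) := by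
  induction g generalizing φ with
  | zero => exact h
  | succ g ih =>
    refine ih (HasCompactSupport.intro h fun x hx => ?_)
    have h1 : φ =ᶠ[nhds x] 0 := notMem_tsupport_iff_eventuallyEq.1 hx
    rw [resolventInv, h1.eq_of_nhds, (lap_eq_zero h1).eq_of_nhds]
    simp

theorem exists_DB_of_hasCompactSupport {φ : Space d → ℝ} (hφ : ∀ n : ℕ, ContDiff ℝ n φ)
    (h : HasCompactSupport φ) (n : ℕ) : ∃ M, ∀ x, DB n 1 M φ x := by
  obtain ⟨C, -, hC⟩ := exists_DB_schwartz (h.toSchwartzMap (contDiff_infty.2 hφ)) n 0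
  exact ⟨C * (1 ^ 0)⁻¹, fun x => by have := hC x; rw [decay, pow_zero] at this; exact this⟩

variable {σ : ℝ} {χ : ℝ → ℝ} {ξ : Distr d} {c : ℕ → ℝ → ℝ}

theorem enhNoise_zero (a : MultiIdx d 0) (κ μ : ℝ) (ψ : Config d 0 → ℝ) :
    enhNoise σ χ ξ c 0 0 a κ μ ψ = pair ξ fun x => ψ (x, Fin.elim0) := by
  rw [enhNoise, genForce, effForce, dif_neg (by omega), dif_pos rfl]
  simp [monomial]

theorem exists_isNoise {g : ℕ} {a : MultiIdx d 0} {κ μ B : ℝ}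
    (hκ : κ ∈ Ioc (0 : ℝ) (1 / 2)) (hμ : 0 < μ) (hB : 0 ≤ B)
    (h : RegBound σ g 0 0 (enhNoise σ χ ξ c 0 0 a) κ μ B) :
    ∃ v, IsNoise ξ g (scale σ μ) B v := by
  obtain ⟨D, v, ⟨U, hU, hD⟩, hv, hm, hn⟩ := h
  have hU : ∀ κ' ∈ Ioc (0 : ℝ) (1 / 2), U κ' = _ := hU
  obtain ⟨hvc, hvb, hvp⟩ := hm.exists_diag hB hn
  have hD : D = U κ := hD
  refine ⟨_, hvc, hvb, hvp, fun φ hφ hs => ?_⟩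
  have hP : ∀ n : ℕ, ContDiff ℝ n ((resolventInv (scale σ μ))^[g] φ) := fun n =>
    contDiff_resolventInv_iterate (hφ _)
  have hPs := resolventInv_iterate_hasCompactSupport hs (scale σ μ) g
  obtain ⟨Φ, hΦ⟩ := exists_schwartz_lift (hPs.toSchwartzMap (contDiff_infty.2 hP))
  obtain ⟨Ψ, hΨ, hT⟩ := hv Φ
  obtain ⟨M, hM⟩ := exists_DB_of_hasCompactSupport hφ hs (2 * g)
  have hΨ' : ∀ x, Ψ (x, Fin.elim0) = φ x := fun x => by
    rw [hΨ, integral_regKernelTensor_zero hμ g (by fun_prop)]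
    simp only [hΦ]
    exact integral_resolventInv_iterate hμ g (hφ _) hM x
  have e : D Ψ = pair ξ φ := by
    rw [hD, hU κ hκ]
    exact (enhNoise_zero a κ μ Ψ).trans (congrArg _ (funext hΨ'))
  have hvc' := hm.continuous
  rw [← e, hT, integral_config_zero (by fun_prop)]
  exact integral_congr_ae (Filter.Eventually.of_forall fun x =>
    congrArg (v (x, Fin.elim0) * ·) (hΦ (x, Fin.elim0)))

theorem integral_mul_average {ρ : Measure (Space d)} [IsProbabilityMeasure ρ] {b Φ : Space d → ℝ}
    {B : ℝ} (hb : Continuous b) (hB : ∀ x, |b x| ≤ B) (hΦ : Integrable Φ) (hΦc : Continuous Φ) :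
    ∫ x, b x * ∫ w, Φ (x + w) ∂ρ = ∫ y, (∫ w, b (y - w) ∂ρ) * Φ y := by
  have hi : Integrable (fun p : Space d × Space d => b (p.1 - p.2) * Φ p.1)
      ((volume : Measure (Space d)).prod ρ) := by
    have h1 : Integrable (fun p : Space d × Space d => Φ p.1) (volume.prod ρ) := by
      simpa using hΦ.mul_prod (integrable_const (μ := ρ) (1 : ℝ))
    exact h1.bdd_mul (c := B) (Continuous.aestronglyMeasurable (by fun_prop))
      (Filter.Eventually.of_forall fun p => hB _)
  calc ∫ x, b x * ∫ w, Φ (x + w) ∂ρ = ∫ x, ∫ w, b x * Φ (x + w) ∂ρ := by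
        simp only [integral_const_mul]
    _ = ∫ w, (∫ x, b x * Φ (x + w)) ∂ρ := by
        refine integral_integral_swap ?_
        have h1 : Integrable (fun p : Space d × Space d => Φ (p.1 + p.2)) (volume.prod ρ) :=
          (integrable_prod_iff' (Continuous.aestronglyMeasurable (by fun_prop))).2
            ⟨Filter.Eventually.of_forall fun w => hΦ.comp_add_right w, by
              have e : ∀ w, ∫ x, ‖Φ (x + w)‖ = ∫ x, ‖Φ x‖ := fun w =>
                integral_add_right_eq_self (fun x => ‖Φ x‖) w
              simpa only [e] using integrable_const _⟩
        exact h1.bdd_mul (c := B) (Continuous.aestronglyMeasurable (by fun_prop))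
          (Filter.Eventually.of_forall fun p => hB _)
    _ = ∫ w, (∫ y, b (y - w) * Φ y) ∂ρ := by
        congr 1
        ext w
        rw [← integral_add_right_eq_self (fun y => b (y - w) * Φ y) w]
        simp
    _ = ∫ y, (∫ w, b (y - w) * Φ y ∂ρ) := (integral_integral_swap hi).symm
    _ = _ := by simp only [integral_mul_const]

theorem abs_monomial_le (a : MultiIdx d m) {ρ : ℝ} {p : Config d m} (hp : p ∈ tube d m ρ) :
    |monomial a p| ≤ ρ ^ a.order := by
  unfold monomial MultiIdx.order
  rw [Finset.abs_prod, ← Finset.prod_pow_eq_pow_sum]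
  refine Finset.prod_le_prod (fun _ _ => abs_nonneg _) fun q _ => ?_
  rw [Finset.abs_prod, ← Finset.prod_pow_eq_pow_sum]
  refine Finset.prod_le_prod (fun _ _ => abs_nonneg _) fun l _ => ?_
  rw [abs_div, abs_pow, Nat.abs_cast]
  have h1 : |p.1 l - p.2 q l| ≤ ρ := by
    have := (PiLp.norm_apply_le (p.2 q - p.1) l).trans (hp q)
    rwa [PiLp.sub_apply, Real.norm_eq_abs, abs_sub_comm] at this
  refine (div_le_self (by positivity) (by exact_mod_cast Nat.factorial_pos _)).trans ?_
  gcongr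

theorem contDiff_monomial (a : MultiIdx d m) (n : ℕ) : ContDiff ℝ n (monomial a) := by
  unfold monomial
  refine contDiff_prod fun q _ => contDiff_prod fun l _ => ?_
  have h1 : ContDiff ℝ n fun p : Config d m => p.1 l :=
    (EuclideanSpace.proj (𝕜 := ℝ) l).contDiff.comp contDiff_fst
  have h2 : ContDiff ℝ n fun p : Config d m => p.2 q l :=
    (EuclideanSpace.proj (𝕜 := ℝ) l).contDiff.comp ((contDiff_apply ℝ _ q).comp contDiff_snd)
  exact ((h1.sub h2).pow _).div_const _

theorem adm_monomial_mul (a : MultiIdx d m) {φ M : Space d → ℝ} (hφ : Continuous φ) (hM : Good M)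
    (hb : ∀ x, |φ x| ≤ M x) : Adm 0 fun p : Config d m => monomial a p * φ p.1 := by
  refine ⟨contDiff_zero.2 ((contDiff_monomial a 0).continuous.mul (hφ.comp continuous_fst)),
    fun ρ => ⟨fun x => |ρ| ^ a.order * M x, hM.const_mul (by positivity), fun p hp => ?_⟩⟩
  show |monomial a p * φ p.1| ≤ _
  rw [abs_mul]
  exact mul_le_mul (abs_monomial_le a (tube_mono (le_abs_self ρ) hp)) (hb _) (abs_nonneg _)
    (by positivity)

theorem IsAct.exists_density {U : (Config d m → ℝ) → ℝ} (hU : IsAct U) (a : MultiIdx d m) :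
    ∃ b : Space d → ℝ, Continuous b ∧ (∃ B, ∀ x, |b x| ≤ B) ∧ ∀ φ M : Space d → ℝ, Continuous φ →
      Good M → (∀ x, |φ x| ≤ M x) → U (fun p => monomial a p * φ p.1) = ∫ x, b x * φ x := by
  obtain ⟨K, A, B, hA, hB, -, hK⟩ := hU
  obtain ⟨ρ, hρ⟩ := K.bdd
  have hmc := (contDiff_monomial a 0).continuous
  have hbd : ∀ x, ∀ᵐ ω ∂K.ν, ‖A (x, ω) * monomial a (K.point (x, ω))‖ ≤ B * ρ ^ a.order := by
    intro x
    filter_upwards [hρ] with ω hω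
    rw [norm_mul]
    exact mul_le_mul (hB _) (abs_monomial_le a fun q => by simpa [Kern.point] using hω q)
      (abs_nonneg _) ((abs_nonneg _).trans (hB (x, ω)))
  refine ⟨fun x => ∫ ω, A (x, ω) * monomial a (K.point (x, ω)) ∂K.ν, ?_, ⟨B * ρ ^ a.order, fun x => ?_⟩,
    fun φ M hφ hM hb => ?_⟩
  · exact continuous_of_dominated (fun x => Continuous.aestronglyMeasurable (by fun_prop)) hbd
      (integrable_const _) (Filter.Eventually.of_forall fun ω => by fun_prop)
  · have := norm_integral_le_of_norm_le (integrable_const _) (hbd x)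
    simpa using this
  · have hΨ := adm_monomial_mul (m := m) a hφ hM hb
    rw [hK _ hΨ, Kern.act, integral_prod _ (Kern.integrable hΨ hA hB)]
    congr 1
    ext x
    rw [← integral_mul_const]
    congr 1
    ext ω
    exact (mul_assoc _ _ _).symm

theorem good_decay {C : ℝ} (hC : 0 ≤ C) : Good fun x : Space d => C * decay (d + 1) x :=
  Good.const_mul ⟨integrable_decay (Nat.lt_succ_self d), fun x => (decay_pos _ _).le, 1,
    fun x => decay_le_one _ _⟩ hC

theorem abs_le_of_regularization {U : (Config d m → ℝ) → ℝ} (hU : IsAct U) {a : MultiIdx d m} {g : ℕ}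
    {μ B : ℝ} (hμ : 0 < μ) (hB0 : 0 ≤ B) {v : Config d 0 → ℝ}
    (hv : IsRegularization σ g μ (fun Φ : 𝓢(Config d 0, ℝ) =>
      U fun p => monomial a p * Φ (p.1, Fin.elim0)) v) (hm : MemV v) (hB : normV v ≤ ENNReal.ofReal B)
    {φ M : Space d → ℝ} (hφ : ContDiff ℝ (2 * g : ℕ) φ) (hM : Good M)
    (h : ∀ x, DB (2 * g) (scale σ μ) (M x) φ x) :
    |U fun p => monomial a p * φ p.1| ≤ B * (1 + d) ^ g * ∫ x, M x := by
  set ℓ := scale σ μ with hℓ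
  have hℓ0 : 0 < ℓ := scale_pos hμ
  have hvc' := hm.continuous
  have hp := isProbabilityMeasure_regKernelPow (d := d) (σ := σ) hμ g
  obtain ⟨hvc, hvb, -⟩ := hm.exists_diag hB0 hB
  obtain ⟨b, hbc, ⟨B', hbB⟩, hUb⟩ := hU.exists_density a
  have hae : ∀ᵐ x, v (x, Fin.elim0) = ∫ w, b (x - w) ∂(regKernelPow d σ μ g) := by
    have hcb : Continuous fun x => ∫ w, b (x - w) ∂(regKernelPow d σ μ g) :=
      continuous_of_dominated (bound := fun _ => B')
        (fun x => Continuous.aestronglyMeasurable (by fun_prop))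
        (fun x => Filter.Eventually.of_forall fun w => hbB _) (integrable_const _)
        (Filter.Eventually.of_forall fun w => by fun_prop)
    refine ae_eq_of_integral_contDiff_smul_eq hvc.locallyIntegrable hcb.locallyIntegrable
      fun G hG hs => ?_
    obtain ⟨Φ, hΦ⟩ := exists_schwartz_lift (hs.toSchwartzMap hG)
    obtain ⟨Ψ, hΨ, hT⟩ := hv Φ
    have hΨ' : ∀ x, Ψ (x, Fin.elim0) = ∫ w, G (x + w) ∂(regKernelPow d σ μ g) := fun x => by
      rw [hΨ, integral_regKernelTensor_zero hμ g (by fun_prop)]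
      simp only [hΦ]; rfl
    obtain ⟨C, hC, hΨb⟩ := exists_DB_schwartz Ψ 0 (d + 1)
    have e := hUb (fun x => Ψ (x, Fin.elim0)) (fun x => C * decay (d + 1) x) (by fun_prop)
      (good_decay hC) fun x => (hΨb (x, Fin.elim0)).abs_le.trans (le_of_eq (by
        simp [decay, Prod.norm_def, norm_of_subsingleton]))
    simp only [smul_eq_mul]
    have e2 := integral_mul_average (ρ := regKernelPow d σ μ g) hbc hbB
      (hG.continuous.integrable_of_hasCompactSupport hs) hG.continuous
    simp only [mul_comm (G _)]
    rw [← e2]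
    simp only [← hΨ']
    refine Eq.trans ?_ (hT.symm.trans e)
    rw [integral_config_zero (by fun_prop)]
    exact integral_congr_ae (Filter.Eventually.of_forall fun x =>
      congrArg (v (x, Fin.elim0) * ·) (hΦ (x, Fin.elim0)).symm)
  obtain ⟨M₀, hM₀⟩ := hM.bdd
  have hP : Continuous ((resolventInv ℓ)^[g] φ) :=
    (contDiff_resolventInv_iterate (n := 0) (by simpa using hφ)).continuous
  have hPb : ∀ x, |(resolventInv ℓ)^[g] φ x| ≤ (1 + d) ^ g * M x := fun x =>
    (DB_resolventInv_iterate (n := 0) hℓ0 (abs_of_pos hℓ0).le (by simpa using hφ)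
      (by simpa using h x)).abs_le
  have hφ1 : ∀ x, DB (2 * g) 1 (max 1 ℓ⁻¹ ^ (2 * g) * M₀) φ x := fun x =>
    (DB.rescale hℓ0 one_pos (le_max_left _ _) (by
      calc (1 : ℝ) = ℓ⁻¹ * ℓ := by field_simp
        _ ≤ _ := by gcongr; exact le_max_right _ _) (h x)).mono one_pos (by
      have := hM₀ x
      gcongr)
  have e1 : U (fun p => monomial a p * φ p.1) = ∫ x, v (x, Fin.elim0) * (resolventInv ℓ)^[g] φ x := by
    rw [hUb φ M hφ.continuous hM fun x => (h x).abs_le]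
    have e2 := integral_mul_average (ρ := regKernelPow d σ μ g) hbc hbB
      ((hM.integrable.const_mul ((1 + d : ℝ) ^ g)).mono' hP.aestronglyMeasurable
        (Filter.Eventually.of_forall hPb)) hP
    simp only [hℓ, integral_resolventInv_iterate hμ g hφ hφ1] at e2
    rw [e2]
    refine integral_congr_ae ?_
    filter_upwards [hae] with x hx
    rw [hx]
  rw [e1, mul_assoc, ← integral_const_mul, ← integral_const_mul]
  refine norm_integral_le_of_norm_le (f := fun x => v (x, Fin.elim0) * (resolventInv ℓ)^[g] φ x)
    ((hM.integrable.const_mul _).const_mul _) (Filter.Eventually.of_forall fun x => ?_)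
  rw [norm_mul]
  exact mul_le_mul (hvb x) (hPb x) (norm_nonneg _) hB0

end Noise

/-! ### Uniform bounds along the flow -/

section Uniform

variable {d m : ℕ}

/-- The fixed data. -/
structure Setup (d : ℕ) (σ ε : ℝ) (χ : ℝ → ℝ) : Prop where
  dim : d ∈ Icc 1 6
  sigma : σ ∈ Ioc ((d : ℝ) / 3) ((d : ℝ) / 2)
  eps : ε ∈ Ioo 0 (epsDiamond d σ / 3)
  cutoff : IsCutoff χ

/-- The assumptions on the noise and the counterterms. -/
structure FlowData (d : ℕ) (σ ε : ℝ) (χ : ℝ → ℝ) (g₀ : (i m : ℕ) → MultiIdx d m → ℕ) (R : ℝ)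
    (ξ : Distr d) (c : ℕ → ℝ → ℝ) : Prop where
  one_lt : 1 < R
  diff : ∀ i' ∈ Icc 1 (iSharp d σ), DifferentiableOn ℝ (c i') (Ioc 0 (1 / 2))
  noise : ∀ (i' m' : ℕ) (a' : MultiIdx d m'), rho d σ 0 i' m' + a'.order ≤ 0 →
    ∀ r ∈ ({0, 1} : Set ℕ), ∀ κ ∈ Ioc (0 : ℝ) (1 / 2), ∀ μ ∈ Ioc (0 : ℝ) (1 / 2),
      RegBound σ (g₀ i' m' a') r 0 (enhNoise σ χ ξ c i' m' a') κ μ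
        (R * scale σ κ ^ ((ε - σ) * r) * scale σ μ ^ (rho d σ ε i' m' + a'.order))

variable {σ ε : ℝ} {χ : ℝ → ℝ} {g₀ : (i m : ℕ) → MultiIdx d m → ℕ}

namespace Setup

variable (h : Setup d σ ε χ)

include h

theorem dim_pos : 0 < d := h.dim.1

theorem sigma_pos : 0 < σ := lt_of_le_of_lt (by positivity) h.sigma.1

theorem sigma_lt : σ < d := by
  have : (0 : ℝ) < d := by exact_mod_cast h.dim_pos
  linarith [h.sigma.2]

end Setup

/-- The derivative of order `s` with respect to the cutoff, for `s ≤ 1`. -/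
def cutD (s : ℕ) (F : ℝ → ℝ → (Config d m → ℝ) → ℝ) : ℝ → ℝ → (Config d m → ℝ) → ℝ :=
  if s = 0 then F else cutDeriv F

/-- Bounds on `F` and its derivative with respect to the cutoff. -/
def HasBound (σ ε : ℝ) (n : ℕ) (r A β : ℝ) (F : ℝ → ℝ → (Config d m → ℝ) → ℝ) : Prop :=
  ∀ κ ∈ Ioc (0 : ℝ) (1 / 2), ∀ μ ∈ Ioc (0 : ℝ) (1 / 2), ∀ s ∈ ({0, 1} : Set ℕ),
    Bdd n (scale σ μ) (r * scale σ μ) (A * scale σ κ ^ ((ε - σ) * s) * scale σ μ ^ β)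
      (cutD s F κ μ)

/-- Bounds with constants that do not depend on the noise and the counterterms. -/
def UnifBdd (ε : ℝ) (χ : ℝ → ℝ) (g₀ : (i m : ℕ) → MultiIdx d m → ℕ) (σ : ℝ) (N : ℤ) (β : ℝ)
    (F : Distr d → (ℕ → ℝ → ℝ) → ℝ → ℝ → (Config d m → ℝ) → ℝ) : Prop :=
  ∃ (n : ℕ) (r C : ℝ), 0 ≤ r ∧ 0 ≤ C ∧ ∀ R ξ c, FlowData d σ ε χ g₀ R ξ c →
    Rep (F ξ c) ∧ HasBound σ ε n r (C * R ^ N) β (F ξ c)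

theorem HasBound.mono {n n' : ℕ} {r r' A A' β : ℝ} {F : ℝ → ℝ → (Config d m → ℝ) → ℝ}
    (h : HasBound σ ε n r A β F) (hn : n ≤ n') (hr : r ≤ r') (hA : A ≤ A') :
    HasBound σ ε n' r' A' β F := fun κ hκ μ hμ s hs => by
  have h1 := scale_pos (σ := σ) hκ.1
  have h2 := scale_pos (σ := σ) hμ.1
  exact (h κ hκ μ hμ s hs).mono hn (by gcongr) (by gcongr)

theorem FlowData.pos {R : ℝ} {ξ : Distr d} {c : ℕ → ℝ → ℝ} (h : FlowData d σ ε χ g₀ R ξ c) :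
    0 < R := zero_lt_one.trans h.one_lt

namespace UnifBdd

variable {N : ℤ} {β : ℝ} {F : Distr d → (ℕ → ℝ → ℝ) → ℝ → ℝ → (Config d m → ℝ) → ℝ}

theorem congr {F' : Distr d → (ℕ → ℝ → ℝ) → ℝ → ℝ → (Config d m → ℝ) → ℝ}
    (h : UnifBdd ε χ g₀ σ N β F) (hF : ∀ ξ c κ η Ψ, F' ξ c κ η Ψ = F ξ c κ η Ψ) :
    UnifBdd ε χ g₀ σ N β F' := by
  have : F' = F := by ext ξ c κ η Ψ; exact hF ξ c κ η Ψ
  rwa [this]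

theorem zero : UnifBdd (m := m) ε χ g₀ σ N β fun _ _ _ _ _ => 0 := by
  refine ⟨0, 0, 0, le_rfl, le_rfl, fun R ξ c _ => ⟨Rep.zero, fun κ hκ μ hμ s _ => ?_⟩⟩
  simp only [zero_mul]
  refine Bdd.zero.congr fun Ψ _ => ?_
  unfold cutD
  split_ifs
  · rfl
  · simp [cutDeriv]

theorem add {F' : Distr d → (ℕ → ℝ → ℝ) → ℝ → ℝ → (Config d m → ℝ) → ℝ}
    (h : UnifBdd ε χ g₀ σ N β F) (h' : UnifBdd ε χ g₀ σ N β F') :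
    UnifBdd ε χ g₀ σ N β fun ξ c κ η Ψ => F ξ c κ η Ψ + F' ξ c κ η Ψ := by
  obtain ⟨n, r, C, hr, hC, hb⟩ := h
  obtain ⟨n', r', C', hr', hC', hb'⟩ := h'
  refine ⟨max n n', max r r', C + C', hr.trans (le_max_left _ _), by positivity,
    fun R ξ c D => ⟨(hb R ξ c D).1.add (hb' R ξ c D).1, fun κ hκ μ hμ s hs => ?_⟩⟩
  have h1 := (hb R ξ c D).2.mono (le_max_left n n') (le_max_left r r') le_rfl κ hκ μ hμ s hs
  have h2 := (hb' R ξ c D).2.mono (le_max_right n n') (le_max_right r r') le_rfl κ hκ μ hμ s hs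
  have h3 := h1.add h2
  rw [← add_mul, ← add_mul, ← add_mul] at h3
  refine h3.congr fun Ψ hΨ => ?_
  have hμ' : μ ∈ Ioc (0 : ℝ) (3 / 4) := ⟨hμ.1, by linarith [hμ.2]⟩
  unfold cutD
  split_ifs
  · rfl
  · exact cutDeriv_unique hκ (((hb R ξ c D).1.hasDeriv hκ hμ' hΨ).add
      ((hb' R ξ c D).1.hasDeriv hκ hμ' hΨ))

theorem const_mul (h : UnifBdd ε χ g₀ σ N β F) (b : ℝ) :
    UnifBdd ε χ g₀ σ N β fun ξ c κ η Ψ => b * F ξ c κ η Ψ := by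
  obtain ⟨n, r, C, hr, hC, hb⟩ := h
  refine ⟨n, r, |b| * C, hr, by positivity,
    fun R ξ c D => ⟨(hb R ξ c D).1.const_mul b, fun κ hκ μ hμ s hs => ?_⟩⟩
  have h1 := ((hb R ξ c D).2 κ hκ μ hμ s hs).const_mul b
  simp only [← mul_assoc] at h1
  refine h1.congr fun Ψ hΨ => ?_
  unfold cutD
  split_ifs
  · rfl
  · exact cutDeriv_unique hκ (((hb R ξ c D).1.hasDeriv hκ ⟨hμ.1, by linarith [hμ.2]⟩ hΨ).const_mul b)

theorem perm (h : UnifBdd ε χ g₀ σ N β F) (π : Equiv.Perm (Fin m)) :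
    UnifBdd ε χ g₀ σ N β fun ξ c κ η Ψ => F ξ c κ η (permTest π Ψ) := by
  obtain ⟨n, r, C, hr, hC, hb⟩ := h
  refine ⟨n, r, C, hr, hC, fun R ξ c D => ⟨(hb R ξ c D).1.perm π, fun κ hκ μ hμ s hs => ?_⟩⟩
  refine (((hb R ξ c D).2 κ hκ μ hμ s hs).perm (scale_pos hμ.1) π).congr fun Ψ _ => ?_
  unfold cutD
  split_ifs <;> rfl

theorem sum {ι : Type*} (t : Finset ι)
    {F : ι → Distr d → (ℕ → ℝ → ℝ) → ℝ → ℝ → (Config d m → ℝ) → ℝ}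
    (h : ∀ i ∈ t, UnifBdd ε χ g₀ σ N β (F i)) :
    UnifBdd ε χ g₀ σ N β fun ξ c κ η Ψ => ∑ i ∈ t, F i ξ c κ η Ψ := by
  classical
  induction t using Finset.induction_on with
  | empty => simpa using zero
  | insert a t ha ih =>
    simp only [Finset.sum_insert ha]
    exact (h a (Finset.mem_insert_self a t)).add
      (ih fun i hi => h i (Finset.mem_insert_of_mem hi))

end UnifBdd

/-! ### Bounds on the right-hand side of the flow equation -/

theorem isLocal_resolventInv_iterate {n g : ℕ} {ℓ r C : ℝ} {H : Space d → ℝ} (hℓ : 0 < ℓ)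
    (h : IsLocal (n + 2 * g) ℓ r C H) :
    IsLocal n ℓ r ((1 + d) ^ g * C) ((resolventInv ℓ)^[g] H) := by
  refine ⟨contDiff_resolventInv_iterate h.smooth, fun w => DB_resolventInv_iterate hℓ
    (abs_of_pos hℓ).le h.smooth (h.bound w), ?_⟩
  have hs := h.supp
  clear h
  induction g generalizing H with
  | zero => exact hs
  | succ g ih =>
    refine ih fun w hw => ?_
    have h1 : H =ᶠ[nhds w] 0 := by
      filter_upwards [(isOpen_lt continuous_const continuous_norm).mem_nhds hw] with y hy
      exact hs y hy
    rw [resolventInv, h1.eq_of_nhds, (lap_eq_zero h1).eq_of_nhds]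
    simp

theorem ballVol_mul {r ℓ : ℝ} (hr : 0 ≤ r) (hℓ : 0 ≤ ℓ) : ballVol d (r * ℓ) = ballVol d r * ℓ ^ d := by
  rw [ballVol, ballVol, mul_comm r, Measure.addHaar_closedBall_mul volume 0 hℓ hr, ENNReal.toReal_mul,
    ENNReal.toReal_ofReal (by positivity), finrank_euclideanSpace_fin, mul_comm]

theorem ballVol_nonneg (r : ℝ) : 0 ≤ ballVol d r := ENNReal.toReal_nonneg

theorem Bdd.pairB_scale {n nU k : ℕ} {ℓ r ρ ρ' A A' K e e' e'' β β' : ℝ} {H : Space d → ℝ}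
    (hℓ : 0 < ℓ) (hr : 0 ≤ r) (hρ' : 0 ≤ ρ') (hA : 0 ≤ A) (he : 0 ≤ e)
    (hH : IsLocal (nU + n) ℓ (r * ℓ) (K * e'' * (ℓ ^ (-ε) * ℓ ^ (-(d : ℝ)))) H)
    {W : (Config d (k + 1) → ℝ) → ℝ} {U : (Config d (m - k) → ℝ) → ℝ} (hUa : IsAct U)
    (hU : Bdd nU ℓ (ρ' * ℓ) (A * e * ℓ ^ β) U) (hW : Bdd n ℓ (ρ * ℓ) (A' * e' * ℓ ^ β') W) :
    Bdd (nU + n) ℓ ((ρ + r + ρ') * ℓ)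
      (A' * A * (ballVol d r * 4 ^ (nU + n) * K) * (e * e' * e'') * ℓ ^ (β' + β - ε))
      (EllipticFlow.pairB k H W U) := by
  have h := Bdd.pairB_isAct hℓ (by positivity) hH (by positivity) (by positivity) hUa hU hW
  have e0 : ℓ ^ d * ℓ ^ (-(d : ℝ)) = 1 := by
    rw [← Real.rpow_natCast, ← Real.rpow_add hℓ, add_neg_cancel, Real.rpow_zero]
  convert h using 1
  · ring
  · rw [ballVol_mul hr hℓ.le, Real.rpow_sub hℓ, Real.rpow_add hℓ, Real.rpow_neg hℓ.le ε]
    linear_combination (-(A' * A * (ballVol d r * 4 ^ (nU + n) * K) * (e * e' * e'') *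
      (ℓ ^ β' * ℓ ^ β * (ℓ ^ ε)⁻¹))) * e0

theorem rho_add {i j m k : ℕ} (hj : j ≤ i) (hk : k ≤ m) :
    rho d σ ε j (k + 1) + rho d σ ε (i - j) (m - k) - ε = rho d σ ε i m - σ := by
  unfold rho
  push_cast [hj, hk]
  ring

section

variable (hS : Setup d σ ε χ)

include hS

theorem exists_isLocal_propagator (n : ℕ) : ∃ K, 0 ≤ K ∧ ∀ κ ∈ Ioc (0 : ℝ) (1 / 2),
    ∀ η ∈ Ioc (0 : ℝ) (1 / 2), IsLocal n (scale σ η) (suppRadius σ * scale σ η)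
      (K * 1 * (scale σ η ^ (-ε) * scale σ η ^ (-(d : ℝ)))) (dPropagator d σ χ κ η) ∧
    IsLocal n (scale σ η) (suppRadius σ * scale σ η)
      (K * scale σ κ ^ (ε - σ) * (scale σ η ^ (-ε) * scale σ η ^ (-(d : ℝ))))
      (ddPropagator d σ χ κ η) := by
  obtain ⟨C, hC, h1⟩ := exists_DB_dPropagator hS.dim_pos hS.sigma_pos hS.sigma_lt hS.cutoff n
  obtain ⟨C', hC', h2⟩ := exists_DB_ddPropagator hS.dim_pos hS.sigma_pos hS.sigma_lt hS.cutoff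
    hS.eps.1 n
  refine ⟨C + C', by positivity, fun κ hκ η hη => ?_⟩
  obtain ⟨a1, a2, a3⟩ := h1 κ hκ η hη
  obtain ⟨b1, b2, b3⟩ := h2 κ hκ η hη
  have hℓ := scale_pos (σ := σ) hη.1
  have hℓ' := scale_pos (σ := σ) hκ.1
  have h3 : 1 ≤ scale σ η ^ (-ε) := Real.one_le_rpow_of_pos_of_le_one_of_nonpos hℓ
    (scale_le_one hS.sigma_pos hη.1 (by linarith [hη.2])) (by linarith [hS.eps.1])
  refine ⟨⟨a1, fun w => (a2 w).mono hℓ ?_, a3⟩, ⟨b1, fun w => (b2 w).mono hℓ ?_, b3⟩⟩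
  · calc C * scale σ η ^ (-(d : ℝ)) ≤ (C + C') * (scale σ η ^ (-(d : ℝ))) := by
          gcongr; linarith
      _ ≤ (C + C') * 1 * (scale σ η ^ (-ε) * scale σ η ^ (-(d : ℝ))) := by
          rw [mul_one]
          gcongr
          exact le_mul_of_one_le_left (by positivity) h3
  · rw [mul_assoc (C' * _)]
    gcongr
    linarith

omit hS in
theorem FlowData.exists_isNoise {R : ℝ} {ξ : Distr d} {c : ℕ → ℝ → ℝ}
    (D : FlowData d σ ε χ g₀ R ξ c) {μ : ℝ} (hμ : μ ∈ Ioc (0 : ℝ) (1 / 2)) :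
    ∃ v, IsNoise ξ (g₀ 0 0 fun q => q.elim0) (scale σ μ) (R * scale σ μ ^ rho d σ ε 0 0) v := by
  have h0 : (MultiIdx.order fun q : Fin 0 => (q.elim0 : Fin d → ℕ)) = 0 := by simp [MultiIdx.order]
  have h1 := D.noise 0 0 (fun q => q.elim0) (by
    rw [h0]; simp only [rho]; simp; positivity) 0 (by simp) μ hμ μ hμ
  have hℓ := scale_pos (σ := σ) hμ.1
  refine EllipticFlow.exists_isNoise hμ hμ.1 (mul_nonneg D.pos.le (by positivity))
    (a := fun q => q.elim0) (χ := χ) (c := c) ?_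
  simpa [h0] using h1

theorem FlowData.rep {R : ℝ} {ξ : Distr d} {c : ℕ → ℝ → ℝ}
    (D : FlowData d σ ε χ g₀ R ξ c) (i m : ℕ) :
    (0 < i → Rep fun κ η => effForce σ χ ξ c κ i m η) ∧ Rep (flowRhs σ χ ξ c i m) := by
  obtain ⟨v, hv⟩ := D.exists_isNoise (μ := 1 / 2) ⟨by norm_num, le_rfl⟩
  exact ⟨rep_effForce hS.dim_pos hS.sigma_pos hS.sigma_lt hS.cutoff hv D.diff i m,
    rep_flowRhs hS.dim_pos hS.sigma_pos hS.sigma_lt hS.cutoff hv D.diff i m⟩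

theorem unifBdd_flowTerm_inner {i m j k : ℕ} (hj : j ≤ i) (hk : k ≤ m)
    (hW : UnifBdd ε χ g₀ σ (1 + 3 * (j : ℤ) - (k + 1 : ℕ)) (rho d σ ε j (k + 1))
      fun ξ c κ η => effForce σ χ ξ c κ j (k + 1) η)
    (hU : UnifBdd ε χ g₀ σ (1 + 3 * ((i - j : ℕ) : ℤ) - (m - k : ℕ)) (rho d σ ε (i - j) (m - k))
      fun ξ c κ η => effForce σ χ ξ c κ (i - j) (m - k) η) :
    UnifBdd ε χ g₀ σ (1 + 3 * (i : ℤ) - m) (rho d σ ε i m - σ)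
      fun ξ c => flowTerm σ χ ξ c i m j k := by
  obtain ⟨n, r, C, hr, hC, hb⟩ := hW
  obtain ⟨n', r', C', hr', hC', hb'⟩ := hU
  obtain ⟨K, hK, hL⟩ := exists_isLocal_propagator hS (n' + n)
  have hs := (suppRadius_pos (σ := σ)).le
  have hV := ballVol_nonneg (d := d) (suppRadius σ)
  refine ⟨n' + n, r + suppRadius σ + r', 3 * (C * C' * (ballVol d (suppRadius σ) * 4 ^ (n' + n) * K)),
    by positivity, by positivity, fun R ξ c D => ?_⟩
  obtain ⟨hWr, hWb⟩ := hb R ξ c D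
  obtain ⟨hUr, hUb⟩ := hb' R ξ c D
  obtain ⟨hT, hT'⟩ := rep_flowTerm_inner hS.dim_pos hS.sigma_pos hS.sigma_lt hS.cutoff (i := i)
    (m := m) hWr hUr
  refine ⟨hT, fun κ hκ η hη s hs => ?_⟩
  have hη' : η ∈ Ioc (0 : ℝ) (3 / 4) := ⟨hη.1, by linarith [hη.2]⟩
  have hℓ := scale_pos (σ := σ) hη.1
  have hℓ' := scale_pos (σ := σ) hκ.1
  have hR := D.pos
  have eR : R ^ (1 + 3 * (i : ℤ) - m) = R ^ (1 + 3 * (j : ℤ) - (k + 1 : ℕ)) *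
      R ^ (1 + 3 * ((i - j : ℕ) : ℤ) - (m - k : ℕ)) := by
    rw [← zpow_add₀ hR.ne']
    congr 1
    push_cast [hj, hk]
    ring
  have W0 := hWb κ hκ η hη 0 (by simp)
  have W1 := hWb κ hκ η hη 1 (by simp)
  have U0 := hUb κ hκ η hη 0 (by simp)
  have U1 := hUb κ hκ η hη 1 (by simp)
  simp only [Nat.cast_zero, mul_zero, Real.rpow_zero, Nat.cast_one, mul_one (ε - σ)]
    at W0 W1 U0 U1
  have B0 := Bdd.pairB_scale hℓ suppRadius_pos.le hr' (by positivity) zero_le_one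
    (hL κ hκ η hη).1 (hUr.isAct hκ hη') U0 W0
  have B1 := Bdd.pairB_scale hℓ suppRadius_pos.le hr' (by positivity) zero_le_one
    (hL κ hκ η hη).1 (hUr.isAct hκ hη') U0 W1
  have B2 := Bdd.pairB_scale hℓ suppRadius_pos.le hr' (by positivity) zero_le_one
    (hL κ hκ η hη).2 (hUr.isAct hκ hη') U0 W0
  have B3 := Bdd.pairB_scale hℓ suppRadius_pos.le hr' (by positivity) (by positivity)
    (hL κ hκ η hη).1 (hUr.isAct_cutDeriv hκ hη') U1 W0
  rw [rho_add hj hk] at B0 B1 B2 B3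
  rcases hs with rfl | rfl
  · refine B0.mono le_rfl le_rfl ?_
    simp only [Nat.cast_zero, mul_zero, Real.rpow_zero, mul_one]
    rw [eR]
    have : 0 ≤ C * C' * (ballVol d (suppRadius σ) * 4 ^ (n' + n) * K) *
      (R ^ (1 + 3 * (j : ℤ) - (k + 1 : ℕ)) * R ^ (1 + 3 * ((i - j : ℕ) : ℤ) - (m - k : ℕ))) *
        scale σ η ^ (rho d σ ε i m - σ) := by positivity
    linarith
  · refine (((B1.add B2).add B3).mono le_rfl le_rfl (le_of_eq ?_)).congr fun Ψ hΨ =>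
      hT' κ hκ η hη' Ψ hΨ
    rw [eR, Nat.cast_one]
    ring_nf

theorem unifBdd_flowTerm_noise {i m : ℕ}
    (hW : UnifBdd ε χ g₀ σ (1 + 3 * (i : ℤ) - (m + 1 : ℕ)) (rho d σ ε i (m + 1))
      fun ξ c κ η => effForce σ χ ξ c κ i (m + 1) η) :
    UnifBdd ε χ g₀ σ (1 + 3 * (i : ℤ) - m) (rho d σ ε i m - σ)
      fun ξ c => flowTerm σ χ ξ c i m i m := by
  obtain ⟨n, r, C, hr, hC, hb⟩ := hW
  set g := g₀ 0 0 fun q => q.elim0 with hg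
  obtain ⟨K, hK, hL⟩ := exists_isLocal_propagator hS (0 + n + 2 * g)
  have hs := (suppRadius_pos (σ := σ)).le
  have hV := ballVol_nonneg (d := d) (suppRadius σ)
  refine ⟨0 + n, r + suppRadius σ + 0,
    2 * (C * (ballVol d (suppRadius σ) * 4 ^ (0 + n) * ((1 + d) ^ g * K))),
    by positivity, by positivity, fun R ξ c D => ?_⟩
  obtain ⟨hWr, hWb⟩ := hb R ξ c D
  have hT := fun {η B : ℝ} {v : Space d → ℝ} (hv : IsNoise ξ g (scale σ η) B v) =>
    rep_flowTerm_noise hS.dim_pos hS.sigma_pos hS.sigma_lt hS.cutoff (i := i)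
      (m := m) hv hWr
  refine ⟨(hT (D.exists_isNoise (μ := 1 / 2) ⟨by norm_num, le_rfl⟩).choose_spec).1,
    fun κ hκ η hη s hs => ?_⟩
  obtain ⟨v, hv⟩ := D.exists_isNoise hη
  have hη' : η ∈ Ioc (0 : ℝ) (3 / 4) := ⟨hη.1, by linarith [hη.2]⟩
  have hℓ := scale_pos (σ := σ) hη.1
  have hℓ' := scale_pos (σ := σ) hκ.1
  have hR := D.pos
  have eR : R ^ (1 + 3 * (i : ℤ) - m) = R ^ (1 + 3 * (i : ℤ) - (m + 1 : ℕ)) * R := by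
    rw [← zpow_add_one₀ hR.ne']
    congr 1
    push_cast
    ring
  have W0 := hWb κ hκ η hη 0 (by simp)
  have W1 := hWb κ hκ η hη 1 (by simp)
  simp only [Nat.cast_zero, mul_zero, Real.rpow_zero, Nat.cast_one, mul_one (ε - σ)]
    at W0 W1
  have U0 : Bdd 0 (scale σ η) (0 * scale σ η) (R * 1 * scale σ η ^ rho d σ ε 0 0)
      (diagFun (m - m) v) := bdd_diagFun (by simp) (by simpa using hv.bound)
  have Ua : IsAct (diagFun (d := d) (m - m) v) := by
    have := (rep_diagFun (m := m - m) hv.cont hv.bound hv.periodic (c := fun _ => 1)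
      (differentiableOn_const _)).isAct hκ hη'
    simpa using this
  have L1 := isLocal_resolventInv_iterate hℓ (hL κ hκ η hη).1
  have L2 := isLocal_resolventInv_iterate hℓ (hL κ hκ η hη).2
  simp only [← mul_assoc ((1 + (d : ℝ)) ^ g)] at L1 L2
  have B0 := Bdd.pairB_scale hℓ suppRadius_pos.le le_rfl hR.le zero_le_one L1 Ua U0 W0
  have B1 := Bdd.pairB_scale hℓ suppRadius_pos.le le_rfl hR.le zero_le_one L1 Ua U0 W1
  have B2 := Bdd.pairB_scale hℓ suppRadius_pos.le le_rfl hR.le zero_le_one L2 Ua U0 W0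
  have e := rho_add (d := d) (σ := σ) (ε := ε) (le_refl i) (le_refl m)
  rw [Nat.sub_self, Nat.sub_self] at e
  rw [e] at B0 B1 B2
  rcases hs with rfl | rfl
  · refine (B0.mono le_rfl le_rfl ?_).congr fun Ψ _ => by
      rw [← extPropagator_eq hη.1]
      exact flowTerm_noise hS.dim_pos hS.sigma_pos hS.sigma_lt hS.cutoff hv i m hκ hη' Ψ
    simp only [Nat.cast_zero, mul_zero, Real.rpow_zero, mul_one]
    rw [eR]
    have : 0 ≤ C * (ballVol d (suppRadius σ) * 4 ^ (0 + n) * ((1 + d) ^ g * K)) *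
      (R ^ (1 + 3 * (i : ℤ) - (m + 1 : ℕ)) * R) * scale σ η ^ (rho d σ ε i m - σ) := by positivity
    linarith
  · refine ((B1.add B2).mono le_rfl le_rfl (le_of_eq ?_)).congr fun Ψ hΨ =>
      (hT hv).2 κ hκ η hη' Ψ hΨ
    rw [eR, Nat.cast_one]
    ring_nf

theorem unifBdd_flowRhs {i m : ℕ}
    (ih : ∀ i' m', 0 < i' → (i' < i ∨ i' = i ∧ m < m') →
      UnifBdd ε χ g₀ σ (1 + 3 * (i' : ℤ) - m') (rho d σ ε i' m')
        fun ξ c κ η => effForce σ χ ξ c κ i' m' η) :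
    UnifBdd ε χ g₀ σ (1 + 3 * (i : ℤ) - m) (rho d σ ε i m - σ)
      fun ξ c => flowRhs σ χ ξ c i m := by
  suffices h : ∀ j ∈ Finset.range (i + 1), ∀ k ∈ Finset.range (m + 1),
      UnifBdd ε χ g₀ σ (1 + 3 * (i : ℤ) - m) (rho d σ ε i m - σ)
        fun ξ c => flowTerm σ χ ξ c i m j k by
    unfold flowRhs
    refine UnifBdd.const_mul ?_ _
    refine UnifBdd.sum _ fun π _ => ?_
    refine UnifBdd.sum _ fun j hj => ?_
    refine UnifBdd.sum _ fun k hk => ?_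
    exact ((h j hj k hk).perm π).const_mul (1 + (k : ℝ))
  intro j hj k hk
  have hj : j ≤ i := by simpa [Nat.lt_succ_iff] using hj
  have hk : k ≤ m := by simpa [Nat.lt_succ_iff] using hk
  rcases Nat.eq_zero_or_pos j with h0 | h0
  · exact UnifBdd.zero.congr fun ξ c κ η Ψ => flowTerm_of_zero (Or.inl h0) κ η Ψ
  rcases hj.lt_or_eq with h1 | rfl
  · exact unifBdd_flowTerm_inner hS hj hk (ih j (k + 1) h0 (Or.inl h1))
      (ih (i - j) (m - k) (by omega) (Or.inl (by omega)))
  rcases hk.lt_or_eq with h2 | rfl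
  · exact UnifBdd.zero.congr fun ξ c κ η Ψ => flowTerm_of_zero (Or.inr ⟨rfl, h2⟩) κ η Ψ
  · exact unifBdd_flowTerm_noise hS (ih j (k + 1) h0 (Or.inr ⟨rfl, by omega⟩))

end

end Uniform

/-! ### Exponents -/

section Exponents

variable {d : ℕ} {σ ε : ℝ} {χ : ℝ → ℝ}

theorem rhoDiamond_le {i m l : ℕ} (hi : i ≤ iDiamond d σ + 1) (hm : m ≤ 3 * i)
    (h : 0 < rho d σ 0 i m + l) : rhoDiamond d σ ≤ rho d σ 0 i m + l :=
  csInf_le ⟨0, fun _ hx => by obtain ⟨_, _, _, _, _, _, h⟩ := hx; exact h.le⟩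
    ⟨i, m, l, hi, hm, rfl, h⟩

theorem Setup.rho_pos (h : Setup d σ ε χ) {i m l : ℕ} (hm : m ≤ 3 * i)
    (hp : 0 < rho d σ 0 i m + l) : 0 < rho d σ ε i m + l := by
  have hσ1 : 0 < 3 * σ - d := by linarith [h.sigma.1]
  have hσ2 : 0 ≤ (d : ℝ) / 2 - σ := by linarith [h.sigma.2]
  have hε := h.eps.1
  have he : 3 * ε < epsDiamond d σ := by linarith [h.eps.2]
  have he1 : 3 * ε < (3 * σ - d) / 9 := he.trans_le ((min_le_left _ _).trans (min_le_right _ _))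
  have he2 : 3 * ε < rhoDiamond d σ / (7 + 6 * (iDiamond d σ : ℝ)) :=
    he.trans_le ((min_le_right _ _).trans (min_le_left _ _))
  rw [lt_div_iff₀ (by positivity)] at he2
  have key : ∀ {i m l : ℕ}, i ≤ iDiamond d σ + 1 → m ≤ 3 * i → 0 < rho d σ 0 i m + l →
      0 < rho d σ ε i m + l := by
    intro i m l hi hm hp
    have h1 := rhoDiamond_le hi hm hp
    have h2 : rho d σ ε i m = rho d σ 0 i m - ε * (1 + 6 * i) + 2 * m * ε := by
      unfold rho; ring
    have h3 : (i : ℝ) ≤ iDiamond d σ + 1 := by exact_mod_cast hi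
    have h4 : ε * (1 + 6 * i) ≤ ε * (7 + 6 * iDiamond d σ) :=
      mul_le_mul_of_nonneg_left (by linarith) hε.le
    have h5 : 0 ≤ 2 * m * ε := by positivity
    have h6 : 0 < ε * (7 + 6 * iDiamond d σ) := by positivity
    linarith
  rcases le_or_gt i (iDiamond d σ + 1) with hi | hi
  · exact key hi hm hp
  · have hne : {n : ℕ | 0 < rho d σ 0 (n + 1) 0}.Nonempty := by
      obtain ⟨n, hn⟩ := exists_nat_gt ((d : ℝ) / 2 / (3 * σ - d))
      rw [div_lt_iff₀ hσ1] at hn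
      refine ⟨n, ?_⟩
      simp only [mem_ofPred_eq, rho]
      push_cast
      linarith
    have h0 : 0 < rho d σ 0 (iDiamond d σ + 1) 0 := Nat.sInf_mem hne
    have h1 := key (i := iDiamond d σ + 1) (m := 0) (l := 0) le_rfl (by omega) (by simpa using h0)
    have h2 : ((iDiamond d σ + 1 : ℕ) : ℝ) ≤ i := by exact_mod_cast hi.le
    have h3 : 0 ≤ (m : ℝ) * ((d : ℝ) / 2 - σ + 2 * ε) := by positivity
    have h4 : ((iDiamond d σ + 1 : ℕ) : ℝ) * (3 * σ - d - 6 * ε) ≤ i * (3 * σ - d - 6 * ε) :=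
      mul_le_mul_of_nonneg_right h2 (by linarith)
    have h5 : (0 : ℝ) ≤ l := by positivity
    unfold rho at h1 ⊢
    push_cast at h1 h4
    linarith

theorem Setup.force_monomial_eq_zero (h : Setup d σ ε χ) {ξ : Distr d} {c : ℕ → ℝ → ℝ} {i m : ℕ}
    (hi : 0 < i) {a : MultiIdx d m} (hp : 0 < rho d σ 0 i m + a.order) (κ : ℝ)
    (Ψ : Config d m → ℝ) : force σ ξ c κ i m (fun p => monomial a p * Ψ p) = 0 := by
  have hσ1 : 0 < 3 * σ - d := by linarith [h.sigma.1]
  rcases Nat.eq_zero_or_pos a.order with h0 | h0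
  · rw [h0, Nat.cast_zero, add_zero, rho] at hp
    unfold force
    rw [if_neg (by omega), if_neg, if_neg]
    · rintro ⟨⟨-, h1⟩, rfl⟩
      have h2 : (i : ℝ) ≤ σ / (3 * σ - d) :=
        (Nat.cast_le.2 h1).trans (Nat.floor_le (by have := h.sigma_pos; positivity))
      rw [le_div_iff₀ hσ1] at h2
      push_cast at hp
      linarith
    · rintro ⟨rfl, rfl⟩
      push_cast at hp
      linarith
  · have h1 : ∀ x : Space d, monomial a (x, fun _ => x) = 0 := fun x => by
      have := abs_monomial_le a (ρ := 0) (p := (x, fun _ => x)) fun q => by simp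
      rw [zero_pow h0.ne'] at this
      exact abs_nonpos_iff.1 this
    unfold force
    rw [if_neg (by omega)]
    simp [h1]

end Exponents

/-! ### Monomials -/

section Taylor

variable {d m : ℕ}

theorem exists_DB_monomial (a : MultiIdx d m) (n : ℕ) {r : ℝ} (hr : 0 ≤ r) :
    ∃ K, 0 ≤ K ∧ ∀ ℓ, 0 < ℓ → ∀ p ∈ tube d m (r * ℓ), DB n ℓ (K * ℓ ^ a.order) (monomial a) p := by
  refine ⟨2 ^ (n * (Finset.univ : Finset (Fin m)).card) * ∏ q,
    (2 ^ (n * (Finset.univ : Finset (Fin d)).card) * ∏ l, (2 ^ (n * a q l) * (r + 2) ^ (a q l))),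
    by positivity, fun ℓ hℓ p hp => ?_⟩
  have hs : ∀ q l, ContDiff ℝ n fun p : Config d m => p.1 l - p.2 q l := fun q l =>
    ((EuclideanSpace.proj (𝕜 := ℝ) l).contDiff.comp contDiff_fst).sub
      ((EuclideanSpace.proj (𝕜 := ℝ) l).contDiff.comp ((contDiff_apply ℝ _ q).comp contDiff_snd))
  have h1 : ∀ q l, DB n ℓ ((r + 2) * ℓ) (fun p : Config d m => p.1 l - p.2 q l) p := fun q l => by
    let L : Config d m →L[ℝ] ℝ := (EuclideanSpace.proj l).comp
      (ContinuousLinearMap.fst ℝ _ _ - (ContinuousLinearMap.proj q).comp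
        (ContinuousLinearMap.snd ℝ (Space d) (Fin m → Space d)))
    have hL : ∀ v, L v = v.1 l - v.2 q l := fun v => rfl
    have hL' : ∀ v, |L v| ≤ ‖v.2 q - v.1‖ := fun v => by
      rw [hL, abs_sub_comm]
      exact PiLp.norm_apply_le (v.2 q - v.1) l
    have := DB.linear (n := n) (x := p) (M := (r + 2) * ℓ) L 0 hℓ (by
      rw [add_zero]
      refine (hL' p).trans ((hp q).trans ?_)
      gcongr
      linarith) fun v => ?_
    · simpa only [add_zero, hL] using this
    · refine (hL' v).trans ((norm_sub_le _ _).trans ?_)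
      have e : (r + 2) * ℓ * (‖v‖ / ℓ) = (r + 2) * ‖v‖ := by field_simp
      rw [e]
      have h2 : ‖v.2 q‖ ≤ ‖v‖ := (norm_le_pi_norm v.2 q).trans (norm_snd_le v)
      have h3 : ‖v.1‖ ≤ ‖v‖ := norm_fst_le v
      nlinarith [norm_nonneg v]
  have h2 : ∀ q l, DB n ℓ (2 ^ (n * a q l) * (r + 2) ^ (a q l) * ℓ ^ (a q l))
      (fun p : Config d m => (p.1 l - p.2 q l) ^ (a q l) / ((a q l).factorial : ℝ)) p :=
    fun q l => by
    have h3 := DB.prod (Finset.range (a q l)) hℓ (fun _ _ => (hs q l).contDiffAt)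
      (fun _ _ => h1 q l)
    simp only [Finset.prod_const, Finset.card_range, mul_pow] at h3
    have h4 := (h3.const_mul ((a q l).factorial : ℝ)⁻¹ ((hs q l).pow _).contDiffAt).mono
      (M' := 2 ^ (n * a q l) * ((r + 2) ^ (a q l) * ℓ ^ (a q l))) hℓ (by
        refine mul_le_of_le_one_left (by positivity) ?_
        rw [abs_of_nonneg (by positivity)]
        exact inv_le_one_of_one_le₀ (by exact_mod_cast Nat.factorial_pos _))
    simpa only [div_eq_inv_mul, mul_assoc] using h4
  have hs' : ∀ q l, ContDiff ℝ n fun p : Config d m =>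
      (p.1 l - p.2 q l) ^ (a q l) / ((a q l).factorial : ℝ) := fun q l =>
    ((hs q l).pow _).div_const _
  have h3 := DB.prod Finset.univ hℓ (fun q _ => (contDiff_prod fun l _ => hs' q l).contDiffAt)
    fun q _ => DB.prod Finset.univ hℓ (fun l _ => (hs' q l).contDiffAt) fun l _ => h2 q l
  refine DB.mono hℓ h3 (le_of_eq ?_)
  simp only [Finset.prod_mul_distrib, Finset.prod_pow_eq_pow_sum, MultiIdx.order]
  ring

theorem Adm.monomial_mul {n : ℕ} {Ψ : Config d m → ℝ} (h : Adm n Ψ) (a : MultiIdx d m) :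
    Adm n fun p => monomial a p * Ψ p := by
  refine ⟨(contDiff_monomial a n).mul h.smooth, fun ρ => ?_⟩
  obtain ⟨K, hK, hb⟩ := exists_DB_monomial a n (abs_nonneg ρ)
  obtain ⟨M, hM, hb'⟩ := h.bound ρ
  refine ⟨fun x => 2 ^ n * (K * 1 ^ a.order * M x), (hM.const_mul (by positivity)).const_mul
    (by positivity), fun p hp => DB.mul (contDiff_monomial a n).contDiffAt h.smooth.contDiffAt
      (hb 1 one_pos p (tube_mono (by simpa using le_abs_self ρ) hp)) (hb' p hp)⟩

theorem Adm.zero (n : ℕ) : Adm n fun _ : Config d m => 0 :=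
  ⟨contDiff_const, fun _ => ⟨fun _ => 0, ⟨integrable_zero _ _ _, fun _ => le_rfl, 0, fun _ => le_rfl⟩,
    fun _ _ => DB.const one_pos (by simp)⟩⟩

theorem Adm.add {n : ℕ} {Ψ Ψ' : Config d m → ℝ} (h : Adm n Ψ) (h' : Adm n Ψ') :
    Adm n fun p => Ψ p + Ψ' p := by
  refine ⟨h.smooth.add h'.smooth, fun ρ => ?_⟩
  obtain ⟨M, hM, hb⟩ := h.bound ρ
  obtain ⟨M', hM', hb'⟩ := h'.bound ρ
  exact ⟨fun x => M x + M' x, hM.add hM', fun p hp => DB.add h.smooth.contDiffAt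
    h'.smooth.contDiffAt (hb p hp) (hb' p hp)⟩

theorem Adm.const_mul {n : ℕ} {Ψ : Config d m → ℝ} (h : Adm n Ψ) (b : ℝ) :
    Adm n fun p => b * Ψ p := by
  refine ⟨contDiff_const.mul h.smooth, fun ρ => ?_⟩
  obtain ⟨M, hM, hb⟩ := h.bound ρ
  exact ⟨fun x => |b| * M x, hM.const_mul (abs_nonneg b), fun p hp =>
    (hb p hp).const_mul b h.smooth.contDiffAt⟩

theorem Adm.sum {ι : Type*} (s : Finset ι) {n : ℕ} {f : ι → Config d m → ℝ}
    (h : ∀ i ∈ s, Adm n (f i)) : Adm n fun p => ∑ i ∈ s, f i p := by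
  classical
  induction s using Finset.induction_on with
  | empty => simpa using Adm.zero n
  | insert a s ha ih =>
    simp only [Finset.sum_insert ha]
    exact (h a (Finset.mem_insert_self a s)).add
      (ih fun i hi => h i (Finset.mem_insert_of_mem hi))

theorem IsAct.map_add {U : (Config d m → ℝ) → ℝ} (hU : IsAct U) {Ψ Ψ' : Config d m → ℝ}
    (h : Adm 0 Ψ) (h' : Adm 0 Ψ') : U (fun p => Ψ p + Ψ' p) = U Ψ + U Ψ' := by
  obtain ⟨K, a, A, ha, hA, -, hK⟩ := hU
  rw [hK _ (h.add h'), hK _ h, hK _ h', Kern.act_add h h' ha hA]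

theorem IsAct.map_const_mul {U : (Config d m → ℝ) → ℝ} (hU : IsAct U) {Ψ : Config d m → ℝ}
    (h : Adm 0 Ψ) (b : ℝ) : U (fun p => b * Ψ p) = b * U Ψ := by
  obtain ⟨K, a, A, ha, hA, -, hK⟩ := hU
  rw [hK _ (h.const_mul b), hK _ h, Kern.act_const_mul]

theorem IsAct.map_sum {U : (Config d m → ℝ) → ℝ} (hU : IsAct U) {ι : Type*} (s : Finset ι)
    {f : ι → Config d m → ℝ} (h : ∀ i ∈ s, Adm 0 (f i)) :
    U (fun p => ∑ i ∈ s, f i p) = ∑ i ∈ s, U (f i) := by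
  classical
  induction s using Finset.induction_on with
  | empty =>
    have := hU.map_const_mul (Adm.zero 0) 0
    simpa using this
  | insert a s ha ih =>
    simp only [Finset.sum_insert ha]
    rw [hU.map_add (h a (Finset.mem_insert_self a s))
      (Adm.sum s fun i hi => h i (Finset.mem_insert_of_mem hi)),
      ih fun i hi => h i (Finset.mem_insert_of_mem hi)]

/-! ### Taylor's formula -/

/-- `(x; x + t (y₁ - x), …)`. -/
def contraction (d m : ℕ) (t : ℝ) : Config d m →L[ℝ] Config d m :=
  (ContinuousLinearMap.fst ℝ _ _).prod (ContinuousLinearMap.pi fun q =>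
    (1 - t) • ContinuousLinearMap.fst ℝ (Space d) (Fin m → Space d) +
      t • (ContinuousLinearMap.proj q).comp (ContinuousLinearMap.snd ℝ (Space d) (Fin m → Space d)))

theorem contraction_apply (t : ℝ) (p : Config d m) :
    contraction d m t p = (p.1, fun q => (1 - t) • p.1 + t • p.2 q) := rfl

theorem norm_contraction_le {t : ℝ} (ht : t ∈ Icc (0 : ℝ) 1) (p : Config d m) :
    ‖contraction d m t p‖ ≤ ‖p‖ := by
  rw [contraction_apply]
  refine max_le (norm_fst_le p) ((pi_norm_le_iff_of_nonneg (norm_nonneg p)).2 fun q => ?_)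
  refine (norm_add_le _ _).trans ?_
  rw [norm_smul, norm_smul, Real.norm_of_nonneg ht.1, Real.norm_of_nonneg (sub_nonneg.2 ht.2)]
  have h2 : ‖p.2 q‖ ≤ ‖p‖ := (norm_le_pi_norm p.2 q).trans (norm_snd_le p)
  have h3 : ‖p.1‖ ≤ ‖p‖ := norm_fst_le p
  nlinarith [ht.1, ht.2, norm_nonneg (p.2 q), norm_nonneg p.1, mul_le_mul_of_nonneg_left h2 ht.1,
    mul_le_mul_of_nonneg_left h3 (sub_nonneg.2 ht.2)]

theorem contraction_mem_tube {t ρ : ℝ} (ht : t ∈ Icc (0 : ℝ) 1) {p : Config d m}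
    (hp : p ∈ tube d m ρ) : contraction d m t p ∈ tube d m ρ := fun q => by
  have e : (contraction d m t p).2 q - (contraction d m t p).1 = t • (p.2 q - p.1) := by
    simp only [contraction_apply]
    module
  rw [e, norm_smul, Real.norm_of_nonneg ht.1]
  exact (mul_le_of_le_one_left (norm_nonneg _) ht.2).trans (hp q)

/-- The direction of the coordinate `l` of `y_q`. -/
def dirVec (e : Fin m × Fin d) : Config d m := (0, Pi.single e.1 (unitVec d e.2))

theorem norm_dirVec_le (e : Fin m × Fin d) : ‖(dirVec e : Config d m)‖ ≤ 1 :=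
  max_le (by simp [dirVec]) (by rw [dirVec, Pi.norm_single, norm_unitVec])

/-- The coefficients of the remainder in Taylor's formula. -/
def taylorRem (e : Fin m × Fin d) (Ψ : Config d m → ℝ) (p : Config d m) : ℝ :=
  ∫ t in Ioc (0 : ℝ) 1, fderiv ℝ Ψ (contraction d m t p) (dirVec e)

theorem DB_fderiv_contraction {n : ℕ} {ℓ M t : ℝ} (hℓ : 0 < ℓ) (ht : t ∈ Icc (0 : ℝ) 1)
    (e : Fin m × Fin d) {Ψ : Config d m → ℝ} (hΨ : ContDiff ℝ (n + 1 : ℕ) Ψ) {p : Config d m}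
    (h : DB (n + 1) ℓ M Ψ (contraction d m t p)) :
    DB n ℓ (M / ℓ) (fun p => fderiv ℝ Ψ (contraction d m t p) (dirVec e)) p := by
  have h0 := h.nonneg
  have h1 := ((h.2 (dirVec e)).mono (M' := M / ℓ) hℓ (by
    rw [mul_div_assoc']
    gcongr
    exact mul_le_of_le_one_right h0 (norm_dirVec_le e)))
  have h2 := DB.comp_affine (y := p) (ℓ' := ℓ) (contraction d m t) 0 hℓ (fun v => by
    have := norm_contraction_le ht v
    gcongr) (contDiff_dir hΨ (dirVec e)).contDiffAt (by simpa using h1)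
  simpa using h2

theorem paramInt_taylorRem {n : ℕ} (e : Fin m × Fin d) {Ψ : Config d m → ℝ} (hΨ : Adm (n + 1) Ψ) :
    ParamInt (volume.restrict (Ioc (0 : ℝ) 1)) n
      fun t p => fderiv ℝ Ψ (contraction d m t p) (dirVec e) := by
  have hc := (contDiff_dir hΨ.smooth (dirVec e)).continuous
  refine ⟨Filter.Eventually.of_forall fun t => (contDiff_dir hΨ.smooth _).comp
    (contraction d m t).contDiff, fun p => ?_, fun p₀ => ?_⟩
  · refine Continuous.aestronglyMeasurable (hc.comp ?_)
    simp only [contraction_apply]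
    fun_prop
  · obtain ⟨M, hM, hb⟩ := hΨ.bound (2 * (‖p₀‖ + 1))
    obtain ⟨B, hB⟩ := hM.bdd
    refine ⟨1, one_pos, fun _ => B / 1, integrable_const _, ?_⟩
    filter_upwards [ae_restrict_mem measurableSet_Ioc] with t ht p hp
    have ht' : t ∈ Icc (0 : ℝ) 1 := ⟨ht.1.le, ht.2⟩
    have h1 : ‖p‖ ≤ ‖p₀‖ + 1 := by
      have h2 := norm_sub_norm_le p p₀
      rw [Metric.mem_ball, dist_eq_norm] at hp
      linarith
    refine DB_fderiv_contraction one_pos ht' e hΨ.smooth ((hb _ (contraction_mem_tube ht'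
      (tube_mono (by linarith) (mem_tube_of_norm p)))).mono one_pos (hB _))

theorem DB_taylorRem {n : ℕ} (e : Fin m × Fin d) {Ψ : Config d m → ℝ} (hΨ : Adm (n + 1) Ψ)
    {M : Space d → ℝ} {ℓ ρ : ℝ} (hℓ : 0 < ℓ) (h : ∀ p ∈ tube d m ρ, DB (n + 1) ℓ (M p.1) Ψ p)
    {p : Config d m} (hp : p ∈ tube d m ρ) : DB n ℓ (M p.1 / ℓ) (taylorRem e Ψ) p := by
  have := (paramInt_taylorRem e hΨ).db (ℓ := ℓ) (M := fun _ => M p.1 / ℓ) (x := p)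
    (integrable_const _) (by
    filter_upwards [ae_restrict_mem measurableSet_Ioc] with t ht
    have ht' : t ∈ Icc (0 : ℝ) 1 := ⟨ht.1.le, ht.2⟩
    exact DB_fderiv_contraction hℓ ht' e hΨ.smooth (h _ (contraction_mem_tube ht' hp)))
  simp at this
  exact this

theorem Adm.taylorRem {n : ℕ} (e : Fin m × Fin d) {Ψ : Config d m → ℝ} (hΨ : Adm (n + 1) Ψ) :
    Adm n (EllipticFlow.taylorRem e Ψ) := by
  refine ⟨(paramInt_taylorRem e hΨ).contDiff, fun ρ => ?_⟩
  obtain ⟨M, hM, hb⟩ := hΨ.bound ρ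
  exact ⟨M, hM, fun p hp => by simpa using DB_taylorRem e hΨ one_pos hb hp⟩

theorem config_decomp (p : Config d m) :
    ((0, fun q => p.2 q - p.1) : Config d m) =
      ∑ e : Fin m × Fin d, (p.2 e.1 e.2 - p.1 e.2) • dirVec e := by
  refine Prod.ext ?_ (funext fun q => ?_)
  · simp [dirVec, Prod.fst_sum]
  · ext l
    simp only [dirVec, Prod.snd_sum, Prod.smul_snd, Finset.sum_apply, Pi.smul_apply, PiLp.sub_apply,
      WithLp.ofLp_sum, PiLp.smul_apply, smul_eq_mul]
    rw [Finset.sum_eq_single (q, l)]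
    · simp [unitVec]
    · rintro ⟨q', l'⟩ - hne
      by_cases hq : q = q'
      · subst hq
        have : l ≠ l' := fun h => hne (by rw [h])
        simp [unitVec, this]
      · simp [Pi.single_eq_of_ne hq]
    · simp

theorem taylor_formula {Ψ : Config d m → ℝ} (hΨ : ContDiff ℝ (1 : ℕ) Ψ) (p : Config d m) :
    Ψ p = Ψ (p.1, fun _ => p.1) +
      ∑ e : Fin m × Fin d, (p.2 e.1 e.2 - p.1 e.2) * taylorRem e Ψ p := by
  have hcont : ∀ v, Continuous fun t : ℝ => fderiv ℝ Ψ (contraction d m t p) v := fun v => by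
    refine (contDiff_dir (n := 0) hΨ v).continuous.comp ?_
    simp only [contraction_apply]
    fun_prop
  have h1 : ∀ t : ℝ, HasDerivAt (fun t => Ψ (contraction d m t p))
      (fderiv ℝ Ψ (contraction d m t p) (0, fun q => p.2 q - p.1)) t := fun t => by
    have h2 : HasDerivAt (fun t => contraction d m t p)
        ((0, fun q => p.2 q - p.1) : Config d m) t := by
      simp only [contraction_apply]
      refine (hasDerivAt_const t p.1).prodMk (hasDerivAt_pi.2 fun q => ?_)
      have := (((hasDerivAt_id t).const_sub 1).smul_const p.1).add
        ((hasDerivAt_id t).smul_const (p.2 q))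
      refine this.congr_deriv ?_
      module
    exact ((hΨ.differentiable (by simp)) _).hasFDerivAt.comp_hasDerivAt
      (f := fun t => contraction d m t p) t h2
  have h3 := intervalIntegral.integral_eq_sub_of_hasDerivAt (a := 0) (b := 1) (fun t _ => h1 t)
    ((hcont _).intervalIntegrable _ _)
  have e0 : contraction d m 0 p = (p.1, fun _ => p.1) := by simp [contraction_apply]
  have e1 : contraction d m 1 p = p := by simp [contraction_apply]
  rw [e0, e1] at h3
  simp only [config_decomp, map_sum, map_smul, smul_eq_mul] at h3
  rw [intervalIntegral.integral_finsetSum fun e _ =>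
    ((hcont (dirVec e)).const_mul _).intervalIntegrable _ _] at h3
  simp only [intervalIntegral.integral_const_mul] at h3
  simp only [taylorRem, ← intervalIntegral.integral_of_le zero_le_one]
  rw [h3]
  ring

/-- The multi-index `a` raised by one in the coordinate `l` of `y_q`. -/
def MultiIdx.raise (a : MultiIdx d m) (e : Fin m × Fin d) : MultiIdx d m :=
  Function.update a e.1 (Function.update (a e.1) e.2 (a e.1 e.2 + 1))

theorem sum_update {ι β : Type*} [Fintype ι] [DecidableEq ι] (f : β → ℕ) (a : ι → β) (i : ι) (b : β) :
    ∑ j, f (Function.update a i b j) + f (a i) = ∑ j, f (a j) + f b := by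
  rw [← Finset.add_sum_erase _ _ (Finset.mem_univ i), ← Finset.add_sum_erase (a := i) _
    (fun j => f (a j)) (Finset.mem_univ i), Function.update_self,
    Finset.sum_congr rfl fun j hj => by rw [Function.update_of_ne (Finset.ne_of_mem_erase hj)]]
  ring

theorem prod_update {ι β : Type*} [Fintype ι] [DecidableEq ι] (f : ι → β → ℝ) (a : ι → β) (i : ι)
    (b : β) (x y : ℝ) (h : x * f i b = y * f i (a i)) :
    x * ∏ j, f j (Function.update a i b j) = y * ∏ j, f j (a j) := by
  rw [← Finset.mul_prod_erase _ _ (Finset.mem_univ i), ← Finset.mul_prod_erase (a := i) _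
    (fun j => f j (a j)) (Finset.mem_univ i), Function.update_self,
    Finset.prod_congr rfl fun j hj => by rw [Function.update_of_ne (Finset.ne_of_mem_erase hj)],
    ← mul_assoc, ← mul_assoc, h]

theorem MultiIdx.order_raise (a : MultiIdx d m) (e : Fin m × Fin d) :
    (a.raise e).order = a.order + 1 := by
  have h1 := sum_update (fun b : Fin d → ℕ => ∑ l, b l) a e.1
    (Function.update (a e.1) e.2 (a e.1 e.2 + 1))
  have h2 := sum_update id (a e.1) e.2 (a e.1 e.2 + 1)
  simp only [id] at h2
  unfold MultiIdx.order MultiIdx.raise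
  omega

theorem monomial_raise (a : MultiIdx d m) (e : Fin m × Fin d) (p : Config d m) :
    (a e.1 e.2 + 1 : ℝ) * monomial (a.raise e) p = (p.1 e.2 - p.2 e.1 e.2) * monomial a p := by
  unfold monomial MultiIdx.raise
  refine prod_update (fun q (b : Fin d → ℕ) =>
    ∏ l, (p.1 l - p.2 q l) ^ (b l) / ((b l).factorial : ℝ)) a e.1 _ _ _ ?_
  refine prod_update (fun l (b : ℕ) =>
    (p.1 l - p.2 e.1 l) ^ b / (b.factorial : ℝ)) (a e.1) e.2 _ _ _ ?_
  have : ((a e.1 e.2).factorial : ℝ) ≠ 0 := by positivity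
  rw [Nat.factorial_succ]
  push_cast
  field_simp
  ring

theorem monomial_mul_eq {Ψ : Config d m → ℝ} (hΨ : ContDiff ℝ (1 : ℕ) Ψ) (a : MultiIdx d m)
    (p : Config d m) : monomial a p * Ψ p = monomial a p * Ψ (p.1, fun _ => p.1) +
      ∑ e : Fin m × Fin d, (-(a e.1 e.2 + 1 : ℝ)) * (monomial (a.raise e) p * taylorRem e Ψ p) := by
  conv_lhs => rw [taylor_formula hΨ p, mul_add, Finset.mul_sum]
  congr 1
  refine Finset.sum_congr rfl fun e _ => ?_
  linear_combination (taylorRem e Ψ p) * monomial_raise a e p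

end Taylor

/-! ### Bounds on the effective force coefficients -/

section Main

variable {d m : ℕ} {σ ε : ℝ} {χ : ℝ → ℝ} {g₀ : (i m : ℕ) → MultiIdx d m → ℕ}

theorem cutD_genForce {ξ : Distr d} {c : ℕ → ℝ → ℝ} {i : ℕ} (a : MultiIdx d m) (s : ℕ) (κ μ : ℝ)
    (Ψ : Config d m → ℝ) : cutD s (genForce σ χ ξ c i m a) κ μ Ψ =
      cutD s (fun κ η => effForce σ χ ξ c κ i m η) κ μ fun p => monomial a p * Ψ p := by
  unfold cutD
  split_ifs <;> rfl

theorem Rep.isAct_cutD {F : ℝ → ℝ → (Config d m → ℝ) → ℝ} (h : Rep F) {κ η : ℝ}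
    (hκ : κ ∈ Ioc (0 : ℝ) (1 / 2)) (hη : η ∈ Ioc (0 : ℝ) (3 / 4)) (s : ℕ) :
    IsAct (cutD s F κ η) := by
  unfold cutD
  split_ifs
  · exact h.isAct hκ hη
  · exact h.isAct_cutDeriv hκ hη

variable (hS : Setup d σ ε χ)

include hS

theorem cutD_effForce_eq_integral {R : ℝ} {ξ : Distr d} {c : ℕ → ℝ → ℝ}
    (D : FlowData d σ ε χ g₀ R ξ c) {i : ℕ} (hi : 0 < i) (hm : m ≤ 3 * i) {κ μ : ℝ}
    (hκ : κ ∈ Ioc (0 : ℝ) (1 / 2)) (hμ : μ ∈ Ioc (0 : ℝ) (1 / 2)) {Ψ : Config d m → ℝ} (hΨ : Adm 0 Ψ)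
    (h0 : ∀ κ, force σ ξ c κ i m Ψ = 0) (s : ℕ) :
    cutD s (fun κ η => effForce σ χ ξ c κ i m η) κ μ Ψ =
      ∫ η in (0 : ℝ)..μ, cutD s (flowRhs σ χ ξ c i m) κ η Ψ := by
  have h1 : ∀ κ, effForce σ χ ξ c κ i m μ Ψ = ∫ η in (0 : ℝ)..μ, flowRhs σ χ ξ c i m κ η Ψ :=
    fun κ => by rw [effForce_eq_flowRhs hi hm, h0, zero_add]
  unfold cutD
  split_ifs
  · exact h1 κ
  · rw [← (D.rep hS i m).2.cutDeriv_integral hκ ⟨hμ.1, by linarith [hμ.2]⟩ hΨ]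
    unfold cutDeriv
    simp only [h1]

omit hS in
theorem FlowData.exists_regularization {R : ℝ} {ξ : Distr d} {c : ℕ → ℝ → ℝ}
    (D : FlowData d σ ε χ g₀ R ξ c) {i : ℕ} {a : MultiIdx d m} (ha : rho d σ 0 i m + a.order ≤ 0)
    {s : ℕ} (hs : s ∈ ({0, 1} : Set ℕ)) {κ μ : ℝ} (hκ : κ ∈ Ioc (0 : ℝ) (1 / 2))
    (hμ : μ ∈ Ioc (0 : ℝ) (1 / 2)) : ∃ v : Config d 0 → ℝ,
      IsRegularization σ (g₀ i m a) μ (fun Φ : 𝓢(Config d 0, ℝ) =>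
        cutD s (fun κ η => effForce σ χ ξ c κ i m η) κ μ
          fun p => monomial a p * Φ (p.1, Fin.elim0)) v ∧ MemV v ∧
      normV v ≤ ENNReal.ofReal
        (R * scale σ κ ^ ((ε - σ) * s) * scale σ μ ^ (rho d σ ε i m + a.order)) := by
  obtain ⟨T, v, ⟨U, hU, hT⟩, hv, hm, hn⟩ := D.noise i m a ha s hs κ hκ μ hμ
  refine ⟨v, ?_, hm, hn⟩
  have hU : ∀ κ' ∈ Ioc (0 : ℝ) (1 / 2), U κ' = fun Φ : 𝓢(Config d 0, ℝ) =>
    enhNoise σ χ ξ c i m a κ' μ Φ := hU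
  convert hv using 1
  rcases hs with rfl | rfl
  · have hT : T = U κ := hT
    rw [hT, hU κ hκ]
    rfl
  · obtain ⟨U', hU', hT⟩ := hT
    have hU' : ∀ κ' ∈ Ioc (0 : ℝ) (1 / 2), U' κ' = U κ' := hU'
    ext Φ
    refine cutDeriv_unique hκ ((hT Φ).congr (fun κ' hκ' => ?_) ?_)
    · rw [hU' κ' hκ', hU κ' hκ']; rfl
    · rw [hU' κ hκ, hU κ hκ]; rfl

omit hS in
variable (σ ε χ g₀) in
/-- Bounds on the coefficient `F^{i,m,a}`. -/
def GenBdd (i : ℕ) (a : MultiIdx d m) : Prop :=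
  ∃ (n : ℕ) (r C : ℝ), 0 ≤ r ∧ 0 ≤ C ∧ ∀ R ξ c, FlowData d σ ε χ g₀ R ξ c →
    HasBound σ ε n r (C * R ^ (1 + 3 * (i : ℤ) - m)) (rho d σ ε i m + a.order)
      (genForce σ χ ξ c i m a)

theorem genBdd_of_pos {i : ℕ} (hi : 0 < i) (hm : m ≤ 3 * i)
    (hrhs : UnifBdd ε χ g₀ σ (1 + 3 * (i : ℤ) - m) (rho d σ ε i m - σ)
      fun ξ c => flowRhs (d := d) σ χ ξ c i m)
    (a : MultiIdx d m) (ha : 0 < rho d σ 0 i m + a.order) : GenBdd σ ε χ g₀ i a := by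
  obtain ⟨n, r, C, hr, hC, hb⟩ := hrhs
  obtain ⟨K, hK, hKb⟩ := exists_DB_monomial a n hr
  have hσ := hS.sigma_pos
  set γ := rho d σ ε i m + a.order with hγd
  have hγ : 0 < γ := hS.rho_pos hm ha
  refine ⟨n, r, C * (2 ^ n * K) * (σ / γ), hr, by positivity, fun R ξ c D κ hκ μ hμ s hs Ψ M hΨ hM hbd => ?_⟩
  have hΨ' := hΨ.monomial_mul a
  rw [cutD_genForce, cutD_effForce_eq_integral hS D hi hm hκ hμ (hΨ'.of_le (Nat.zero_le n))
    (fun κ => hS.force_monomial_eq_zero hi ha κ Ψ) s]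
  have hℓμ := scale_pos (σ := σ) hμ.1
  have hℓκ := scale_pos (σ := σ) hκ.1
  have hR := D.pos
  set A := C * R ^ (1 + 3 * (i : ℤ) - m) * scale σ κ ^ ((ε - σ) * s) * (2 ^ n * K) * ∫ x, M x with hA
  have key : ∀ η ∈ Ioc 0 μ, |cutD s (flowRhs σ χ ξ c i m) κ η fun p => monomial a p * Ψ p| ≤
      A * η ^ (γ / σ - 1) := fun η hη => by
    have hη' : η ∈ Ioc (0 : ℝ) (1 / 2) := ⟨hη.1, hη.2.trans hμ.2⟩
    have hℓ := scale_pos (σ := σ) hη.1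
    have hle := scale_le hσ hη.1 hη.2
    have h1 := (hb R ξ c D).2 κ hκ η hη' s hs _
      (fun x => 2 ^ n * (K * scale σ η ^ a.order * M x)) hΨ'
      ((hM.const_mul (by positivity)).const_mul (by positivity))
      fun p hp => DB.mul (contDiff_monomial a n).contDiffAt hΨ.smooth.contDiffAt (hKb _ hℓ p hp)
        ((hbd p (tube_mono (by gcongr) hp)).scale_le hℓμ hℓ hle)
    refine h1.trans (le_of_eq ?_)
    have e : scale σ η ^ (rho d σ ε i m - σ) * scale σ η ^ a.order = η ^ (γ / σ - 1) := by
      rw [← Real.rpow_natCast, ← Real.rpow_add hℓ, scale_rpow' hη.1]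
      congr 1
      rw [hγd]
      field_simp
      ring
    rw [integral_const_mul, integral_const_mul, ← e, hA]
    ring
  have h2 : -1 < γ / σ - 1 := by have : 0 < γ / σ := by positivity
                                 linarith
  refine (intervalIntegral.norm_integral_le_of_norm_le
    (f := fun η => cutD s (flowRhs σ χ ξ c i m) κ η fun p => monomial a p * Ψ p) hμ.1.le
    (Filter.Eventually.of_forall key)
    ((intervalIntegral.intervalIntegrable_rpow' h2).const_mul A)).trans (le_of_eq ?_)
  rw [intervalIntegral.integral_const_mul, integral_rpow (Or.inl h2), sub_add_cancel,
    Real.zero_rpow (by positivity), sub_zero, scale_rpow' hμ.1, ← hγd, hA]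
  field_simp

theorem genBdd_of_raise {i : ℕ} (hi : 0 < i) (hm : m ≤ 3 * i) (a : MultiIdx d m)
    (ha : rho d σ 0 i m + a.order ≤ 0) (ih : ∀ e, GenBdd σ ε χ g₀ i (a.raise e)) :
    GenBdd σ ε χ g₀ i a := by
  choose n r C hr hC hb using ih
  set g := g₀ i m a
  have hsum : ∀ (f : Fin m × Fin d → ℝ) (_ : ∀ e, 0 ≤ f e) e, f e ≤ ∑ e, f e := fun f hf e =>
    Finset.single_le_sum (f := f) (fun e _ => hf e) (Finset.mem_univ e)
  have hn : ∀ e, n e + 1 ≤ 2 * g + ∑ e, n e + 1 := fun e => by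
    have := Finset.single_le_sum (f := n) (fun e _ => Nat.zero_le _) (Finset.mem_univ e)
    omega
  refine ⟨2 * g + ∑ e, n e + 1, ∑ e, r e, (1 + d) ^ g + ∑ e : Fin m × Fin d, (a e.1 e.2 + 1) * C e,
    Finset.sum_nonneg fun e _ => hr e, add_nonneg (by positivity) (Finset.sum_nonneg fun e _ =>
      mul_nonneg (by positivity) (hC e)), fun R ξ c D κ hκ μ hμ s hs Ψ M hΨ hM hbd => ?_⟩
  have hℓμ := scale_pos (σ := σ) hμ.1
  have hℓκ := scale_pos (σ := σ) hκ.1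
  have hR := D.pos
  have hU := ((D.rep hS i m).1 hi).isAct_cutD hκ (η := μ) ⟨hμ.1, by linarith [hμ.2]⟩ s
  have hdiag : ∀ x : Space d, (x, fun _ => x) ∈ tube d m ((∑ e, r e) * scale σ μ) := fun x q => by
    simpa using mul_nonneg (Finset.sum_nonneg fun e _ => hr e) hℓμ.le
  let L : Space d →L[ℝ] Config d m :=
    (ContinuousLinearMap.id ℝ _).prod (ContinuousLinearMap.pi fun _ => ContinuousLinearMap.id ℝ _)
  have hL : ∀ x, L x = (x, fun _ => x) := fun _ => rfl
  have hφ : ContDiff ℝ (2 * g : ℕ) fun x : Space d => Ψ (x, fun _ => x) :=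
    (hΨ.smooth.of_le (by norm_cast; omega)).comp L.contDiff
  have hφb : ∀ x, DB (2 * g) (scale σ μ) (M x) (fun x : Space d => Ψ (x, fun _ => x)) x := fun x => by
    have := DB.comp_affine (n := 2 * g) (y := x) (f := Ψ) (ℓ := scale σ μ) (M := M x) L 0 hℓμ
      (fun v => by
        gcongr
        exact max_le le_rfl ((pi_norm_le_iff_of_nonneg (norm_nonneg v)).2 fun _ => le_rfl))
      (hΨ.smooth.of_le (by norm_cast; omega)).contDiffAt
      (by simpa [hL] using (hbd _ (hdiag x)).of_le (by omega))
    simpa [hL] using this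
  have hT : ∀ e, Adm (n e) (taylorRem e Ψ) := fun e => (hΨ.of_le (hn e)).taylorRem e
  have e1 : cutD s (genForce σ χ ξ c i m a) κ μ Ψ =
      cutD s (fun κ η => effForce σ χ ξ c κ i m η) κ μ
        (fun p => monomial a p * Ψ (p.1, fun _ => p.1)) +
      ∑ e : Fin m × Fin d, (-(a e.1 e.2 + 1 : ℝ)) *
        cutD s (genForce σ χ ξ c i m (a.raise e)) κ μ (taylorRem e Ψ) := by
    have hA : ∀ e, Adm 0 fun p => monomial (a.raise e) p * taylorRem e Ψ p := fun e =>
      ((hT e).of_le (Nat.zero_le _)).monomial_mul _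
    simp only [cutD_genForce]
    rw [funext (monomial_mul_eq (hΨ.smooth.of_le (by norm_cast; omega)) a), hU.map_add
      (adm_monomial_mul a hφ.continuous hM fun x => (hφb x).abs_le)
      (Adm.sum _ fun e _ => (hA e).const_mul _), hU.map_sum _ fun e _ => (hA e).const_mul _]
    congr 1
    exact Finset.sum_congr rfl fun e _ => hU.map_const_mul (hA e) _
  set B := R ^ (1 + 3 * (i : ℤ) - m) * scale σ κ ^ ((ε - σ) * s) *
    scale σ μ ^ (rho d σ ε i m + a.order) with hB
  have b1 : |cutD s (fun κ η => effForce σ χ ξ c κ i m η) κ μ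
      (fun p => monomial a p * Ψ (p.1, fun _ => p.1))| ≤ (1 + d) ^ g * B * ∫ x, M x := by
    obtain ⟨v, hv, hvm, hvn⟩ := D.exists_regularization ha hs hκ hμ
    refine (abs_le_of_regularization hU hμ.1 (by positivity) hv hvm hvn hφ hM hφb).trans ?_
    have h1 : R ≤ R ^ (1 + 3 * (i : ℤ) - m) := by
      conv_lhs => rw [← zpow_one R]
      exact zpow_le_zpow_right₀ D.one_lt.le (by omega)
    refine mul_le_mul_of_nonneg_right ?_ hM.integral_nonneg
    rw [mul_comm, hB]
    gcongr
  have b2 : ∀ e : Fin m × Fin d, |(-(a e.1 e.2 + 1 : ℝ)) *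
      cutD s (genForce σ χ ξ c i m (a.raise e)) κ μ (taylorRem e Ψ)| ≤
        (a e.1 e.2 + 1) * C e * B * ∫ x, M x := fun e => by
    have h1 := hb e R ξ c D κ hκ μ hμ s hs (taylorRem e Ψ) (fun x => M x * (scale σ μ)⁻¹) (hT e)
      (hM.mul_const (by positivity)) fun p hp => DB_taylorRem e (hΨ.of_le (hn e)) hℓμ
        (fun p hp => (hbd p hp).of_le (hn e)) (tube_mono (mul_le_mul_of_nonneg_right
          (hsum r hr e) hℓμ.le) hp)
    rw [abs_mul, abs_neg, abs_of_nonneg (by positivity), mul_assoc, mul_assoc]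
    refine mul_le_mul_of_nonneg_left (h1.trans (le_of_eq ?_)) (by positivity)
    rw [integral_mul_const, MultiIdx.order_raise, hB]
    push_cast
    rw [← add_assoc, Real.rpow_add_one hℓμ.ne']
    field_simp
  rw [e1]
  refine (abs_add_le _ _).trans ((add_le_add b1 ((Finset.abs_sum_le_sum_abs _ _).trans
    (Finset.sum_le_sum fun e _ => b2 e))).trans (le_of_eq ?_))
  rw [← Finset.sum_mul, ← Finset.sum_mul, hB]
  ring

theorem genBdd_of_rhs {i : ℕ} (hi : 0 < i) (hm : m ≤ 3 * i)
    (hrhs : UnifBdd ε χ g₀ σ (1 + 3 * (i : ℤ) - m) (rho d σ ε i m - σ)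
      fun ξ c => flowRhs (d := d) σ χ ξ c i m) (k : ℕ) :
    ∀ a : MultiIdx d m, 0 < rho d σ 0 i m + a.order + k → GenBdd σ ε χ g₀ i a := by
  induction k with
  | zero => exact fun a ha => genBdd_of_pos hS hi hm hrhs a (by simpa using ha)
  | succ k ih =>
    intro a ha
    rcases lt_or_ge 0 (rho d σ 0 i m + a.order) with h | h
    · exact genBdd_of_pos hS hi hm hrhs a h
    · refine genBdd_of_raise hS hi hm a h fun e => ih _ ?_
      rw [MultiIdx.order_raise]
      push_cast at ha ⊢
      linarith

theorem unifBdd_effForce (i m : ℕ) (hi : 0 < i) :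
    UnifBdd ε χ g₀ σ (1 + 3 * (i : ℤ) - m) (rho d σ ε i m)
      fun ξ c κ η => effForce (d := d) σ χ ξ c κ i m η := by
  induction i using Nat.strong_induction_on generalizing m with
  | _ i ihi =>
  induction hn : 3 * i + 1 - m using Nat.strong_induction_on generalizing m with
  | _ n ihn =>
  subst hn
  rcases lt_or_ge (3 * i) m with hm | hm
  · exact UnifBdd.zero.congr fun ξ c κ η Ψ => by rw [effForce_of_lt hm]
  have hrhs := unifBdd_flowRhs (g₀ := g₀) hS (i := i) (m := m) fun i' m' hi' h => by
    rcases h with h | ⟨rfl, h⟩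
    · exact ihi i' h m' hi'
    · exact ihn (3 * i' + 1 - m') (by omega) m' rfl
  obtain ⟨k, hk⟩ := exists_nat_gt (-rho d σ 0 i m)
  have h0 : MultiIdx.order (0 : MultiIdx d m) = 0 := by simp [MultiIdx.order]
  obtain ⟨n, r, C, hr, hC, hb⟩ := genBdd_of_rhs hS hi hm hrhs k 0 (by rw [h0]; push_cast; linarith)
  refine ⟨n, r, C, hr, hC, fun R ξ c D => ⟨(D.rep hS i m).1 hi, fun κ hκ μ hμ s hs => ?_⟩⟩
  have h1 := hb R ξ c D κ hκ μ hμ s hs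
  rw [h0, Nat.cast_zero, add_zero] at h1
  refine h1.congr fun Ψ _ => ?_
  rw [cutD_genForce]
  simp [monomial]

theorem unifBdd_flowRhs' (i m : ℕ) : UnifBdd ε χ g₀ σ (1 + 3 * (i : ℤ) - m) (rho d σ ε i m - σ)
    fun ξ c => flowRhs (d := d) σ χ ξ c i m :=
  unifBdd_flowRhs hS fun i' m' hi' _ => unifBdd_effForce hS i' m' hi'

end Main

/-! ### Regularization of functionals -/

section Regularize

variable {d m : ℕ}

/-- The function that dominates the regularizing kernel. -/
def bump (d : ℕ) (ℓ : ℝ) (w : Space d) : ℝ := ℓ ^ (-(d : ℝ)) * decay (d + 1) (ℓ⁻¹ • w)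

@[fun_prop]
theorem continuous_bump (ℓ : ℝ) : Continuous (bump d ℓ) := by unfold bump; fun_prop

theorem bump_nonneg {ℓ : ℝ} (hℓ : 0 < ℓ) (w : Space d) : 0 ≤ bump d ℓ w :=
  mul_nonneg (by positivity) (decay_pos _ _).le

theorem bump_le {ℓ : ℝ} (hℓ : 0 < ℓ) (w : Space d) : bump d ℓ w ≤ ℓ ^ (-(d : ℝ)) :=
  mul_le_of_le_one_right (by positivity) (decay_le_one _ _)

theorem bump_add_le {ℓ r : ℝ} (hℓ : 0 < ℓ) {w h : Space d} (hh : ‖h‖ ≤ r * ℓ) :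
    bump d ℓ (w + h) ≤ (1 + r) ^ (d + 1) * bump d ℓ w := by
  have h1 := decay_add_le (d + 1) (ℓ⁻¹ • w) (ℓ⁻¹ • h)
  rw [← smul_add] at h1
  have h2 : ‖ℓ⁻¹ • h‖ ≤ r := by
    rw [norm_smul, norm_inv, Real.norm_of_nonneg hℓ.le, inv_mul_le_iff₀ hℓ, mul_comm]
    exact hh
  have h3 := (decay_pos (d + 1) (ℓ⁻¹ • w)).le
  calc bump d ℓ (w + h) ≤ ℓ ^ (-(d : ℝ)) * ((1 + r) ^ (d + 1) * decay (d + 1) (ℓ⁻¹ • w)) := by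
        unfold bump
        gcongr
        exact h1.trans (by gcongr)
    _ = _ := by unfold bump; ring

theorem integrable_bump {ℓ : ℝ} (hℓ : 0 < ℓ) : Integrable (bump d ℓ) :=
  ((integrable_decay (Nat.lt_succ_self d)).comp_smul (inv_ne_zero hℓ.ne')).const_mul _

theorem integral_bump {ℓ : ℝ} (hℓ : 0 < ℓ) :
    ∫ w, bump d ℓ w = ∫ w : Space d, decay (d + 1) w := by
  unfold bump
  rw [integral_const_mul, Measure.integral_comp_smul, finrank_euclideanSpace_fin, inv_pow, inv_inv,
    abs_of_pos (by positivity), smul_eq_mul, ← mul_assoc, Real.rpow_neg hℓ.le, Real.rpow_natCast,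
    inv_mul_cancel₀ (by positivity), one_mul]

/-- The weight that controls the regularizing kernel on a tube. -/
def weight (ℓ : ℝ) (ζ : Config d m) (x : Space d) : ℝ :=
  bump d ℓ (ζ.1 - x) * ∏ q, bump d ℓ (ζ.2 q - x)

theorem weight_le {ℓ : ℝ} (hℓ : 0 < ℓ) (ζ : Config d m) (x : Space d) :
    weight ℓ ζ x ≤ (ℓ ^ (-(d : ℝ))) ^ m * bump d ℓ (ζ.1 - x) := by
  rw [weight, mul_comm]
  refine mul_le_mul_of_nonneg_right ?_ (bump_nonneg hℓ _)
  refine (Finset.prod_le_prod (fun q _ => bump_nonneg hℓ _) fun q _ => bump_le hℓ _).trans ?_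
  simp

theorem weight_nonneg {ℓ : ℝ} (hℓ : 0 < ℓ) (ζ : Config d m) (x : Space d) : 0 ≤ weight ℓ ζ x :=
  mul_nonneg (bump_nonneg hℓ _) (Finset.prod_nonneg fun _ _ => bump_nonneg hℓ _)

theorem integrable_bump_sub {ℓ : ℝ} (hℓ : 0 < ℓ) (x : Space d) :
    Integrable fun x' => bump d ℓ (x - x') := (integrable_bump hℓ).comp_sub_left x

theorem good_weight {ℓ : ℝ} (hℓ : 0 < ℓ) (ζ : Config d m) : Good (weight ℓ ζ) := by
  have hc : Continuous (weight ℓ ζ) := by unfold weight; fun_prop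
  constructor
  · refine ((integrable_bump_sub hℓ ζ.1).const_mul ((ℓ ^ (-(d : ℝ))) ^ m)).mono'
      hc.aestronglyMeasurable (Filter.Eventually.of_forall fun x => ?_)
    rw [Real.norm_of_nonneg (weight_nonneg hℓ ζ x)]
    exact weight_le hℓ ζ x
  · exact weight_nonneg hℓ ζ
  · refine ⟨(ℓ ^ (-(d : ℝ))) ^ m * ℓ ^ (-(d : ℝ)), fun x => (weight_le hℓ ζ x).trans ?_⟩
    exact mul_le_mul_of_nonneg_left (bump_le hℓ _) (by positivity)

theorem lintegral_weight {ℓ : ℝ} (hℓ : 0 < ℓ) (x : Space d) :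
    ∫⁻ y : Fin m → Space d, ENNReal.ofReal (∫ x', weight ℓ (x, y) x') =
      ENNReal.ofReal ((∫ w : Space d, decay (d + 1) w) ^ (m + 1)) := by
  have e1 : ∀ y : Fin m → Space d, ENNReal.ofReal (∫ x', weight ℓ (x, y) x') =
      ∫⁻ x', ENNReal.ofReal (weight ℓ (x, y) x') := fun y =>
    ofReal_integral_eq_lintegral_ofReal (good_weight hℓ _).integrable
      (Filter.Eventually.of_forall (weight_nonneg hℓ _))
  have e2 : ∀ x', ∫⁻ y : Fin m → Space d, ENNReal.ofReal (weight ℓ (x, y) x') =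
      ENNReal.ofReal (bump d ℓ (x - x') * (∫ w : Space d, decay (d + 1) w) ^ m) := fun x' => by
    have hi : Integrable fun y : Fin m → Space d => weight ℓ (x, y) x' :=
      (Integrable.fintype_prod (f := fun (_ : Fin m) (y : Space d) => bump d ℓ (y - x'))
        (μ := fun _ => volume) fun _ =>
        (integrable_bump hℓ).comp_sub_right x').const_mul (bump d ℓ (x - x'))
    rw [← ofReal_integral_eq_lintegral_ofReal hi (Filter.Eventually.of_forall fun y => weight_nonneg hℓ _ _)]
    simp only [weight]
    rw [integral_const_mul, integral_fintype_prod_volume_eq_prod (fun _ y => bump d ℓ (y - x'))]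
    simp only [integral_sub_right_eq_self (bump d ℓ), integral_bump hℓ, Finset.prod_const,
      Finset.card_univ, Fintype.card_fin]
  have hI : 0 ≤ ∫ w : Space d, decay (d + 1) w := integral_nonneg fun w => (decay_pos _ _).le
  simp only [e1]
  have hc : Continuous fun p : (Fin m → Space d) × Space d => weight ℓ (x, p.1) p.2 := by
    unfold weight; fun_prop
  rw [lintegral_lintegral_swap (f := fun (y : Fin m → Space d) x' =>
    ENNReal.ofReal (weight ℓ (x, y) x')) hc.measurable.ennreal_ofReal.aemeasurable]
  simp only [e2]
  have hi : Integrable fun x' : Space d =>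
      bump d ℓ (x - x') * (∫ w : Space d, decay (d + 1) w) ^ m :=
    (integrable_bump_sub hℓ x).mul_const _
  rw [← ofReal_integral_eq_lintegral_ofReal hi (Filter.Eventually.of_forall fun x' => mul_nonneg (bump_nonneg hℓ _) (by positivity)),
    integral_mul_const, integral_sub_left_eq_self (bump d ℓ), integral_bump hℓ, pow_succ']

theorem exists_DB_mixTensor (n : ℕ) {g : ℕ} (hg : d + n ≤ 2 * g + 1) :
    ∃ C, 0 ≤ C ∧ ∀ ℓ, 0 < ℓ → ∀ r, 0 ≤ r → ∀ ζ z : Config d m, z ∈ tube d m (r * ℓ) →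
      DB n ℓ (C * (1 + r) ^ ((d + 1) * m) * weight ℓ ζ z.1)
        (fun z => mixTensor d m g ℓ (ζ - z)) z := by
  obtain ⟨C, hC, h⟩ := exists_DB_mixDensity (d := d) n (d + 1) g hg
  refine ⟨2 ^ n * (C * (2 ^ (n * (Finset.univ : Finset (Fin m)).card) * C ^ m)), by positivity,
    fun ℓ hℓ r hr ζ z hz => ?_⟩
  obtain ⟨hs, hb⟩ := h ℓ hℓ
  have key : ∀ (L : Config d m →L[ℝ] Space d) (b : Space d), (∀ v, ‖L v‖ ≤ ‖v‖) →
      ContDiff ℝ n (fun z => mixDensity d g ℓ (b - L z)) ∧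
      DB n ℓ (C * bump d ℓ (b - L z)) (fun z => mixDensity d g ℓ (b - L z)) z := fun L b hL => by
    refine ⟨hs.comp (contDiff_const.sub L.contDiff), ?_⟩
    have := DB.comp_affine (y := z) (ℓ' := ℓ) (-L) b hℓ (fun v => by
      rw [neg_apply, norm_neg]
      have := hL v
      gcongr) hs.contDiffAt (hb _)
    simpa only [neg_apply, neg_add_eq_sub, bump] using this
  have k1 := key (ContinuousLinearMap.fst ℝ _ _) ζ.1 fun v => norm_fst_le v
  have k2 := fun q => key ((ContinuousLinearMap.proj q).comp
    (ContinuousLinearMap.snd ℝ (Space d) (Fin m → Space d))) (ζ.2 q) fun v =>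
      (norm_le_pi_norm v.2 q).trans (norm_snd_le v)
  have h1 := DB.mul k1.1.contDiffAt (contDiff_prod fun q _ => (k2 q).1).contDiffAt k1.2
    (DB.prod Finset.univ hℓ (fun q _ => (k2 q).1.contDiffAt) fun q _ => (k2 q).2)
  refine DB.mono hℓ h1 ?_
  have h2 : ∏ q, bump d ℓ (ζ.2 q - z.2 q) ≤ ∏ q, ((1 + r) ^ (d + 1) * bump d ℓ (ζ.2 q - z.1)) :=
    Finset.prod_le_prod (fun q _ => bump_nonneg hℓ _) fun q _ => by
      have := bump_add_le (w := ζ.2 q - z.1) (h := z.1 - z.2 q) hℓ (by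
        rw [norm_sub_rev]; exact hz q)
      rwa [sub_add_sub_cancel] at this
  rw [Finset.prod_mul_distrib, Finset.prod_const, Finset.card_univ, Fintype.card_fin, ← pow_mul]
    at h2
  have h3 : (∏ q, C * bump d ℓ (ζ.2 q - z.2 q)) = C ^ m * ∏ q, bump d ℓ (ζ.2 q - z.2 q) := by
    rw [Finset.prod_mul_distrib, Finset.prod_const, Finset.card_univ, Fintype.card_fin]
  have h4 := bump_nonneg hℓ (ζ.1 - z.1)
  calc 2 ^ n * (C * bump d ℓ (ζ.1 - z.1) * (2 ^ (n * (Finset.univ : Finset (Fin m)).card) *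
        ∏ q, C * bump d ℓ (ζ.2 q - z.2 q)))
      = 2 ^ n * (C * bump d ℓ (ζ.1 - z.1) * (2 ^ (n * (Finset.univ : Finset (Fin m)).card) *
        (C ^ m * ∏ q, bump d ℓ (ζ.2 q - z.2 q)))) := by rw [h3]
    _ ≤ 2 ^ n * (C * bump d ℓ (ζ.1 - z.1) * (2 ^ (n * (Finset.univ : Finset (Fin m)).card) *
        (C ^ m * ((1 + r) ^ ((d + 1) * m) * ∏ q, bump d ℓ (ζ.2 q - z.1))))) := by gcongr
    _ = _ := by unfold weight; ring

/-- The test functions that define the regularization. -/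
def regTest (a : MultiIdx d m) (g : ℕ) (ℓ : ℝ) (ζ z : Config d m) : ℝ :=
  monomial a z * mixTensor d m g ℓ (ζ - z)

theorem continuous_regTest (a : MultiIdx d m) {g : ℕ} (hg : d ≤ 2 * g + 1) {ℓ : ℝ} (hℓ : 0 < ℓ) :
    Continuous fun p : Config d m × Config d m => regTest a g ℓ p.1 p.2 := by
  have h1 := (contDiff_monomial a 0).continuous
  have h2 := continuous_mixTensor (d := d) (m := m) hg hℓ
  unfold regTest
  fun_prop

theorem adm_mixTensor (n : ℕ) {g : ℕ} (hg : d + n ≤ 2 * g + 1) {ℓ : ℝ} (hℓ : 0 < ℓ)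
    (ζ : Config d m) : Adm n fun z => mixTensor d m g ℓ (ζ - z) := by
  obtain ⟨C, hC, h⟩ := exists_DB_mixTensor (m := m) n hg
  obtain ⟨C', -, h'⟩ := exists_DB_mixDensity (d := d) n (d + 1) g hg
  have hs := (h' ℓ hℓ).1
  refine ⟨?_, fun ρ => ⟨fun x => max 1 ℓ⁻¹ ^ n * (C * (1 + |ρ| / ℓ) ^ ((d + 1) * m) * weight ℓ ζ x),
    ((good_weight hℓ ζ).const_mul (by positivity)).const_mul (by positivity), fun p hp => ?_⟩⟩
  · unfold mixTensor
    simp only [Prod.fst_sub, Prod.snd_sub, Pi.sub_apply]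
    exact (hs.comp (by fun_prop)).mul (contDiff_prod fun q _ => hs.comp (by fun_prop))
  · refine DB.rescale hℓ one_pos (le_max_left _ _) ?_ (h ℓ hℓ (|ρ| / ℓ) (by positivity) ζ p
      (tube_mono ?_ hp))
    · calc (1 : ℝ) = ℓ⁻¹ * ℓ := by field_simp
        _ ≤ _ := by gcongr; exact le_max_right _ _
    · rw [div_mul_cancel₀ _ hℓ.ne']
      exact le_abs_self ρ

theorem exists_regTest_le (a : MultiIdx d m) {g : ℕ} (hg : d ≤ 2 * g + 1) {ℓ : ℝ} (hℓ : 0 < ℓ)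
    (ρ : ℝ) : ∃ C, 0 ≤ C ∧ ∀ ζ z : Config d m, z ∈ tube d m ρ →
      |regTest a g ℓ ζ z| ≤ C * bump d ℓ (ζ.1 - z.1) := by
  obtain ⟨C, hC, h⟩ := exists_DB_mixTensor (m := m) 0 (g := g) (by omega)
  refine ⟨|ρ| ^ a.order * (C * (1 + |ρ| / ℓ) ^ ((d + 1) * m) * (ℓ ^ (-(d : ℝ))) ^ m),
    by positivity, fun ζ z hz => ?_⟩
  have hz' := tube_mono (le_abs_self ρ) hz
  have h1 : |mixTensor d m g ℓ (ζ - z)| ≤ _ := h ℓ hℓ (|ρ| / ℓ) (by positivity) ζ z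
    (by rwa [div_mul_cancel₀ _ hℓ.ne'])
  have h2 := weight_le hℓ ζ z.1
  rw [regTest, abs_mul]
  calc _ ≤ |ρ| ^ a.order * (C * (1 + |ρ| / ℓ) ^ ((d + 1) * m) *
        ((ℓ ^ (-(d : ℝ))) ^ m * bump d ℓ (ζ.1 - z.1))) :=
        mul_le_mul (abs_monomial_le a hz') (h1.trans (by gcongr)) (abs_nonneg _) (by positivity)
    _ = _ := by ring

theorem admFam_regTest (a : MultiIdx d m) {g : ℕ} (hg : d ≤ 2 * g + 1) {ℓ : ℝ} (hℓ : 0 < ℓ) :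
    AdmFam 0 fun p : Config d m × Config d m => regTest a g ℓ p.1 p.2 := by
  refine ⟨contDiff_zero.2 (continuous_regTest a hg hℓ), fun ζ₀ ρ => ?_⟩
  obtain ⟨C, hC, h⟩ := exists_regTest_le a hg hℓ ρ
  refine ⟨1, one_pos, fun x => C * ((1 + ℓ⁻¹) ^ (d + 1) * bump d ℓ (ζ₀.1 - x)),
    ⟨((integrable_bump_sub hℓ ζ₀.1).const_mul _).const_mul C, fun x =>
      mul_nonneg hC (mul_nonneg (by positivity) (bump_nonneg hℓ _)),
      C * ((1 + ℓ⁻¹) ^ (d + 1) * ℓ ^ (-(d : ℝ))), fun x => ?_⟩, fun ζ hζ z hz => ?_⟩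
  · have := bump_le hℓ (ζ₀.1 - x)
    gcongr
  · refine (h ζ z hz).trans (mul_le_mul_of_nonneg_left ?_ hC)
    have := bump_add_le (w := ζ₀.1 - z.1) (h := ζ.1 - ζ₀.1) (r := ℓ⁻¹) hℓ (by
      rw [inv_mul_cancel₀ hℓ.ne']
      rw [Metric.mem_ball, dist_eq_norm] at hζ
      exact (norm_fst_le (ζ - ζ₀)).trans hζ.le)
    rwa [add_comm, sub_add_sub_cancel] at this

theorem monomial_add_const (a : MultiIdx d m) (p : Config d m) (x : Space d) :
    monomial a (p.1 + x, fun q => p.2 q + x) = monomial a p := by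
  simp [monomial]

theorem regTest_add_const (a : MultiIdx d m) (g : ℕ) (ℓ : ℝ) (ζ z : Config d m) (x : Space d) :
    regTest a g ℓ (ζ.1 + x, fun q => ζ.2 q + x) (z.1 + x, fun q => z.2 q + x) =
      regTest a g ℓ ζ z := by
  rw [regTest, regTest, monomial_add_const]
  congr 2
  exact Prod.ext (by simp) (by ext; simp)

namespace Kern

variable {K : Kern d m} {A : Space d × K.Ω → ℝ} {B : ℝ}

theorem act_regTest_periodic (hp : ∀ n x ω, A (x + latticePoint n, ω) = A (x, ω))
    (a : MultiIdx d m) (g : ℕ) (ℓ : ℝ) (n : Fin d → ℤ) (ζ : Config d m) :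
    K.act A (regTest a g ℓ (ζ.1 + latticePoint n, fun q => ζ.2 q + latticePoint n)) =
      K.act A (regTest a g ℓ ζ) := by
  have h : MeasurePreserving (fun t : Space d × K.Ω => (t.1 + latticePoint n, t.2))
      ((volume : Measure (Space d)).prod K.ν) ((volume : Measure (Space d)).prod K.ν) :=
    (measurePreserving_add_right volume (latticePoint n)).prod (MeasurePreserving.id K.ν)
  have he : MeasurableEmbedding fun t : Space d × K.Ω => (t.1 + latticePoint n, t.2) :=
    ((MeasurableEquiv.addRight (latticePoint n)).prodCongr
      (MeasurableEquiv.refl K.Ω)).measurableEmbedding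
  unfold act
  rw [← h.integral_comp he]
  refine integral_congr_ae (Filter.Eventually.of_forall fun t => ?_)
  have e : K.point (t.1 + latticePoint n, t.2) =
      ((K.point t).1 + latticePoint n, fun q => (K.point t).2 q + latticePoint n) :=
    Prod.ext rfl (funext fun q => by simp only [point]; abel)
  beta_reduce
  rw [hp n t.1 t.2, e, regTest_add_const]

theorem act_average (ha : Continuous A) (hA : ∀ t, |A t| ≤ B) (a : MultiIdx d m) {g : ℕ}
    (hg : d ≤ 2 * g + 1) {ℓ : ℝ} (hℓ : 0 < ℓ) {Φ : Config d m → ℝ} (hΦ : Continuous Φ)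
    (hi : Integrable Φ) :
    K.act A (fun z => monomial a z * ∫ ζ, mixTensor d m g ℓ (ζ - z) * Φ ζ) =
      ∫ ζ, K.act A (regTest a g ℓ ζ) * Φ ζ := by
  have hJ := admFam_regTest a hg hℓ
  have hc := continuous_regTest a hg hℓ
  obtain ⟨ρ, hρ⟩ := K.exists_tube
  obtain ⟨C, hC, hb⟩ := exists_regTest_le a hg hℓ ρ
  have hf : Continuous fun p : (Space d × K.Ω) × Config d m =>
      A p.1 * regTest a g ℓ p.2 (K.point p.1) * Φ p.2 := by fun_prop
  have hint : ∀ ζ, Integrable (fun t => A t * regTest a g ℓ ζ (K.point t))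
      ((volume : Measure (Space d)).prod K.ν) := fun ζ => integrable (hJ.adm ζ) ha hA
  have hprod : Integrable (fun p : (Space d × K.Ω) × Config d m =>
      A p.1 * regTest a g ℓ p.2 (K.point p.1) * Φ p.2)
      (((volume : Measure (Space d)).prod K.ν).prod volume) := by
    rw [integrable_prod_iff' hf.aestronglyMeasurable]
    refine ⟨Filter.Eventually.of_forall fun ζ => (hint ζ).mul_const (Φ ζ), ?_⟩
    refine ((hi.norm).const_mul (|B| * (C * ∫ w : Space d, decay (d + 1) w))).mono'
      (hf.norm.aestronglyMeasurable (μ := ((volume : Measure (Space d)).prod K.ν).prod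
        volume)).prod_swap.integral_prod_right' (Filter.Eventually.of_forall fun ζ => ?_)
    rw [Real.norm_of_nonneg (integral_nonneg fun _ => norm_nonneg _)]
    have h1 : Integrable (fun x : Space d => |B| * (C * bump d ℓ (ζ.1 - x))) :=
      ((integrable_bump_sub hℓ ζ.1).const_mul C).const_mul _
    have h2 := K.integral_fst fun x : Space d => |B| * (C * bump d ℓ (ζ.1 - x))
    rw [probReal_univ, one_mul, integral_const_mul |B| fun x : Space d => C * bump d ℓ (ζ.1 - x),
      integral_const_mul C fun x : Space d => bump d ℓ (ζ.1 - x), integral_sub_left_eq_self (bump d ℓ), integral_bump hℓ] at h2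
    simp only [norm_mul, integral_mul_const]
    refine mul_le_mul_of_nonneg_right ?_ (norm_nonneg _)
    rw [← h2]
    refine integral_mono_ae ((hint ζ).norm.congr (Filter.Eventually.of_forall fun t =>
      norm_mul _ _)) (K.integrable_fst h1) ?_
    filter_upwards [hρ ρ le_rfl] with t ht
    exact mul_le_mul ((hA t).trans (le_abs_self B)) (hb ζ _ ht) (norm_nonneg _) (abs_nonneg B)
  have hsw := integral_integral_swap
    (f := fun t ζ => A t * regTest a g ℓ ζ (K.point t) * Φ ζ) hprod
  simp only [integral_mul_const] at hsw
  refine Eq.trans ?_ hsw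
  unfold act
  refine integral_congr_ae (Filter.Eventually.of_forall fun t => ?_)
  beta_reduce
  rw [← integral_const_mul, ← integral_const_mul]
  refine integral_congr_ae (Filter.Eventually.of_forall fun ζ => ?_)
  simp only [regTest]
  ring

end Kern

theorem adm_schwartz (Ψ : 𝓢(Config d m, ℝ)) : Adm 0 Ψ := by
  obtain ⟨C, hC, h⟩ := exists_DB_schwartz Ψ 0 (d + 1)
  exact ⟨Ψ.smooth 0, fun ρ => ⟨_, good_decay hC, fun p _ => (h p).trans
    (mul_le_mul_of_nonneg_left (inv_anti₀ (by positivity) (by gcongr; exact norm_fst_le p)) hC)⟩⟩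

theorem exists_regularization (a : MultiIdx d m) (n : ℕ) {r : ℝ} (hr : 0 ≤ r) {g : ℕ}
    (hg : d + n ≤ 2 * g + 1) : ∃ C, 0 ≤ C ∧ ∀ (σ μ : ℝ), 0 < μ → ∀ (U : (Config d m → ℝ) → ℝ)
      (c : ℝ), 0 ≤ c → IsAct U → Bdd n (scale σ μ) (r * scale σ μ) c U → ∃ v : Config d m → ℝ,
        IsRegularization σ (g + 1) μ (fun Φ => U fun p => monomial a p * Φ p) v ∧ MemV v ∧
          normV v ≤ ENNReal.ofReal (C * c * scale σ μ ^ a.order) := by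
  obtain ⟨C, hC, h⟩ := exists_DB_mixTensor (m := m) n hg
  obtain ⟨K', hK', hm⟩ := exists_DB_monomial a n hr
  have hg' : d ≤ 2 * g + 1 := by omega
  set I := ∫ w : Space d, decay (d + 1) w with hI
  have hI0 : 0 ≤ I := integral_nonneg fun w => (decay_pos _ _).le
  refine ⟨2 ^ n * (K' * (C * (1 + r) ^ ((d + 1) * m))) * I ^ (m + 1), by positivity,
    fun σ μ hμ U c hc hU hbd => ?_⟩
  have hℓ : 0 < scale σ μ := scale_pos hμ
  set ℓ := scale σ μ with hℓd
  have hadm : ∀ ζ : Config d m, Adm n (regTest a g ℓ ζ) := fun ζ =>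
    (adm_mixTensor n hg hℓ ζ).monomial_mul a
  have hv : ∀ ζ : Config d m, |U (regTest a g ℓ ζ)| ≤
      c * (2 ^ n * (K' * ℓ ^ a.order * (C * (1 + r) ^ ((d + 1) * m)))) * ∫ x, weight ℓ ζ x := by
    intro ζ
    refine (hbd _ (fun x => 2 ^ n * (K' * ℓ ^ a.order * (C * (1 + r) ^ ((d + 1) * m) *
      weight ℓ ζ x))) (hadm ζ) ((((good_weight hℓ ζ).const_mul (by positivity)).const_mul
        (by positivity)).const_mul (by positivity)) fun p hp => ?_).trans (le_of_eq ?_)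
    · exact DB.mul (contDiff_monomial a n).contDiffAt (adm_mixTensor n hg hℓ ζ).smooth.contDiffAt
        (hm ℓ hℓ p hp) (h ℓ hℓ r hr ζ p hp)
    · simp only [integral_const_mul]
      ring
  have hn : normV (fun ζ : Config d m => U (regTest a g ℓ ζ)) ≤ ENNReal.ofReal
      (2 ^ n * (K' * (C * (1 + r) ^ ((d + 1) * m))) * I ^ (m + 1) * c * ℓ ^ a.order) := by
    refine iSup_le fun x => ?_
    have hp : 0 ≤ c * (2 ^ n * (K' * ℓ ^ a.order * (C * (1 + r) ^ ((d + 1) * m)))) := by positivity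
    calc _ ≤ ∫⁻ y : Fin m → Space d, ENNReal.ofReal (c * (2 ^ n * (K' * ℓ ^ a.order *
          (C * (1 + r) ^ ((d + 1) * m))))) * ENNReal.ofReal (∫ x', weight ℓ (x, y) x') := by
          refine lintegral_mono fun y => ?_
          rw [← ENNReal.ofReal_mul hp, Real.enorm_eq_ofReal_abs]
          exact ENNReal.ofReal_le_ofReal (hv _)
      _ = _ := by
          rw [lintegral_const_mul' _ _ ENNReal.ofReal_ne_top, lintegral_weight hℓ,
            ← ENNReal.ofReal_mul hp]
          congr 1
          ring
  have hU' := hU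
  obtain ⟨K, A, B, hA, hB, hp, hK⟩ := hU'
  have hKv : ∀ ζ, U (regTest a g ℓ ζ) = K.act A (regTest a g ℓ ζ) := fun ζ =>
    hK _ ((hadm ζ).of_le (Nat.zero_le n))
  refine ⟨fun ζ => U (regTest a g ℓ ζ), fun Φ => ?_, ⟨?_, hn.trans_lt ENNReal.ofReal_lt_top,
    fun k x y => ?_⟩, hn⟩
  · obtain ⟨Ψ, hΨ⟩ := exists_schwartz_average (integrable_moment_regKernelTensor (m := m) (σ := σ)
      hμ (g + 1)) Φ
    refine ⟨Ψ, hΨ, ?_⟩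
    beta_reduce
    rw [hK _ ((adm_schwartz Ψ).monomial_mul a)]
    simp only [hΨ, integral_regKernelTensor hg' hμ, hKv]
    exact Kern.act_average hA hB a hg' hℓ Φ.continuous Φ.integrable
  · simp only [hKv]
    have := (Kern.paramInt (admFam_regTest a hg' hℓ) hA hB).contDiff.continuous
    exact this
  · simp only [hKv]
    have := Kern.act_regTest_periodic hp a g ℓ k (x, fun q => y q + x)
    simp only [add_assoc] at this
    exact this

end Regularize

/-! ### Bounds on the generalized coefficients -/

section Final

variable {d m : ℕ} {σ ε : ℝ} {χ : ℝ → ℝ} {g₀ : (i m : ℕ) → MultiIdx d m → ℕ}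

theorem hasMixedDeriv_zero {Θ : Type*} {V : ℝ → ℝ → Θ → ℝ} {T : Θ → ℝ} (hV : ∀ κ μ, V κ μ = T)
    {r s : ℕ} (hr : r ∈ ({0, 1} : Set ℕ)) (hs : s ∈ ({0, 1} : Set ℕ))
    (h : (r = 0 ∧ s = 0) → T = fun _ => 0) (κ μ : ℝ) : HasMixedDeriv r s V κ μ fun _ => 0 := by
  refine ⟨if s = 0 then fun _ => T else fun _ _ => 0, fun κ' _ => ?_, ?_⟩
  · rcases hs with rfl | rfl
    · exact (hV κ' μ).symm
    · exact ⟨V κ', fun _ _ => rfl, fun φ => by simpa [hV] using hasDerivWithinAt_const μ _ (T φ)⟩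
  · rcases hr with rfl | rfl
    · show (fun _ => 0) = (if s = 0 then fun _ => T else fun _ _ => 0 : ℝ → Θ → ℝ) κ
      split_ifs with h0
      · exact (h ⟨rfl, h0⟩).symm
      · rfl
    · exact ⟨_, fun _ _ => rfl, fun φ => by split_ifs <;> exact hasDerivWithinAt_const κ _ _⟩

theorem regBound_of_zero {V : ℝ → ℝ → (Config d m → ℝ) → ℝ} {g r s : ℕ} {κ μ : ℝ} (hμ : 0 < μ)
    (h : HasMixedDeriv r s (fun κ' μ' (Φ : 𝓢(Config d m, ℝ)) => V κ' μ' Φ) κ μ fun _ => 0) (B : ℝ) :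
    RegBound σ g r s V κ μ B := by
  refine ⟨fun _ => 0, fun _ => 0, h, fun Φ => ?_, ⟨continuous_const, by simp [normV],
    fun _ _ _ => rfl⟩, by simp [normV]⟩
  obtain ⟨Ψ, hΨ⟩ := exists_schwartz_average (integrable_moment_regKernelTensor (m := m) (σ := σ)
    hμ g) Φ
  exact ⟨Ψ, hΨ, by simp⟩

variable (hS : Setup d σ ε χ)

include hS

theorem hasDerivWithinAt_effForce {R : ℝ} {ξ : Distr d} {c : ℕ → ℝ → ℝ}
    (D : FlowData d σ ε χ g₀ R ξ c) {i : ℕ} (hi : 0 < i) (hm : m ≤ 3 * i) {κ μ : ℝ}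
    (hκ : κ ∈ Ioc (0 : ℝ) (1 / 2)) (hμ : μ ∈ Ioc (0 : ℝ) (1 / 2)) {Ψ : Config d m → ℝ}
    (hΨ : Adm 0 Ψ) : HasDerivWithinAt (fun μ' => effForce σ χ ξ c κ i m μ' Ψ)
      (flowRhs σ χ ξ c i m κ μ Ψ) (Ioc 0 1) μ := by
  obtain ⟨f, f', hf, -, he⟩ := (D.rep hS i m).2.exists_continuous
  rw [(he κ hκ μ ⟨hμ.1, by linarith [hμ.2]⟩ Ψ hΨ).1]
  have h1 := ((hf κ Ψ hΨ).integral_hasStrictDerivAt 0 μ).hasDerivAt.const_add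
    (force σ ξ c κ i m Ψ)
  refine (h1.congr_of_eventuallyEq ?_).hasDerivWithinAt
  have h2 : Ioo (0 : ℝ) (3 / 4) ∈ nhds μ := Ioo_mem_nhds hμ.1 (by linarith [hμ.2])
  filter_upwards [h2] with u hu
  rw [effForce_eq_flowRhs hi hm, intervalIntegral.integral_of_le hu.1.le,
    intervalIntegral.integral_of_le hu.1.le]
  congr 1
  exact setIntegral_congr_fun measurableSet_Ioc fun η hη =>
    (he κ hκ η ⟨hη.1, hη.2.trans hu.2.le⟩ Ψ hΨ).1

theorem exists_regBound_of_le {i : ℕ} (hi : 0 < i) (hm : m ≤ 3 * i) (a : MultiIdx d m) :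
    ∃ (g : ℕ) (C : ℝ), 0 < C ∧ ∀ R ξ c, FlowData d σ ε χ g₀ R ξ c →
      ∀ r ∈ ({0, 1} : Set ℕ), ∀ s ∈ ({0, 1} : Set ℕ),
      ∀ κ ∈ Ioc (0 : ℝ) (1 / 2), ∀ μ ∈ Ioc (0 : ℝ) (1 / 2),
        RegBound σ g r s (genForce σ χ ξ c i m a) κ μ
          (C * R ^ (1 + 3 * (i : ℤ) - (m : ℤ)) * scale σ κ ^ ((ε - σ) * r) *
            scale σ μ ^ (rho d σ ε i m + a.order - σ * s)) := by
  obtain ⟨n₁, r₁, C₁, hr₁, hC₁, h₁⟩ := unifBdd_effForce (g₀ := g₀) hS i m hi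
  obtain ⟨n₂, r₂, C₂, hr₂, hC₂, h₂⟩ := unifBdd_flowRhs' (g₀ := g₀) hS i m
  obtain ⟨K, hK, hreg⟩ := exists_regularization a (max n₁ n₂) (r := max r₁ r₂)
    (hr₁.trans (le_max_left _ _)) (g := d + max n₁ n₂) (by omega)
  refine ⟨d + max n₁ n₂ + 1, K * (C₁ + C₂) + 1, by positivity, fun R ξ c D r hr s hs κ hκ μ hμ => ?_⟩
  have hR := D.pos
  have hℓ := scale_pos (σ := σ) hμ.1
  have hℓ' := scale_pos (σ := σ) hκ.1
  have hμ' : μ ∈ Ioc (0 : ℝ) (3 / 4) := ⟨hμ.1, by linarith [hμ.2]⟩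
  obtain ⟨F, hF, hFb, hFd⟩ : ∃ F : ℝ → ℝ → (Config d m → ℝ) → ℝ, Rep F ∧
      HasBound σ ε (max n₁ n₂) (max r₁ r₂) ((C₁ + C₂) * R ^ (1 + 3 * (i : ℤ) - m))
        (rho d σ ε i m - σ * s) F ∧
      ∀ κ' ∈ Ioc (0 : ℝ) (1 / 2), HasWeakDeriv (Ioc 0 1) s
        (fun μ' (Φ : 𝓢(Config d m, ℝ)) => genForce σ χ ξ c i m a κ' μ' Φ) μ
        fun Φ => F κ' μ fun p => monomial a p * Φ p := by
    rcases hs with rfl | rfl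
    · refine ⟨_, (h₁ R ξ c D).1, ?_, fun κ' _ => rfl⟩
      rw [Nat.cast_zero, mul_zero, sub_zero]
      exact (h₁ R ξ c D).2.mono (le_max_left _ _) (le_max_left _ _) (by gcongr; linarith)
    · refine ⟨_, (h₂ R ξ c D).1, ?_, fun κ' hκ' => ⟨_, fun _ _ => rfl, fun Φ =>
        hasDerivWithinAt_effForce hS D hi hm hκ' hμ ((adm_schwartz Φ).monomial_mul a)⟩⟩
      rw [Nat.cast_one, mul_one]
      exact (h₂ R ξ c D).2.mono (le_max_right _ _) (le_max_right _ _) (by gcongr; linarith)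
  obtain ⟨v, hv, hvm, hvn⟩ := hreg σ μ hμ.1 (cutD r F κ μ) _ (by positivity)
    (hF.isAct_cutD hκ hμ' r) (hFb κ hκ μ hμ r hr)
  refine ⟨_, v, ⟨fun κ' Φ => F κ' μ fun p => monomial a p * Φ p, hFd, ?_⟩, hv, hvm,
    hvn.trans (ENNReal.ofReal_le_ofReal ?_)⟩
  · rcases hr with rfl | rfl
    · rfl
    · exact ⟨_, fun _ _ => rfl, fun Φ => hF.hasDeriv hκ hμ' ((adm_schwartz Φ).monomial_mul a)⟩
  · have e : scale σ μ ^ (rho d σ ε i m + a.order - σ * s) =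
        scale σ μ ^ (rho d σ ε i m - σ * s) * scale σ μ ^ a.order := by
      rw [← Real.rpow_natCast, ← Real.rpow_add hℓ]
      congr 1
      ring
    rw [e]
    have : 0 ≤ R ^ (1 + 3 * (i : ℤ) - m) * scale σ κ ^ ((ε - σ) * r) *
      (scale σ μ ^ (rho d σ ε i m - σ * s) * scale σ μ ^ a.order) := by positivity
    linarith

theorem exists_regBound (i m : ℕ) (a : MultiIdx d m) :
    ∃ (g : ℕ) (C : ℝ), 0 < C ∧ ∀ R ξ c, FlowData d σ ε χ g₀ R ξ c →
      ∀ r ∈ ({0, 1} : Set ℕ), ∀ s ∈ ({0, 1} : Set ℕ),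
      ∀ κ ∈ Ioc (0 : ℝ) (1 / 2), ∀ μ ∈ Ioc (0 : ℝ) (1 / 2),
        RegBound σ g r s (genForce σ χ ξ c i m a) κ μ
          (C * R ^ (1 + 3 * (i : ℤ) - (m : ℤ)) * scale σ κ ^ ((ε - σ) * r) *
            scale σ μ ^ (rho d σ ε i m + a.order - σ * s)) := by
  rcases lt_or_ge (3 * i) m with hm | hm
  · refine ⟨0, 1, one_pos, fun R ξ c D r hr s hs κ hκ μ hμ => regBound_of_zero hμ.1
      (hasMixedDeriv_zero (T := fun _ => 0) (fun κ μ => ?_) hr hs (fun _ => rfl) κ μ) _⟩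
    simp only [genForce, effForce_of_lt hm]
  rcases Nat.eq_zero_or_pos i with rfl | hi
  · obtain rfl : m = 0 := by omega
    have h0 : a.order = 0 := by simp [MultiIdx.order]
    refine ⟨g₀ 0 0 a, 1, one_pos, fun R ξ c D r hr s hs κ hκ μ hμ => ?_⟩
    by_cases h : r = 0 ∧ s = 0
    · obtain ⟨rfl, rfl⟩ := h
      have h1 := D.noise 0 0 a (by
        rw [h0]; simp only [rho]; simp; positivity) 0 (by simp) κ hκ μ hμ
      have e : genForce σ χ ξ c 0 0 a = enhNoise σ χ ξ c 0 0 a := by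
        ext κ μ Ψ
        unfold enhNoise
        congr 1
        ext p
        exact congrArg Ψ (Prod.ext rfl (Subsingleton.elim _ _))
      rw [e]
      simpa using h1
    · refine regBound_of_zero hμ.1 (hasMixedDeriv_zero (T := fun Φ => pair ξ fun x => Φ (x, Fin.elim0))
        (fun κ μ => ?_) hr hs (fun h' => absurd h' h) κ μ) _
      ext Φ
      rw [← enhNoise_zero (σ := σ) (χ := χ) (c := c) a κ μ]
      unfold enhNoise
      congr 1
      ext p
      exact congrArg Φ (Prod.ext rfl (Subsingleton.elim _ _))
  · exact exists_regBound_of_le hS hi hm a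

end Final

end

end EllipticFlow

open EllipticFlow

theorem mainTheorem6
    (d : ℕ) (hd : d ∈ Set.Icc 1 6)
    (σ : ℝ) (hσ : σ ∈ Set.Ioc ((d : ℝ) / 3) ((d : ℝ) / 2))
    (ε : ℝ) (hε : ε ∈ Set.Ioo 0 (epsDiamond d σ / 3))
    (χ : ℝ → ℝ) (hχ : IsCutoff χ)
    (g₀ : (i m : ℕ) → MultiIdx d m → ℕ) :
    ∀ (i m : ℕ) (a : MultiIdx d m), ∃ (g : ℕ) (C : ℝ), 0 < C ∧
      ∀ R : ℝ, 1 < R →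
      ∀ ξ : Distr d, IsPeriodic ξ →
      ∀ c : ℕ → ℝ → ℝ,
        (∀ i' ∈ Set.Icc 1 (iSharp d σ), DifferentiableOn ℝ (c i') (Set.Ioc 0 (1 / 2))) →
        (∀ (i' m' : ℕ) (a' : MultiIdx d m'), rho d σ 0 i' m' + a'.order ≤ 0 →
          ∀ r ∈ ({0, 1} : Set ℕ), ∀ κ ∈ Set.Ioc (0 : ℝ) (1 / 2), ∀ μ ∈ Set.Ioc (0 : ℝ) (1 / 2),
            RegBound σ (g₀ i' m' a') r 0 (enhNoise σ χ ξ c i' m' a') κ μ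
              (R * scale σ κ ^ ((ε - σ) * r) * scale σ μ ^ (rho d σ ε i' m' + a'.order))) →
        ∀ r ∈ ({0, 1} : Set ℕ), ∀ s ∈ ({0, 1} : Set ℕ),
          ∀ κ ∈ Set.Ioc (0 : ℝ) (1 / 2), ∀ μ ∈ Set.Ioc (0 : ℝ) (1 / 2),
            RegBound σ g r s (genForce σ χ ξ c i m a) κ μ
              (C * R ^ (1 + 3 * (i : ℤ) - (m : ℤ)) * scale σ κ ^ ((ε - σ) * r) *
                scale σ μ ^ (rho d σ ε i m + a.order - σ * s)) := by
  intro i m a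
  obtain ⟨g, C, hC, h⟩ := exists_regBound (g₀ := g₀) ⟨hd, hσ, hε, hχ⟩ i m a
  exact ⟨g, C, hC, fun R hR ξ _ c hc hn r hr s hs κ hκ μ hμ =>
    h R ξ c ⟨hR, hc, hn⟩ r hr s hs κ hκ μ hμ⟩
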